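/- Let $k$ be a field and let $\mathcal A$ be a smooth and proper (small) dg category over $k$: $\mathcal A$ is compact in the derived category $\mathcal D(\mathcal A^{\mathrm{op}}\otimes\mathcal A)$ as a bimodule over itself, and $\sum_n\dim_k H^n\mathcal A(x,y)<\infty$ for all objects $x,y$. Here $\mathcal D(\mathcal B)$ denotes the localization of the category of right dg $\mathcal B$-modules at the objectwise quasi-isomorphisms, and $\mathcal D_c(\mathcal B)$ its subcategory of compact objects. Let $M\in\mathcal D_c(\mathcal A)$ be a compact right dg $\mathcal A$-module. For every $N\in\mathcal D_c(\mathcal A)$ the $k$-vector space $\bigoplus_n\mathrm{Hom}_{\mathcal D(\mathcal A)}(M,N[-n])$ is finite dimensional, so that the Euler pairing $$\chi([M],[N])=\sum_n(-1)^n\dim_k\mathrm{Hom}_{\mathcal D(\mathcal A)}(M,N[-n])\in\mathbb Z$$ is defined. The module $M$ has a homotopically projective resolution $Q\to M$, and for any such resolution and every compact right dg $\mathcal A^{\mathrm{op}}$-module $P\in\mathcal D_c(\mathcal A^{\mathrm{op}})$ the derived tensor product $M\otimes^{\mathbf L}_{\mathcal A}P=Q\otimes_{\mathcal A}P$ is a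 compact object of the derived category $\mathcal D(k)$ of $k$-vector spaces, so that it has a class in the Grothendieck group $K_0(k)=K_0(\mathcal D_c(k))$ of this triangulated category. Then $\chi([M],[N])=0$ for every $N\in\mathcal D_c(\mathcal A)$ if and only if $[M\otimes^{\mathbf L}_{\mathcal A}P]=0$ in $K_0(k)$ for every $P\in\mathcal D_c(\mathcal A^{\mathrm{op}})$. -/

import Mathlib

open CategoryTheory CategoryTheory.Limits
open scoped DirectSum TensorProduct

universe w u v v' u'

set_option linter.unusedSectionVars false

noncomputable section

namespace DG

/-- Cochain complexes of `k`-vector spaces. -/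
abbrev Cx (k : Type u) [Field k] := CochainComplex (ModuleCat.{u} k) ℤ

section SumTensor

variable {k : Type u} [Field k] {ι : Type u} (K L : ι → Cx k)

/-- The vector space `⨁ᵢ ⨁_{p + q = n} (K i)^p ⊗ (L i)^q`. -/
abbrev SumTensorX (n : ℤ) : Type u :=
  ⨁ s : ι × {pq : ℤ × ℤ // pq.1 + pq.2 = n},
    TensorProduct k ((K s.1).X s.2.1.1) ((L s.1).X s.2.1.2)

open Classical in
/-- The element `a ⊗ b` of the total tensor product, for `a ∈ (K i)^p` and `b ∈ (L i)^q`. -/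
def tmk (i : ι) {p q n : ℤ} (h : p + q = n) :
    (K i).X p →ₗ[k] (L i).X q →ₗ[k] SumTensorX K L n :=
  (TensorProduct.mk k _ _).compr₂
    (DirectSum.lof k (ι × {pq : ℤ × ℤ // pq.1 + pq.2 = n})
      (fun s => TensorProduct k ((K s.1).X s.2.1.1) ((L s.1).X s.2.1.2)) (i, ⟨(p, q), h⟩))

variable {K L}

open Classical in
/-- The linear map given on `a ⊗ b` by a family of bilinear maps. -/
def tlift {n : ℤ} {V : Type u} [AddCommGroup V] [Module k V]
    (φ : ∀ (i : ι) (p q : ℤ), p + q = n → (K i).X p →ₗ[k] (L i).X q →ₗ[k] V) :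
    SumTensorX K L n →ₗ[k] V :=
  DirectSum.toModule k _ V (fun s => TensorProduct.lift (φ s.1 s.2.1.1 s.2.1.2 s.2.2))

@[simp]
lemma tlift_tmk {n : ℤ} {V : Type u} [AddCommGroup V] [Module k V]
    (φ : ∀ (i : ι) (p q : ℤ), p + q = n → (K i).X p →ₗ[k] (L i).X q →ₗ[k] V)
    (i : ι) {p q : ℤ} (h : p + q = n) (a : (K i).X p) (b : (L i).X q) :
    tlift φ (tmk K L i h a b) = φ i p q h a b := by
  simp only [tlift, tmk, LinearMap.compr₂_apply, TensorProduct.mk_apply]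
  erw [DirectSum.toModule_lof]
  simp

lemma tensor_ext {n : ℤ} {V : Type u} [AddCommGroup V] [Module k V]
    {f g : SumTensorX K L n →ₗ[k] V}
    (h : ∀ (i : ι) (p q : ℤ) (h : p + q = n) (a : (K i).X p) (b : (L i).X q),
      f (tmk K L i h a b) = g (tmk K L i h a b)) : f = g := by
  classical
  refine DirectSum.linearMap_ext k fun s => TensorProduct.ext' fun a b => ?_
  obtain ⟨i, ⟨⟨p, q⟩, hs⟩⟩ := s
  exact h i p q hs a b

lemma tensor_ind {n : ℤ} {P : SumTensorX K L n → Prop} (h0 : P 0)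
    (hadd : ∀ f g, P f → P g → P (f + g))
    (h : ∀ (i : ι) (p q : ℤ) (h : p + q = n) (a : (K i).X p) (b : (L i).X q),
      P (tmk K L i h a b)) (f : SumTensorX K L n) : P f := by
  classical
  induction f using DirectSum.induction_on with
  | zero => exact h0
  | add f g hf hg => exact hadd f g hf hg
  | of s x =>
    obtain ⟨i, ⟨⟨p, q⟩, hs⟩⟩ := s
    induction x using TensorProduct.induction_on with
    | zero => simpa using h0
    | add x y hx hy => rw [map_add]; exact hadd _ _ hx hy
    | tmul a b => exact h i p q hs a b

variable (K L)

/-- The differential `d (a ⊗ b) = da ⊗ b + (-1)^|a| a ⊗ db`. -/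
def tensorD (n m : ℤ) : SumTensorX K L n →ₗ[k] SumTensorX K L m :=
  if hm : n + 1 = m then
    tlift fun i p q h =>
      (tmk K L i (show p + 1 + q = m by omega)).comp ((K i).d p (p + 1)).hom +
        (-1 : k) ^ p •
          (tmk K L i (show p + (q + 1) = m by omega)).compl₂ ((L i).d q (q + 1)).hom
  else 0

lemma tensorD_tmk (i : ι) {p q n m : ℤ} (hm : n + 1 = m) (h : p + q = n)
    (a : (K i).X p) (b : (L i).X q) :
    tensorD K L n m (tmk K L i h a b) =
      tmk K L i (show p + 1 + q = m by omega) (((K i).d p (p + 1)).hom a) b +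
        (-1 : k) ^ p •
          tmk K L i (show p + (q + 1) = m by omega) a (((L i).d q (q + 1)).hom b) := by
  rw [tensorD, dif_pos hm, tlift_tmk]
  rfl

lemma d_d {K : Cx k} {i j l : ℤ} (a : K.X i) : (K.d j l).hom ((K.d i j).hom a) = 0 := by
  rw [← LinearMap.comp_apply, ← ModuleCat.hom_comp, K.d_comp_d]; rfl

lemma sgn_succ (p : ℤ) : (-1 : k) ^ (p + 1) = - (-1 : k) ^ p := by
  rw [zpow_add_one₀ (by simp)]; ring

/-- The cochain complex `⨁ᵢ K i ⊗ L i`. -/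
def sumTensor : Cx k where
  X n := ModuleCat.of k (SumTensorX K L n)
  d n m := ModuleCat.ofHom (tensorD K L n m)
  shape n m h := by
    have : ¬ (n + 1 = m) := h
    rw [tensorD, dif_neg this]; rfl
  d_comp_d' n m l h h' := by
    have h1 : n + 1 = m := h
    have h2 : m + 1 = l := h'
    rw [← ModuleCat.ofHom_comp]
    have : tensorD K L m l ∘ₗ tensorD K L n m = 0 := by
      refine tensor_ext fun i p q hpq a b => ?_
      rw [LinearMap.comp_apply, tensorD_tmk K L i h1 hpq, map_add, map_smul,
        tensorD_tmk K L i h2, tensorD_tmk K L i h2, d_d, d_d, sgn_succ]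
      simp only [map_zero, LinearMap.zero_apply, smul_zero, zero_add, add_zero]
      rw [← add_smul, neg_add_cancel, zero_smul]
    rw [this]; rfl

end SumTensor

variable (k : Type u) [Field k]

/-- A (small) dg category over `k`, i.e. a category enriched over cochain complexes of `k`-vector
spaces. The composition `A(y, z) ⊗ A(x, y) ⟶ A(x, z)` is given by the bilinear maps
`A(y, z)^p × A(x, y)^q → A(x, z)^{p+q}`, `(f, g) ↦ f ∘ g`; it is a morphism of complexes by the
Leibniz rule `d (f ∘ g) = df ∘ g + (-1)^|f| f ∘ dg`. -/
structure DGCat : Type (u + 1) where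
  Obj : Type u
  Hom : Obj → Obj → Cx k
  id (x : Obj) : (Hom x x).X 0
  comp {x y z : Obj} {p q n : ℤ} (h : p + q = n) :
    (Hom y z).X p →ₗ[k] (Hom x y).X q →ₗ[k] (Hom x z).X n
  id_comp {x y : Obj} {p : ℤ} (f : (Hom x y).X p) : comp (zero_add p) (id y) f = f
  comp_id {x y : Obj} {p : ℤ} (f : (Hom x y).X p) : comp (add_zero p) f (id x) = f
  assoc {w x y z : Obj} {p q r s t n : ℤ} (hs : p + q = s) (ht : q + r = t)
    (h : s + r = n) (h' : p + t = n)
    (f : (Hom y z).X p) (g : (Hom x y).X q) (e : (Hom w x).X r) :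
    comp h (comp hs f g) e = comp h' f (comp ht g e)
  d_id (x : Obj) : ((Hom x x).d 0 1).hom (id x) = 0
  d_comp {x y z : Obj} {p q n : ℤ} (h : p + q = n)
    (f : (Hom y z).X p) (g : (Hom x y).X q) :
    ((Hom x z).d n (n + 1)).hom (comp h f g) =
      comp (show p + 1 + q = n + 1 by omega) (((Hom y z).d p (p + 1)).hom f) g +
        (-1 : k) ^ p •
          comp (show p + (q + 1) = n + 1 by omega) f (((Hom x y).d q (q + 1)).hom g)

variable {k}

lemma sgn_congr {a b : ℤ} (h : Even (a - b)) : (-1 : k) ^ a = (-1 : k) ^ b := by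
  have : a = b + (a - b) := by ring
  rw [this, zpow_add₀ (by simp), h.neg_one_zpow, mul_one]

namespace DGCat

/-- The opposite dg category: `Aᵒᵖ(x, y) = A(y, x)`, with `f ∘ᵒᵖ g = (-1)^{|f||g|} g ∘ f`. -/
abbrev op (A : DGCat k) : DGCat k where
  Obj := A.Obj
  Hom x y := A.Hom y x
  id x := A.id x
  comp {x y z p q n} h := (-1 : k) ^ (p * q) • (A.comp (show q + p = n by omega)).flip
  id_comp f := by simp [A.comp_id]
  comp_id f := by simp [A.id_comp]
  assoc {w x y z p q r s t n} hs ht h h' f g e := by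
    subst hs ht
    simp only [LinearMap.smul_apply, LinearMap.flip_apply, map_smul, smul_smul]
    rw [A.assoc (show r + q = q + r by omega) (show q + p = p + q by omega) _ (by omega),
      ← zpow_add₀ (by simp), ← zpow_add₀ (by simp)]
    congr 2
    ring
  d_id x := A.d_id x
  d_comp {x y z p q n} h f g := by
    simp only [LinearMap.smul_apply, LinearMap.flip_apply, map_smul]
    rw [A.d_comp, smul_add, smul_smul, smul_smul, ← zpow_add₀ (by simp), ← zpow_add₀ (by simp)]
    refine (add_comm _ _).trans (congrArg₂ _ (congrArg₂ _ ?_ rfl) (congrArg₂ _ ?_ rfl))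
    · exact sgn_congr ⟨0, by ring⟩
    · exact sgn_congr ⟨-p, by ring⟩

section Tensor

variable (A B : DGCat k)

variable {A B}

/-- The degree `n` part of `(A ⊗ B)(a, b) = A(a₁, b₁) ⊗ B(a₂, b₂)`. -/
abbrev TensX (a b : A.Obj × B.Obj) (n : ℤ) : Type u :=
  SumTensorX (fun _ : PUnit.{u + 1} => A.Hom a.1 b.1) (fun _ => B.Hom a.2 b.2) n

/-- The element `f ⊗ g` of `(A ⊗ B)(a, b)`. -/
abbrev tens {a b : A.Obj × B.Obj} {p q n : ℤ} (h : p + q = n) :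
    (A.Hom a.1 b.1).X p →ₗ[k] (B.Hom a.2 b.2).X q →ₗ[k] TensX a b n :=
  tmk (fun _ : PUnit.{u + 1} => A.Hom a.1 b.1) (fun _ => B.Hom a.2 b.2) PUnit.unit h

/-- Left composition with `f ⊗ g`. -/
def tensorComp₁ {a b c : A.Obj × B.Obj} {p q r s n : ℤ} (h : r + s = n) (hr : p + q = r)
    (f : (A.Hom b.1 c.1).X p) (g : (B.Hom b.2 c.2).X q) : TensX a b s →ₗ[k] TensX a c n :=
  tlift fun _ p' q' h' => (-1 : k) ^ (q * p') •
      (tens (show (p + p') + (q + q') = n by omega)).compl₁₂ (A.comp rfl f) (B.comp rfl g)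

lemma tensorComp₁_tens {a b c : A.Obj × B.Obj} {p q r s n p' q' : ℤ} (h : r + s = n)
    (hr : p + q = r) (f : (A.Hom b.1 c.1).X p) (g : (B.Hom b.2 c.2).X q) (h' : p' + q' = s)
    (f' : (A.Hom a.1 b.1).X p') (g' : (B.Hom a.2 b.2).X q') :
    tensorComp₁ h hr f g (tens h' f' g') = (-1 : k) ^ (q * p') •
      tens (show (p + p') + (q + q') = n by omega) (A.comp rfl f f') (B.comp rfl g g') := by
  rw [tensorComp₁, tlift_tmk]
  rfl

lemma tens_ext {a b : A.Obj × B.Obj} {n : ℤ} {V : Type u} [AddCommGroup V] [Module k V]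
    {F G : TensX a b n →ₗ[k] V}
    (h : ∀ (p q : ℤ) (h : p + q = n) (f : (A.Hom a.1 b.1).X p) (g : (B.Hom a.2 b.2).X q),
      F (tens h f g) = G (tens h f g)) : F = G :=
  tensor_ext fun _ _ _ _ _ _ => h _ _ _ _ _

lemma tens_ind {a b : A.Obj × B.Obj} {n : ℤ} {P : TensX a b n → Prop} (h0 : P 0)
    (hadd : ∀ f g, P f → P g → P (f + g))
    (h : ∀ (p q : ℤ) (h : p + q = n) (f : (A.Hom a.1 b.1).X p) (g : (B.Hom a.2 b.2).X q),
      P (tens h f g)) (f : TensX a b n) : P f :=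
  tensor_ind h0 hadd (fun _ _ _ _ _ _ => h _ _ _ _ _) f

/-- Composition in the tensor product:
`(f ⊗ g) ∘ (f' ⊗ g') = (-1)^{|g||f'|} (f ∘ f') ⊗ (g ∘ g')`. -/
def tensorComp {a b c : A.Obj × B.Obj} {r s n : ℤ} (h : r + s = n) :
    TensX b c r →ₗ[k] TensX a b s →ₗ[k] TensX a c n :=
  tlift fun _ _ _ hr => LinearMap.mk₂ k (fun f g => tensorComp₁ h hr f g)
    (fun f f' g => tens_ext fun _ _ _ _ _ => by
      simp only [LinearMap.add_apply, tensorComp₁_tens, map_add, smul_add])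
    (fun c f g => tens_ext fun _ _ _ _ _ => by
      simp only [LinearMap.smul_apply, tensorComp₁_tens, map_smul, smul_comm c])
    (fun f g g' => tens_ext fun _ _ _ _ _ => by
      simp only [LinearMap.add_apply, tensorComp₁_tens, map_add, smul_add])
    (fun c f g => tens_ext fun _ _ _ _ _ => by
      simp only [LinearMap.smul_apply, tensorComp₁_tens, map_smul, smul_comm c])

lemma tensorComp_tens {a b c : A.Obj × B.Obj} {p q r s n p' q' p'' q'' : ℤ} (h : r + s = n)
    (hr : p + q = r)
    (f : (A.Hom b.1 c.1).X p) (g : (B.Hom b.2 c.2).X q) (h' : p' + q' = s)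
    (f' : (A.Hom a.1 b.1).X p') (g' : (B.Hom a.2 b.2).X q')
    (hp : p + p' = p'') (hq : q + q' = q'') :
    tensorComp h (tens hr f g) (tens h' f' g') = (-1 : k) ^ (q * p') •
      tens (show p'' + q'' = n by omega) (A.comp hp f f') (B.comp hq g g') := by
  subst hp hq
  rw [tensorComp, tlift_tmk]
  exact tensorComp₁_tens h hr f g h' f' g'

lemma tensorComp_assoc {w x y z : A.Obj × B.Obj} {p q r s t n : ℤ} (hs : p + q = s)
    (ht : q + r = t) (h : s + r = n) (h' : p + t = n)
    (f : TensX y z p) (g : TensX x y q) (e : TensX w x r) :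
    tensorComp h (tensorComp hs f g) e = tensorComp h' f (tensorComp ht g e) := by
  induction f using tens_ind with
  | h0 => simp
  | hadd f f' hf hf' => simp only [map_add, LinearMap.add_apply, hf, hf']
  | h p₁ p₂ hp f₁ f₂ =>
  induction g using tens_ind with
  | h0 => simp
  | hadd f f' hf hf' => simp only [map_add, LinearMap.add_apply, hf, hf']
  | h q₁ q₂ hq g₁ g₂ =>
  induction e using tens_ind with
  | h0 => simp
  | hadd f f' hf hf' => simp only [map_add, hf, hf']
  | h r₁ r₂ hr e₁ e₂ =>
  rw [tensorComp_tens hs hp f₁ f₂ hq g₁ g₂ rfl rfl, tensorComp_tens ht hq g₁ g₂ hr e₁ e₂ rfl rfl,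
    map_smul, map_smul, LinearMap.smul_apply,
    tensorComp_tens h _ _ _ hr e₁ e₂ rfl rfl,
    tensorComp_tens h' hp f₁ f₂ _ _ _ (add_assoc p₁ q₁ r₁).symm (add_assoc p₂ q₂ r₂).symm,
    A.assoc rfl rfl rfl (add_assoc p₁ q₁ r₁).symm, B.assoc rfl rfl rfl (add_assoc p₂ q₂ r₂).symm,
    smul_smul, smul_smul, ← zpow_add₀ (by simp), ← zpow_add₀ (by simp)]
  congr 2
  ring

lemma tensorComp_d {x y z : A.Obj × B.Obj} {p q n : ℤ} (h : p + q = n)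
    (f : TensX y z p) (g : TensX x y q) :
    tensorD _ _ n (n + 1) (tensorComp h f g) =
      tensorComp (show p + 1 + q = n + 1 by omega) (tensorD _ _ p (p + 1) f) g +
      (-1 : k) ^ p • tensorComp (show p + (q + 1) = n + 1 by omega) f (tensorD _ _ q (q + 1) g) := by
  induction f using tens_ind with
  | h0 => simp
  | hadd f f' hf hf' => simp only [map_add, LinearMap.add_apply, hf, hf', smul_add]; abel
  | h p₁ p₂ hp f₁ f₂ =>
  induction g using tens_ind with
  | h0 => simp
  | hadd f f' hf hf' => simp only [map_add, hf, hf', smul_add]; abel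
  | h q₁ q₂ hq g₁ g₂ =>
  rw [tensorComp_tens h hp f₁ f₂ hq g₁ g₂ rfl rfl, map_smul, tensorD_tmk _ _ _ rfl hp,
    tensorD_tmk _ _ _ rfl hq, tensorD_tmk _ _ _ rfl]
  rw [A.d_comp rfl, B.d_comp rfl]
  simp only [map_add, map_smul, LinearMap.add_apply, LinearMap.smul_apply]
  rw [tensorComp_tens _ _ _ _ hq g₁ g₂ (show p₁ + 1 + q₁ = p₁ + q₁ + 1 by omega) rfl,
    tensorComp_tens _ _ _ _ hq g₁ g₂ rfl (show p₂ + 1 + q₂ = p₂ + q₂ + 1 by omega),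
    tensorComp_tens _ hp f₁ f₂ _ _ _ (show p₁ + (q₁ + 1) = p₁ + q₁ + 1 by omega) rfl,
    tensorComp_tens _ hp f₁ f₂ _ _ _ rfl (show p₂ + (q₂ + 1) = p₂ + q₂ + 1 by omega)]
  simp only [smul_add, smul_smul, ← zpow_add₀ (show (-1 : k) ≠ 0 by simp)]
  rw [add_add_add_comm]
  refine congrArg₂ _ (congrArg₂ _ rfl ?_) (congrArg₂ _ ?_ ?_) <;>
    refine congrArg₂ _ (sgn_congr ?_) rfl
  · exact ⟨0, by ring⟩
  · exact ⟨-p₂, by rw [← hp]; ring⟩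
  · exact ⟨0, by rw [← hp]; ring⟩

variable (A B)

/-- The tensor product of dg categories, with
`(A ⊗ B)((x, w), (y, z)) = A(x, y) ⊗ B(w, z)`. -/
abbrev tensor : DGCat k where
  Obj := A.Obj × B.Obj
  Hom a b := sumTensor (fun _ : PUnit.{u + 1} => A.Hom a.1 b.1) (fun _ => B.Hom a.2 b.2)
  id a := tens (add_zero 0) (A.id a.1) (B.id a.2)
  comp h := tensorComp h
  id_comp {a b p} f := by
    have : tensorComp (zero_add p) (tens (add_zero 0) (A.id b.1) (B.id b.2)) =
        (LinearMap.id : TensX a b p →ₗ[k] _) := by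
      refine tens_ext fun p' q' h' f g => ?_
      refine (tensorComp_tens _ _ _ _ h' _ _ (zero_add p') (zero_add q')).trans ?_
      rw [A.id_comp, B.id_comp]
      simp
    exact LinearMap.congr_fun this f
  comp_id {a b p} f := by
    have : (tensorComp (add_zero p)).flip (tens (add_zero 0) (A.id a.1) (B.id a.2)) =
        (LinearMap.id : TensX a b p →ₗ[k] _) := by
      refine tens_ext fun p' q' h' f g => ?_
      refine (tensorComp_tens _ h' _ _ _ _ _ (add_zero p') (add_zero q')).trans ?_
      rw [A.comp_id, B.comp_id]
      simp
    exact LinearMap.congr_fun this f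
  assoc hs ht h h' f g e := tensorComp_assoc hs ht h h' f g e
  d_id a := by
    refine (tensorD_tmk _ _ _ (zero_add 1) (add_zero 0) _ _).trans ?_
    erw [A.d_id, B.d_id]
    simp only [map_zero, LinearMap.zero_apply, smul_zero, add_zero]
    rfl
  d_comp h f g := tensorComp_d h f g

end Tensor

end DGCat
end DG

namespace DG
namespace LocAdd

variable {C : Type u} [Category.{v} C] [Preadditive C] [HasBinaryBiproducts C]
  {W : MorphismProperty C} [PreservesFiniteProducts W.Q]

variable (W) in
/-- `Q (X ⊞ Y)` is the product of `Q X` and `Q Y`. -/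
def isLim (X Y : C) : IsLimit (BinaryFan.mk (W.Q.map (biprod.fst : X ⊞ Y ⟶ X))
    (W.Q.map (biprod.snd : X ⊞ Y ⟶ Y))) :=
  mapIsLimitOfPreservesOfIsLimit W.Q _ _ (BinaryBiproduct.isLimit X Y)

/-- The morphism to `Q (X ⊞ Y)` with given components. -/
def lift {T : W.Localization} {X Y : C} (f : T ⟶ W.Q.obj X) (g : T ⟶ W.Q.obj Y) :
    T ⟶ W.Q.obj (X ⊞ Y) :=
  (BinaryFan.IsLimit.lift' (isLim W X Y) f g).1

@[simp]
lemma lift_fst {T : W.Localization} {X Y : C} (f : T ⟶ W.Q.obj X) (g : T ⟶ W.Q.obj Y) :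
    lift f g ≫ W.Q.map biprod.fst = f :=
  (BinaryFan.IsLimit.lift' (isLim W X Y) f g).2.1

@[simp]
lemma lift_snd {T : W.Localization} {X Y : C} (f : T ⟶ W.Q.obj X) (g : T ⟶ W.Q.obj Y) :
    lift f g ≫ W.Q.map biprod.snd = g :=
  (BinaryFan.IsLimit.lift' (isLim W X Y) f g).2.2

@[simp]
lemma lift_fst_assoc {T Z : W.Localization} {X Y : C} (f : T ⟶ W.Q.obj X) (g : T ⟶ W.Q.obj Y)
    (h : W.Q.obj X ⟶ Z) : lift f g ≫ W.Q.map biprod.fst ≫ h = f ≫ h := by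
  rw [← Category.assoc, lift_fst]

@[simp]
lemma lift_snd_assoc {T Z : W.Localization} {X Y : C} (f : T ⟶ W.Q.obj X) (g : T ⟶ W.Q.obj Y)
    (h : W.Q.obj Y ⟶ Z) : lift f g ≫ W.Q.map biprod.snd ≫ h = g ≫ h := by
  rw [← Category.assoc, lift_snd]

lemma Q_ext {T : W.Localization} {X Y : C} {f g : T ⟶ W.Q.obj (X ⊞ Y)}
    (h₁ : f ≫ W.Q.map biprod.fst = g ≫ W.Q.map biprod.fst)
    (h₂ : f ≫ W.Q.map biprod.snd = g ≫ W.Q.map biprod.snd) : f = g :=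
  BinaryFan.IsLimit.hom_ext (isLim W X Y) h₁ h₂

/-- The sum of two morphisms `T ⟶ Q Y`. -/
def add {T : W.Localization} {Y : C} (f g : T ⟶ W.Q.obj Y) : T ⟶ W.Q.obj Y :=
  lift f g ≫ W.Q.map (biprod.fst + biprod.snd)

lemma add_map {T : W.Localization} {Z Y : C} (t : T ⟶ W.Q.obj Z) (a b : Z ⟶ Y) :
    add (t ≫ W.Q.map a) (t ≫ W.Q.map b) = t ≫ W.Q.map (a + b) := by
  have : lift (t ≫ W.Q.map a) (t ≫ W.Q.map b) = t ≫ W.Q.map (biprod.lift a b) := by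
    apply Q_ext <;> simp [← Functor.map_comp]
  rw [add, this, Category.assoc, ← Functor.map_comp]
  simp

lemma comp_add {S T : W.Localization} {Y : C} (s : S ⟶ T) (f g : T ⟶ W.Q.obj Y) :
    s ≫ add f g = add (s ≫ f) (s ≫ g) := by
  have : lift (s ≫ f) (s ≫ g) = s ≫ lift f g := by apply Q_ext <;> simp
  rw [add, add, this, Category.assoc]

variable [HasZeroObject C]

open ZeroObject in
lemma comp_zero {T : C} {Y Z : C} (f : W.Q.obj T ⟶ W.Q.obj Y) :
    f ≫ W.Q.map (0 : Y ⟶ Z) = W.Q.map 0 := by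
  have h : IsTerminal (W.Q.obj (0 : C)) :=
    IsTerminal.isTerminalObj W.Q _ (isZero_zero C).isTerminal
  have h1 : (0 : Y ⟶ Z) = (0 : Y ⟶ 0) ≫ (0 : 0 ⟶ Z) := by simp
  have h2 : (0 : T ⟶ Z) = (0 : T ⟶ 0) ≫ (0 : 0 ⟶ Z) := by simp
  rw [h1, h2, Functor.map_comp, Functor.map_comp, ← Category.assoc]
  congr 1
  exact h.hom_ext _ _

variable (W) in
/-- The morphisms which are compatible with the addition. -/
def addProp : MorphismProperty W.Localization := fun X Y h =>
  W.Q.map (biprod.fst + biprod.snd : X.as.obj ⊞ X.as.obj ⟶ X.as.obj) ≫ (show W.Q.obj X.as.obj ⟶ Y from h) =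
    add (Y := Y.as.obj) (W.Q.map biprod.fst ≫ h) (W.Q.map biprod.snd ≫ h)

lemma add_comp_of {T : W.Localization} {X Y : C} (f g : T ⟶ W.Q.obj X)
    (h : W.Q.obj X ⟶ W.Q.obj Y) (hh : addProp W h) : add f g ≫ h = add (f ≫ h) (g ≫ h) := by
  have hh' : W.Q.map (biprod.fst + biprod.snd : X ⊞ X ⟶ X) ≫ h =
    add (W.Q.map biprod.fst ≫ h) (W.Q.map biprod.snd ≫ h) := hh
  rw [add, Category.assoc, hh', comp_add]
  simp

lemma addProp_map {X Y : C} (f : X ⟶ Y) : addProp W (W.Q.map f) := by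
  have := add_map (W := W) (𝟙 _) ((biprod.fst : X ⊞ X ⟶ X) ≫ f) (biprod.snd ≫ f)
  simp only [Category.id_comp, Functor.map_comp, ← Preadditive.add_comp] at this
  exact this.symm

instance : (addProp W).IsStableUnderComposition where
  comp_mem := by
    rintro ⟨⟨X⟩⟩ ⟨⟨Y⟩⟩ ⟨⟨Z⟩⟩ f g hf hg
    change W.Q.obj X ⟶ W.Q.obj Y at f
    change W.Q.obj Y ⟶ W.Q.obj Z at g
    have h1 : W.Q.map (biprod.fst + biprod.snd : X ⊞ X ⟶ X) ≫ f =
      add (W.Q.map biprod.fst ≫ f) (W.Q.map biprod.snd ≫ f) := hf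
    change W.Q.map (biprod.fst + biprod.snd : X ⊞ X ⟶ X) ≫ f ≫ g =
      add (W.Q.map biprod.fst ≫ f ≫ g) (W.Q.map biprod.snd ≫ f ≫ g)
    rw [← Category.assoc, h1, add_comp_of _ _ g hg, Category.assoc, Category.assoc]

lemma addProp_eq_top : addProp W = ⊤ := by
  refine Localization.Construction.morphismProperty_eq_top' _ (fun _ _ f => addProp_map f) ?_
  rintro ⟨⟨X⟩⟩ ⟨⟨Y⟩⟩ e he
  change W.Q.obj X ≅ W.Q.obj Y at e
  change W.Q.map (biprod.fst + biprod.snd : Y ⊞ Y ⟶ Y) ≫ e.inv =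
    add (W.Q.map biprod.fst ≫ e.inv) (W.Q.map biprod.snd ≫ e.inv)
  rw [← cancel_mono e.hom, add_comp_of _ _ _ he]
  have := add_map (W := W) (𝟙 _) (biprod.fst : Y ⊞ Y ⟶ Y) biprod.snd
  simp only [Category.id_comp] at this
  simp [this]

lemma add_comp {T : W.Localization} {X Y : C} (f g : T ⟶ W.Q.obj X)
    (h : W.Q.obj X ⟶ W.Q.obj Y) : add f g ≫ h = add (f ≫ h) (g ≫ h) :=
  add_comp_of _ _ _ (by rw [addProp_eq_top]; trivial)

lemma add_comm' {T : W.Localization} {Y : C} (f g : T ⟶ W.Q.obj Y) : add f g = add g f := by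
  have h1 := add_map (lift f g) biprod.fst biprod.snd
  have h2 := add_map (lift f g) biprod.snd biprod.fst
  rw [add_comm, ← h1] at h2
  simpa using h2.symm

lemma add_assoc' {T : W.Localization} {Y : C} (f g h : T ⟶ W.Q.obj Y) :
    add (add f g) h = add f (add g h) := by
  let t := lift f (lift g h)
  have hf : f = t ≫ W.Q.map biprod.fst := by simp [t]
  have hg : g = t ≫ W.Q.map (biprod.snd ≫ biprod.fst) := by simp [t]
  have hh : h = t ≫ W.Q.map (biprod.snd ≫ biprod.snd) := by simp [t]
  rw [hf, hg, hh, add_map, add_map, add_map, add_map, add_assoc]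

lemma zero_add' {T Y : C} (f : W.Q.obj T ⟶ W.Q.obj Y) : add (W.Q.map 0) f = f := by
  have := add_map f 0 (𝟙 Y)
  rw [comp_zero] at this
  simpa using this

lemma neg_add' {T Y : C} (f : W.Q.obj T ⟶ W.Q.obj Y) :
    add (f ≫ W.Q.map (-𝟙 Y)) f = W.Q.map 0 := by
  have := add_map f (-𝟙 Y) (𝟙 Y)
  rw [neg_add_cancel, comp_zero] at this
  simpa using this

variable (W) in
/-- The additive structure on morphisms in the localized category. -/
@[reducible]
def addCommGroup (X Y : C) : AddCommGroup (W.Q.obj X ⟶ W.Q.obj Y) :=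
  letI : Zero (W.Q.obj X ⟶ W.Q.obj Y) := ⟨W.Q.map 0⟩
  letI : Add (W.Q.obj X ⟶ W.Q.obj Y) := ⟨add⟩
  letI : Neg (W.Q.obj X ⟶ W.Q.obj Y) := ⟨fun f => f ≫ W.Q.map (-𝟙 Y)⟩
  { add_assoc := add_assoc'
    zero_add := zero_add'
    add_zero := fun f => (add_comm' _ _).trans (zero_add' f)
    nsmul := nsmulRec
    zsmul := zsmulRec
    neg_add_cancel := neg_add'
    add_comm := add_comm' }

variable (W) in
/-- The localized category is preadditive. -/
@[reducible]
def preadditive : Preadditive W.Localization where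
  homGroup X Y := addCommGroup W X.as.obj Y.as.obj
  add_comp _ Y Z f g h := add_comp (X := Y.as.obj) (Y := Z.as.obj) f g h
  comp_add _ _ Z f g h := comp_add (Y := Z.as.obj) f g h

lemma additive : letI := preadditive W; W.Q.Additive := by
  let := preadditive W
  refine ⟨fun {X Y f g} => ?_⟩
  have := add_map (W := W) (𝟙 _) f g
  simp only [Category.id_comp] at this
  exact this.symm

end LocAdd
end DG

namespace DG
variable {k : Type u} [Field k]

/-- A right dg `A`-module `M`: complexes `M(x)` with an action `M(y)^p × A(x, y)^q → M(x)^{p+q}`,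
`(m, f) ↦ m · f`, which is unital, associative and satisfies the Leibniz rule. This is the same
thing as a dg functor from `Aᵒᵖ` to the dg category of complexes, which sends `f ∈ A(x, y)^q` to
the map `m ↦ (-1)^{|f||m|} m · f`. -/
structure DGModule (A : DGCat k) : Type (u + 1) where
  obj : A.Obj → Cx k
  act {x y : A.Obj} {p q n : ℤ} (h : p + q = n) :
    (obj y).X p →ₗ[k] (A.Hom x y).X q →ₗ[k] (obj x).X n
  act_id {x : A.Obj} {p : ℤ} (m : (obj x).X p) : act (add_zero p) m (A.id x) = m
  act_comp {x y z : A.Obj} {p q r s t n : ℤ} (hs : p + q = s) (ht : q + r = t)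
    (h : s + r = n) (h' : p + t = n)
    (m : (obj z).X p) (f : (A.Hom y z).X q) (g : (A.Hom x y).X r) :
    act h (act hs m f) g = act h' m (A.comp ht f g)
  d_act {x y : A.Obj} {p q n : ℤ} (h : p + q = n)
    (m : (obj y).X p) (f : (A.Hom x y).X q) :
    ((obj x).d n (n + 1)).hom (act h m f) =
      act (show p + 1 + q = n + 1 by omega) (((obj y).d p (p + 1)).hom m) f +
        (-1 : k) ^ p •
          act (show p + (q + 1) = n + 1 by omega) m (((A.Hom x y).d q (q + 1)).hom f)

namespace DGModule

variable {A : DGCat k}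

/-- A morphism of right dg modules: chain maps compatible with the action. -/
@[ext]
structure Hom (M N : DGModule A) where
  app (x : A.Obj) : M.obj x ⟶ N.obj x
  map_act {x y : A.Obj} {p q n : ℤ} (h : p + q = n) (m : (M.obj y).X p)
    (f : (A.Hom x y).X q) :
    ((app x).f n).hom (M.act h m f) = N.act h (((app y).f p).hom m) f

instance : Category (DGModule A) where
  Hom := Hom
  id M := { app := fun x => 𝟙 _, map_act := fun h m f => rfl }
  comp f g :=
    { app := fun x => f.app x ≫ g.app x
      map_act := fun h m a => by simp [f.map_act, g.map_act] }

@[ext]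
lemma hom_ext {M N : DGModule A} {f g : M ⟶ N} (h : ∀ x, f.app x = g.app x) : f = g :=
  Hom.ext (funext h)

@[simp] lemma id_app (M : DGModule A) (x : A.Obj) : Hom.app (𝟙 M) x = 𝟙 _ := rfl
@[simp] lemma comp_app {M N P : DGModule A} (f : M ⟶ N) (g : N ⟶ P) (x : A.Obj) :
  (f ≫ g).app x = f.app x ≫ g.app x := rfl

section
variable (M N : DGModule A)

instance : Zero (M ⟶ N) := ⟨{ app := fun _ => 0, map_act := fun h m f => by simp }⟩
instance : Add (M ⟶ N) :=
  ⟨fun f g => { app := fun x => f.app x + g.app x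
                map_act := fun h m a => by simp [f.map_act, g.map_act] }⟩
instance : Neg (M ⟶ N) :=
  ⟨fun f => { app := fun x => - f.app x, map_act := fun h m a => by simp [f.map_act] }⟩
instance : Sub (M ⟶ N) :=
  ⟨fun f g => { app := fun x => f.app x - g.app x
                map_act := fun h m a => by simp [f.map_act, g.map_act] }⟩
instance : SMul k (M ⟶ N) :=
  ⟨fun c f => { app := fun x => c • f.app x, map_act := fun h m a => by simp [f.map_act] }⟩
instance : SMul ℕ (M ⟶ N) :=
  ⟨fun c f => { app := fun x => c • f.app x, map_act := fun h m a => by simp [f.map_act] }⟩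
instance : SMul ℤ (M ⟶ N) :=
  ⟨fun c f => { app := fun x => c • f.app x, map_act := fun h m a => by simp [f.map_act] }⟩

variable {M N}
@[simp] lemma zero_app (x : A.Obj) : Hom.app (0 : M ⟶ N) x = 0 := rfl
@[simp] lemma add_app (f g : M ⟶ N) (x : A.Obj) : (f + g).app x = f.app x + g.app x := rfl
@[simp] lemma smul_app (c : k) (f : M ⟶ N) (x : A.Obj) : (c • f).app x = c • f.app x := rfl

instance : AddCommGroup (M ⟶ N) :=
  Function.Injective.addCommGroup (fun (f : M ⟶ N) (x : A.Obj) => f.app x)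
    (fun _ _ h => hom_ext (congrFun h)) rfl (fun _ _ => rfl) (fun _ => rfl) (fun _ _ => rfl)
    (fun _ _ => rfl) (fun _ _ => rfl)

instance : Module k (M ⟶ N) :=
  Function.Injective.module k
    (AddMonoidHom.mk' (fun (f : M ⟶ N) (x : A.Obj) => f.app x) (fun _ _ => rfl))
    (fun _ _ h => hom_ext (congrFun h)) (fun _ _ => rfl)

end

instance : Preadditive (DGModule A) where

instance : Linear k (DGModule A) where

/-- Evaluation at an object. -/
@[simps]
def ev (x : A.Obj) : DGModule A ⥤ Cx k where
  obj M := M.obj x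
  map f := f.app x

instance (x : A.Obj) : (ev x).Additive where

/-- The zero dg module. -/
def zero (A : DGCat k) : DGModule A where
  obj _ :=
    { X := fun _ => ModuleCat.of k PUnit.{u + 1}
      d := fun _ _ => 0 }
  act _ := 0
  act_id _ := rfl
  act_comp _ _ _ _ _ _ _ := rfl
  d_act _ _ _ := rfl

lemma isZero_zero (A : DGCat k) : IsZero (zero A) := by
  rw [IsZero.iff_id_eq_zero]
  ext x n m
  rfl

instance : HasZeroObject (DGModule A) := ⟨⟨zero A, isZero_zero A⟩⟩

lemma d_f {K L : Cx k} (f : K ⟶ L) {i j : ℤ} (a : K.X i) :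
    (L.d i j).hom ((f.f i).hom a) = (f.f j).hom ((K.d i j).hom a) := by
  rw [← LinearMap.comp_apply, ← ModuleCat.hom_comp, f.comm]; rfl

lemma comp_el {K L P : Cx k} (f : K ⟶ L) (g : L ⟶ P) {n : ℤ} (a : K.X n) :
    (g.f n).hom ((f.f n).hom a) = ((f ≫ g).f n).hom a := rfl

lemma fst_inl {K L : Cx k} {n : ℤ} (a : K.X n) :
    ((biprod.fst : K ⊞ L ⟶ K).f n).hom (((biprod.inl : K ⟶ K ⊞ L).f n).hom a) = a := by
  rw [comp_el, biprod.inl_fst]; rfl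

lemma snd_inl {K L : Cx k} {n : ℤ} (a : K.X n) :
    ((biprod.snd : K ⊞ L ⟶ L).f n).hom (((biprod.inl : K ⟶ K ⊞ L).f n).hom a) = 0 := by
  rw [comp_el, biprod.inl_snd]; rfl

lemma fst_inr {K L : Cx k} {n : ℤ} (a : L.X n) :
    ((biprod.fst : K ⊞ L ⟶ K).f n).hom (((biprod.inr : L ⟶ K ⊞ L).f n).hom a) = 0 := by
  rw [comp_el, biprod.inr_fst]; rfl

lemma snd_inr {K L : Cx k} {n : ℤ} (a : L.X n) :
    ((biprod.snd : K ⊞ L ⟶ L).f n).hom (((biprod.inr : L ⟶ K ⊞ L).f n).hom a) = a := by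
  rw [comp_el, biprod.inr_snd]; rfl

/-- The componentwise action on a direct sum. -/
def prodAct (M N : DGModule A) {x y : A.Obj} {p q n : ℤ} (h : p + q = n) :
    (M.obj y ⊞ N.obj y).X p →ₗ[k] (A.Hom x y).X q →ₗ[k] (M.obj x ⊞ N.obj x).X n :=
  ((M.act h).compr₂ ((biprod.inl : M.obj x ⟶ M.obj x ⊞ N.obj x).f n).hom).comp
      ((biprod.fst : M.obj y ⊞ N.obj y ⟶ M.obj y).f p).hom +
    ((N.act h).compr₂ ((biprod.inr : N.obj x ⟶ M.obj x ⊞ N.obj x).f n).hom).comp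
      ((biprod.snd : M.obj y ⊞ N.obj y ⟶ N.obj y).f p).hom

lemma prodAct_apply (M N : DGModule A) {x y : A.Obj} {p q n : ℤ} (h : p + q = n)
    (m : (M.obj y ⊞ N.obj y).X p) (f : (A.Hom x y).X q) :
    prodAct M N h m f =
      ((biprod.inl : M.obj x ⟶ M.obj x ⊞ N.obj x).f n).hom
        (M.act h (((biprod.fst : M.obj y ⊞ N.obj y ⟶ M.obj y).f p).hom m) f) +
      ((biprod.inr : N.obj x ⟶ M.obj x ⊞ N.obj x).f n).hom
        (N.act h (((biprod.snd : M.obj y ⊞ N.obj y ⟶ N.obj y).f p).hom m) f) := rfl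

section
variable (M N : DGModule A) {x y : A.Obj} {p q n : ℤ} (h : p + q = n) (f : (A.Hom x y).X q)

lemma prodAct_fst (m : (M.obj y ⊞ N.obj y).X p) :
    ((biprod.fst : M.obj x ⊞ N.obj x ⟶ _).f n).hom (prodAct M N h m f) =
      M.act h (((biprod.fst : M.obj y ⊞ N.obj y ⟶ _).f p).hom m) f := by
  rw [prodAct_apply, map_add, fst_inl, fst_inr, add_zero]

lemma prodAct_snd (m : (M.obj y ⊞ N.obj y).X p) :
    ((biprod.snd : M.obj x ⊞ N.obj x ⟶ _).f n).hom (prodAct M N h m f) =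
      N.act h (((biprod.snd : M.obj y ⊞ N.obj y ⟶ _).f p).hom m) f := by
  rw [prodAct_apply, map_add, snd_inl, snd_inr, zero_add]

lemma prodAct_inl (m : (M.obj y).X p) :
    prodAct M N h (((biprod.inl : _ ⟶ M.obj y ⊞ N.obj y).f p).hom m) f =
      ((biprod.inl : _ ⟶ M.obj x ⊞ N.obj x).f n).hom (M.act h m f) := by
  rw [prodAct_apply, fst_inl, snd_inl, map_zero, LinearMap.zero_apply, map_zero, add_zero]

lemma prodAct_inr (m : (N.obj y).X p) :
    prodAct M N h (((biprod.inr : _ ⟶ M.obj y ⊞ N.obj y).f p).hom m) f =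
      ((biprod.inr : _ ⟶ M.obj x ⊞ N.obj x).f n).hom (N.act h m f) := by
  rw [prodAct_apply, fst_inr, snd_inr, map_zero, LinearMap.zero_apply, map_zero, zero_add]

end

/-- The direct sum of two dg modules. -/
def prod (M N : DGModule A) : DGModule A where
  obj x := M.obj x ⊞ N.obj x
  act h := prodAct M N h
  act_id {x p} m := by
    simp only [prodAct_apply, act_id]
    simp only [← LinearMap.comp_apply, ← ModuleCat.hom_comp, ← HomologicalComplex.comp_f,
      ← LinearMap.add_apply, ← ModuleCat.hom_add, ← HomologicalComplex.add_f_apply, biprod.total]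
    rfl
  act_comp hs ht h h' m f g := by
    rw [prodAct_apply M N h, prodAct_fst, prodAct_snd, M.act_comp hs ht h h',
      N.act_comp hs ht h h', prodAct_apply]
  d_act h m f := by
    simp only [prodAct_apply, map_add, d_f, M.d_act h, N.d_act h, map_smul, smul_add]
    abel

/-- The direct sum as a biproduct. -/
def bicone (M N : DGModule A) : BinaryBicone M N where
  pt := prod M N
  fst :=
    { app := fun x => biprod.fst
      map_act := fun h m f => prodAct_fst M N h f m }
  snd :=
    { app := fun x => biprod.snd
      map_act := fun h m f => prodAct_snd M N h f m }
  inl :=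
    { app := fun x => biprod.inl
      map_act := fun h m f => (prodAct_inl M N h f m).symm }
  inr :=
    { app := fun x => biprod.inr
      map_act := fun h m f => (prodAct_inr M N h f m).symm }
  inl_fst := by ext x : 1; exact biprod.inl_fst
  inl_snd := by ext x : 1; exact biprod.inl_snd
  inr_fst := by ext x : 1; exact biprod.inr_fst
  inr_snd := by ext x : 1; exact biprod.inr_snd

instance : HasBinaryBiproducts (DGModule A) where
  has_binary_biproduct M N := HasBinaryBiproduct.mk
    ⟨bicone M N, isBinaryBilimitOfTotal _ (by ext x : 1; exact biprod.total)⟩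

instance : HasFiniteProducts (DGModule A) := hasFiniteProducts_of_has_binary_and_terminal

instance : HasFiniteBiproducts (DGModule A) := HasFiniteBiproducts.of_hasFiniteProducts

/-- The class of objectwise quasi-isomorphisms. -/
def qis (A : DGCat k) : MorphismProperty (DGModule A) := fun _ _ f => ∀ x, QuasiIso (f.app x)

instance : (qis A).ContainsIdentities where
  id_mem M x := inferInstanceAs (QuasiIso (𝟙 (M.obj x)))

instance : (qis A).IsStableUnderFiniteProducts where
  isStableUnderProductsOfShape J _ := ⟨fun X₁ X₂ c₁ c₂ hc₁ hc₂ f hf φ hφ x => by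
    rw [quasiIso_iff]
    intro n
    rw [quasiIsoAt_iff_isIso_homologyMap]
    let F : DGModule A ⥤ ModuleCat.{u} k :=
      ev x ⋙ HomologicalComplex.homologyFunctor _ (ComplexShape.up ℤ) n
    have : F.Additive := inferInstance
    have : PreservesLimitsOfShape (Discrete J) F := by
      have : PreservesFiniteProducts F := ⟨fun _ => preservesProductsOfShape_of_preservesBiproductsOfShape F⟩
      infer_instance
    have hf' : ∀ j, IsIso ((Functor.whiskerRight f F).app j) := fun j => by
      have := hf j x
      change IsIso (HomologicalComplex.homologyMap ((f.app j).app x) n)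
      infer_instance
    have := NatIso.isIso_of_isIso_app (Functor.whiskerRight f F)
    let e := (isLimitOfPreserves F hc₁).conePointsIsoOfNatIso (isLimitOfPreserves F hc₂)
      (asIso (Functor.whiskerRight f F))
    have he : e.hom = F.map φ := (isLimitOfPreserves F hc₂).hom_ext fun j => by
      simp only [e, IsLimit.conePointsIsoOfNatIso_hom]
      refine (IsLimit.map_π _ _ _ _).trans ?_
      change F.map _ ≫ F.map _ = F.map _ ≫ F.map _
      rw [← F.map_comp, ← F.map_comp, hφ]
    change IsIso (F.map φ)
    rw [← he]
    infer_instance⟩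

end DGModule

/-- The derived category `D(A)`: the localization of the category of right dg `A`-modules
with respect to the objectwise quasi-isomorphisms. -/
abbrev D (A : DGCat k) := (DGModule.qis A).Localization

namespace D
variable {A : DGCat k}

/-- The localization functor. -/
abbrev Q : DGModule A ⥤ D A := (DGModule.qis A).Q

/-- The additive structure on the derived category. -/
instance : Preadditive (D A) := LocAdd.preadditive _

instance : (Q : DGModule A ⥤ D A).Additive := LocAdd.additive

instance : Linear k (D A) := Localization.linear k Q (DGModule.qis A)

end D

/-- An object `X` is compact if `Hom(X, -)` commutes with all small coproducts. -/
def IsCompactObject {C : Type u'} [Category.{v'} C] [Preadditive C] (X : C) : Prop :=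
  ∀ J : Type w, PreservesColimitsOfShape (Discrete J) (preadditiveCoyoneda.obj (Opposite.op X))

namespace DGModule
variable {A : DGCat k}

/-- A dg module is compact if it is a compact object of the derived category, i.e. if it belongs
to `D_c(A)`. -/
def IsCompact (M : DGModule A) : Prop := IsCompactObject.{u} (D.Q.obj M)

lemma negOnePow_smul {V : Type*} [AddCommGroup V] [Module k V] (n : ℤ) (v : V) :
    n.negOnePow • v = (-1 : k) ^ n • v := by
  rcases Int.even_or_odd n with h | h
  · rw [Int.negOnePow_even n h, h.neg_one_zpow, one_smul, one_smul]
  · rw [Int.negOnePow_odd n h, h.neg_one_zpow, neg_smul, one_smul, Units.neg_smul, one_smul]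

lemma shift_d (K : Cx k) (n i j : ℤ) (m : K.X (i + n)) :
    (((CochainComplex.shiftFunctor _ n).obj K).d i j).hom m =
      (-1 : k) ^ n • (K.d (i + n) (j + n)).hom m :=
  negOnePow_smul n _

lemma d_act' (M : DGModule A) {x y : A.Obj} {p q n p' n' : ℤ} (h : p + q = n)
    (hp : p + 1 = p') (hn : n + 1 = n') (m : (M.obj y).X p) (f : (A.Hom x y).X q) :
    ((M.obj x).d n n').hom (M.act h m f) =
      M.act (show p' + q = n' by omega) (((M.obj y).d p p').hom m) f +
        (-1 : k) ^ p •
          M.act (show p + (q + 1) = n' by omega) m (((A.Hom x y).d q (q + 1)).hom f) := by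
  subst hp hn
  exact M.d_act h m f

lemma shift_d_act (M : DGModule A) (n : ℤ) {x y : A.Obj} {p q r : ℤ} (h : p + q = r)
    (m : (M.obj y).X (p + n)) (f : (A.Hom x y).X q) :
    (-1 : k) ^ n • ((M.obj x).d (r + n) (r + 1 + n)).hom
        (M.act (show p + n + q = r + n by omega) m f) =
      M.act (show p + 1 + n + q = r + 1 + n by omega)
          ((-1 : k) ^ n • ((M.obj y).d (p + n) (p + 1 + n)).hom m) f +
        (-1 : k) ^ p • M.act (show p + n + (q + 1) = r + 1 + n by omega) m
          (((A.Hom x y).d q (q + 1)).hom f) := by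
  rw [M.d_act' (p' := p + 1 + n) _ (by omega) (by omega) m f]
  simp only [smul_add, map_smul, LinearMap.smul_apply, smul_smul]
  refine congrArg₂ _ rfl (congrArg₂ _ ?_ rfl)
  rw [← zpow_add₀ (by simp)]
  exact sgn_congr ⟨n, by ring⟩

/-- The shift `M[n]`, with `M[n]^i = M^{i+n}`, differential `(-1)^n d` and the same action. -/
def shift (M : DGModule A) (n : ℤ) : DGModule A where
  obj x := (CochainComplex.shiftFunctor _ n).obj (M.obj x)
  act {x y p q r} h := M.act (show p + n + q = r + n by omega)
  act_id m := M.act_id m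
  act_comp hs ht h h' m f g := M.act_comp _ _ _ _ m f g
  d_act {x y p q r} h m f := by
    refine (shift_d (M.obj x) n r (r + 1) _).trans ((M.shift_d_act n h m f).trans ?_)
    exact congrArg₂ (· + ·) (congrArg (fun z => M.act (x := x)
      (show p + 1 + n + q = r + 1 + n by omega) z f) (shift_d (M.obj y) n p (p + 1) m)).symm rfl

/-- The total dimension of `⨁ₙ Hom_{D(A)}(M, N[-n])` is finite. -/
def HomFinite (M N : DGModule A) : Prop :=
  (∀ n : ℤ, Module.Finite k (D.Q.obj M ⟶ D.Q.obj (N.shift (-n)))) ∧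
    {n : ℤ | Nontrivial (D.Q.obj M ⟶ D.Q.obj (N.shift (-n)))}.Finite

/-- The Euler pairing `χ([M], [N]) = ∑ₙ (-1)ⁿ dim Hom_{D(A)}(M, N[-n])`. -/
def euler (M N : DGModule A) : ℤ :=
  ∑ᶠ n : ℤ, (n.negOnePow : ℤ) * (Module.finrank k (D.Q.obj M ⟶ D.Q.obj (N.shift (-n))) : ℤ)

/-- The subspace of `(⨁ₓ M(x) ⊗ P(x))^n` spanned by the elements
`(m · f) ⊗ r - m ⊗ (f · r)`, where `f · r = (-1)^{|f||r|} r · f` is the left action of `A` on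
the right `Aᵒᵖ`-module `P`. -/
def tensorRel (M : DGModule A) (P : DGModule A.op) (n : ℤ) :
    Submodule k (SumTensorX M.obj P.obj n) :=
  Submodule.span k {t | ∃ (x y : A.Obj) (a b c : ℤ) (h : a + b + c = n) (m : (M.obj y).X a)
    (f : (A.Hom x y).X b) (r : (P.obj x).X c),
    t = tmk M.obj P.obj x h (M.act rfl m f) r -
      (-1 : k) ^ (b * c) • tmk M.obj P.obj y (show a + (c + b) = n by omega) m
        (P.act (x := y) (y := x) rfl r f)}

lemma tmk_sub_mem (M : DGModule A) (P : DGModule A.op) {n : ℤ} {x y : A.Obj} {a b c ab cb : ℤ}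
    (hab : a + b = ab) (hcb : c + b = cb) (h : ab + c = n)
    (m : (M.obj y).X a) (f : (A.Hom x y).X b) (r : (P.obj x).X c) :
    tmk M.obj P.obj x h (M.act hab m f) r -
      (-1 : k) ^ (b * c) • tmk M.obj P.obj y (show a + cb = n by omega) m
        (P.act (x := y) (y := x) hcb r f) ∈ tensorRel M P n := by
  subst hab hcb
  exact Submodule.subset_span ⟨x, y, a, b, c, h, m, f, r, rfl⟩

lemma tensorRel_le (M : DGModule A) (P : DGModule A.op) (n n' : ℤ) :
    tensorRel M P n ≤ (tensorRel M P n').comap (tensorD M.obj P.obj n n') := by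
  by_cases hn : n + 1 = n'
  swap
  · intro t _
    rw [Submodule.mem_comap, tensorD, dif_neg hn]
    exact Submodule.zero_mem _
  refine Submodule.span_le.2 ?_
  rintro _ ⟨x, y, a, b, c, h, m, f, r, rfl⟩
  refine Submodule.mem_comap.2 ?_
  subst hn
  have e : c + b = b + c := by omega
  have h₁ := tmk_sub_mem M P (show a + 1 + b = a + b + 1 by omega) rfl
    (show a + b + 1 + c = n + 1 by omega) (((M.obj y).d a (a + 1)).hom m) f r
  have h₂ := tmk_sub_mem M P (show a + (b + 1) = a + b + 1 by omega)
    (show c + (b + 1) = c + b + 1 by omega)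
    (show a + b + 1 + c = n + 1 by omega) m (((A.Hom x y).d b (b + 1)).hom f) r
  have h₃ := tmk_sub_mem M P (show a + b = a + b by omega) (show c + 1 + b = c + b + 1 by omega)
    (show a + b + (c + 1) = n + 1 by omega) m f (((P.obj x).d c (c + 1)).hom r)
  have := Submodule.add_mem _ (Submodule.add_mem _ h₁ (Submodule.smul_mem _ ((-1 : k) ^ a) h₂))
    (Submodule.smul_mem _ ((-1 : k) ^ (a + b)) h₃)
  convert this using 1
  rw [map_sub, map_smul, tensorD_tmk _ _ _ rfl, tensorD_tmk _ _ _ rfl, M.d_act rfl,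
    P.d_act (x := y) (y := x) rfl]
  simp only [map_add, map_smul, LinearMap.add_apply, LinearMap.smul_apply, smul_add, smul_sub,
    smul_smul, ← zpow_add₀ (show (-1 : k) ≠ 0 by simp)]
  rw [sgn_congr (k := k) (a := b * c + (a + c)) (b := a + (b + 1) * c) ⟨0, by ring⟩,
    sgn_congr (k := k) (a := b * c + a) (b := a + b + b * (c + 1)) ⟨-b, by ring⟩]
  abel

/-- The complex `M ⊗_A P`, the quotient of `⨁ₓ M(x) ⊗ P(x)` by the relations
`(m · f) ⊗ r = m ⊗ (f · r)`. -/
def tensorOver (M : DGModule A) (P : DGModule A.op) : Cx k where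
  X n := ModuleCat.of k (SumTensorX M.obj P.obj n ⧸ tensorRel M P n)
  d n n' := ModuleCat.ofHom
    ((tensorRel M P n).mapQ (tensorRel M P n') (tensorD M.obj P.obj n n') (tensorRel_le M P n n'))
  shape n n' h := by
    have h1 : ¬ (n + 1 = n') := h
    ext t
    change Submodule.Quotient.mk (tensorD M.obj P.obj n n' t) = 0
    rw [tensorD, dif_neg h1]
    rfl
  d_comp_d' n n' n'' _ _ := by
    ext t
    change Submodule.Quotient.mk
      (tensorD M.obj P.obj n' n'' (tensorD M.obj P.obj n n' t)) = 0
    have := d_d (K := sumTensor M.obj P.obj) (i := n) (j := n') (l := n'') t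
    change tensorD M.obj P.obj n' n'' (tensorD M.obj P.obj n n' t) = 0 at this
    rw [this]
    rfl

/-- A dg module is acyclic if all its values are acyclic complexes. -/
def Acyclic (N : DGModule A) : Prop := ∀ x, (N.obj x).Acyclic

/-- A morphism `g` is null-homotopic if `g = d s + s d` for a family `s` of maps of degree `-1`
which is compatible with the action. -/
def NullHomotopic {M N : DGModule A} (g : M ⟶ N) : Prop :=
  ∃ s : ∀ (x : A.Obj) (p q : ℤ), q + 1 = p → ((M.obj x).X p →ₗ[k] (N.obj x).X q),
    (∀ (x y : A.Obj) (p q b p' q' : ℤ) (h : q + 1 = p) (h' : q' + 1 = p') (hp : p + b = p')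
      (m : (M.obj y).X p) (f : (A.Hom x y).X b),
      s x p' q' h' (M.act hp m f) = N.act (show q + b = q' by omega) (s y p q h m) f) ∧
    ∀ (x : A.Obj) (n : ℤ) (m : (M.obj x).X n),
      ((g.app x).f n).hom m =
        ((N.obj x).d (n - 1) n).hom (s x n (n - 1) (by omega) m) +
          s x (n + 1) n rfl (((M.obj x).d n (n + 1)).hom m)

/-- A dg module `Q` is homotopically projective if every morphism from `Q` to an acyclic
dg module is null-homotopic. -/
def IsHProjective (Q : DGModule A) : Prop :=
  ∀ N : DGModule A, N.Acyclic → ∀ g : Q ⟶ N, NullHomotopic g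

/-- A homotopically projective resolution of `M`. -/
structure Resolution (M : DGModule A) where
  Q : DGModule A
  isHProjective : Q.IsHProjective
  π : Q ⟶ M
  qis : qis A π

/-- The derived tensor product `M ⊗ᴸ_A P` in the derived category of `k`-vector spaces,
computed with a homotopically projective resolution of `M`. -/
def derivedTensor [HasDerivedCategory.{w} (ModuleCat.{u} k)] {M : DGModule A}
    (R : M.Resolution) (P : DGModule A.op) : DerivedCategory (ModuleCat.{u} k) :=
  DerivedCategory.Q.obj (tensorOver R.Q P)

end DGModule

namespace DGCat

/-- The map `f ⊗ g ↦ a · (f ⊗ g) = (-1)^{|a||f|} f ∘ a ∘ g`, for `f ⊗ g` in `Aᵒᵖ ⊗ A`. -/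
def diagAct₁ (A : DGCat k) {x y : A.Obj × A.Obj} {p q n : ℤ} (h : p + q = n)
    (a : (A.Hom y.2 y.1).X p) : TensX (A := A.op) (B := A) x y q →ₗ[k] (A.Hom x.2 x.1).X n :=
  tlift fun _ q₁ q₂ h' => (-1 : k) ^ (p * q₁) •
    ((A.comp (show q₁ + (p + q₂) = n by omega)).compl₂ (A.comp rfl a))

lemma diagAct₁_tens (A : DGCat k) {x y : A.Obj × A.Obj} {p q n q₁ q₂ r : ℤ} (h : p + q = n)
    (h' : q₁ + q₂ = q) (hr : p + q₂ = r)
    (a : (A.Hom y.2 y.1).X p) (f : (A.Hom y.1 x.1).X q₁) (g : (A.Hom x.2 y.2).X q₂) :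
    diagAct₁ A h a (tens (A := A.op) (B := A) h' f g) =
      (-1 : k) ^ (p * q₁) • A.comp (show q₁ + r = n by omega) f (A.comp hr a g) := by
  subst hr
  rw [diagAct₁, tlift_tmk]
  rfl

/-- The action of `Aᵒᵖ ⊗ A` on the diagonal bimodule. -/
def diagAct (A : DGCat k) {x y : A.Obj × A.Obj} {p q n : ℤ} (h : p + q = n) :
    (A.Hom y.2 y.1).X p →ₗ[k] TensX (A := A.op) (B := A) x y q →ₗ[k] (A.Hom x.2 x.1).X n where
  toFun a := diagAct₁ A h a
  map_add' a b := tens_ext fun q₁ q₂ h' f g => by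
    rw [LinearMap.add_apply, diagAct₁_tens A h h' rfl, diagAct₁_tens A h h' rfl,
      diagAct₁_tens A h h' rfl]
    simp only [map_add, LinearMap.add_apply, smul_add]
  map_smul' c a := tens_ext fun q₁ q₂ h' f g => by
    rw [LinearMap.smul_apply, diagAct₁_tens A h h' rfl, diagAct₁_tens A h h' rfl]
    simp only [map_smul, LinearMap.smul_apply, RingHom.id_apply, smul_comm c]

lemma diagAct_tens (A : DGCat k) {x y : A.Obj × A.Obj} {p q n q₁ q₂ r : ℤ} (h : p + q = n)
    (h' : q₁ + q₂ = q) (hr : p + q₂ = r)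
    (a : (A.Hom y.2 y.1).X p) (f : (A.Hom y.1 x.1).X q₁) (g : (A.Hom x.2 y.2).X q₂) :
    diagAct A h a (tens (A := A.op) (B := A) h' f g) =
      (-1 : k) ^ (p * q₁) • A.comp (show q₁ + r = n by omega) f (A.comp hr a g) :=
  diagAct₁_tens A h h' hr a f g

lemma op_comp (A : DGCat k) {x y z : A.Obj} {p q n : ℤ} (h : p + q = n) (hn : q + p = n)
    (f : (A.Hom z y).X p) (g : (A.Hom y x).X q) :
    A.op.comp (x := x) (y := y) (z := z) h f g = (-1 : k) ^ (p * q) • A.comp hn g f := rfl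

lemma assoc₅ (A : DGCat k) {v w x y z e : A.Obj} {p q₁ q₂ r₁ r₂ i j l m o s n : ℤ}
    (h₁ : p + q₂ = i) (h₂ : q₁ + i = s) (h₃ : s + r₂ = j) (h₄ : r₁ + j = n)
    (h₅ : r₁ + q₁ = l) (h₆ : q₂ + r₂ = m) (h₇ : p + m = o) (h₈ : l + o = n)
    (g₁ : (A.Hom z e).X r₁) (f₁ : (A.Hom y z).X q₁) (a : (A.Hom x y).X p)
    (f₂ : (A.Hom w x).X q₂) (g₂ : (A.Hom v w).X r₂) :
    A.comp h₄ g₁ (A.comp h₃ (A.comp h₂ f₁ (A.comp h₁ a f₂)) g₂) =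
      A.comp h₈ (A.comp h₅ g₁ f₁) (A.comp h₇ a (A.comp h₆ f₂ g₂)) := by
  rw [A.assoc h₂ (show i + r₂ = o by omega) h₃ (by omega), A.assoc h₁ h₆ _ h₇,
    A.assoc h₅ (show q₁ + o = j by omega) h₈ h₄]

lemma diagAct_comp (A : DGCat k) {x y z : A.Obj × A.Obj} {p q r s t n : ℤ} (hs : p + q = s)
    (ht : q + r = t) (h : s + r = n) (h' : p + t = n) (a : (A.Hom z.2 z.1).X p)
    (f : TensX (A := A.op) (B := A) y z q) (g : TensX (A := A.op) (B := A) x y r) :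
    diagAct A h (diagAct A hs a f) g = diagAct A h' a (tensorComp ht f g) := by
  induction f using tens_ind with
  | h0 => simp
  | hadd f f' hf hf' => simp only [map_add, LinearMap.add_apply, hf, hf']
  | h q₁ q₂ hq f₁ f₂ =>
  induction g using tens_ind with
  | h0 => simp
  | hadd f f' hf hf' => simp only [map_add, hf, hf']
  | h r₁ r₂ hr g₁ g₂ =>
  rw [diagAct_tens A hs hq rfl, tensorComp_tens ht hq f₁ f₂ hr g₁ g₂ rfl rfl, map_smul, map_smul,
    LinearMap.smul_apply, diagAct_tens A h hr rfl, diagAct_tens A h' _ rfl,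
    op_comp A rfl (add_comm _ _), map_smul, LinearMap.smul_apply, smul_smul, smul_smul, smul_smul,
    ← zpow_add₀ (by simp), ← zpow_add₀ (by simp), ← zpow_add₀ (by simp)]
  refine congrArg₂ _ (sgn_congr ⟨0, by rw [← hs, ← hq]; ring⟩) ?_
  exact A.assoc₅ _ _ _ _ _ _ _ _ _ _ _ _ _

lemma diagAct_d (A : DGCat k) {x y : A.Obj × A.Obj} {p q n : ℤ} (h : p + q = n)
    (a : (A.Hom y.2 y.1).X p) (f : TensX (A := A.op) (B := A) x y q) :
    ((A.Hom x.2 x.1).d n (n + 1)).hom (diagAct A h a f) =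
      diagAct A (show p + 1 + q = n + 1 by omega) (((A.Hom y.2 y.1).d p (p + 1)).hom a) f +
        (-1 : k) ^ p • diagAct A (show p + (q + 1) = n + 1 by omega) a
          (tensorD _ _ q (q + 1) f) := by
  induction f using tens_ind with
  | h0 => simp
  | hadd f f' hf hf' => simp only [map_add, hf, hf', smul_add]; abel
  | h q₁ q₂ hq f₁ f₂ =>
  rw [diagAct_tens A h hq rfl, tensorD_tmk _ _ _ rfl hq,
    diagAct_tens A _ hq (show p + 1 + q₂ = p + q₂ + 1 by omega), map_smul,
    A.d_comp, A.d_comp rfl, map_add, map_smul, map_add, map_smul,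
    diagAct_tens A _ _ rfl, diagAct_tens A _ _ (show p + (q₂ + 1) = p + q₂ + 1 by omega)]
  simp only [smul_add, smul_smul, ← zpow_add₀ (show (-1 : k) ≠ 0 by simp)]
  rw [sgn_congr (k := k) (a := p * q₁) (b := p + p * (q₁ + 1)) ⟨-p, by ring⟩,
    sgn_congr (k := k) (a := p * q₁ + q₁) (b := (p + 1) * q₁) ⟨0, by ring⟩,
    sgn_congr (k := k) (a := p + (q₁ + p * q₁)) (b := p * q₁ + (q₁ + p)) ⟨0, by ring⟩,
    add_left_comm]

/-- The diagonal bimodule `(x, z) ↦ A(z, x)`, as a right dg module over `Aᵒᵖ ⊗ A`. -/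
def diag (A : DGCat k) : DGModule (tensor A.op A) where
  obj x := A.Hom x.2 x.1
  act h := diagAct A h
  act_id {x p} m := by
    refine (diagAct_tens A (add_zero p) (add_zero 0) (add_zero p) m _ _).trans ?_
    rw [A.comp_id]
    refine (congrArg _ (A.id_comp m)).trans ?_
    simp
  act_comp hs ht h h' m f g := diagAct_comp A hs ht h h' m f g
  d_act h m f := diagAct_d A h m f

/-- `A` is smooth if it is compact as a bimodule over itself. -/
def IsSmooth (A : DGCat k) : Prop := A.diag.IsCompact

/-- `A` is proper if `∑ₙ dim Hⁿ A(x, y) < ∞` for all objects `x` and `y`. -/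
def IsProper (A : DGCat k) : Prop :=
  ∀ x y : A.Obj, (∀ n : ℤ, Module.Finite k ((A.Hom x y).homology n)) ∧
    {n : ℤ | Nontrivial ((A.Hom x y).homology n)}.Finite

end DGCat

section K0

open Pretriangulated

variable (T : Type u') [Category.{v'} T] [HasZeroObject T] [HasShift T ℤ] [Preadditive T]
  [∀ n : ℤ, (shiftFunctor T n).Additive] [Pretriangulated T]

/-- The relations `[X₂] = [X₁] + [X₃]`, for the distinguished triangles `X₁ ⟶ X₂ ⟶ X₃ ⟶ X₁[1]`
of compact objects. -/
def K0Rel : AddSubgroup (FreeAbelianGroup {X : T // IsCompactObject.{w} X}) :=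
  AddSubgroup.closure {r | ∃ (t : Triangle T) (_ : t ∈ distTriang T)
    (h₁ : IsCompactObject.{w} t.obj₁) (h₂ : IsCompactObject.{w} t.obj₂)
    (h₃ : IsCompactObject.{w} t.obj₃),
    r = FreeAbelianGroup.of ⟨t.obj₂, h₂⟩ - FreeAbelianGroup.of ⟨t.obj₁, h₁⟩ -
      FreeAbelianGroup.of ⟨t.obj₃, h₃⟩}

/-- The Grothendieck group of the triangulated subcategory of compact objects of `T`. -/
abbrev K0 : Type u' := FreeAbelianGroup {X : T // IsCompactObject.{w} X} ⧸ K0Rel.{w} T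

variable {T}

/-- The class of a compact object in the Grothendieck group. -/
def K0.mk (X : T) (hX : IsCompactObject.{w} X) : K0.{w} T :=
  QuotientAddGroup.mk (FreeAbelianGroup.of ⟨X, hX⟩)

end K0

end DG

end

/-!
Write `X^∨ = Hom_k(X, k)`; this is a right dg `A`-module for a right dg `Aᵒᵖ`-module `X`, and
conversely. The theorem rests on two facts.

*The pairing is an Euler characteristic.* Morphisms of dg modules `M ⊗_A P ⟶ V` correspond to
morphisms `M ⟶ Hom_k(P, V)` (`sharp`), and this respects homotopies (`nullHomotopic_sharp_iff`). If
`M` is homotopically projective, morphisms from `M` in the derived category are homotopy classes of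
morphisms of dg modules (`IsHProjective.Q_map_surjective`, `IsHProjective.Q_map_eq_zero_iff`). With
`V = k[-n]`, the space `Hom(M, P^∨[-n])` is dual to `Hⁿ(M ⊗ᴸ P)`
(`IsHProjective.nonempty_equiv_dual`), so `χ([M], [P^∨])` is the Euler characteristic of `M ⊗ᴸ P`
(`euler_eq`). The Euler characteristic is an injective homomorphism `K₀(k) → ℤ`, so it vanishes if
and only if the class of `M ⊗ᴸ P` does (`mk_Q_eq_zero_iff`).

*Duality exchanges the compact modules of `A` and of `Aᵒᵖ`.* Compact modules over a smooth and
proper dg category are those with finite dimensional total homology at every object: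

* If `M` is compact and `P` has perfect values, then `M ⊗ᴸ P` is a compact complex, because
  `Hom_k(P, -)` preserves direct sums (`perf_tensorOver`). For `P = A(y, -)`, which has perfect
  values by properness, this complex is `M(y)` by the co-Yoneda isomorphism (`IsCompact.perf`).
* Let `N` be homotopically projective with perfect values. A morphism `N ⟶ ⨁ V` is a morphism of
  bimodules `A ⟶ Hom_k(N, ⨁ V) ≃ ⨁ Hom_k(N, V)`. By smoothness it takes values in a finite subsum
  up to homotopy on a resolution `X` of the diagonal bimodule, and tensoring with `N` transports
  this homotopy to `N ⊗_A X ≃ N` (`isCompact_of_isSmooth`).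

Smoothness passes to `Aᵒᵖ` by swapping the variables of bimodules (`IsSmooth.op`). Complexes with
finite total homology are stable under `Hom_k(-, k)` and reflexive (`Perf.ihom_kc`,
`qis_toBidual`). Hence `P^∨` is compact for compact `P`, and every compact `N` is `P^∨` for the
compact module `P = N^∨`, up to quasi-isomorphism; both implications follow.

Everything is done with explicit complexes of vector spaces. Over a field every complex splits
(`nonempty_splitting`), so morphisms and cocycles of internal Hom complexes are determined by their
effect on homology, up to homotopy (`ihom_mem_Bc_of`). Homotopically projective resolutions are
built by attaching cells (`nonempty_resolution`).
-/

set_option linter.unusedSectionVars false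

noncomputable section

namespace DG

variable {k : Type u} [Field k]

/-! ### Complexes of vector spaces, elementwise -/

/-- The cycles of a complex. -/
def Zc (K : Cx k) (n : ℤ) : Submodule k (K.X n) := LinearMap.ker (K.d n (n + 1)).hom

/-- The boundaries of a complex. -/
def Bc (K : Cx k) (n : ℤ) : Submodule k (K.X n) := LinearMap.range (K.d (n - 1) n).hom

lemma mem_Zc {K : Cx k} {n : ℤ} {a : K.X n} : a ∈ Zc K n ↔ (K.d n (n + 1)).hom a = 0 := Iff.rfl

lemma d_eq_zero {K : Cx k} {n : ℤ} {a : K.X n} (h : a ∈ Zc K n) (m : ℤ) :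
    (K.d n m).hom a = 0 := by
  by_cases hm : n + 1 = m
  · subst hm; exact h
  · rw [K.shape n m hm]; rfl

lemma mem_Zc_of {K : Cx k} {n m : ℤ} (hm : n + 1 = m) {a : K.X n} (h : (K.d n m).hom a = 0) :
    a ∈ Zc K n := by
  subst hm; exact h

lemma d_mem_Bc {K : Cx k} {m n : ℤ} (c : K.X m) : (K.d m n).hom c ∈ Bc K n := by
  by_cases hm : m + 1 = n
  · obtain rfl : m = n - 1 := by omega
    exact ⟨c, rfl⟩
  · rw [K.shape m n hm]; exact zero_mem _

lemma exists_of_mem_Bc {K : Cx k} {m n : ℤ} (hm : m + 1 = n) {a : K.X n} (h : a ∈ Bc K n) :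
    ∃ c : K.X m, (K.d m n).hom c = a := by
  obtain rfl : m = n - 1 := by omega
  exact h

lemma d_mem_Zc {K : Cx k} {m n : ℤ} (c : K.X m) : (K.d m n).hom c ∈ Zc K n := d_d c

lemma Bc_le_Zc (K : Cx k) (n : ℤ) : Bc K n ≤ Zc K n := by
  rintro _ ⟨c, rfl⟩
  exact d_mem_Zc c

lemma map_mem_Zc {K L : Cx k} (f : K ⟶ L) {n : ℤ} {a : K.X n} (h : a ∈ Zc K n) :
    (f.f n).hom a ∈ Zc L n := by
  rw [mem_Zc, DGModule.d_f, mem_Zc.1 h, map_zero]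

lemma map_mem_Bc {K L : Cx k} (f : K ⟶ L) {n : ℤ} {a : K.X n} (h : a ∈ Bc K n) :
    (f.f n).hom a ∈ Bc L n := by
  obtain ⟨c, rfl⟩ := h
  rw [← DGModule.d_f]
  exact d_mem_Bc _

/-- The class of a cycle in the homology. -/
def hcls (K : Cx k) (n : ℤ) : Zc K n →ₗ[k] K.homology n :=
  (K.liftCycles (ModuleCat.ofHom (Zc K n).subtype) (n + 1) (by simp)
    (by ext a; exact a.2) ≫ K.homologyπ n).hom

lemma hcls_surjective (K : Cx k) (n : ℤ) : Function.Surjective (hcls K n) := by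
  intro y
  obtain ⟨c, rfl⟩ := (ModuleCat.epi_iff_surjective (K.homologyπ n)).1 inferInstance y
  have hc : (K.iCycles n).hom c ∈ Zc K n := by
    rw [mem_Zc, ← LinearMap.comp_apply, ← ModuleCat.hom_comp, K.iCycles_d]; rfl
  refine ⟨⟨_, hc⟩, ?_⟩
  change (K.homologyπ n).hom ((K.liftCycles _ _ _ _).hom _) = _
  congr 1
  refine (ModuleCat.mono_iff_injective (K.iCycles n)).1 inferInstance ?_
  change ((K.liftCycles _ _ _ _ ≫ K.iCycles n).hom _) = _
  rw [K.liftCycles_i]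
  rfl

lemma hcls_eq_zero_iff (K : Cx k) (n : ℤ) (a : Zc K n) : hcls K n a = 0 ↔ a.1 ∈ Bc K n := by
  have hn : (ComplexShape.up ℤ).prev n = n - 1 := by simp
  have hS := ShortComplex.exact_of_g_is_cokernel
    (ShortComplex.mk _ _ (K.toCycles_comp_homologyπ (n - 1) n))
    (K.homologyIsCokernel (n - 1) n hn)
  rw [ShortComplex.moduleCat_exact_iff] at hS
  have hi : (K.iCycles n).hom ((K.liftCycles (ModuleCat.ofHom (Zc K n).subtype) (n + 1) (by simp)
    (by ext a; exact a.2)).hom a) = a.1 := by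
    change ((K.liftCycles _ _ _ _ ≫ K.iCycles n).hom _) = _
    rw [K.liftCycles_i]
    rfl
  constructor
  · intro h
    obtain ⟨c, hc⟩ := hS _ h
    refine ⟨c, ?_⟩
    rw [← hi]
    erw [← hc]
    change _ = ((K.toCycles (n - 1) n ≫ K.iCycles n).hom _)
    rw [K.toCycles_i]
  · rintro ⟨c, hc⟩
    have : (K.liftCycles (ModuleCat.ofHom (Zc K n).subtype) (n + 1) (by simp)
      (by ext a; exact a.2)).hom a = (K.toCycles (n - 1) n).hom c := by
      refine (ModuleCat.mono_iff_injective (K.iCycles n)).1 inferInstance ?_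
      refine hi.trans ?_
      rw [← hc]
      change _ = ((K.toCycles (n - 1) n ≫ K.iCycles n).hom _)
      rw [K.toCycles_i]
    refine (congrArg (K.homologyπ n).hom this).trans ?_
    change (K.toCycles (n - 1) n ≫ K.homologyπ n).hom c = 0
    rw [K.toCycles_comp_homologyπ]
    rfl

lemma homologyMap_hcls {K L : Cx k} (f : K ⟶ L) (n : ℤ) (a : Zc K n) :
    (HomologicalComplex.homologyMap f n).hom (hcls K n a) =
      hcls L n ⟨(f.f n).hom a, map_mem_Zc f a.2⟩ := by
  have : (HomologicalComplex.cyclesMap f n).hom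
      ((K.liftCycles (ModuleCat.ofHom (Zc K n).subtype) (n + 1) (by simp)
        (by ext a; exact a.2)).hom a) =
      (L.liftCycles (ModuleCat.ofHom (Zc L n).subtype) (n + 1) (by simp)
        (by ext a; exact a.2)).hom ⟨(f.f n).hom a, map_mem_Zc f a.2⟩ := by
    refine (ModuleCat.mono_iff_injective (L.iCycles n)).1 inferInstance ?_
    change ((K.liftCycles _ _ _ _ ≫ HomologicalComplex.cyclesMap f n ≫ L.iCycles n).hom _) =
      ((L.liftCycles _ _ _ _ ≫ L.iCycles n).hom _)
    rw [HomologicalComplex.cyclesMap_i, L.liftCycles_i, HomologicalComplex.liftCycles_i_assoc]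
    rfl
  refine Eq.trans ?_ (congrArg (L.homologyπ n).hom this)
  change (K.homologyπ n ≫ HomologicalComplex.homologyMap f n).hom _ = _
  rw [HomologicalComplex.homologyπ_naturality]
  rfl

/-- A morphism is a quasi-isomorphism if it is injective and surjective on homology, in terms of
cycles and boundaries. -/
lemma quasiIso_iff {K L : Cx k} (f : K ⟶ L) : QuasiIso f ↔ ∀ n,
    (∀ a ∈ Zc K n, (f.f n).hom a ∈ Bc L n → a ∈ Bc K n) ∧
      ∀ b ∈ Zc L n, ∃ a ∈ Zc K n, (f.f n).hom a - b ∈ Bc L n := by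
  rw [_root_.quasiIso_iff]
  refine forall_congr' fun n => ?_
  rw [quasiIsoAt_iff_isIso_homologyMap, ConcreteCategory.isIso_iff_bijective]
  refine and_congr ?_ ?_
  · refine (injective_iff_map_eq_zero (HomologicalComplex.homologyMap f n).hom).trans ?_
    constructor
    · intro h a ha hfa
      have := h (hcls K n ⟨a, ha⟩) (by rw [homologyMap_hcls, hcls_eq_zero_iff]; exact hfa)
      exact (hcls_eq_zero_iff K n _).1 this
    · intro h x hx
      obtain ⟨a, rfl⟩ := hcls_surjective K n x
      rw [homologyMap_hcls, hcls_eq_zero_iff] at hx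
      exact (hcls_eq_zero_iff K n _).2 (h a.1 a.2 hx)
  · constructor
    · intro h b hb
      obtain ⟨x, hx⟩ := h (hcls L n ⟨b, hb⟩)
      obtain ⟨a, rfl⟩ := hcls_surjective K n x
      refine ⟨a.1, a.2, ?_⟩
      have hx' := (homologyMap_hcls f n a).symm.trans hx
      rw [← sub_eq_zero, ← map_sub, hcls_eq_zero_iff] at hx'
      exact hx'
    · intro h y
      obtain ⟨b, rfl⟩ := hcls_surjective L n y
      obtain ⟨a, ha, hab⟩ := h b.1 b.2
      refine ⟨hcls K n ⟨a, ha⟩, (homologyMap_hcls f n ⟨a, ha⟩).trans ?_⟩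
      rw [← sub_eq_zero, ← map_sub, hcls_eq_zero_iff]
      exact hab

lemma acyclic_iff {K : Cx k} : K.Acyclic ↔ ∀ n, Zc K n ≤ Bc K n := by
  refine forall_congr' fun n => ?_
  rw [HomologicalComplex.exactAt_iff_isZero_homology, ModuleCat.isZero_iff_subsingleton]
  constructor
  · intro h a ha
    exact (hcls_eq_zero_iff K n ⟨a, ha⟩).1 (Subsingleton.elim _ _)
  · intro h
    refine subsingleton_of_forall_eq 0 fun x => ?_
    obtain ⟨a, rfl⟩ := hcls_surjective K n x
    exact (hcls_eq_zero_iff K n a).2 (h a.2)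

/-- The identification `K^i = K^j` for `i = j`. -/
def cst (K : Cx k) {i j : ℤ} (h : i = j) : K.X i →ₗ[k] K.X j := (K.XIsoOfEq h).hom.hom

@[simp] lemma cst_rfl (K : Cx k) {i : ℤ} (h : i = i) (a : K.X i) : cst K h a = a := by
  simp [cst]

lemma d_cst {K : Cx k} {i j l : ℤ} (h : i = j) (a : K.X i) :
    (K.d j l).hom (cst K h a) = (K.d i l).hom a := by
  subst h; simp

/-- A decomposition of a complex of vector spaces: `e` is a projection onto a complement of the
boundaries in the cycles which kills a complement of the cycles, and `h` is a homotopy from `e`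
to the identity. -/
structure Splitting (K : Cx k) where
  e (n : ℤ) : K.X n →ₗ[k] K.X n
  h (n m : ℤ) : K.X n →ₗ[k] K.X m
  d_e (n m : ℤ) (a : K.X n) : (K.d n m).hom (e n a) = 0
  e_d (n m : ℤ) (a : K.X n) : e m ((K.d n m).hom a) = 0
  e_e (n : ℤ) (a : K.X n) : e n (e n a) = e n a
  eq (i n j : ℤ) (hi : i + 1 = n) (hj : n + 1 = j) (a : K.X n) :
    a = e n a + (K.d i n).hom (h n i a) + h j n ((K.d n j).hom a)

lemma exists_section {V W : Type u} [AddCommGroup V] [Module k V] [AddCommGroup W] [Module k W]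
    (f : V →ₗ[k] W) : ∃ s : W →ₗ[k] V, ∀ v, f (s (f v)) = f v := by
  obtain ⟨t, ht⟩ := LinearMap.exists_rightInverse_of_surjective f.rangeRestrict
    (LinearMap.range_rangeRestrict f)
  obtain ⟨s, hs⟩ := LinearMap.exists_extend t
  refine ⟨s, fun v => ?_⟩
  have h1 : s (f v) = t (f.rangeRestrict v) := (LinearMap.congr_fun hs (f.rangeRestrict v))
  have h2 := LinearMap.congr_fun ht (f.rangeRestrict v)
  rw [h1]
  exact congrArg Subtype.val h2

lemma nonempty_splitting (K : Cx k) : Nonempty (Splitting K) := by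
  choose s hs using fun (n m : ℤ) => exists_section (K.d m n).hom
  -- With `d s d = d`, take `e = (1 - d s) (1 - s d)` and `h = s (1 - s d)`.
  have hz (n : ℤ) (a : K.X n) (m : ℤ) :
      (K.d n m).hom (a - s (n + 1) n ((K.d n (n + 1)).hom a)) = 0 :=
    d_eq_zero (mem_Zc.2 (by rw [map_sub, hs, sub_self])) m
  refine ⟨{
    e := fun n => (LinearMap.id - (K.d (n - 1) n).hom ∘ₗ s n (n - 1)) ∘ₗ
      (LinearMap.id - s (n + 1) n ∘ₗ (K.d n (n + 1)).hom)
    h := fun n m => s n m ∘ₗ (LinearMap.id - s (n + 1) n ∘ₗ (K.d n (n + 1)).hom)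
    d_e := fun n m a => ?_
    e_d := fun n m a => ?_
    e_e := fun n a => ?_
    eq := fun i n j hi hj a => ?_ }⟩
  · simp only [LinearMap.comp_apply, LinearMap.sub_apply, LinearMap.id_apply, map_sub, d_d, sub_zero]
    rw [← map_sub, hz]
  · simp only [LinearMap.comp_apply, LinearMap.sub_apply, LinearMap.id_apply, d_d, map_zero,
      sub_zero]
    by_cases hm : n + 1 = m
    · obtain rfl : n = m - 1 := by omega
      rw [hs, sub_self]
    · rw [K.shape n m hm]; simp
  · simp only [LinearMap.comp_apply, LinearMap.sub_apply, LinearMap.id_apply]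
    have := hz n a (n + 1)
    rw [map_sub (K.d n (n + 1)).hom (a - _), this, d_d]
    simp only [map_sub, map_zero, sub_zero, hs, sub_self]
  · obtain rfl : i = n - 1 := by omega
    subst hj
    simp only [LinearMap.comp_apply, LinearMap.sub_apply, LinearMap.id_apply, map_sub, d_d, map_zero,
      sub_zero]
    abel

namespace Splitting

variable {K : Cx k} (S : Splitting K)

lemma e_mem_Zc (n : ℤ) (a : K.X n) : S.e n a ∈ Zc K n := S.d_e n _ a

lemma e_eq_zero {n : ℤ} {a : K.X n} (h : a ∈ Bc K n) : S.e n a = 0 := by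
  obtain ⟨c, rfl⟩ := h
  exact S.e_d _ _ _

lemma sub_e_mem {n : ℤ} {a : K.X n} (h : a ∈ Zc K n) : a - S.e n a ∈ Bc K n := by
  have := S.eq (n - 1) n (n + 1) (by omega) rfl a
  rw [mem_Zc.1 h, map_zero, add_zero] at this
  rw [sub_eq_iff_eq_add'.2 this]
  exact d_mem_Bc _

lemma eq_d_h {n m : ℤ} (h : m + 1 = n) {a : K.X n} (ha : a ∈ Bc K n) :
    (K.d m n).hom (S.h n m a) = a := by
  have := S.eq m n (n + 1) h rfl a
  rw [S.e_eq_zero ha, mem_Zc.1 (Bc_le_Zc _ _ ha), map_zero, add_zero, zero_add] at this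
  exact this.symm

/-- The image of `e` is isomorphic to the homology. -/
def rangeEquiv (n : ℤ) : LinearMap.range (S.e n) ≃ₗ[k] K.homology n :=
  LinearEquiv.ofBijective (hcls K n ∘ₗ Submodule.inclusion (by
    rintro _ ⟨a, rfl⟩; exact S.e_mem_Zc n a)) <| by
  constructor
  · refine (injective_iff_map_eq_zero _).2 ?_
    rintro ⟨_, a, rfl⟩ h
    have := S.e_eq_zero ((hcls_eq_zero_iff K n _).1 h)
    ext
    exact (S.e_e n a).symm.trans this
  · intro x
    obtain ⟨a, rfl⟩ := hcls_surjective K n x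
    refine ⟨⟨S.e n a.1, a.1, rfl⟩, ?_⟩
    rw [← sub_eq_zero, LinearMap.comp_apply, ← map_sub, hcls_eq_zero_iff]
    have := (Bc K n).neg_mem (S.sub_e_mem a.2)
    rwa [neg_sub] at this

end Splitting

/-- A complex is perfect if its total homology is finite dimensional. -/
def Perf (K : Cx k) : Prop :=
  (∀ n : ℤ, Module.Finite k (K.homology n)) ∧ {n : ℤ | Nontrivial (K.homology n)}.Finite

lemma Splitting.perf_iff {K : Cx k} (S : Splitting K) :
    Perf K ↔ (∀ n, Module.Finite k (LinearMap.range (S.e n))) ∧ {n | S.e n ≠ 0}.Finite := by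
  refine and_congr (forall_congr' fun n => (Module.Finite.equiv_iff (S.rangeEquiv n)).symm) ?_
  have : {n : ℤ | Nontrivial (K.homology n)} = {n | S.e n ≠ 0} := by
    ext n
    change Nontrivial _ ↔ _
    rw [← (S.rangeEquiv n).toEquiv.nontrivial_congr, Submodule.nontrivial_iff_ne_bot, Ne,
      LinearMap.range_eq_bot]
    rfl
  rw [this]

lemma Perf.of_quasiIso {K L : Cx k} (f : K ⟶ L) (hf : QuasiIso f) : Perf K ↔ Perf L := by
  have e (n : ℤ) : K.homology n ≃ₗ[k] L.homology n :=
    (asIso (HomologicalComplex.homologyMap f n)).toLinearEquiv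
  refine and_congr (forall_congr' fun n => Module.Finite.equiv_iff (e n)) ?_
  simp only [(e _).toEquiv.nontrivial_congr]

end DG

namespace DG

variable {k : Type u} [Field k]

/-! ### Internal Hom complexes -/

/-- The cochain complex with terms `X n` and differential `d`. -/
abbrev mkCx (X : ℤ → Type u) [∀ n, AddCommGroup (X n)] [∀ n, Module k (X n)]
    (d : ∀ n, X n →ₗ[k] X (n + 1)) (hd : ∀ n a, d (n + 1) (d n a) = 0) : Cx k where
  X n := ModuleCat.of k (X n)
  d n m := if h : n + 1 = m then ModuleCat.ofHom (d n) ≫ eqToHom (by rw [h]) else 0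
  shape n m h := dif_neg h
  d_comp_d' n m l h h' := by
    obtain rfl : n + 1 = m := h
    obtain rfl : n + 1 + 1 = l := h'
    ext a
    simp [hd]

lemma mkCx_d (X : ℤ → Type u) [∀ n, AddCommGroup (X n)] [∀ n, Module k (X n)]
    (d : ∀ n, X n →ₗ[k] X (n + 1)) (hd : ∀ n a, d (n + 1) (d n a) = 0) (n : ℤ) (a : X n) :
    ((mkCx X d hd).d n (n + 1)).hom a = d n a := by
  simp

/-- The morphism of complexes with given components. -/
abbrev mkHom {K L : Cx k} (F : ∀ n, K.X n →ₗ[k] L.X n)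
    (hF : ∀ n a, (L.d n (n + 1)).hom (F n a) = F (n + 1) ((K.d n (n + 1)).hom a)) : K ⟶ L where
  f n := ModuleCat.ofHom (F n)
  comm' n m hm := by
    obtain rfl : n + 1 = m := hm
    ext a
    exact hF n a

lemma sgn_ne_zero (n : ℤ) : (-1 : k) ^ n ≠ 0 := zpow_ne_zero _ (by simp)

lemma sgn_mul_self (n : ℤ) : (-1 : k) ^ n * (-1 : k) ^ n = 1 := by
  rw [← mul_zpow]; simp

lemma sgn_pred (n : ℤ) : (-1 : k) ^ (n - 1) = - (-1 : k) ^ n := by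
  rw [← neg_neg ((-1 : k) ^ (n - 1)), ← sgn_succ, sub_add_cancel]

/-- The graded linear maps `K → V` of degree `n`: a linear map `K^p → V^q` for every pair with
`p + n = q`. -/
abbrev Gr (K V : Cx k) (n : ℤ) : Type u :=
  ∀ s : {s : ℤ × ℤ // s.1 + n = s.2}, K.X s.1.1 →ₗ[k] V.X s.1.2

/-- The component `K^p → V^q` of a graded linear map. -/
abbrev ap {K V : Cx k} {n : ℤ} (φ : Gr K V n) (p q : ℤ) (h : p + n = q) : K.X p →ₗ[k] V.X q :=
  φ ⟨(p, q), h⟩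

/-- The graded linear map with given components. -/
abbrev grMk {K V : Cx k} {n : ℤ} (F : ∀ p q : ℤ, p + n = q → (K.X p →ₗ[k] V.X q)) : Gr K V n :=
  fun s => F s.1.1 s.1.2 s.2

lemma gr_ext {K V : Cx k} {n : ℤ} {φ ψ : Gr K V n}
    (H : ∀ p q h (a : K.X p), ap φ p q h a = ap ψ p q h a) : φ = ψ :=
  funext fun s => LinearMap.ext fun a => H s.1.1 s.1.2 s.2 a

/-- The differential `φ ↦ d φ - (-1)^n φ d` of the internal Hom complex. -/
def grD (K V : Cx k) (n : ℤ) : Gr K V n →ₗ[k] Gr K V (n + 1) where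
  toFun φ := grMk fun p q h => (V.d (q - 1) q).hom ∘ₗ ap φ p (q - 1) (by omega) -
    (-1 : k) ^ n • ap φ (p + 1) q (by omega) ∘ₗ (K.d p (p + 1)).hom
  map_add' φ ψ := gr_ext fun p q h a => by
    simp only [ap, grMk, Pi.add_apply, LinearMap.sub_apply, LinearMap.comp_apply,
      LinearMap.add_apply, LinearMap.smul_apply, map_add, smul_add]
    abel
  map_smul' c φ := gr_ext fun p q h a => by
    simp only [ap, grMk, Pi.smul_apply, LinearMap.sub_apply, LinearMap.comp_apply,
      LinearMap.smul_apply, map_smul, smul_sub, smul_comm c, RingHom.id_apply]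

lemma grD_apply {K V : Cx k} {n : ℤ} (φ : Gr K V n) {p q q' p' : ℤ} (h : p + (n + 1) = q)
    (hq : q' + 1 = q) (hp : p + 1 = p') (a : K.X p) :
    ap (grD K V n φ) p q h a = (V.d q' q).hom (ap φ p q' (by omega) a) -
      (-1 : k) ^ n • ap φ p' q (by omega) ((K.d p p').hom a) := by
  obtain rfl : q' = q - 1 := by omega
  subst hp
  rfl

lemma grD_grD {K V : Cx k} {n : ℤ} (φ : Gr K V n) : grD K V (n + 1) (grD K V n φ) = 0 := by
  refine gr_ext fun p q h a => ?_
  rw [grD_apply _ h (sub_add_cancel q 1) rfl, grD_apply φ _ (sub_add_cancel (q - 1) 1) rfl,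
    grD_apply φ _ (sub_add_cancel q 1) rfl, map_sub, d_d, d_d, map_zero, map_smul, sgn_succ]
  simp

/-- The internal Hom complex. -/
abbrev ihom (K V : Cx k) : Cx k := mkCx (Gr K V) (grD K V) fun _ => grD_grD

lemma ihom_d {K V : Cx k} {n : ℤ} (φ : Gr K V n) :
    ((ihom K V).d n (n + 1)).hom φ = grD K V n φ := mkCx_d _ _ _ _ _

lemma ihom_mem_Zc {K V : Cx k} {n : ℤ} {φ : Gr K V n} :
    φ ∈ Zc (ihom K V) n ↔ ∀ (p q p' q' : ℤ) (h : p + n = q) (hp : p + 1 = p') (hq : q + 1 = q')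
      (a : K.X p), (V.d q q').hom (ap φ p q h a) =
        (-1 : k) ^ n • ap φ p' q' (by omega) ((K.d p p').hom a) := by
  rw [mem_Zc]
  erw [ihom_d]
  constructor
  · intro hφ p q p' q' h hp hq a
    have := LinearMap.congr_fun (congrFun hφ ⟨(p, q'), (by omega : p + (n + 1) = q')⟩) a
    change ap (grD K V n φ) p q' _ a = 0 at this
    rw [grD_apply φ _ hq hp] at this
    exact sub_eq_zero.1 this
  · intro hφ
    refine gr_ext fun p q h a => ?_
    rw [grD_apply φ _ (sub_add_cancel q 1) rfl, hφ p (q - 1) (p + 1) q (by omega) rfl (by omega),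
      sub_self]
    rfl

lemma ihom_mem_Bc {K V : Cx k} {n m : ℤ} (hm : m + 1 = n) {φ : Gr K V n} :
    φ ∈ Bc (ihom K V) n ↔ ∃ ψ : Gr K V m, ∀ (p q p' q' : ℤ) (h : p + n = q) (hp : p + 1 = p')
      (hq : q' + 1 = q) (a : K.X p), ap φ p q h a = (V.d q' q).hom (ap ψ p q' (by omega) a) -
        (-1 : k) ^ m • ap ψ p' q (by omega) ((K.d p p').hom a) := by
  subst hm
  constructor
  · intro h
    obtain ⟨ψ, hψ⟩ := exists_of_mem_Bc rfl h
    refine ⟨ψ, fun p q p' q' h hp hq a => ?_⟩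
    erw [ihom_d] at hψ
    rw [← hψ, grD_apply ψ _ hq hp]
  · rintro ⟨ψ, hψ⟩
    have : ((ihom K V).d m (m + 1)).hom ψ = φ := by
      erw [ihom_d]
      refine gr_ext fun p q h a => ?_
      rw [grD_apply ψ _ (sub_add_cancel q 1) rfl, hψ p q (p + 1) (q - 1) h rfl (by omega)]
    rw [← this]
    exact d_mem_Bc _

/-- A cocycle of the internal Hom complex is a coboundary as soon as it induces zero on homology:
there is no obstruction over a field. -/
lemma ihom_mem_Bc_of {K V : Cx k} {n : ℤ} {φ : Gr K V n} (hφ : φ ∈ Zc (ihom K V) n)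
    (h0 : ∀ p q h, ∀ a ∈ Zc K p, ap φ p q h a ∈ Bc V q) : φ ∈ Bc (ihom K V) n := by
  obtain ⟨S⟩ := nonempty_splitting K
  obtain ⟨T⟩ := nonempty_splitting V
  rw [ihom_mem_Zc] at hφ
  -- `φ` is homotopic to `φ e` through `φ h`, and `φ e` is the coboundary of `h φ e`.
  refine (ihom_mem_Bc (sub_add_cancel n 1)).2
    ⟨grMk fun p q hpq => T.h (q + 1) q ∘ₗ ap φ p (q + 1) (by omega) ∘ₗ S.e p +
      (-1 : k) ^ n • ap φ (p - 1) q (by omega) ∘ₗ S.h p (p - 1), fun p q p' q' h hp hq a => ?_⟩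
  subst hp
  obtain rfl : q' = q - 1 := by omega
  have h1 := S.eq (p - 1) p (p + 1) (by omega) rfl a
  have h2 : (V.d (q - 1) q).hom (T.h q (q - 1) (ap φ p q h (S.e p a))) = ap φ p q h (S.e p a) :=
    T.eq_d_h (by omega) (h0 p q h _ (S.e_mem_Zc p a))
  have h3 := hφ (p - 1) (q - 1) p q (by omega) (by omega) (by omega) (S.h p (p - 1) a)
  have e1 (c : K.X p) (q₁ : ℤ) (hq : q₁ = q) (h' : p + n = q₁) (h'' : q₁ - 1 = q - 1) :
      T.h q₁ (q - 1) (ap φ p q₁ h' c) = T.h q (q - 1) (ap φ p q h c) := by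
    subst hq; rfl
  have e2 (c : K.X (p + 1)) (p₁ : ℤ) (hp : p₁ = p) (h' : p₁ + n = q) :
      ap φ p₁ q h' (S.h (p + 1) p₁ c) = ap φ p q h (S.h (p + 1) p c) := by
    subst hp; rfl
  simp only [LinearMap.add_apply, LinearMap.smul_apply, LinearMap.comp_apply, map_add, map_smul,
    S.e_d, map_zero, zero_add]
  rw [e1 _ _ (by omega) _ (by omega), e2 _ _ (by omega), h2, h3, smul_smul, smul_smul, sgn_pred,
    neg_mul, sgn_mul_self, one_smul, neg_smul, one_smul, sub_neg_eq_add]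
  exact (congrArg _ h1).trans (by rw [map_add, map_add])

lemma map_mem_Zc_of_ihom {K V : Cx k} {n : ℤ} {φ : Gr K V n} (hφ : φ ∈ Zc (ihom K V) n)
    {p q : ℤ} (h : p + n = q) {a : K.X p} (ha : a ∈ Zc K p) : ap φ p q h a ∈ Zc V q := by
  rw [mem_Zc, ihom_mem_Zc.1 hφ p q _ _ h rfl rfl, mem_Zc.1 ha, map_zero, smul_zero]

lemma map_mem_Bc_of_ihom {K V : Cx k} {n : ℤ} {φ : Gr K V n} (hφ : φ ∈ Zc (ihom K V) n)
    {p q : ℤ} (h : p + n = q) {a : K.X p} (ha : a ∈ Bc K p) : ap φ p q h a ∈ Bc V q := by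
  obtain ⟨c, hc⟩ := exists_of_mem_Bc (sub_add_cancel p 1) ha
  have := ihom_mem_Zc.1 hφ (p - 1) (q - 1) p q (by omega) (by omega) (by omega) c
  rw [← hc, ((inv_smul_eq_iff₀ (sgn_ne_zero n)).2 this).symm]
  exact (Bc V q).smul_mem _ (d_mem_Bc _)

lemma map_mem_Bc_of_ihom_mem_Bc {K V : Cx k} {n : ℤ} {φ : Gr K V n} (hφ : φ ∈ Bc (ihom K V) n)
    {p q : ℤ} (h : p + n = q) {a : K.X p} (ha : a ∈ Zc K p) : ap φ p q h a ∈ Bc V q := by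
  obtain ⟨ψ, hψ⟩ := (ihom_mem_Bc (sub_add_cancel n 1)).1 hφ
  rw [hψ p q (p + 1) (q - 1) h rfl (by omega) a, mem_Zc.1 ha, map_zero, smul_zero, sub_zero]
  exact d_mem_Bc _

/-- Postcomposition on internal Hom complexes. -/
def ihomMap (K : Cx k) {V W : Cx k} (f : V ⟶ W) : ihom K V ⟶ ihom K W :=
  mkHom (K := ihom K V) (L := ihom K W)
    (fun n =>
      { toFun := fun φ : Gr K V n => (grMk fun p q h => (f.f q).hom ∘ₗ ap φ p q h : Gr K W n)
        map_add' := fun φ ψ => gr_ext fun p q h a => map_add (f.f q).hom _ _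
        map_smul' := fun c φ => gr_ext fun p q h a => map_smul (f.f q).hom _ _ })
    fun n φ => by
      erw [ihom_d, ihom_d]
      refine gr_ext (K := K) (V := W) fun p q h a => ?_
      change ap (grD K W n (grMk fun p q h => (f.f q).hom ∘ₗ ap φ p q h)) p q h a =
        (f.f q).hom (ap (grD K V n φ) p q h a)
      rw [grD_apply _ h (sub_add_cancel q 1) rfl,
        grD_apply φ h (sub_add_cancel q 1) rfl, map_sub, map_smul, ← DGModule.d_f]
      rfl

lemma ihomMap_apply (K : Cx k) {V W : Cx k} (f : V ⟶ W) {n : ℤ} (φ : Gr K V n) (p q : ℤ)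
    (h : p + n = q) (a : K.X p) :
    ap (V := W) (((ihomMap K f).f n).hom φ) p q h a = (f.f q).hom (ap φ p q h a) := rfl

/-- Precomposition on internal Hom complexes. -/
def ihomPre {K L : Cx k} (f : K ⟶ L) (V : Cx k) : ihom L V ⟶ ihom K V :=
  mkHom (K := ihom L V) (L := ihom K V)
    (fun n =>
      { toFun := fun φ : Gr L V n => (grMk fun p q h => ap φ p q h ∘ₗ (f.f p).hom : Gr K V n)
        map_add' := fun φ ψ => rfl
        map_smul' := fun c φ => rfl })
    fun n φ => by
      erw [ihom_d, ihom_d]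
      refine gr_ext (K := K) (V := V) fun p q h a => ?_
      change ap (grD K V n (grMk fun p q h => ap φ p q h ∘ₗ (f.f p).hom)) p q h a =
        ap (grD L V n φ) p q h ((f.f p).hom a)
      rw [grD_apply _ h (sub_add_cancel q 1) rfl,
        grD_apply φ h (sub_add_cancel q 1) rfl, DGModule.d_f]
      rfl

lemma ihomPre_apply {K L : Cx k} (f : K ⟶ L) (V : Cx k) {n : ℤ} (φ : Gr L V n) (p q : ℤ)
    (h : p + n = q) (a : K.X p) :
    ap (K := K) (((ihomPre f V).f n).hom φ) p q h a = ap φ p q h ((f.f p).hom a) := rfl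

/-- A quasi-isomorphism has a linear section on cycles, up to boundaries. -/
lemma exists_section_of_quasiIso {K L : Cx k} (f : K ⟶ L) (hf : QuasiIso f) (n : ℤ) :
    ∃ l : L.X n →ₗ[k] K.X n, ∀ b ∈ Zc L n, l b ∈ Zc K n ∧ (f.f n).hom (l b) - b ∈ Bc L n := by
  have hf' := ((quasiIso_iff f).1 hf n).2
  let g : Zc K n →ₗ[k] L.X n ⧸ Bc L n := (Bc L n).mkQ ∘ₗ (f.f n).hom ∘ₗ (Zc K n).subtype
  obtain ⟨s, hs⟩ := exists_section g
  refine ⟨(Zc K n).subtype ∘ₗ s ∘ₗ (Bc L n).mkQ, fun b hb => ⟨(s _).2, ?_⟩⟩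
  obtain ⟨a, ha, hab⟩ := hf' b hb
  rw [← Submodule.Quotient.eq] at hab ⊢
  have := hs ⟨a, ha⟩
  change Submodule.Quotient.mk _ = Submodule.Quotient.mk _ at this
  rw [← hab]
  refine Eq.trans ?_ this
  rw [LinearMap.comp_apply, LinearMap.comp_apply, Submodule.mkQ_apply, ← hab]
  rfl

/-- Over a field no finiteness or projectivity is needed: composing with linear sections on cycles lifts
graded cocycles. -/
lemma quasiIso_ihomMap (K : Cx k) {V W : Cx k} (f : V ⟶ W) (hf : QuasiIso f) :
    QuasiIso (ihomMap K f) := by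
  have hf' := (quasiIso_iff f).1 hf
  refine (quasiIso_iff _).2 fun n => ⟨fun φ hφ hb => ihom_mem_Bc_of hφ fun p q h a ha => ?_,
    fun φ hφ => ?_⟩
  · exact (hf' q).1 _ (map_mem_Zc_of_ihom hφ h ha) (map_mem_Bc_of_ihom_mem_Bc hb h ha)
  · choose l hl using exists_section_of_quasiIso f hf
    obtain ⟨S⟩ := nonempty_splitting K
    have hψ : (grMk fun p q h => l q ∘ₗ ap φ p q h ∘ₗ S.e p : Gr K V n) ∈ Zc (ihom K V) n := by
      refine ihom_mem_Zc.2 fun p q p' q' h hp hq a => ?_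
      simp only [LinearMap.comp_apply, S.e_d, map_zero, smul_zero]
      exact d_eq_zero (hl q _ (map_mem_Zc_of_ihom hφ h (S.e_mem_Zc p a))).1 _
    refine ⟨_, hψ, ihom_mem_Bc_of (Submodule.sub_mem _ (map_mem_Zc _ hψ) hφ) fun p q h a ha => ?_⟩
    change (f.f q).hom (l q (ap φ p q h (S.e p a))) - ap φ p q h a ∈ Bc W q
    have h1 := (hl q _ (map_mem_Zc_of_ihom hφ h (S.e_mem_Zc p a))).2
    have h2 := map_mem_Bc_of_ihom hφ h (S.sub_e_mem ha)
    rw [map_sub] at h2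
    simpa using (Bc W q).sub_mem h1 h2

lemma quasiIso_ihomPre {K L : Cx k} (f : K ⟶ L) (hf : QuasiIso f) (V : Cx k) :
    QuasiIso (ihomPre f V) := by
  have hf' := (quasiIso_iff f).1 hf
  refine (quasiIso_iff _).2 fun n => ⟨fun φ hφ hb => ihom_mem_Bc_of hφ fun p q h b hb' => ?_,
    fun φ hφ => ?_⟩
  · obtain ⟨a, ha, hab⟩ := (hf' p).2 b hb'
    have h1 := map_mem_Bc_of_ihom_mem_Bc hb h ha
    have h2 := map_mem_Bc_of_ihom hφ h hab
    rw [map_sub] at h2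
    rw [ihomPre_apply] at h1
    simpa using (Bc V q).sub_mem h1 h2
  · choose l hl using exists_section_of_quasiIso f hf
    obtain ⟨S⟩ := nonempty_splitting L
    have hψ : (grMk fun p q h => ap φ p q h ∘ₗ l p ∘ₗ S.e p : Gr L V n) ∈ Zc (ihom L V) n := by
      refine ihom_mem_Zc.2 fun p q p' q' h hp hq a => ?_
      simp only [LinearMap.comp_apply, S.e_d, map_zero, smul_zero]
      exact d_eq_zero (map_mem_Zc_of_ihom hφ h (hl p _ (S.e_mem_Zc p a)).1) _
    refine ⟨_, hψ, ihom_mem_Bc_of (Submodule.sub_mem _ (map_mem_Zc _ hψ) hφ) fun p q h a ha => ?_⟩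
    change ap φ p q h (l p (S.e p ((f.f p).hom a))) - ap φ p q h a ∈ Bc V q
    rw [← map_sub]
    have hfa := map_mem_Zc f ha
    have h1 := hl p _ (S.e_mem_Zc p ((f.f p).hom a))
    refine map_mem_Bc_of_ihom hφ h ((hf' p).1 _ (Submodule.sub_mem _ h1.1 ha) ?_)
    have h2 := S.sub_e_mem hfa
    rw [map_sub]
    simpa using (Bc L p).sub_mem h1.2 h2

end DG

namespace DG

variable {k : Type u} [Field k]

/-! ### Direct sums -/

section Sum

variable {J : Type u} (V : J → Cx k)

/-- The direct sum of a family of complexes. -/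
abbrev sumC : Cx k :=
  mkCx (fun n => Π₀ j, (V j).X n)
    (fun n => DFinsupp.mapRange.linearMap fun j => ((V j).d n (n + 1)).hom)
    fun n a => DFinsupp.ext fun j => by simp [d_d]

lemma sumC_d {n m : ℤ} (a : Π₀ j, (V j).X n) (j : J) :
    (show Π₀ j, (V j).X m from ((sumC V).d n m).hom a) j = ((V j).d n m).hom (a j) := by
  by_cases h : n + 1 = m
  · subst h
    erw [mkCx_d]
    rfl
  · rw [(sumC V).shape n m h, (V j).shape n m h]
    rfl

/-- The projection onto a summand. -/
def sumπ (j : J) : sumC V ⟶ V j :=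
  mkHom (K := sumC V) (fun _ => DFinsupp.lapply j) fun _ a => (sumC_d V a j).symm

open Classical in
/-- The inclusion of a summand. -/
def sumι (j : J) : V j ⟶ sumC V :=
  mkHom (L := sumC V) (fun n => DFinsupp.lsingle (M := fun j => (V j).X n) j) fun n a => by
    refine DFinsupp.ext fun i => (sumC_d V _ i).trans ?_
    by_cases h : j = i
    · subst h; simp
    · simp [DFinsupp.single_eq_of_ne (Ne.symm h)]

lemma sumι_same (j : J) {n : ℤ} (a : (V j).X n) :
    (show Π₀ j, (V j).X n from ((sumι V j).f n).hom a) j = a := by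
  classical exact DFinsupp.single_eq_same

lemma sumι_of_ne {i j : J} (h : i ≠ j) {n : ℤ} (a : (V i).X n) :
    (show Π₀ j, (V j).X n from ((sumι V i).f n).hom a) j = 0 := by
  classical exact DFinsupp.single_eq_of_ne (Ne.symm h)

open Classical in
lemma sumι_apply (j : J) {n : ℤ} (a : (V j).X n) :
    ((sumι V j).f n).hom a = DFinsupp.single (β := fun j => (V j).X n) j a := rfl

lemma sumC_ext {n : ℤ} {W : Type u} [AddCommGroup W] [Module k W]
    {f g : (sumC V).X n →ₗ[k] W}
    (h : ∀ j a, f (((sumι V j).f n).hom a) = g (((sumι V j).f n).hom a)) : f = g := by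
  classical
  refine DFinsupp.lhom_ext fun j a => ?_
  have := h j a
  rw [sumι_apply] at this
  convert this

open Classical in
/-- The linear map out of a direct sum with given components. -/
def sumLift {n : ℤ} {W : Type u} [AddCommGroup W] [Module k W] (f : ∀ j, (V j).X n →ₗ[k] W) :
    (sumC V).X n →ₗ[k] W :=
  DFinsupp.lsum k f

lemma sumLift_sumι {n : ℤ} {W : Type u} [AddCommGroup W] [Module k W]
    (f : ∀ j, (V j).X n →ₗ[k] W) (j : J) (a : (V j).X n) :
    sumLift V f (((sumι V j).f n).hom a) = f j a := by
  classical
  exact DFinsupp.lsum_single (S := k) (F := f) j a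

/-- The morphism out of a direct sum with given components. -/
def sumDesc {W : Cx k} (f : ∀ j, V j ⟶ W) : sumC V ⟶ W :=
  mkHom (K := sumC V) (fun n => sumLift V fun j => ((f j).f n).hom) fun n a => by
    refine LinearMap.congr_fun (f := (W.d n (n + 1)).hom ∘ₗ sumLift V fun j => ((f j).f n).hom)
      (g := (sumLift V fun j => ((f j).f (n + 1)).hom) ∘ₗ ((sumC V).d n (n + 1)).hom)
      (sumC_ext V fun j a => ?_) a
    rw [LinearMap.comp_apply, LinearMap.comp_apply, DGModule.d_f, sumLift_sumι, sumLift_sumι,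
      DGModule.d_f]

lemma sumDesc_sumι {W : Cx k} (f : ∀ j, V j ⟶ W) {n : ℤ} (j : J) (a : (V j).X n) :
    ((sumDesc V f).f n).hom (((sumι V j).f n).hom a) = ((f j).f n).hom a :=
  sumLift_sumι V _ j a

lemma sumι_sumDesc {W : Cx k} (f : ∀ j, V j ⟶ W) (j : J) : sumι V j ≫ sumDesc V f = f j := by
  ext n a
  exact sumDesc_sumι V f j a

lemma sum_hom_ext {W : Cx k} {f g : sumC V ⟶ W} (h : ∀ j, sumι V j ≫ f = sumι V j ≫ g) :
    f = g := by
  ext n : 2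
  refine sumC_ext V fun j a => ?_
  rw [DGModule.comp_el, DGModule.comp_el, h]

lemma sumι_sumπ (j : J) : sumι V j ≫ sumπ V j = 𝟙 _ := by
  ext n a
  exact sumι_same V j a

lemma sumι_sumπ_ne {i j : J} (h : i ≠ j) : sumι V i ≫ sumπ V j = 0 := by
  ext n a
  exact sumι_of_ne V h a

lemma sumC_mem_Zc {n : ℤ} {a : Π₀ j, (V j).X n} :
    (show (sumC V).X n from a) ∈ Zc (sumC V) n ↔ ∀ j, a j ∈ Zc (V j) n := by
  constructor
  · intro h j
    rw [mem_Zc, ← sumC_d, mem_Zc.1 h]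
    rfl
  · intro h
    refine mem_Zc.2 (DFinsupp.ext fun j => (sumC_d V a j).trans (h j))

lemma sumC_mem_Bc {n : ℤ} {a : Π₀ j, (V j).X n} :
    (show (sumC V).X n from a) ∈ Bc (sumC V) n ↔ ∀ j, a j ∈ Bc (V j) n := by
  classical
  constructor
  · intro h j
    exact map_mem_Bc (sumπ V j) h
  · intro h
    -- The chosen preimage of `0` is `0`, so that the family of preimages has finite support.
    have h' (j : J) (b : (V j).X n) : ∃ c : (V j).X (n - 1),
        (b ∈ Bc (V j) n → ((V j).d (n - 1) n).hom c = b) ∧ (b = 0 → c = 0) := by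
      by_cases hb : b = 0
      · exact ⟨0, fun _ => by rw [hb, map_zero], fun _ => rfl⟩
      · by_cases hb' : b ∈ Bc (V j) n
        · obtain ⟨c, hc⟩ := hb'
          exact ⟨c, fun _ => hc, fun h => (hb h).elim⟩
        · exact ⟨0, fun h => (hb' h).elim, fun h => rfl⟩
    choose c hc hc' using h'
    refine ⟨a.mapRange c fun j => hc' j 0 rfl, DFinsupp.ext fun j => (sumC_d V _ j).trans ?_⟩
    rw [DFinsupp.mapRange_apply, hc _ _ (h j)]

lemma sum_f_apply {V W : J → Cx k} (f : ∀ j, V j ⟶ W j) {n : ℤ} (a : Π₀ j, (V j).X n) (j : J) :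
    (show Π₀ j, (W j).X n from ((sumDesc V fun j => f j ≫ sumι W j).f n).hom a) j =
      ((f j).f n).hom (a j) := by
  have : (sumDesc V fun j => f j ≫ sumι W j) ≫ sumπ W j = sumπ V j ≫ f j := by
    refine sum_hom_ext V fun i => ?_
    rw [← Category.assoc, sumι_sumDesc, Category.assoc, ← Category.assoc (sumι V i)]
    by_cases h : i = j
    · subst h; rw [sumι_sumπ, sumι_sumπ, Category.comp_id, Category.id_comp]
    · rw [sumι_sumπ_ne _ h, sumι_sumπ_ne _ h, comp_zero, zero_comp]
  exact LinearMap.congr_fun (congrArg (fun g => (g.f n).hom) this) a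

lemma quasiIso_sum {V W : J → Cx k} (f : ∀ j, V j ⟶ W j) (hf : ∀ j, QuasiIso (f j)) :
    QuasiIso (sumDesc V fun j => f j ≫ sumι W j) := by
  classical
  have hf' := fun j => (quasiIso_iff (f j)).1 (hf j)
  refine (quasiIso_iff _).2 fun n => ⟨fun a ha hb => ?_, fun b hb => ?_⟩
  · refine (sumC_mem_Bc V).2 fun j => (hf' j n).1 _ ((sumC_mem_Zc V).1 ha j) ?_
    rw [← sum_f_apply]
    exact (sumC_mem_Bc W).1 hb j
  · have h' (j : J) (b : (W j).X n) : ∃ a : (V j).X n,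
        (b ∈ Zc (W j) n → a ∈ Zc (V j) n ∧ ((f j).f n).hom a - b ∈ Bc (W j) n) ∧
          (b = 0 → a = 0) := by
      by_cases hb : b = 0
      · exact ⟨0, fun _ => ⟨zero_mem _, by rw [hb, map_zero, sub_zero]; exact zero_mem _⟩,
          fun _ => rfl⟩
      · by_cases hb' : b ∈ Zc (W j) n
        · obtain ⟨a, ha⟩ := (hf' j n).2 b hb'
          exact ⟨a, fun _ => ha, fun h => (hb h).elim⟩
        · exact ⟨0, fun h => (hb' h).elim, fun h => rfl⟩
    choose a ha ha' using h'
    have hb' := (sumC_mem_Zc W).1 hb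
    let b' : Π₀ j, (W j).X n := b
    refine ⟨b'.mapRange a fun j => ha' j 0 rfl, (sumC_mem_Zc V).2 fun j => ?_,
      (sumC_mem_Bc W).2 fun j => ?_⟩
    · rw [DFinsupp.mapRange_apply]
      exact (ha j _ (hb' j)).1
    · have := (ha j _ (hb' j)).2
      rw [DFinsupp.sub_apply, sum_f_apply, DFinsupp.mapRange_apply]
      exact this

end Sum

namespace DGModule

variable {A : DGCat k}

section Sum

variable {J : Type u} (L : J → DGModule A)

/-- The componentwise action on a direct sum. -/
def sumAct {x y : A.Obj} {p q n : ℤ} (h : p + q = n) :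
    (Π₀ j, ((L j).obj y).X p) →ₗ[k] (A.Hom x y).X q →ₗ[k] (Π₀ j, ((L j).obj x).X n) :=
  LinearMap.mk₂ k (fun m f => m.mapRange (fun j a => (L j).act h a f) (by simp))
    (fun m m' f => DFinsupp.ext fun j => by simp)
    (fun c m f => DFinsupp.ext fun j => by simp)
    (fun m f f' => DFinsupp.ext fun j => by simp)
    (fun c m f => DFinsupp.ext fun j => by simp)

lemma sumAct_apply {x y : A.Obj} {p q n : ℤ} (h : p + q = n) (m : Π₀ j, ((L j).obj y).X p)
    (f : (A.Hom x y).X q) (j : J) : sumAct L h m f j = (L j).act h (m j) f := rfl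

/-- The direct sum of a family of dg modules. -/
abbrev sum : DGModule A where
  obj x := sumC fun j => (L j).obj x
  act h := sumAct L h
  act_id m := DFinsupp.ext fun j => (L j).act_id _
  act_comp hs ht h h' m f g := DFinsupp.ext fun j => (L j).act_comp hs ht h h' _ f g
  d_act h m f := DFinsupp.ext fun j => by
    refine (sumC_d _ _ j).trans ?_
    refine ((L j).d_act h _ f).trans ?_
    rw [← sumC_d (fun j => (L j).obj _)]
    rfl

/-- The projection onto a summand. -/
def prj (j : J) : sum L ⟶ L j where
  app _ := sumπ _ j
  map_act _ _ _ := rfl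

/-- The inclusion of a summand. -/
def inj (j : J) : L j ⟶ sum L where
  app x := sumι (fun j => (L j).obj x) j
  map_act {x y p q n} h m f := by
    refine DFinsupp.ext fun i => ?_
    refine Eq.trans ?_ (sumAct_apply L h _ f i).symm
    by_cases hi : j = i
    · subst hi
      erw [sumι_same, sumι_same]
    · erw [sumι_of_ne _ hi, sumι_of_ne _ hi]
      simp

/-- The morphism out of a direct sum with given components. -/
def desc {N : DGModule A} (f : ∀ j, L j ⟶ N) : sum L ⟶ N where
  app x := sumDesc (fun j => (L j).obj x) fun j => (f j).app x
  map_act {x y p q n} h m a := by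
    refine LinearMap.congr_fun (f := ((sumDesc (fun j => (L j).obj x) fun j => (f j).app x).f n).hom ∘ₗ
      (sumAct L h).flip a) (g := (N.act h).flip a ∘ₗ
        ((sumDesc (fun j => (L j).obj y) fun j => (f j).app y).f p).hom)
      (sumC_ext (fun j => (L j).obj y) fun j m => ?_) m
    have h1 := (inj L j).map_act h m a
    rw [LinearMap.comp_apply, LinearMap.comp_apply, LinearMap.flip_apply, LinearMap.flip_apply,
      sumDesc_sumι, ← (f j).map_act]
    refine (congrArg _ h1.symm).trans ?_
    exact sumDesc_sumι (fun j => (L j).obj x) (fun j => (f j).app x) j _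

lemma inj_desc {N : DGModule A} (f : ∀ j, L j ⟶ N) (j : J) : inj L j ≫ desc L f = f j := by
  ext x : 1
  exact sumι_sumDesc _ _ _

lemma sum_hom_ext {N : DGModule A} {f g : sum L ⟶ N} (h : ∀ j, inj L j ≫ f = inj L j ≫ g) :
    f = g := by
  ext x : 1
  refine DG.sum_hom_ext _ fun j => ?_
  exact congrArg (fun f => f.app x) (h j)

lemma inj_prj (j : J) : inj L j ≫ prj L j = 𝟙 _ := by
  ext x : 1
  exact sumι_sumπ _ _

lemma inj_prj_ne {i j : J} (h : i ≠ j) : inj L i ≫ prj L j = 0 := by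
  ext x : 1
  exact sumι_sumπ_ne _ h

/-- The direct sum of a family of morphisms. -/
abbrev sumMap {L N : J → DGModule A} (f : ∀ j, L j ⟶ N j) : sum L ⟶ sum N :=
  desc L fun j => f j ≫ inj N j

lemma qis_sumMap {L N : J → DGModule A} (f : ∀ j, L j ⟶ N j) (hf : ∀ j, qis A (f j)) :
    qis A (sumMap f) := fun x => quasiIso_sum (fun j => (f j).app x) fun j => hf j x

end Sum

end DGModule

end DG

namespace DG

/-! ### Morphisms in a localized category -/

section Localization

variable {C : Type u} [Category.{v} C] [Preadditive C] {D : Type u'} [Category.{v'} D]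
  [Preadditive D] (L : C ⥤ D) [L.Additive] (W : MorphismProperty C) [L.IsLocalization W] {P : C}
  (N : ∀ Z, AddSubgroup (P ⟶ Z))

/-- If every morphism from `P` lifts along `W` up to the negligible morphisms `N`, then every
morphism from `P` in the localized category comes from a morphism. -/
lemma exists_map_eq_of_lift (hL : ∀ Z, ∀ f ∈ N Z, L.map f = 0)
    (hW : ∀ {X Y : C} (w : X ⟶ Y), W w → ∀ g : P ⟶ Y, ∃ g' : P ⟶ X, g - g' ≫ w ∈ N Y)
    {Z : C} (φ : L.obj P ⟶ L.obj Z) : ∃ f : P ⟶ Z, L.map f = φ := by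
  refine Localization.induction_structuredArrow L W
    (P := fun g => ∃ f : P ⟶ g.right, L.map f = g.hom) ⟨𝟙 _, L.map_id _⟩ ?_ ?_
    (StructuredArrow.mk φ)
  · rintro Y₁ Y₂ f φ ⟨g, hg⟩
    exact ⟨g ≫ f, (L.map_comp _ _).trans (congrArg (· ≫ L.map f) hg)⟩
  · rintro Y₁ Y₂ w hw φ ⟨g, hg⟩
    obtain ⟨g', hg'⟩ := hW w hw g
    refine ⟨g', ?_⟩
    change _ = φ ≫ _
    rw [Iso.eq_comp_inv]
    have := hL _ _ hg'
    rw [L.map_sub, sub_eq_zero, L.map_comp] at this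
    exact this.symm.trans hg

/-- If lifts along `W` exist and are unique up to the negligible morphisms `N`, then only the
negligible morphisms from `P` become zero in the localized category. -/
lemma mem_of_map_eq_zero (hN : ∀ {X Y : C} (f : P ⟶ X) (g : X ⟶ Y), f ∈ N X → f ≫ g ∈ N Y)
    (hW : ∀ {X Y : C} (w : X ⟶ Y), W w → ∀ g : P ⟶ Y, ∃ g' : P ⟶ X, g - g' ≫ w ∈ N Y)
    (hW' : ∀ {X Y : C} (w : X ⟶ Y), W w → ∀ g : P ⟶ X, g ≫ w ∈ N Y → g ∈ N X)
    {Z : C} (f : P ⟶ Z) (hf : L.map f = 0) : f ∈ N Z := by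
  -- The functor `Z ↦ Hom(P, Z) / N Z` inverts `W`, so it factors through `L` and identifies `f`
  -- with `0`; evaluate it at the class of the identity.
  let F : C ⥤ Type v :=
    { obj := fun Z => (P ⟶ Z) ⧸ N Z
      map := fun {X Y} g => TypeCat.ofHom (QuotientAddGroup.map _ _ (Preadditive.rightComp P g)
        fun f hf => hN f g hf)
      map_id := fun X => by
        ext x
        obtain ⟨a, rfl⟩ := QuotientAddGroup.mk_surjective x
        exact congrArg QuotientAddGroup.mk (Category.comp_id a)
      map_comp := fun f g => by
        ext x
        obtain ⟨a, rfl⟩ := QuotientAddGroup.mk_surjective x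
        exact congrArg QuotientAddGroup.mk (Category.assoc a f g).symm }
  have hF : W.IsInvertedBy F := by
    intro X Y w hw
    rw [isIso_iff_bijective]
    constructor
    · intro x y hxy
      obtain ⟨a, rfl⟩ := QuotientAddGroup.mk_surjective x
      obtain ⟨b, rfl⟩ := QuotientAddGroup.mk_surjective y
      change QuotientAddGroup.mk (a ≫ w) = QuotientAddGroup.mk (b ≫ w) at hxy
      rw [QuotientAddGroup.eq] at hxy ⊢
      refine hW' w hw _ ?_
      simpa using hxy
    · intro y
      obtain ⟨b, rfl⟩ := QuotientAddGroup.mk_surjective y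
      obtain ⟨a, ha⟩ := hW w hw b
      refine ⟨QuotientAddGroup.mk a, ?_⟩
      change QuotientAddGroup.mk (a ≫ w) = QuotientAddGroup.mk b
      rw [QuotientAddGroup.eq]
      simpa [sub_eq_neg_add] using ha
  have h0 : L.map f = L.map 0 := by rw [hf, L.map_zero]
  have h1 : F.map f = F.map 0 := by
    have e := Localization.fac F hF L
    rw [← cancel_epi (e.hom.app P), ← e.hom.naturality, ← e.hom.naturality]
    simp only [Functor.comp_map, h0]
  have h2 : F.map f (QuotientAddGroup.mk (𝟙 P)) = F.map 0 (QuotientAddGroup.mk (𝟙 P)) := by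
    rw [h1]
  change QuotientAddGroup.mk (𝟙 P ≫ f) = QuotientAddGroup.mk (𝟙 P ≫ 0) at h2
  rw [QuotientAddGroup.eq] at h2
  simpa using h2

end Localization

variable {k : Type u} [Field k]

/-! ### Mapping cones -/

section Cone

variable {K L : Cx k} (f : K ⟶ L)

/-- The degree `n` part of the shift `K[1]`, as a product over the one-element type of indices equal
to `n + 1`, so that no transport along equalities of degrees is needed. -/
abbrev Sh (K : Cx k) (n : ℤ) : Type u := ∀ s : {q : ℤ // n + 1 = q}, K.X s.1

lemma Sh.ext {K : Cx k} {n m : ℤ} (h : n + 1 = m) {x y : Sh K n} (e : x ⟨m, h⟩ = y ⟨m, h⟩) :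
    x = y := by
  subst h
  funext ⟨m, hm⟩
  subst hm
  exact e

/-- The differential of the mapping cone. -/
def coneD (n : ℤ) : (L.X n × Sh K n) →ₗ[k] (L.X (n + 1) × Sh K (n + 1)) where
  toFun z := ((L.d n (n + 1)).hom z.1 + (f.f (n + 1)).hom (z.2 ⟨n + 1, rfl⟩),
    fun s => -(K.d (n + 1) s.1).hom (z.2 ⟨n + 1, rfl⟩))
  map_add' z z' := by
    refine Prod.ext ?_ (funext fun s => ?_)
    · simp only [Prod.fst_add, Prod.snd_add, Pi.add_apply, map_add]; abel
    · simp only [Prod.snd_add, Pi.add_apply, map_add, neg_add]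
  map_smul' c z := by
    refine Prod.ext ?_ (funext fun s => ?_)
    · simp
    · simp

/-- The mapping cone of a morphism of complexes. -/
abbrev coneC : Cx k :=
  mkCx (fun n => L.X n × Sh K n) (coneD f) fun n z => by
    refine Prod.ext ?_ (funext fun s => ?_)
    · simp [coneD, d_d, DGModule.d_f]
    · simp [coneD, d_d]

lemma coneC_d {n m : ℤ} (h : n + 1 = m) (z : L.X n × Sh K n) :
    ((coneC f).d n m).hom z = ((L.d n m).hom z.1 + (f.f m).hom (z.2 ⟨m, h⟩),
      fun s : {q : ℤ // m + 1 = q} => -(K.d m s.1).hom (z.2 ⟨m, h⟩)) := by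
  subst h
  exact mkCx_d _ _ _ _ _

/-- The mapping cone of a quasi-isomorphism is acyclic. -/
lemma acyclic_coneC (hf : QuasiIso f) : (coneC f).Acyclic := by
  have hf' := (quasiIso_iff f).1 hf
  refine acyclic_iff.2 fun n => ?_
  rintro ⟨y, x⟩ hz
  have hz' := (coneC_d f rfl (y, x)).symm.trans hz
  have h1 : (L.d n (n + 1)).hom y + (f.f (n + 1)).hom (x ⟨n + 1, rfl⟩) = 0 :=
    congrArg Prod.fst hz'
  have h2 : x ⟨n + 1, rfl⟩ ∈ Zc K (n + 1) := by
    have := congrFun (congrArg Prod.snd hz') ⟨n + 1 + 1, rfl⟩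
    exact neg_eq_zero.1 this
  have h3 : x ⟨n + 1, rfl⟩ ∈ Bc K (n + 1) := by
    refine (hf' (n + 1)).1 _ h2 ?_
    rw [← neg_eq_of_add_eq_zero_right h1]
    exact (Bc _ _).neg_mem (d_mem_Bc _)
  obtain ⟨c, hc⟩ := exists_of_mem_Bc (m := n) rfl h3
  obtain ⟨a, ha, b, hb⟩ := (hf' n).2 (y + (f.f n).hom c) (by
    rw [mem_Zc, map_add, DGModule.d_f, hc, h1])
  refine ⟨(-b, fun s => cst K (by omega) (a - c)), (coneC_d f (sub_add_cancel n 1) _).trans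
    (Prod.ext ?_ (Sh.ext rfl ?_))⟩
  · simp only [map_neg, hb, cst_rfl, map_sub]
    abel
  · simp only [cst_rfl, map_sub, mem_Zc.1 ha, hc]
    simp

end Cone

namespace DGModule

variable {A : DGCat k}

section Cone

variable {M N : DGModule A} (f : M ⟶ N)

/-- The action on the shift. -/
def shAct (M : DGModule A) {x y : A.Obj} {p q n : ℤ} (h : p + q = n) :
    Sh (M.obj y) p →ₗ[k] (A.Hom x y).X q →ₗ[k] Sh (M.obj x) n :=
  LinearMap.mk₂ k (fun m a s => M.act (show p + 1 + q = s.1 by omega) (m ⟨p + 1, rfl⟩) a)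
    (fun m m' a => funext fun s => by simp) (fun c m a => funext fun s => by simp)
    (fun m a a' => funext fun s => by simp) (fun c m a => funext fun s => by simp)

lemma shAct_apply (M : DGModule A) {x y : A.Obj} {p q n p' n' : ℤ} (h : p + q = n)
    (hp : p + 1 = p') (hn : n + 1 = n') (m : Sh (M.obj y) p) (a : (A.Hom x y).X q) :
    shAct M h m a ⟨n', hn⟩ = M.act (show p' + q = n' by omega) (m ⟨p', hp⟩) a := by
  subst hp; rfl

/-- The action on the mapping cone. -/
def coneAct (M N : DGModule A) {x y : A.Obj} {p q n : ℤ} (h : p + q = n) :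
    ((N.obj y).X p × Sh (M.obj y) p) →ₗ[k] (A.Hom x y).X q →ₗ[k]
      ((N.obj x).X n × Sh (M.obj x) n) :=
  LinearMap.mk₂ k (fun m a => (N.act h m.1 a, shAct M h m.2 a))
    (fun m m' a => Prod.ext (by simp) (by simp)) (fun c m a => Prod.ext (by simp) (by simp))
    (fun m a a' => Prod.ext (by simp) (by simp)) (fun c m a => Prod.ext (by simp) (by simp))

/-- The mapping cone of a morphism of dg modules. -/
abbrev cone : DGModule A where
  obj x := coneC (f.app x)
  act h := coneAct M N h
  act_id m := Prod.ext (N.act_id _) (Sh.ext rfl (M.act_id _))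
  act_comp hs ht h h' m a b := Prod.ext (N.act_comp hs ht h h' _ a b)
    (Sh.ext rfl (M.act_comp _ ht _ _ _ a b))
  d_act {x y p q n} h m a := by
    refine (coneC_d (f.app x) rfl _).trans ?_
    erw [coneC_d (f.app y) rfl]
    refine Prod.ext ?_ (Sh.ext rfl ?_)
    · change ((N.obj x).d n (n + 1)).hom (N.act h m.1 a) + ((f.app x).f (n + 1)).hom
        (M.act _ (m.2 ⟨p + 1, rfl⟩) a) = N.act _ (_ + _) a + (-1 : k) ^ p • N.act _ m.1 _
      rw [N.d_act, f.map_act, map_add, LinearMap.add_apply]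
      abel
    · change -((M.obj x).d (n + 1) (n + 1 + 1)).hom (M.act _ (m.2 ⟨p + 1, rfl⟩) a) =
        M.act _ (-((M.obj y).d (p + 1) (p + 1 + 1)).hom (m.2 ⟨p + 1, rfl⟩)) a +
          (-1 : k) ^ p • M.act _ (m.2 ⟨p + 1, rfl⟩) _
      rw [M.d_act' _ rfl rfl, sgn_succ]
      simp only [map_neg, LinearMap.neg_apply, neg_add, neg_smul, neg_neg]

/-- The inclusion of the target into the mapping cone. -/
def coneInl : N ⟶ cone f where
  app x := mkHom (L := coneC (f.app x)) (fun n => LinearMap.inl k _ _) fun n a => by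
    refine (coneC_d (f.app x) rfl _).trans (Prod.ext ?_ (Sh.ext rfl ?_))
    · simp
    · simp
  map_act h m a := Prod.ext rfl (Sh.ext rfl (by
    refine Eq.trans ?_ (shAct_apply M h rfl rfl _ _).symm
    simp))

lemma acyclic_cone (hf : qis A f) : (cone f).Acyclic := fun x => acyclic_coneC _ (hf x)

end Cone

/-! ### Null-homotopic morphisms -/

lemma nullHomotopic_zero (M N : DGModule A) : NullHomotopic (0 : M ⟶ N) :=
  ⟨fun _ _ _ _ => 0, fun x y p q b p' q' h h' hp m f => by simp, fun x n m => by
    simp only [LinearMap.zero_apply, map_zero, add_zero]; rfl⟩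

lemma NullHomotopic.add {M N : DGModule A} {f g : M ⟶ N} (hf : NullHomotopic f)
    (hg : NullHomotopic g) : NullHomotopic (f + g) := by
  obtain ⟨s, hs, hs'⟩ := hf
  obtain ⟨t, ht, ht'⟩ := hg
  refine ⟨fun x p q h => s x p q h + t x p q h, fun x y p q b p' q' h h' hp m f => ?_,
    fun x n m => ?_⟩
  · rw [LinearMap.add_apply, hs _ _ _ _ _ _ _ h, ht _ _ _ _ _ _ _ h, LinearMap.add_apply, map_add,
      LinearMap.add_apply]
  · refine (congrArg₂ (· + ·) (hs' x n m) (ht' x n m)).trans ?_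
    simp only [LinearMap.add_apply, map_add]
    abel

lemma NullHomotopic.smul {M N : DGModule A} {f : M ⟶ N} (c : k) (hf : NullHomotopic f) :
    NullHomotopic (c • f) := by
  obtain ⟨s, hs, hs'⟩ := hf
  refine ⟨fun x p q h => c • s x p q h, fun x y p q b p' q' h h' hp m f => ?_, fun x n m => ?_⟩
  · rw [LinearMap.smul_apply, hs _ _ _ _ _ _ _ h, LinearMap.smul_apply, map_smul,
      LinearMap.smul_apply]
  · refine (congrArg (c • ·) (hs' x n m)).trans ?_
    simp only [LinearMap.smul_apply, map_smul, smul_add]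

lemma NullHomotopic.comp {M N L : DGModule A} {f : M ⟶ N} (hf : NullHomotopic f) (g : N ⟶ L) :
    NullHomotopic (f ≫ g) := by
  obtain ⟨s, hs, hs'⟩ := hf
  refine ⟨fun x p q h => ((g.app x).f q).hom ∘ₗ s x p q h, fun x y p q b p' q' h h' hp m f => ?_,
    fun x n m => ?_⟩
  · rw [LinearMap.comp_apply, hs _ _ _ _ _ _ _ h, g.map_act, LinearMap.comp_apply]
  · refine (congrArg ((g.app x).f n).hom (hs' x n m)).trans ?_
    rw [map_add, ← d_f]
    rfl

lemma NullHomotopic.precomp {M N L : DGModule A} {g : N ⟶ L} (hg : NullHomotopic g) (f : M ⟶ N) :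
    NullHomotopic (f ≫ g) := by
  obtain ⟨s, hs, hs'⟩ := hg
  refine ⟨fun x p q h => s x p q h ∘ₗ ((f.app x).f p).hom, fun x y p q b p' q' h h' hp m a => ?_,
    fun x n m => ?_⟩
  · rw [LinearMap.comp_apply, f.map_act, hs _ _ _ _ _ _ _ h, LinearMap.comp_apply]
  · refine (hs' x n _).trans ?_
    rw [LinearMap.comp_apply, LinearMap.comp_apply, ← d_f]
    rfl

/-- The subspace of null-homotopic morphisms. -/
def nullSubmodule (M N : DGModule A) : Submodule k (M ⟶ N) where
  carrier := {f | NullHomotopic f}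
  add_mem' := NullHomotopic.add
  zero_mem' := nullHomotopic_zero M N
  smul_mem' c _ := NullHomotopic.smul c

lemma NullHomotopic.neg {M N : DGModule A} {f : M ⟶ N} (hf : NullHomotopic f) :
    NullHomotopic (-f) := (nullSubmodule M N).neg_mem hf

lemma NullHomotopic.eq {M N : DGModule A} {g : M ⟶ N} {s : ∀ (x : A.Obj) (p q : ℤ), q + 1 = p →
      ((M.obj x).X p →ₗ[k] (N.obj x).X q)}
    (hs : ∀ (x : A.Obj) (n : ℤ) (m : (M.obj x).X n),
      ((g.app x).f n).hom m =
        ((N.obj x).d (n - 1) n).hom (s x n (n - 1) (by omega) m) +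
          s x (n + 1) n rfl (((M.obj x).d n (n + 1)).hom m))
    {x : A.Obj} {n n' n'' : ℤ} (h' : n' + 1 = n) (h'' : n + 1 = n'') (m : (M.obj x).X n) :
    ((g.app x).f n).hom m = ((N.obj x).d n' n).hom (s x n n' h' m) +
      s x n'' n h'' (((M.obj x).d n n'').hom m) := by
  obtain rfl : n' = n - 1 := by omega
  subst h''
  exact hs x n m

lemma acyclic_shift {N : DGModule A} (hN : N.Acyclic) (n : ℤ) : (N.shift n).Acyclic := by
  intro x
  refine acyclic_iff.2 fun i a ha => ?_
  have h := acyclic_iff.1 (hN x)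
  have ha' : ((N.obj x).d (i + n) (i + 1 + n)).hom a = 0 := by
    have := (shift_d (N.obj x) n i (i + 1) a).symm.trans ha
    exact (smul_eq_zero.1 this).resolve_left (sgn_ne_zero n)
  obtain ⟨c, hc⟩ := exists_of_mem_Bc (m := i - 1 + n) (by omega) (h _ (mem_Zc_of (by omega) ha'))
  refine ⟨(-1 : k) ^ n • c, (shift_d (N.obj x) n (i - 1) i _).trans ?_⟩
  rw [map_smul, smul_smul, sgn_mul_self, one_smul, hc]

/-- A null-homotopic morphism vanishes in the derived category, since it factors through the
mapping cone of an identity. -/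
lemma Q_map_eq_zero {M N : DGModule A} {g : M ⟶ N} (hg : NullHomotopic g) : D.Q.map g = 0 := by
  obtain ⟨s, hs, hs'⟩ := hg
  let r : cone (𝟙 M) ⟶ N :=
    { app := fun x => mkHom (K := coneC (𝟙 (M.obj x)))
        (fun n => ((g.app x).f n).hom ∘ₗ LinearMap.fst k _ _ +
          s x (n + 1) n rfl ∘ₗ LinearMap.proj (φ := fun s : {q : ℤ // n + 1 = q} =>
            (M.obj x).X s.1) ⟨n + 1, rfl⟩ ∘ₗ LinearMap.snd k _ _) fun n a => by
          erw [coneC_d (𝟙 (M.obj x)) rfl]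
          simp only [LinearMap.add_apply, LinearMap.comp_apply, LinearMap.fst_apply,
            LinearMap.snd_apply, LinearMap.proj_apply, map_add, map_neg]
          rw [d_f]
          have := NullHomotopic.eq hs' (x := x) (rfl : n + 1 = n + 1) rfl (a.2 ⟨n + 1, rfl⟩)
          erw [this]
          abel
      map_act := fun {x y p q n} h m f => by
        refine (congrArg₂ (· + ·) ((g.map_act h m.1 f)) (hs x y (p + 1) p q (n + 1) n rfl rfl
          (by omega) (m.2 ⟨p + 1, rfl⟩) f)).trans ?_
        refine Eq.trans ?_ (LinearMap.congr_fun ((N.act h).map_add _ _) f).symm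
        rfl }
  have hr : coneInl (𝟙 M) ≫ r = g := by
    ext x n m
    change ((g.app x).f n).hom m + s x (n + 1) n rfl 0 = _
    rw [map_zero, add_zero]
  have h0 : qis A (0 : zero A ⟶ cone (𝟙 M)) := fun x => by
    refine (DG.quasiIso_iff _).2 fun n => ⟨fun a _ _ => ?_, fun b hb => ⟨0, zero_mem _, ?_⟩⟩
    · exact (show a = 0 from rfl) ▸ zero_mem _
    · have := acyclic_iff.1 (acyclic_cone (𝟙 M) (fun x => (inferInstance : QuasiIso (𝟙 _))) x) n hb
      rw [map_zero, zero_sub]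
      exact (Bc _ _).neg_mem this
  have : IsIso (D.Q.map (0 : zero A ⟶ cone (𝟙 M))) := Localization.inverts _ (qis A) _ h0
  have hz : IsZero (D.Q.obj (cone (𝟙 M))) := by
    rw [IsZero.iff_id_eq_zero, ← IsIso.inv_hom_id (D.Q.map (0 : zero A ⟶ cone (𝟙 M)))]
    exact (congrArg (inv (D.Q.map (0 : zero A ⟶ cone (𝟙 M))) ≫ ·) (D.Q.map_zero _ _)).trans
      comp_zero
  rw [← hr, D.Q.map_comp, hz.eq_zero_of_tgt (D.Q.map _), zero_comp]

end DGModule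

end DG

namespace DG

variable {k : Type u} [Field k]

namespace DGModule

variable {A : DGCat k}

/-! ### Homotopically projective dg modules -/

section Cone

variable {M N L : DGModule A} (f : M ⟶ N)

/-- The morphism out of a mapping cone given by a null-homotopy. -/
def coneDesc (g : N ⟶ L) (s : ∀ (x : A.Obj) (p q : ℤ), q + 1 = p →
      ((M.obj x).X p →ₗ[k] (L.obj x).X q))
    (hs : ∀ (x y : A.Obj) (p q b p' q' : ℤ) (h : q + 1 = p) (h' : q' + 1 = p') (hp : p + b = p')
      (m : (M.obj y).X p) (f : (A.Hom x y).X b),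
      s x p' q' h' (M.act hp m f) = L.act (show q + b = q' by omega) (s y p q h m) f)
    (hs' : ∀ (x : A.Obj) (n : ℤ) (m : (M.obj x).X n),
      (((f ≫ g).app x).f n).hom m =
        ((L.obj x).d (n - 1) n).hom (s x n (n - 1) (by omega) m) +
          s x (n + 1) n rfl (((M.obj x).d n (n + 1)).hom m)) : cone f ⟶ L where
  app := fun x => mkHom (K := coneC (f.app x))
        (fun n => ((g.app x).f n).hom ∘ₗ LinearMap.fst k _ _ +
          s x (n + 1) n rfl ∘ₗ LinearMap.proj (φ := fun s : {q : ℤ // n + 1 = q} =>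
            (M.obj x).X s.1) ⟨n + 1, rfl⟩ ∘ₗ LinearMap.snd k _ _) fun n a => by
          erw [coneC_d (f.app x) rfl]
          simp only [LinearMap.add_apply, LinearMap.comp_apply, LinearMap.fst_apply,
            LinearMap.snd_apply, LinearMap.proj_apply, map_add, map_neg]
          rw [d_f]
          have := NullHomotopic.eq hs' (x := x) (rfl : n + 1 = n + 1) rfl (a.2 ⟨n + 1, rfl⟩)
          erw [this]
          abel
  map_act := fun {x y p q n} h m a => by
        refine (congrArg₂ (· + ·) ((g.map_act h m.1 a)) (hs x y (p + 1) p q (n + 1) n rfl rfl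
          (by omega) (m.2 ⟨p + 1, rfl⟩) a)).trans ?_
        refine Eq.trans ?_ (LinearMap.congr_fun ((L.act h).map_add _ _) a).symm
        rfl

lemma coneDesc_apply (g : N ⟶ L) (s : ∀ (x : A.Obj) (p q : ℤ), q + 1 = p →
      ((M.obj x).X p →ₗ[k] (L.obj x).X q)) (hs hs') {x : A.Obj} {n n' : ℤ} (h : n + 1 = n')
    (a : (N.obj x).X n × Sh (M.obj x) n) :
    (((coneDesc f g s hs hs').app x).f n).hom a = ((g.app x).f n).hom a.1 +
      s x n' n h (a.2 ⟨n', h⟩) := by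
  subst h; rfl

lemma coneInl_coneDesc (g : N ⟶ L) (s : ∀ (x : A.Obj) (p q : ℤ), q + 1 = p →
      ((M.obj x).X p →ₗ[k] (L.obj x).X q)) (hs hs') :
    coneInl f ≫ coneDesc f g s hs hs' = g := by
  ext x n m
  refine (coneDesc_apply f g s hs hs' rfl (m, 0)).trans ?_
  erw [map_zero]
  rw [add_zero]

/-- A null-homotopy of `g ≫ coneInl f` consists of a lift of `g` along `f` and a homotopy. -/
lemma exists_lift_of_nullHomotopic (g : L ⟶ N) (h : NullHomotopic (g ≫ coneInl f)) :
    ∃ g' : L ⟶ M, NullHomotopic (g - g' ≫ f) := by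
  obtain ⟨s, hs, hs'⟩ := h
  have key (x : A.Obj) {n n' n'' : ℤ} (h' : n' + 1 = n) (h'' : n + 1 = n'')
      (m : (L.obj x).X n) :
      ((g.app x).f n).hom m = ((N.obj x).d n' n).hom (s x n n' h' m).1 +
        ((f.app x).f n).hom ((s x n n' h' m).2 ⟨n, h'⟩) +
        (s x n'' n h'' (((L.obj x).d n n'').hom m)).1 ∧
      0 = -((M.obj x).d n n'').hom ((s x n n' h' m).2 ⟨n, h'⟩) +
        (s x n'' n h'' (((L.obj x).d n n'').hom m)).2 ⟨n'', h''⟩ := by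
    have e := (NullHomotopic.eq hs' h' h'' m).trans (congrArg (· + _)
      (coneC_d (f.app x) h' (s x n n' h' m)))
    exact ⟨congrArg Prod.fst e, congrFun (congrArg Prod.snd e) ⟨n'', h''⟩⟩
  let g' : L ⟶ M :=
    { app := fun x => mkHom (fun n => LinearMap.proj (φ := fun s : {q : ℤ // n - 1 + 1 = q} =>
          (M.obj x).X s.1) ⟨n, by omega⟩ ∘ₗ LinearMap.snd k _ _ ∘ₗ s x n (n - 1) (by omega))
          fun n a => by
        have e := (key x (sub_add_cancel n 1) rfl a).2
        have e' := eq_neg_of_add_eq_zero_right e.symm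
        rw [neg_neg] at e'
        refine e'.symm.trans ?_
        have (i : ℤ) (hi : i = n) : (s x (n + 1) n rfl (((L.obj x).d n (n + 1)).hom a)).2
            ⟨n + 1, rfl⟩ = (s x (n + 1) i (by omega) (((L.obj x).d n (n + 1)).hom a)).2
            ⟨n + 1, by omega⟩ := by subst hi; rfl
        exact this _ (by omega)
      map_act := fun {x y p q n} h m a => by
        refine (congrArg (fun z => z.2 ⟨n, by omega⟩)
          (hs x y p (p - 1) q n (n - 1) (by omega) (by omega) h m a)).trans ?_
        exact shAct_apply M (show p - 1 + q = n - 1 by omega) (by omega) (by omega) _ a }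
  refine ⟨g', fun x p q h => LinearMap.fst k _ _ ∘ₗ s x p q h,
    fun x y p q b p' q' h h' hp m a => congrArg Prod.fst (hs x y p q b p' q' h h' hp m a),
    fun x n m => ?_⟩
  have e := (key x (sub_add_cancel n 1) rfl m).1
  refine (congrArg (· - ((f.app x).f n).hom ((s x n (n - 1) (by omega) m).2 ⟨n, by omega⟩))
    e).trans ?_
  simp only [LinearMap.comp_apply, LinearMap.fst_apply]
  abel

end Cone

/-- Morphisms of degree `-1` from a homotopically projective dg module to an acyclic one are
null-homotopic as well. -/
lemma IsHProjective.exists_homotopy {M L : DGModule A} (hM : M.IsHProjective) (hL : L.Acyclic)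
    (F : ∀ (x : A.Obj) (p q : ℤ), q + 1 = p → ((M.obj x).X p →ₗ[k] (L.obj x).X q))
    (hF : ∀ (x y : A.Obj) (p q b p' q' : ℤ) (h : q + 1 = p) (h' : q' + 1 = p') (hp : p + b = p')
      (m : (M.obj y).X p) (f : (A.Hom x y).X b),
      F x p' q' h' (M.act hp m f) = L.act (show q + b = q' by omega) (F y p q h m) f)
    (hd : ∀ (x : A.Obj) (p q r : ℤ) (h : q + 1 = p) (ht : p + 1 = r) (m : (M.obj x).X p),
      ((L.obj x).d q p).hom (F x p q h m) = -F x r p ht (((M.obj x).d p r).hom m)) :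
    ∃ t : ∀ (x : A.Obj) (p q : ℤ), q + 2 = p → ((M.obj x).X p →ₗ[k] (L.obj x).X q),
      (∀ (x y : A.Obj) (p q b p' q' : ℤ) (h : q + 2 = p) (h' : q' + 2 = p') (hp : p + b = p')
        (m : (M.obj y).X p) (f : (A.Hom x y).X b),
        t x p' q' h' (M.act hp m f) = L.act (show q + b = q' by omega) (t y p q h m) f) ∧
      ∀ (x : A.Obj) (p q r r' : ℤ) (h : q + 1 = p) (h' : r + 1 = q) (hr : p + 1 = r')
        (m : (M.obj x).X p), F x p q h m =
          -((L.obj x).d r q).hom (t x p r (by omega) m) +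
            t x r' q (by omega) (((M.obj x).d p r').hom m) := by
  have e1 : (-1 : k) ^ (-1 : ℤ) = -1 := by simp
  let φ : M ⟶ L.shift (-1) :=
    { app := fun x => mkHom (L := (L.shift (-1)).obj x) (fun n => F x n (n + -1) (by omega))
        fun n m => by
          refine (shift_d (L.obj x) (-1) n (n + 1) _).trans ?_
          have (i : ℤ) (hi : i = n) : (-1 : k) ^ (-1 : ℤ) • ((L.obj x).d (n + -1) i).hom
              (F x n (n + -1) (by omega) m) =
              F x (n + 1) i (by omega) (((M.obj x).d n (n + 1)).hom m) := by
            subst hi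
            rw [hd x i _ (i + 1) (by omega) rfl, e1, neg_smul, one_smul, neg_neg]
          exact this _ (by omega)
      map_act := fun {x y p q n} h m a => hF x y p (p + -1) q n (n + -1) _ _ h m a }
  obtain ⟨t', ht', htd'⟩ := hM _ (acyclic_shift hL _) φ
  let t (x : A.Obj) (p q : ℤ) (h : q + 1 = p) : (M.obj x).X p →ₗ[k] (L.obj x).X (q + -1) :=
    t' x p q h
  have ht (x y : A.Obj) (p q b p' q' : ℤ) (h : q + 1 = p) (h' : q' + 1 = p') (hp : p + b = p')
      (m : (M.obj y).X p) (f : (A.Hom x y).X b) : t x p' q' h' (M.act hp m f) =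
        L.act (show q + -1 + b = q' + -1 by omega) (t y p q h m) f :=
    ht' x y p q b p' q' h h' hp m f
  have htd (x : A.Obj) (p r' : ℤ) (hr : p + 1 = r') (m : (M.obj x).X p) :
      F x p (p + -1) (by omega) m =
        -((L.obj x).d (p + -1 + -1) (p + -1)).hom (t x p (p + -1) (by omega) m) +
          t x r' p hr (((M.obj x).d p r').hom m) := by
    have e := (NullHomotopic.eq htd' (n' := p + -1) (by omega) hr m).trans (congrArg (· + _)
      (shift_d (L.obj x) (-1) (p + -1) p _))
    rw [e1, neg_smul, one_smul] at e
    exact e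
  have key (x : A.Obj) (p q i : ℤ) (h : q + 1 = p) (hi : q + -1 = i) (m : (M.obj x).X p) :
      cst (L.obj x) (show i + 1 + -1 = i by omega) (t x p (i + 1) (by omega) m) =
        cst (L.obj x) hi (t x p q h m) := by
    obtain rfl : q = i + 1 := by omega
    rfl
  refine ⟨fun x p q h => cst (L.obj x) (show q + 1 + -1 = q by omega) ∘ₗ t x p (q + 1) (by omega),
    fun x y p q b p' q' h h' hp m f => ?_, fun x p q r r' h h' hr m => ?_⟩
  · have e := ht x y p (q + 1) b p' (q' + 1) (by omega) (by omega) hp m f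
    rw [LinearMap.comp_apply, LinearMap.comp_apply, e]
    have (i j : ℤ) (hi : i = q) (hj : j = q') (h : i + b = j) (z : (L.obj y).X i) :
        cst (L.obj x) hj (L.act h z f) = L.act (by omega) (cst (L.obj y) hi z) f := by
      subst hi hj
      rw [cst_rfl, cst_rfl]
    exact this _ _ _ _ _ _
  · obtain rfl : q = p + -1 := by omega
    obtain rfl : r = p + -1 + -1 := by omega
    rw [LinearMap.comp_apply, LinearMap.comp_apply, key x p (p + -1) _ (by omega) rfl,
      key x r' p _ hr rfl, cst_rfl, cst_rfl]
    exact htd x p r' hr m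

namespace IsHProjective

variable {Q : DGModule A} (hQ : Q.IsHProjective)
include hQ

lemma exists_lift {X Y : DGModule A} (w : X ⟶ Y) (hw : qis A w) (g : Q ⟶ Y) :
    ∃ g' : Q ⟶ X, NullHomotopic (g - g' ≫ w) :=
  exists_lift_of_nullHomotopic w g (hQ _ (acyclic_cone w hw) _)

/-- A morphism from a homotopically projective dg module is null-homotopic if its composition with a
quasi-isomorphism is. -/
lemma nullHomotopic_of_comp {X Y : DGModule A} (w : X ⟶ Y) (hw : qis A w) (g : Q ⟶ X)
    (h : NullHomotopic (g ≫ w)) : NullHomotopic g := by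
  obtain ⟨t, ht, htd⟩ := h
  -- The map `(-t, g)` of degree `-1` to the acyclic mapping cone of `w` is null-homotopic.
  let F (x : A.Obj) (p q : ℤ) (h : q + 1 = p) : (Q.obj x).X p →ₗ[k]
      ((Y.obj x).X q × Sh (X.obj x) q) :=
    LinearMap.prod (-t x p q h)
      (LinearMap.pi fun s => cst (X.obj x) (h.symm.trans s.2) ∘ₗ ((g.app x).f p).hom)
  have hF (x : A.Obj) {p q : ℤ} (h : q + 1 = p) (m : (Q.obj x).X p) :
      (F x p q h m).2 ⟨p, h⟩ = ((g.app x).f p).hom m :=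
    cst_rfl (X.obj x) (rfl : p = p) (((g.app x).f p).hom m)
  obtain ⟨s, hs, hsd⟩ := hQ.exists_homotopy (acyclic_cone w hw) F
    (fun x y p q b p' q' h h' hp m a => by
      refine Prod.ext ?_ (Sh.ext h' ?_)
      · change -t x p' q' _ (Q.act _ m a) = Y.act _ (-t y p q _ m) a
        rw [ht x y p q b p' q' h h' hp, map_neg, LinearMap.neg_apply]
      · refine (hF x _ _).trans ((g.map_act hp m a).trans ?_)
        refine Eq.trans ?_ (shAct_apply X (show q + b = q' by omega) h h' _ a).symm
        rw [hF])
    (fun x p q r h hr m => by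
      refine (coneC_d (w.app x) h _).trans (Prod.ext ?_ (Sh.ext hr ?_))
      · have e := NullHomotopic.eq htd h hr m
        change ((Y.obj x).d q p).hom (-t x p q h m) + ((w.app x).f p).hom ((F x p q h m).2 ⟨p, h⟩) =
          - -t x r p hr _
        rw [hF, map_neg]
        refine (congrArg (_ + ·) e).trans ?_
        abel
      · change -((X.obj x).d p r).hom ((F x p q h m).2 ⟨p, h⟩) = -(F x r p hr _).2 ⟨r, hr⟩
        rw [hF, hF, d_f])
  refine ⟨fun x p q h => LinearMap.proj (φ := fun s : {i : ℤ // q - 1 + 1 = i} =>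
          (X.obj x).X s.1) ⟨q, by omega⟩ ∘ₗ LinearMap.snd k _ _ ∘ₗ s x p (q - 1) (by omega),
    fun x y p q b p' q' h h' hp m a => ?_, fun x n m => ?_⟩
  · refine (congrArg (fun z => z.2 ⟨q', by omega⟩)
      (hs x y p (q - 1) b p' (q' - 1) (by omega) (by omega) hp m a)).trans ?_
    exact shAct_apply X (show q - 1 + b = q' - 1 by omega) (by omega) (by omega) _ a
  · have e := (hsd x n (n - 1) (n - 1 - 1) (n + 1) (by omega) (by omega) rfl m).trans
      (congrArg (fun z => -z + s x (n + 1) (n - 1) (by omega) (((Q.obj x).d n (n + 1)).hom m))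
        (coneC_d (w.app x) (show n - 1 - 1 + 1 = n - 1 by omega) _))
    refine (hF x (sub_add_cancel n 1) m).symm.trans
      ((congrArg (fun z => z.2 ⟨n, by omega⟩) e).trans ?_)
    exact congrArg₂ (· + ·) (neg_neg (((X.obj x).d (n - 1) n).hom _)) rfl

/-- Morphisms from a homotopically projective dg module in the derived category are morphisms of dg
modules, up to homotopy (see `Q_map_eq_zero_iff`). -/
lemma Q_map_surjective {Z : DGModule A} (φ : D.Q.obj Q ⟶ D.Q.obj Z) :
    ∃ f : Q ⟶ Z, D.Q.map f = φ :=
  exists_map_eq_of_lift D.Q (qis A) (fun Z => (nullSubmodule Q Z).toAddSubgroup)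
    (fun _ _ hf => Q_map_eq_zero hf) (fun w hw g => hQ.exists_lift w hw g) φ

lemma Q_map_eq_zero_iff {Z : DGModule A} (f : Q ⟶ Z) : D.Q.map f = 0 ↔ NullHomotopic f :=
  ⟨fun hf => mem_of_map_eq_zero D.Q (qis A) (fun Z => (nullSubmodule Q Z).toAddSubgroup)
    (fun _ g hf => NullHomotopic.comp hf g) (fun w hw g => hQ.exists_lift w hw g)
    (fun w hw g h => hQ.nullHomotopic_of_comp w hw g h) f hf, Q_map_eq_zero⟩

end IsHProjective

lemma isHProjective_zero : (zero A).IsHProjective := fun N _ g => by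
  rw [(isZero_zero A).eq_zero_of_src g]
  exact nullHomotopic_zero _ _

/-- Null-homotopies of the components of a morphism out of a direct sum add up to a
null-homotopy. -/
lemma exists_homotopy_sum {J : Type u} (L : J → DGModule A) {N : DGModule A} (g : sum L ⟶ N)
    (s : ∀ (j : J) (x : A.Obj) (p q : ℤ), q + 1 = p → (((L j).obj x).X p →ₗ[k] (N.obj x).X q))
    (hs : ∀ (j : J) (x y : A.Obj) (p q b p' q' : ℤ) (h : q + 1 = p) (h' : q' + 1 = p')
      (hp : p + b = p') (m : ((L j).obj y).X p) (f : (A.Hom x y).X b),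
      s j x p' q' h' ((L j).act hp m f) = N.act (show q + b = q' by omega) (s j y p q h m) f)
    (hs' : ∀ (j : J) (x : A.Obj) (n : ℤ) (m : ((L j).obj x).X n),
      (((inj L j ≫ g).app x).f n).hom m =
        ((N.obj x).d (n - 1) n).hom (s j x n (n - 1) (by omega) m) +
          s j x (n + 1) n rfl ((((L j).obj x).d n (n + 1)).hom m)) :
    ∃ S : ∀ (x : A.Obj) (p q : ℤ), q + 1 = p → (((sum L).obj x).X p →ₗ[k] (N.obj x).X q),
      (∀ (x y : A.Obj) (p q b p' q' : ℤ) (h : q + 1 = p) (h' : q' + 1 = p') (hp : p + b = p')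
        (m : ((sum L).obj y).X p) (f : (A.Hom x y).X b),
        S x p' q' h' ((sum L).act hp m f) = N.act (show q + b = q' by omega) (S y p q h m) f) ∧
      (∀ (x : A.Obj) (n : ℤ) (m : ((sum L).obj x).X n),
        ((g.app x).f n).hom m =
          ((N.obj x).d (n - 1) n).hom (S x n (n - 1) (by omega) m) +
            S x (n + 1) n rfl ((((sum L).obj x).d n (n + 1)).hom m)) ∧
      ∀ (x : A.Obj) (p q : ℤ) (h : q + 1 = p) (j : J) (m : ((L j).obj x).X p),
        S x p q h ((((inj L j).app x).f p).hom m) = s j x p q h m := by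
  refine ⟨fun x p q h => sumLift (fun j => (L j).obj x) fun j => s j x p q h,
    fun x y p q b p' q' h h' hp m f => ?_, fun x n m => ?_,
    fun x p q h j m => sumLift_sumι (fun j => (L j).obj x) _ j m⟩
  · refine LinearMap.congr_fun (f := (sumLift (fun j => (L j).obj x) fun j => s j x p' q' h') ∘ₗ
      (sumAct L hp).flip f) (g := (N.act (show q + b = q' by omega)).flip f ∘ₗ
        (sumLift (fun j => (L j).obj y) fun j => s j y p q h))
      (sumC_ext (fun j => (L j).obj y) fun j m => ?_) m
    have h1 := (inj L j).map_act hp m f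
    rw [LinearMap.comp_apply, LinearMap.comp_apply, LinearMap.flip_apply, LinearMap.flip_apply,
      sumLift_sumι, ← hs j x y p q b p' q' h h' hp m f]
    refine (congrArg _ h1.symm).trans ?_
    exact sumLift_sumι (fun j => (L j).obj x) _ j _
  · refine LinearMap.congr_fun (f := ((g.app x).f n).hom) (g := ((N.obj x).d (n - 1) n).hom ∘ₗ
      (sumLift (fun j => (L j).obj x) fun j => s j x n (n - 1) (by omega)) +
      (sumLift (fun j => (L j).obj x) fun j => s j x (n + 1) n rfl) ∘ₗ
        ((sumC fun j => (L j).obj x).d n (n + 1)).hom)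
      (sumC_ext (fun j => (L j).obj x) fun j m => ?_) m
    rw [LinearMap.add_apply, LinearMap.comp_apply, LinearMap.comp_apply, d_f, sumLift_sumι,
      sumLift_sumι]
    exact hs' j x n m

lemma nullHomotopic_of_inj {J : Type u} (L : J → DGModule A) {N : DGModule A} (g : sum L ⟶ N)
    (h : ∀ j, NullHomotopic (inj L j ≫ g)) : NullHomotopic g := by
  choose s hs hs' using h
  obtain ⟨S, hS, hS', -⟩ := exists_homotopy_sum L g s hs hs'
  exact ⟨S, hS, hS'⟩

lemma isHProjective_sum {J : Type u} (L : J → DGModule A) (h : ∀ j, (L j).IsHProjective) :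
    (sum L).IsHProjective := fun N hN g =>
  nullHomotopic_of_inj L g fun j => h j N hN _

/-- Homotopically projective dg modules are closed under mapping cones: a morphism `g` from the cone
to an acyclic module is contracted first on `N`, and the rest is a morphism of degree `-1` on `M`. -/
lemma isHProjective_cone {M N : DGModule A} (f : M ⟶ N) (hM : M.IsHProjective)
    (hN : N.IsHProjective) : (cone f).IsHProjective := by
  intro L hL g
  obtain ⟨s, hs, hs'⟩ := hN L hL (coneInl f ≫ g)
  -- The restriction of `g` to `M`, corrected by `s f`, is a morphism `M → L[-1]`.
  let ir (x : A.Obj) (p q : ℤ) (h : q + 1 = p) : (M.obj x).X p →ₗ[k]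
      ((N.obj x).X q × Sh (M.obj x) q) :=
    LinearMap.inr k _ _ ∘ₗ (LinearMap.pi fun i => cst (M.obj x) (h.symm.trans i.2))
  have ir_snd (x : A.Obj) (p q : ℤ) (h : q + 1 = p) (m : (M.obj x).X p) :
      (ir x p q h m).2 ⟨p, h⟩ = m := cst_rfl (M.obj x) (rfl : p = p) m
  let F (x : A.Obj) (p q : ℤ) (h : q + 1 = p) : (M.obj x).X p →ₗ[k] (L.obj x).X q :=
    ((g.app x).f q).hom ∘ₗ ir x p q h - s x p q h ∘ₗ ((f.app x).f p).hom
  have hF2 (x : A.Obj) (p q : ℤ) (h : q + 1 = p) (m : (M.obj x).X p) :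
      ((g.app x).f q).hom (ir x p q h m) = F x p q h m + s x p q h (((f.app x).f p).hom m) :=
    (sub_add_cancel _ _).symm
  have hF (x : A.Obj) (p q : ℤ) (h : q + 1 = p) (a : (N.obj x).X q × Sh (M.obj x) q) :
      ((g.app x).f q).hom a = (((coneInl f ≫ g).app x).f q).hom a.1 +
        (F x p q h (a.2 ⟨p, h⟩) + s x p q h (((f.app x).f p).hom (a.2 ⟨p, h⟩))) := by
    rw [← hF2]
    refine Eq.trans (congrArg _ ?_) (map_add ((g.app x).f q).hom (a.1, 0) (ir x p q h (a.2 ⟨p, h⟩)))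
    refine Prod.ext (add_zero _).symm (Sh.ext h ?_)
    exact ((zero_add _).trans (ir_snd x p q h _)).symm
  obtain ⟨t, ht, htd⟩ := hM.exists_homotopy hL F (fun x y p q b p' q' h h' hp m a => by
    have e := hs x y p q b p' q' h h' hp (((f.app y).f p).hom m) a
    have e2 : ((g.app x).f q').hom (ir x p' q' h' (M.act hp m a)) =
        L.act (show q + b = q' by omega) (((g.app y).f q).hom (ir y p q h m)) a := by
      refine Eq.trans (congrArg _ ?_) (g.map_act (show q + b = q' by omega) (ir y p q h m) a)
      refine Prod.ext (LinearMap.congr_fun (map_zero (N.act _)) a).symm (Sh.ext h' ?_)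
      refine (ir_snd x p' q' h' _).trans ((shAct_apply M _ h h' _ a).trans ?_).symm
      rw [ir_snd]
    refine (congrArg₂ (· - ·) e2 ((congrArg _ (f.map_act hp m a)).trans e)).trans
      (LinearMap.congr_fun (map_sub (L.act _) _ _) a).symm) (fun x p q r h hr m => by
    have e1 := NullHomotopic.eq hs' h hr (((f.app x).f p).hom m)
    have e2 : ((coneC (f.app x)).d q p).hom (ir x p q h m) =
        (((f.app x).f p).hom m, (ir x r p hr (-((M.obj x).d p r).hom m)).2) := by
      refine (coneC_d (f.app x) h _).trans (Prod.ext ?_ (Sh.ext hr ?_))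
      · refine (congrArg₂ (· + ·) (map_zero _) (congrArg _ (ir_snd x p q h m))).trans (zero_add _)
      · exact (congrArg (fun z => -((M.obj x).d p r).hom z) (ir_snd x p q h m)).trans
          (ir_snd x r p hr _).symm
    have e3 := congrArg ((L.obj x).d q p).hom (hF2 x p q h m)
    rw [d_f] at e3
    have e4 := (congrArg ((g.app x).f p).hom e2).symm.trans e3
    rw [hF x r p hr, ir_snd, e1, d_f, map_add, map_neg, map_neg, map_neg] at e4
    have e5 : ∀ {V : Type u} [AddCommGroup V] (a b c d : V), a + b + (-c + -b) = d + a → d = -c := by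
      intro V _ a b c d h
      have := congrArg (· - a) h
      simp only [add_sub_cancel_right] at this
      rw [← this]; abel
    exact e5 _ _ _ _ e4)
  refine ⟨fun x p q h => s x p q h ∘ₗ LinearMap.fst k _ _ -
      t x (p + 1) q (by omega) ∘ₗ LinearMap.proj (φ := fun s : {q : ℤ // p + 1 = q} =>
            (M.obj x).X s.1) ⟨p + 1, rfl⟩ ∘ₗ LinearMap.snd k _ _,
    fun x y p q b p' q' h h' hp m a => ?_, fun x n m => ?_⟩
  · have e := ht x y (p + 1) q b (p' + 1) q' (by omega) (by omega) (by omega) (m.2 ⟨p + 1, rfl⟩) a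
    change s x p' q' _ (N.act hp m.1 a) - t x (p' + 1) q' _ (M.act _ (m.2 ⟨p + 1, rfl⟩) a) =
      L.act _ (s y p q _ m.1 - t y (p + 1) q _ (m.2 ⟨p + 1, rfl⟩)) a
    rw [e, hs x y p q b p' q' (by omega) (by omega), map_sub, LinearMap.sub_apply]
  · rw [hF x (n + 1) n rfl m, NullHomotopic.eq hs' (sub_add_cancel n 1) rfl m.1,
      htd x (n + 1) n (n - 1) (n + 1 + 1) rfl (by omega) rfl]
    refine Eq.trans ?_ (congrArg (fun z : (N.obj x).X (n + 1) × Sh (M.obj x) (n + 1) =>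
      ((L.obj x).d (n - 1) n).hom (s x n (n - 1) (by omega) m.1 - t x (n + 1) (n - 1) (by omega)
        (m.2 ⟨n + 1, rfl⟩)) + (s x (n + 1) n rfl z.1 - t x (n + 1 + 1) n (by omega)
          (z.2 ⟨n + 1 + 1, rfl⟩))) (coneC_d (f.app x) rfl m)).symm
    simp only [map_sub, map_add, map_neg]
    abel

/-! ### Representable dg modules -/

lemma comp_cst_id {x y : A.Obj} {i p q : ℤ} (h0 : 0 = i) (h : i + p = q) (a : (A.Hom x y).X p) :
    A.comp h (cst (A.Hom y y) h0 (A.id y)) a = cst (A.Hom x y) (by omega) a := by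
  subst h0
  obtain rfl : p = q := by omega
  rw [cst_rfl, cst_rfl, A.id_comp]

/-- The representable dg module `A(-, y)`. -/
abbrev rep (y : A.Obj) : DGModule A where
  obj x := A.Hom x y
  act h := A.comp h
  act_id m := A.comp_id m
  act_comp hs ht h h' m f g := A.assoc hs ht h h' m f g
  d_act h m f := A.d_comp h m f

/-- The representable dg module `A(-, y)` with its generator placed in degree `n`. -/
abbrev free (y : A.Obj) (n : ℤ) : DGModule A := (rep y).shift (-n)

/-- The generator of `free y n`. -/
def gen (y : A.Obj) (n : ℤ) : ((free y n).obj y).X n :=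
  cst (A.Hom y y) (show 0 = n + -n by omega) (A.id y)

lemma gen_mem_Zc (y : A.Obj) (n : ℤ) : gen y n ∈ Zc ((free y n).obj y) n := by
  have e : ((A.Hom y y).d (n + -n) (n + 1 + -n)).hom (cst (A.Hom y y) (by omega) (A.id y)) = 0 := by
    rw [d_cst, d_eq_zero (mem_Zc_of (zero_add 1) (A.d_id y))]
  exact mem_Zc.2 ((shift_d (A.Hom y y) (-n) n (n + 1) _).trans ((congrArg _ e).trans
    (smul_zero (A := (A.Hom y y).X (n + 1 + -n)) _)))

lemma gen_act {x y : A.Obj} {n q : ℤ} (a : ((free y n).obj x).X q) :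
    (free y n).act (show n + (q + -n) = q by omega) (gen y n) (show (A.Hom x y).X (q + -n) from a)
      = a := (comp_cst_id _ _ _).trans (cst_rfl _ _ _)

lemma free_d_act {N : DGModule A} {x y : A.Obj} {n p p' q q' i : ℤ} (hp : p + 1 = p')
    (h : n + p = q) (hq : q + 1 = q') (hi : n + 1 = i) (c : (N.obj y).X n) (a : (A.Hom x y).X p) :
    ((N.obj x).d q q').hom (N.act h c a) =
      N.act (show i + p = q' by omega) (((N.obj y).d n i).hom c) a +
        N.act (show n + p' = q' by omega) c ((-1 : k) ^ (-n) • ((A.Hom x y).d p p').hom a) := by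
  subst hp hi
  rw [N.d_act' h rfl hq, map_smul, sgn_congr (k := k) (a := -n) (b := n) ⟨-n, by ring⟩]

/-- The morphism `free y n ⟶ N` which sends the generator to a given cycle. -/
def freeDesc {N : DGModule A} {y : A.Obj} {n : ℤ} (c : (N.obj y).X n) (hc : c ∈ Zc (N.obj y) n) :
    free y n ⟶ N where
  app x := mkHom (K := (free y n).obj x)
    (fun p => N.act (x := x) (show n + (p + -n) = p by omega) c) fun p a => by
      refine (free_d_act (p' := p + 1 + -n) (by omega) _ rfl rfl c a).trans ?_
      rw [d_eq_zero hc, map_zero]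
      refine (zero_add _).trans ?_
      exact congrArg _ (shift_d (A.Hom x y) (-n) p (p + 1) a).symm
  map_act {x x' p q r} h m f := (N.act_comp _ (by omega) _ _ c m f).symm

lemma freeDesc_gen {N : DGModule A} {y : A.Obj} {n : ℤ} (c : (N.obj y).X n)
    (hc : c ∈ Zc (N.obj y) n) : (((freeDesc c hc).app y).f n).hom (gen y n) = c := by
  have (i : ℤ) (hi : 0 = i) (h : n + i = n) : N.act h c (cst (A.Hom y y) hi (A.id y)) = c := by
    subst hi; rw [cst_rfl, N.act_id]
  exact this _ _ _

/-- A morphism from a free dg module which sends the generator to a boundary `d b` is null-homotopic,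
the homotopy being `a ↦ ± b · a`. -/
lemma free_homotopy {N : DGModule A} {y : A.Obj} {n : ℤ} (g : free y n ⟶ N)
    (b : (N.obj y).X (n - 1))
    (hb : ((N.obj y).d (n - 1) n).hom b = ((g.app y).f n).hom (gen y n)) (x : A.Obj) (p : ℤ)
    (a : ((free y n).obj x).X p) : ((g.app x).f p).hom a =
      ((N.obj x).d (p - 1) p).hom (N.act (x := x) (show n - 1 + (p + -n) = p - 1 by omega) b a) +
        N.act (x := x) (show n - 1 + (p + 1 + -n) = p by omega) b
          ((((free y n).obj x).d p (p + 1)).hom a) := by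
  have e1 := g.map_act (show n + (p + -n) = p by omega) (gen y n)
    (show (A.Hom x y).X (p + -n) from a)
  rw [gen_act, ← hb] at e1
  have e2 := free_d_act (p' := p + 1 + -n) (n := n - 1) (by omega)
    (show n - 1 + (p + -n) = p - 1 by omega) (sub_add_cancel p 1) (sub_add_cancel n 1) b
    (show (A.Hom x y).X (p + -n) from a)
  have e3 := congrArg (N.act (x := x) (show n - 1 + (p + 1 + -n) = p by omega) b)
    (shift_d (A.Hom x y) (-n) p (p + 1) a)
  refine e1.trans (Eq.trans ?_ (congrArg₂ (· + ·) e2.symm e3.symm))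
  rw [map_smul, map_smul, sgn_congr (k := k) (a := -(n - 1)) (b := -n + 1) ⟨0, by ring⟩, sgn_succ,
    neg_smul]
  exact (neg_add_cancel_right _ _).symm

lemma isHProjective_free (y : A.Obj) (n : ℤ) : (free (A := A) y n).IsHProjective := by
  intro N hN g
  obtain ⟨b, hb⟩ := acyclic_iff.1 (hN y) n (map_mem_Zc (g.app y) (gen_mem_Zc y n))
  exact ⟨fun x p q h => N.act (x := x) (show n - 1 + (p + -n) = q by omega) b,
    fun x x' p q c p' q' h h' hp m f => (N.act_comp _ (by omega) _ _ b m f).symm,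
    free_homotopy g b hb⟩

end DGModule

end DG

namespace DG

variable {k : Type u} [Field k]

namespace DGModule

variable {A : DGCat k}

/-! ### Homotopically projective resolutions -/

/-- A homotopically projective dg module over `M`. -/
structure Approx (M : DGModule A) where
  Q : DGModule A
  isHProjective : Q.IsHProjective
  π : Q ⟶ M

/-- The map of degree `-1` from a free dg module which sends the generator to `b`. -/
def freeHtpy {M : DGModule A} {y : A.Obj} {n : ℤ} (b : (M.obj y).X (n - 1)) (x : A.Obj) (p q : ℤ)
    (h : q + 1 = p) : ((free y n).obj x).X p →ₗ[k] (M.obj x).X q :=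
  M.act (x := x) (show n - 1 + (p + -n) = q by omega) b

lemma freeHtpy_act {M : DGModule A} {y : A.Obj} {n : ℤ} (b : (M.obj y).X (n - 1))
    (x x' : A.Obj) (p q c p' q' : ℤ) (h : q + 1 = p) (h' : q' + 1 = p') (hp : p + c = p')
    (m : ((free y n).obj x').X p) (f : (A.Hom x x').X c) :
    freeHtpy b x p' q' h' ((free y n).act hp m f) =
      M.act (show q + c = q' by omega) (freeHtpy b x' p q h m) f :=
  (M.act_comp _ (by omega) _ _ b m f).symm

lemma freeHtpy_gen {M : DGModule A} {y : A.Obj} {n : ℤ} (b : (M.obj y).X (n - 1)) :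
    freeHtpy b y n (n - 1) (sub_add_cancel _ _) (gen y n) = b := by
  have (i d : ℤ) (hi : 0 = i) (h : d + i = d) (c : (M.obj y).X d) :
      M.act h c (cst (A.Hom y y) hi (A.id y)) = c := by
    subst hi; rw [cst_rfl, M.act_id]
  exact this _ _ _ _ _

lemma freeDesc_comp_homotopy {N M : DGModule A} {y : A.Obj} {n : ℤ} (c : (N.obj y).X n)
    (hc : c ∈ Zc (N.obj y) n) (π : N ⟶ M) (b : (M.obj y).X (n - 1))
    (hb : ((M.obj y).d (n - 1) n).hom b = ((π.app y).f n).hom c) (g : free y n ⟶ M)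
    (hg : g = freeDesc c hc ≫ π) (x : A.Obj) (p : ℤ)
    (a : ((free y n).obj x).X p) : ((g.app x).f p).hom a =
      ((M.obj x).d (p - 1) p).hom (freeHtpy b x p (p - 1) (sub_add_cancel _ _) a) +
        freeHtpy b x (p + 1) p rfl ((((free y n).obj x).d p (p + 1)).hom a) := by
  subst hg
  refine free_homotopy (freeDesc c hc ≫ π) b ?_ x p a
  rw [hb]
  exact (congrArg ((π.app y).f n).hom (freeDesc_gen c hc)).symm

/-- The morphism `⨁ free ⟶ N ⟶ M` which sends the generators to the boundaries `π (c j) = d (b j)`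
has a null-homotopy which sends the generators to the elements `b j`. -/
lemma exists_cells_homotopy {N M : DGModule A} (π : N ⟶ M) {J : Type u} (y : J → A.Obj)
    (n : J → ℤ) (c : ∀ j, (N.obj (y j)).X (n j)) (hc : ∀ j, c j ∈ Zc (N.obj (y j)) (n j))
    (b : ∀ j, (M.obj (y j)).X (n j - 1))
    (hb : ∀ j, ((M.obj (y j)).d (n j - 1) (n j)).hom (b j) = ((π.app (y j)).f (n j)).hom (c j))
    (α : sum (fun j => free (y j) (n j)) ⟶ N) (hα : ∀ j, inj _ j ≫ α = freeDesc (c j) (hc j)) :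
    ∃ S : ∀ (x : A.Obj) (p q : ℤ), q + 1 = p →
        (((sum fun j => free (y j) (n j)).obj x).X p →ₗ[k] (M.obj x).X q),
      (∀ (x x' : A.Obj) (p q b p' q' : ℤ) (h : q + 1 = p) (h' : q' + 1 = p') (hp : p + b = p')
        (m : ((sum fun j => free (y j) (n j)).obj x').X p) (f : (A.Hom x x').X b),
        S x p' q' h' ((sum fun j => free (y j) (n j)).act hp m f) =
          M.act (show q + b = q' by omega) (S x' p q h m) f) ∧
      (∀ (x : A.Obj) (p : ℤ) (m : ((sum fun j => free (y j) (n j)).obj x).X p),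
        (((α ≫ π).app x).f p).hom m =
          ((M.obj x).d (p - 1) p).hom (S x p (p - 1) (by omega) m) +
            S x (p + 1) p rfl ((((sum fun j => free (y j) (n j)).obj x).d p (p + 1)).hom m)) ∧
      ∀ j, S (y j) (n j) (n j - 1) (sub_add_cancel _ _)
        ((((inj (fun j => free (y j) (n j)) j).app (y j)).f (n j)).hom (gen (y j) (n j))) = b j := by
  obtain ⟨S, h₁, h₂, h₃⟩ := exists_homotopy_sum (fun j => free (y j) (n j)) (α ≫ π)
    (fun j => freeHtpy (b j)) (fun j => freeHtpy_act (b j)) (fun j =>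
      freeDesc_comp_homotopy (c j) (hc j) π (b j) (hb j) _ (by rw [← Category.assoc, hα]))
  exact ⟨S, h₁, h₂, fun j => (h₃ _ _ _ _ j _).trans (freeHtpy_gen _)⟩

/-- Attaching free cells to kill the homology classes which become zero in `M`, and to make the
homology of `M` surjected upon. -/
lemma Approx.exists_step {M : DGModule A} (T : Approx M) : ∃ (T' : Approx M) (ι : T.Q ⟶ T'.Q),
    ι ≫ T'.π = T.π ∧ (∀ x n (q : (T.Q.obj x).X n), ((ι.app x).f n).hom q = 0 → q = 0) ∧
    (∀ x n, ∀ q ∈ Zc (T.Q.obj x) n, ((T.π.app x).f n).hom q ∈ Bc (M.obj x) n →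
      ((ι.app x).f n).hom q ∈ Bc (T'.Q.obj x) n) ∧
    ∀ x n, ∀ m ∈ Zc (M.obj x) n, ∃ q ∈ Zc (T'.Q.obj x) n, ((T'.π.app x).f n).hom q = m := by
  -- A cell of degree `n` is a cycle `q` of degree `n` together with `m` such that `π q = d m`.
  let J : Type u := Σ (x : A.Obj) (n : ℤ), {z : (T.Q.obj x).X n × (M.obj x).X (n - 1) //
    z.1 ∈ Zc (T.Q.obj x) n ∧ ((M.obj x).d (n - 1) n).hom z.2 = ((T.π.app x).f n).hom z.1}
  let L (j : J) : DGModule A := free j.1 j.2.1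
  let α : sum L ⟶ T.Q := desc L fun j => freeDesc j.2.2.1.1 j.2.2.2.1
  have hα (j : J) : inj L j ≫ α = freeDesc j.2.2.1.1 j.2.2.2.1 := inj_desc _ _ _
  obtain ⟨S, hS, hS', hSe⟩ := exists_cells_homotopy T.π (fun j : J => j.1) (fun j => j.2.1)
    (fun j => j.2.2.1.1) (fun j => j.2.2.2.1) (fun j => j.2.2.1.2) (fun j => j.2.2.2.2) α hα
  let e (j : J) : ((sum L).obj j.1).X j.2.1 := (((inj L j).app j.1).f j.2.1).hom (gen j.1 j.2.1)
  have he (j : J) (i : ℤ) : (((sum L).obj j.1).d j.2.1 i).hom (e j) = 0 := by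
    rw [d_f, d_eq_zero (gen_mem_Zc _ _), map_zero]
  have hαe (j : J) : ((α.app j.1).f j.2.1).hom (e j) = j.2.2.1.1 := by
    have := congrArg (fun f => ((f.app j.1).f j.2.1).hom (gen j.1 j.2.1)) (hα j)
    exact this.trans (freeDesc_gen _ _)
  refine ⟨⟨cone α, isHProjective_cone α (isHProjective_sum L fun j => isHProjective_free _ _)
    T.isHProjective, coneDesc α T.π S hS hS'⟩, coneInl α, coneInl_coneDesc α T.π S hS hS',
    fun x n q h => congrArg Prod.fst h, fun x n q hq hb => ?_, fun x n m hm => ?_⟩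
  · obtain ⟨m, hm⟩ := hb
    let j : J := ⟨x, n, (q, m), hq, hm⟩
    refine ⟨((0, fun s => cst ((sum L).obj x) (show n = s.1 by have := s.2; omega) (e j)) :
      (T.Q.obj x).X (n - 1) × Sh ((sum L).obj x) (n - 1)), ?_⟩
    have e1 : cst ((sum L).obj x) (rfl : n = n) (e j) = e j := cst_rfl _ _ _
    refine (coneC_d (α.app x) (sub_add_cancel n 1) _).trans
      (Prod.ext ?_ (Sh.ext rfl ?_))
    · refine (congrArg₂ (· + ·) (map_zero _) (congrArg _ e1)).trans ((zero_add _).trans (hαe j))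
    · refine (congrArg (fun z => -((((sum L).obj x).d n (n + 1)).hom z)) e1).trans ?_
      exact (congrArg Neg.neg (he j _)).trans neg_zero
  · have hi : n + 1 - 1 = n := by omega
    -- The cycle `m` is hit by the cell of degree `n + 1` with trivial attaching cycle.
    let j : J := ⟨x, n + 1, (0, cst (M.obj x) hi.symm m), zero_mem _, by
      rw [d_cst, mem_Zc.1 hm, map_zero]⟩
    let z : (T.Q.obj x).X n × Sh ((sum L).obj x) n :=
      (0, fun s => cst ((sum L).obj x) s.2 (e j))
    have hz : z.2 ⟨n + 1, rfl⟩ = e j := cst_rfl ((sum L).obj x) (rfl : n + 1 = n + 1) _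
    refine ⟨z, ?_, ?_⟩
    · refine mem_Zc.2 ((coneC_d (α.app x) rfl _).trans (Prod.ext ?_ (Sh.ext rfl ?_)))
      · refine (congrArg₂ (· + ·) (map_zero _) (congrArg _ hz)).trans ((zero_add _).trans (hαe j))
      · refine (congrArg (fun z => -((((sum L).obj x).d (n + 1) (n + 1 + 1)).hom z)) hz).trans ?_
        exact (congrArg Neg.neg (he j _)).trans neg_zero
    · refine (coneDesc_apply α T.π S hS hS' rfl z).trans ?_
      have e2 : S x (n + 1) n rfl (e j) = m := by
        have := hSe j
        have h3 (i : ℤ) (hi : i = n) (h : i + 1 = n + 1)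
          (h' : S x (n + 1) i h (e j) = cst (M.obj x) hi.symm m) :
            S x (n + 1) n rfl (e j) = m := by
          subst hi; rw [h', cst_rfl]
        exact h3 _ hi _ this
      refine (congrArg₂ (· + ·) (map_zero _) (congrArg _ hz)).trans ((zero_add _).trans e2)

section Telescope

variable (Q : ℕ → DGModule A) (ι : ∀ i, Q i ⟶ Q (i + 1))

/-- The family indexed by a type in the universe `u`. -/
abbrev ulf (i : ULift.{u} ℕ) : DGModule A := Q i.down

/-- The shift map of a telescope. -/
def telσ : sum (ulf Q) ⟶ sum (ulf Q) :=
  desc (ulf Q) fun i => ι i.down ≫ inj (ulf Q) ⟨i.down + 1⟩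

/-- The mapping cone of `telD` is the mapping telescope. -/
def telD : sum (ulf Q) ⟶ sum (ulf Q) := 𝟙 _ - telσ Q ι

variable {Q} {x : A.Obj} {n : ℤ}

lemma telσ_inj (i : ℕ) (q : ((Q i).obj x).X n) :
    (((telσ Q ι).app x).f n).hom ((((inj (ulf Q) ⟨i⟩).app x).f n).hom q) =
      (((inj (ulf Q) ⟨i + 1⟩).app x).f n).hom ((((ι i).app x).f n).hom q) :=
  congrArg (fun f => ((f.app x).f n).hom q) (inj_desc (ulf Q)
    (fun i => ι i.down ≫ inj (ulf Q) ⟨i.down + 1⟩) ⟨i⟩)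

lemma telσ_zero (a : Π₀ i, ((ulf Q i).obj x).X n) :
    (show Π₀ i, ((ulf Q i).obj x).X n from (((telσ Q ι).app x).f n).hom a) ⟨0⟩ = 0 := by
  have : telσ Q ι ≫ prj (ulf Q) ⟨0⟩ = 0 := by
    refine sum_hom_ext _ fun j => ?_
    rw [telσ, ← Category.assoc, inj_desc, Category.assoc, inj_prj_ne, comp_zero, comp_zero]
    intro h
    exact absurd (congrArg ULift.down h) (by simp)
  exact congrArg (fun f => ((f.app x).f n).hom a) this

lemma telσ_succ (a : Π₀ i, ((ulf Q i).obj x).X n) (i : ℕ) :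
    (show Π₀ i, ((ulf Q i).obj x).X n from (((telσ Q ι).app x).f n).hom a) ⟨i + 1⟩ =
      (((ι i).app x).f n).hom (a ⟨i⟩) := by
  have : telσ Q ι ≫ prj (ulf Q) ⟨i + 1⟩ = prj (ulf Q) ⟨i⟩ ≫ ι i := by
    refine sum_hom_ext _ fun j => ?_
    obtain ⟨j⟩ := j
    rw [telσ, ← Category.assoc, inj_desc, Category.assoc, ← Category.assoc (inj _ _)]
    by_cases h : j = i
    · subst h
      rw [inj_prj, inj_prj, Category.id_comp]
      exact Category.comp_id _
    · rw [inj_prj_ne, inj_prj_ne, comp_zero, zero_comp]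
      · exact fun h' => h (congrArg ULift.down h')
      · exact fun h' => h (Nat.succ_injective (congrArg ULift.down h'))
  exact congrArg (fun f => ((f.app x).f n).hom a) this

/-- Modulo the image of `telD`, every element is concentrated in one summand. -/
lemma exists_eq_inj_add_telD (y : Π₀ i, ((ulf Q i).obj x).X n) : ∃ N₀ : ℕ, ∀ N, N₀ ≤ N →
    ∃ (q : ((Q N).obj x).X n) (b : ((sum (ulf Q)).obj x).X n),
      (show ((sum (ulf Q)).obj x).X n from y) = (((inj (ulf Q) ⟨N⟩).app x).f n).hom q +
        (((telD Q ι).app x).f n).hom b := by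
  classical
  induction y using DFinsupp.induction with
  | h0 => exact ⟨0, fun N _ => ⟨0, 0, by rw [map_zero, map_zero, add_zero]⟩⟩
  | ha i c f hi hc hf =>
    obtain ⟨N₁, h₁⟩ := hf
    refine ⟨max N₁ i.down, fun N hN => ?_⟩
    obtain ⟨q, b, hqb⟩ := h₁ N (le_of_max_le_left hN)
    have : ∀ N, i.down ≤ N → ∃ (q : ((Q N).obj x).X n) (b : ((sum (ulf Q)).obj x).X n),
        (((inj (ulf Q) i).app x).f n).hom c = (((inj (ulf Q) ⟨N⟩).app x).f n).hom q +
          (((telD Q ι).app x).f n).hom b := by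
      refine Nat.le_induction ⟨c, 0, by rw [map_zero, add_zero]⟩ fun N hN h => ?_
      obtain ⟨q, b, hqb⟩ := h
      refine ⟨(((ι N).app x).f n).hom q, (((inj (ulf Q) ⟨N⟩).app x).f n).hom q + b, ?_⟩
      rw [hqb, map_add, ← telσ_inj, ← add_assoc]
      congr 1
      change _ = _ + ((((inj (ulf Q) ⟨N⟩).app x).f n).hom q - (((telσ Q ι).app x).f n).hom _)
      abel
    obtain ⟨q', b', hqb'⟩ := this N (le_of_max_le_right hN)
    refine ⟨q' + q, b' + b, ?_⟩
    rw [map_add, map_add, add_add_add_comm, ← hqb', ← hqb]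
    refine congrArg (· + f) (Eq.trans ?_ (sumι_apply (fun j => (ulf Q j).obj x) i c).symm)
    classical
    exact congrArg₂ (fun (_ : DecidableEq (ULift ℕ)) z => DFinsupp.single (β := fun j => ((ulf Q j).obj x).X n) i z) (Subsingleton.elim _ _) rfl

/-- If all maps of the telescope are injective, the image of `telD` meets every summand trivially, and
`telD` is injective. -/
lemma eq_zero_of_telD (hι : ∀ i (q : ((Q i).obj x).X n), (((ι i).app x).f n).hom q = 0 → q = 0)
    (a : Π₀ i, ((ulf Q i).obj x).X n) {N : ℕ} (c : ((Q N).obj x).X n)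
    (h : (((telD Q ι).app x).f n).hom a = (((inj (ulf Q) ⟨N⟩).app x).f n).hom c) : a = 0 := by
  classical
  let S : Π₀ i, ((ulf Q i).obj x).X n := (((telσ Q ι).app x).f n).hom a
  have h0 (i : ULift ℕ) (hi : i ≠ ⟨N⟩) : a i = S i := by
    have e := congrArg (fun z : Π₀ i, ((ulf Q i).obj x).X n => z i) h
    exact eq_of_sub_eq_zero (e.trans (sumι_of_ne (fun j => (ulf Q j).obj x) (Ne.symm hi) c))
  have h1 (i : ℕ) (hi : i + 1 ≠ N) : a ⟨i + 1⟩ = (((ι i).app x).f n).hom (a ⟨i⟩) :=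
    (h0 ⟨i + 1⟩ fun h => hi (congrArg ULift.down h)).trans (telσ_succ ι a i)
  have h2 : ∃ K : ℕ, ∀ i, K ≤ i → a ⟨i⟩ = 0 := by
    obtain ⟨K, hK⟩ := (a.support.image ULift.down).bddAbove
    refine ⟨K + 1, fun i hi => ?_⟩
    by_contra h
    have := hK (Finset.mem_coe.2 (Finset.mem_image_of_mem ULift.down (DFinsupp.mem_support_iff.2 h)))
    change i ≤ K at this
    omega
  obtain ⟨K, hK⟩ := h2
  have h3 : ∀ j i, N ≤ i → K ≤ i + j → a ⟨i⟩ = 0 := by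
    intro j
    induction j with
    | zero => exact fun i _ h => hK i h
    | succ j ih =>
      intro i hi h
      refine hι i _ ?_
      rw [← h1 i (by omega)]
      exact ih _ (by omega) (by omega)
  have h4 : ∀ i, i < N → a ⟨i⟩ = 0 := by
    intro i
    induction i with
    | zero => exact fun h => (h0 _ fun h' => h.ne (congrArg ULift.down h')).trans (telσ_zero ι a)
    | succ i ih => exact fun h => by rw [h1 i h.ne, ih (by omega), map_zero]
  ext ⟨i⟩
  rcases lt_or_ge i N with h | h
  · exact h4 i h
  · exact h3 K i h (by omega)

end Telescope

/-- Every dg module has a homotopically projective resolution: the mapping telescope of the modules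
obtained from `0` by attaching cells again and again. A homology class of some stage which vanishes
in `M` is killed at the next stage, and the first stage already hits all homology classes of `M`. -/
lemma nonempty_resolution (M : DGModule A) : Nonempty M.Resolution := by
  choose st ι hπ hinj hB hZ using Approx.exists_step (M := M)
  let T (i : ℕ) : Approx M := Nat.rec ⟨zero A, isHProjective_zero, 0⟩ (fun _ => st) i
  let Q (i : ℕ) : DGModule A := (T i).Q
  let j (i : ℕ) : Q i ⟶ Q (i + 1) := ι (T i)
  let p : sum (ulf Q) ⟶ M := desc (ulf Q) fun i => (T i.down).π
  have hp (i : ℕ) : inj (ulf Q) ⟨i⟩ ≫ p = (T i).π := inj_desc _ _ _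
  have hDp : telD Q j ≫ p = 0 := by
    refine sum_hom_ext _ fun i => ?_
    obtain ⟨i⟩ := i
    have : inj (ulf Q) ⟨i⟩ ≫ telσ Q j = j i ≫ inj (ulf Q) ⟨i + 1⟩ := inj_desc _ _ _
    rw [telD, Preadditive.sub_comp, Category.id_comp, Preadditive.comp_sub, ← Category.assoc, this,
      Category.assoc, hp, hp, comp_zero, sub_eq_zero]
    exact (hπ (T i)).symm
  let π : cone (telD Q j) ⟶ M := coneDesc _ p (fun _ _ _ _ => 0)
    (fun x y p q b p' q' h h' hp m f => by simp) (fun x n m => by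
      simp only [LinearMap.zero_apply, map_zero, add_zero]
      rw [hDp]; rfl)
  have hπ' (x n) (z : ((sum (ulf Q)).obj x).X n × Sh ((sum (ulf Q)).obj x) n) :
      ((π.app x).f n).hom z = ((p.app x).f n).hom z.1 :=
    (coneDesc_apply _ _ _ _ _ rfl z).trans (add_zero _)
  refine ⟨⟨cone (telD Q j), isHProjective_cone _ (isHProjective_sum _ fun i => (T i.down).isHProjective)
    (isHProjective_sum _ fun i => (T i.down).isHProjective), π, fun x => (DG.quasiIso_iff _).2
      fun n => ⟨?_, fun m hm => ?_⟩⟩⟩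
  · rintro ⟨y, a⟩ hz hb
    have hb : ((p.app x).f n).hom y ∈ Bc (M.obj x) n := by
      have := hπ' x n (y, a)
      rwa [this] at hb
    have hz' := (coneC_d ((telD Q j).app x) rfl (y, a)).symm.trans hz
    obtain ⟨N, hN⟩ := exists_eq_inj_add_telD j y
    obtain ⟨q, b, hqb⟩ := hN N le_rfl
    change y = _ at hqb
    -- Modulo a boundary, the cycle is the image of `q`.
    let a' : ((sum (ulf Q)).obj x).X (n + 1) :=
      a ⟨n + 1, rfl⟩ + (((sum (ulf Q)).obj x).d n (n + 1)).hom b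
    have h1 : (((telD Q j).app x).f (n + 1)).hom a' =
        (((inj (ulf Q) ⟨N⟩).app x).f (n + 1)).hom (-((((Q N).obj x).d n (n + 1)).hom q)) := by
      have := congrArg Prod.fst hz'
      change (((sum (ulf Q)).obj x).d n (n + 1)).hom y + (((telD Q j).app x).f (n + 1)).hom
        (a ⟨n + 1, rfl⟩) = 0 at this
      rw [hqb, map_add, d_f, d_f] at this
      rw [map_add, map_neg, eq_neg_iff_add_eq_zero, ← this]
      abel
    have h2 : a' = 0 := eq_zero_of_telD j (fun i => hinj (T i) x (n + 1)) a' _ h1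
    have h3 : (((Q N).obj x).d n (n + 1)).hom q = 0 := by
      rw [h2, map_zero] at h1
      have := congrArg (fun z => (((prj (ulf Q) ⟨N⟩).app x).f (n + 1)).hom z) h1.symm
      simp only [map_zero] at this
      exact neg_eq_zero.1 ((sumι_same (fun j => (ulf Q j).obj x) ⟨N⟩ _).symm.trans this)
    have h4 : (((T N).π.app x).f n).hom q ∈ Bc (M.obj x) n := by
      rw [hqb, map_add] at hb
      have e1 : ((p.app x).f n).hom ((((telD Q j).app x).f n).hom b) = 0 :=
        congrArg (fun f => ((f.app x).f n).hom b) hDp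
      have e2 : ((p.app x).f n).hom ((((inj (ulf Q) ⟨N⟩).app x).f n).hom q) =
        (((T N).π.app x).f n).hom q := congrArg (fun f => ((f.app x).f n).hom q) (hp N)
      rwa [e1, e2, add_zero] at hb
    obtain ⟨c, hc⟩ := hB (T N) x n q h3 h4
    let i1 := ((inj (ulf Q) ⟨N⟩).app x).f n
    let w : ((sum (ulf Q)).obj x).X n := i1.hom q + b
    refine ⟨(((((inj (ulf Q) ⟨N + 1⟩).app x).f (n - 1)).hom c,
      fun s => cst ((sum (ulf Q)).obj x) (by have := s.2; omega) w) :
      ((sum (ulf Q)).obj x).X (n - 1) × Sh ((sum (ulf Q)).obj x) (n - 1)), ?_⟩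
    have e0 : cst ((sum (ulf Q)).obj x) (rfl : n = n) w = w := cst_rfl _ _ _
    refine (coneC_d ((telD Q j).app x) (sub_add_cancel n 1) _).trans (Prod.ext ?_ (Sh.ext rfl ?_))
    · refine (congrArg₂ (· + ·) (x' := (((inj (ulf Q) ⟨N + 1⟩).app x).f n).hom
        ((((j N).app x).f n).hom q)) ?_ (congrArg _ e0)).trans (Eq.trans ?_ hqb.symm)
      · exact (d_f ((inj (ulf Q) ⟨N + 1⟩).app x) c).trans (congrArg _ hc)
      · rw [map_add, ← add_assoc]
        congr 1
        rw [← telσ_inj]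
        change _ + (i1.hom q - (((telσ Q j).app x).f n).hom (i1.hom q)) = _
        exact add_sub_cancel _ _
    · refine (congrArg (fun z => -((((sum (ulf Q)).obj x).d n (n + 1)).hom z)) e0).trans ?_
      have : (((sum (ulf Q)).obj x).d n (n + 1)).hom (i1.hom q) = 0 := by
        rw [d_f]
        erw [h3]
        rw [map_zero]
      rw [map_add, this, zero_add]
      exact neg_eq_of_add_eq_zero_left h2
  · obtain ⟨q, hq, hqm⟩ := hZ (T 0) x n m hm
    refine ⟨(((coneInl (telD Q j)).app x).f n).hom ((((inj (ulf Q) ⟨1⟩).app x).f n).hom q),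
      map_mem_Zc _ (map_mem_Zc _ hq), ?_⟩
    have e1 : ((π.app x).f n).hom ((((coneInl (telD Q j)).app x).f n).hom
        ((((inj (ulf Q) ⟨1⟩).app x).f n).hom q)) = m := by
      refine (hπ' x n _).trans (Eq.trans ?_ hqm)
      exact congrArg (fun f => ((f.app x).f n).hom q) (hp 1)
    rw [e1, sub_self]
    exact zero_mem _

end DGModule

end DG

namespace DG

/-! ### Compact objects -/

section Compact

variable {T : Type u'} [Category.{v'} T]

variable [Preadditive T]

/-- The universal property of a coproduct need only be checked on the image of an essentially
surjective functor, with uniqueness in the form of a vanishing statement. -/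
lemma nonempty_isColimit_cofan {C : Type u} [Category.{v} C] (L : C ⥤ T) [L.EssSurj]
    {J : Type w} {S : T} {X : J → T} (ι : ∀ j, X j ⟶ S)
    (hex : ∀ (Z : C) (φ : ∀ j, X j ⟶ L.obj Z), ∃ ψ : S ⟶ L.obj Z, ∀ j, ι j ≫ ψ = φ j)
    (huniq : ∀ (Z : C) (ψ : S ⟶ L.obj Z), (∀ j, ι j ≫ ψ = 0) → ψ = 0) :
    Nonempty (IsColimit (Cofan.mk S ι)) := by
  choose ψ hψ using hex
  have e (Z : T) := L.objObjPreimageIso Z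
  have h (Z : T) (φ : ∀ j, X j ⟶ Z) (j : J) :
      ι j ≫ ψ _ (fun j => φ j ≫ (L.objObjPreimageIso Z).inv) ≫ (L.objObjPreimageIso Z).hom =
        φ j := by
    rw [← Category.assoc, hψ, Category.assoc, Iso.inv_hom_id, Category.comp_id]
  refine ⟨Cofan.IsColimit.mk _ (fun s => ψ _ (fun j => s.inj j ≫ (L.objObjPreimageIso s.pt).inv) ≫
    (L.objObjPreimageIso s.pt).hom) (fun s j => h _ _ j) fun s m hm => ?_⟩
  rw [← sub_eq_zero, ← cancel_mono (L.objObjPreimageIso s.pt).inv, zero_comp]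
  refine huniq _ _ fun j => ?_
  rw [← Category.assoc, Preadditive.comp_sub, h]
  exact (congrArg (· ≫ _) (sub_eq_zero.2 (hm j))).trans zero_comp

/-- A morphism from a compact object to a coproduct factors through a finite subcoproduct. -/
lemma IsCompactObject.exists_finset {X : T} (hX : IsCompactObject.{w} X) {J : Type w} {V : J → T}
    {S : T} (ι : ∀ j, V j ⟶ S) (π : ∀ j, S ⟶ V j) (h₁ : ∀ j, ι j ≫ π j = 𝟙 _)
    (h₂ : ∀ i j, i ≠ j → ι i ≫ π j = 0) (hc : IsColimit (Cofan.mk S ι)) (φ : X ⟶ S) :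
    ∃ F : Finset J, φ = ∑ j ∈ F, φ ≫ π j ≫ ι j := by
  classical
  have := hX J
  let G := preadditiveCoyoneda.obj (Opposite.op X)
  have hG := isColimitOfPreserves G hc
  let K : AddSubgroup (X ⟶ S) := AddSubgroup.closure {φ | ∃ j, ∃ a : X ⟶ V j, φ = a ≫ ι j}
  let q : G.obj S ⟶ AddCommGrpCat.of ((X ⟶ S) ⧸ K) :=
    AddCommGrpCat.ofHom (QuotientAddGroup.mk' K)
  have hq : q = 0 := hG.hom_ext fun j => by
    ext a
    exact (QuotientAddGroup.eq_zero_iff _).2 (AddSubgroup.subset_closure ⟨j.as, a, rfl⟩)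
  have hφ : φ ∈ K := (QuotientAddGroup.eq_zero_iff _).1 (congrArg (fun f => f.hom φ) hq)
  suffices h : ∃ F : Finset J, ∀ F', F ⊆ F' → φ = ∑ j ∈ F', φ ≫ π j ≫ ι j by
    obtain ⟨F, hF⟩ := h
    exact ⟨F, hF F le_rfl⟩
  induction hφ using AddSubgroup.closure_induction with
  | mem x hx =>
    obtain ⟨i, a, rfl⟩ := hx
    refine ⟨{i}, fun F' hF' => ?_⟩
    rw [Finset.sum_eq_single_of_mem i (hF' (Finset.mem_singleton_self i))]
    · rw [Category.assoc, ← Category.assoc (ι i), h₁, Category.id_comp]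
    · intro j _ hj
      rw [Category.assoc, ← Category.assoc (ι i), h₂ i j hj.symm, zero_comp, comp_zero]
  | zero => exact ⟨∅, fun F' _ => by simp⟩
  | add x y _ _ hx hy =>
    obtain ⟨F, hF⟩ := hx
    obtain ⟨F', hF'⟩ := hy
    refine ⟨F ∪ F', fun E hE => ?_⟩
    simp only [Preadditive.add_comp, Finset.sum_add_distrib]
    rw [← hF E (Finset.union_subset_left hE), ← hF' E (Finset.union_subset_right hE)]
  | neg x _ hx =>
    obtain ⟨F, hF⟩ := hx
    refine ⟨F, fun E hE => ?_⟩
    simp only [Preadditive.neg_comp, Finset.sum_neg_distrib]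
    rw [← hF E hE]

/-- If every morphism from `X` to a coproduct `S` factors through a finite subsum, then `Hom(X, -)`
preserves this coproduct: the map from `Hom(X, S)` to another cocone is the finite sum of the
components. -/
lemma preservesColimit_coyoneda {X : T} {J : Type w} {V : J → T} {S : T} (ι : ∀ j, V j ⟶ S)
    (π : ∀ j, S ⟶ V j) (h₁ : ∀ j, ι j ≫ π j = 𝟙 _) (h₂ : ∀ i j, i ≠ j → ι i ≫ π j = 0)
    (hc : IsColimit (Cofan.mk S ι))
    (h : ∀ φ : X ⟶ S, ∃ F : Finset J, φ = ∑ j ∈ F, φ ≫ π j ≫ ι j) :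
    PreservesColimit (Discrete.functor V) (preadditiveCoyoneda.obj (Opposite.op X)) := by
  classical
  have hπ (φ : X ⟶ S) : ∃ F : Finset J, φ = ∑ j ∈ F, φ ≫ π j ≫ ι j ∧ ∀ j ∉ F, φ ≫ π j = 0 := by
    obtain ⟨F, hF⟩ := h φ
    refine ⟨F, hF, fun j hj => ?_⟩
    rw [hF, Preadditive.sum_comp]
    refine Finset.sum_eq_zero fun i hi => ?_
    rw [Category.assoc, Category.assoc, h₂ i j (fun h => hj (h ▸ hi)), comp_zero, comp_zero]
  refine preservesColimit_of_preserves_colimit_cocone hc ?_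
  have hsum (s : Cocone (Discrete.functor V ⋙ preadditiveCoyoneda.obj (Opposite.op X)))
      (φ : X ⟶ S) :
      (Function.support (M := s.pt) fun j => (s.ι.app ⟨j⟩).hom (φ ≫ π j)).Finite := by
    obtain ⟨F, -, hF⟩ := hπ φ
    refine F.finite_toSet.subset fun j hj => ?_
    by_contra hj'
    refine hj ?_
    change (s.ι.app ⟨j⟩).hom (φ ≫ π j) = 0
    rw [hF j hj']
    exact map_zero _
  exact
    { desc := fun s => AddCommGrpCat.ofHom (AddMonoidHom.mk'
        (fun φ : X ⟶ S => ∑ᶠ j, ((s.ι.app ⟨j⟩).hom (φ ≫ π j) : s.pt)) fun φ ψ => by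
          rw [← finsum_add_distrib (hsum s φ) (hsum s ψ)]
          refine finsum_congr fun j => ?_
          exact (congrArg _ (Preadditive.add_comp _ _ _ (show X ⟶ S from φ) ψ (π j))).trans
            (map_add _ _ _))
      fac := fun s j => by
        ext a
        change ∑ᶠ i, ((s.ι.app ⟨i⟩).hom (((show X ⟶ V j.as from a) ≫ ι j.as) ≫ π i) : s.pt) =
          (s.ι.app j).hom a
        rw [finsum_eq_single _ j.as]
        · rw [Category.assoc, h₁, Category.comp_id]
        · intro i hi
          rw [Category.assoc, h₂ _ _ hi.symm, comp_zero]
          exact map_zero _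
      uniq := fun s m hm => by
        ext φ
        change X ⟶ S at φ
        obtain ⟨F, hF, hF'⟩ := hπ φ
        change m.hom φ = ∑ᶠ j, ((s.ι.app ⟨j⟩).hom (φ ≫ π j) : s.pt)
        rw [finsum_eq_sum_of_support_subset (s := F) _ fun j hj => by
          by_contra hj'
          refine hj ?_
          change (s.ι.app ⟨j⟩).hom (φ ≫ π j) = 0
          rw [hF' j hj']
          exact map_zero _]
        refine (congrArg m.hom hF).trans ((map_sum m.hom _ _).trans ?_)
        refine Finset.sum_congr rfl fun j _ => ?_
        rw [← hm ⟨j⟩, ← Category.assoc]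
        rfl }

/-- Compactness may be tested on the coproducts of objects in the image of an essentially surjective
functor. -/
lemma isCompactObject_of {C : Type u} [Category.{v} C] (L : C ⥤ T) [L.EssSurj] {X : T}
    (H : ∀ (J : Type w) (V : J → C), ∃ (S : T) (ι : ∀ j, L.obj (V j) ⟶ S)
      (π : ∀ j, S ⟶ L.obj (V j)), (∀ j, ι j ≫ π j = 𝟙 _) ∧ (∀ i j, i ≠ j → ι i ≫ π j = 0) ∧
        Nonempty (IsColimit (Cofan.mk S ι)) ∧
        ∀ φ : X ⟶ S, ∃ F : Finset J, φ = ∑ j ∈ F, φ ≫ π j ≫ ι j) :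
    IsCompactObject.{w} X := fun J => ⟨fun {K} => by
  obtain ⟨S, ι, π, h₁, h₂, ⟨hc⟩, h⟩ := H J fun j => L.objPreimage (K.obj ⟨j⟩)
  have := preservesColimit_coyoneda ι π h₁ h₂ hc h
  exact preservesColimit_of_iso_diagram _
    (Discrete.natIso (fun j => L.objObjPreimageIso (K.obj j)) :
      Discrete.functor (fun j => L.obj (L.objPreimage (K.obj ⟨j⟩))) ≅ K)⟩

lemma IsCompactObject.of_iso {X Y : T} (e : X ≅ Y) (hX : IsCompactObject.{w} X) :
    IsCompactObject.{w} Y := fun J => by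
  have := hX J
  exact preservesColimitsOfShape_of_natIso (preadditiveCoyoneda.mapIso e.symm.op)

end Compact

variable {k : Type u} [Field k]

/-! ### Coproducts in the derived category of a dg category -/

namespace DGModule

variable {A : DGCat k}

/-- Direct sums of dg modules are coproducts in the derived category. -/
lemma nonempty_isColimit_sum {J : Type u} (V : J → DGModule A) :
    Nonempty (IsColimit (Cofan.mk (D.Q.obj (sum V)) fun j => D.Q.map (inj V j))) := by
  have R (j : J) : (V j).Resolution := (nonempty_resolution (V j)).some
  have hS : (sum fun j => (R j).Q).IsHProjective := isHProjective_sum _ fun j => (R j).isHProjective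
  let r := sumMap fun j => (R j).π
  have hr (j : J) : inj _ j ≫ r = (R j).π ≫ inj V j := inj_desc _ _ _
  have h1 : IsIso (D.Q.map r) :=
    Localization.inverts _ (qis A) _ (qis_sumMap _ fun j => (R j).qis)
  have h2 (j : J) : IsIso (D.Q.map (R j).π) := Localization.inverts _ (qis A) _ (R j).qis
  have : (D.Q (A := A)).EssSurj := Localization.essSurj D.Q (qis A)
  refine nonempty_isColimit_cofan D.Q _ (fun Z φ => ?_) fun Z ψ h => ?_
  · have h3 (j : J) : ∃ f : (R j).Q ⟶ Z, D.Q.map f = D.Q.map (R j).π ≫ φ j :=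
      (R j).isHProjective.Q_map_surjective _
    choose f hf using h3
    refine ⟨inv (D.Q.map r) ≫ D.Q.map (desc _ f), fun j => ?_⟩
    rw [← cancel_epi (D.Q.map (R j).π), ← Category.assoc, ← D.Q.map_comp, ← hr, D.Q.map_comp,
      Category.assoc, IsIso.hom_inv_id_assoc, ← D.Q.map_comp, inj_desc, hf]
  · rw [← cancel_epi (D.Q.map r), comp_zero]
    obtain ⟨f, hf⟩ := hS.Q_map_surjective (D.Q.map r ≫ ψ)
    rw [← hf, hS.Q_map_eq_zero_iff]
    refine nullHomotopic_of_inj _ _ fun j => ?_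
    rw [← (R j).isHProjective.Q_map_eq_zero_iff, D.Q.map_comp, hf, ← Category.assoc,
      ← D.Q.map_comp, hr, D.Q.map_comp, Category.assoc, h j, comp_zero]

lemma Q_inj_prj {J : Type u} (V : J → DGModule A) (j : J) :
    D.Q.map (inj V j) ≫ D.Q.map (prj V j) = 𝟙 _ := by
  rw [← D.Q.map_comp, inj_prj, D.Q.map_id]

lemma Q_inj_prj_ne {J : Type u} (V : J → DGModule A) (i j : J) (h : i ≠ j) :
    D.Q.map (inj V i) ≫ D.Q.map (prj V j) = 0 := by
  rw [← D.Q.map_comp, inj_prj_ne V h, D.Q.map_zero]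

/-- A dg module is compact if and only if every morphism in the derived category to a direct sum factors
through a finite subsum. -/
lemma isCompact_iff {M : DGModule A} : M.IsCompact ↔ ∀ (J : Type u) (V : J → DGModule A)
    (φ : D.Q.obj M ⟶ D.Q.obj (sum V)), ∃ F : Finset J,
      φ = ∑ j ∈ F, φ ≫ D.Q.map (prj V j) ≫ D.Q.map (inj V j) := by
  constructor
  · intro hM J V φ
    exact IsCompactObject.exists_finset hM _ _ (Q_inj_prj V) (Q_inj_prj_ne V)
      (nonempty_isColimit_sum V).some φ
  · intro H
    have : (D.Q (A := A)).EssSurj := Localization.essSurj D.Q (qis A)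
    exact isCompactObject_of D.Q fun J V => ⟨_, _, _, Q_inj_prj V, Q_inj_prj_ne V,
      nonempty_isColimit_sum V, H J V⟩

lemma isCompact_iff_of_qis {M N : DGModule A} (f : M ⟶ N) (hf : qis A f) :
    M.IsCompact ↔ N.IsCompact := by
  have : IsIso (D.Q.map f) := Localization.inverts _ (qis A) _ hf
  exact ⟨IsCompactObject.of_iso (asIso (D.Q.map f)),
    IsCompactObject.of_iso (asIso (D.Q.map f)).symm⟩

end DGModule

/-! ### The derived category of vector spaces -/

section DerivedCat

/-- A morphism of complexes which vanishes on homology. -/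
def HZero {K L : Cx k} (f : K ⟶ L) : Prop := ∀ n, ∀ a ∈ Zc K n, (f.f n).hom a ∈ Bc L n

/-- The graded map underlying a morphism of complexes. -/
def toGr {K L : Cx k} (f : K ⟶ L) : Gr K L 0 :=
  grMk fun p q h => cst L (by omega) ∘ₗ (f.f p).hom

lemma ap_toGr {K L : Cx k} (f : K ⟶ L) {p : ℤ} (h : p + 0 = p) (a : K.X p) :
    ap (toGr f) p p h a = (f.f p).hom a := cst_rfl L (rfl : p = p) _

lemma toGr_mem_Zc {K L : Cx k} (f : K ⟶ L) : toGr f ∈ Zc (ihom K L) 0 := by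
  refine ihom_mem_Zc.2 fun p q p' q' h hp hq a => ?_
  obtain rfl : p = q := by omega
  obtain rfl : p' = q' := by omega
  rw [ap_toGr, ap_toGr, DGModule.d_f, zpow_zero, one_smul]

/-- The morphism of complexes given by a cycle of the internal Hom complex. -/
def ofGr {K L : Cx k} (φ : Gr K L 0) (hφ : φ ∈ Zc (ihom K L) 0) : K ⟶ L :=
  mkHom (fun n => ap φ n n (add_zero n)) fun n a => by
    rw [ihom_mem_Zc.1 hφ n n (n + 1) (n + 1) (add_zero n) rfl rfl, zpow_zero, one_smul]

lemma toGr_mem_Bc {K L : Cx k} {f : K ⟶ L} (hf : HZero f) : toGr f ∈ Bc (ihom K L) 0 := by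
  refine ihom_mem_Bc_of (toGr_mem_Zc f) fun p q h a ha => ?_
  obtain rfl : p = q := by omega
  rw [ap_toGr]
  exact hf p a ha

/-- A morphism of complexes of vector spaces which vanishes on homology is null-homotopic. -/
lemma nonempty_homotopy {K L : Cx k} {f : K ⟶ L} (hf : HZero f) : Nonempty (Homotopy f 0) := by
  obtain ⟨ψ, hψ⟩ := (ihom_mem_Bc (show (-1 : ℤ) + 1 = 0 by omega)).1 (toGr_mem_Bc hf)
  refine ⟨⟨fun i j => if h : i + -1 = j then ModuleCat.ofHom (ap ψ i j h) else 0,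
    fun i j h => dif_neg fun h' => h (show j + 1 = i by omega), fun n => ?_⟩⟩
  rw [dNext_eq _ (show (ComplexShape.up ℤ).Rel n (n + 1) from rfl),
    prevD_eq _ (show (ComplexShape.up ℤ).Rel (n - 1) n from sub_add_cancel n 1),
    dif_pos (by omega), dif_pos (by omega)]
  ext a
  have e := hψ n n (n + 1) (n - 1) (add_zero n) rfl (by omega) a
  rw [ap_toGr] at e
  refine e.trans ?_
  have e1 : (-1 : k) ^ (-1 : ℤ) = -1 := by simp
  rw [e1, neg_smul, one_smul, sub_neg_eq_add, add_comm]
  exact (add_zero _).symm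

/-- A graded cocycle from a perfect complex to a direct sum takes values, up to boundaries, in a
finite subsum. -/
lemma Perf.exists_finset {K : Cx k} (hK : Perf K) {J : Type u} (V : J → Cx k) {n : ℤ}
    {φ : Gr K (sumC V) n} (hφ : φ ∈ Zc (ihom K (sumC V)) n) :
    ∃ F : Finset J, ∀ p q h, ∀ a ∈ Zc K p, ∀ j ∉ F,
      (show Π₀ j, (V j).X q from ap φ p q h a) j ∈ Bc (V j) q := by
  classical
  obtain ⟨S⟩ := nonempty_splitting K
  obtain ⟨hK1, hK2⟩ := S.perf_iff.1 hK
  have h1 (p : ℤ) : ∃ F : Finset J, ∀ a, ∀ j ∉ F,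
      (show Π₀ j, (V j).X (p + n) from ap φ p (p + n) rfl (S.e p a)) j = 0 := by
    have := hK1 p
    obtain ⟨B, hB⟩ := (Submodule.fg_top _).1 (Module.Finite.fg_top (R := k)
      (M := LinearMap.range (S.e p)))
    let supp (z : (sumC V).X (p + n)) : Finset J :=
      DFinsupp.support (β := fun j => (V j).X (p + n)) z
    refine ⟨B.biUnion fun b => supp (ap φ p (p + n) rfl b), fun a j hj => ?_⟩
    have ha : S.e p a ∈ Submodule.span k (B : Set (K.X p)) := hB ▸ ⟨a, rfl⟩
    generalize S.e p a = z at ha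
    induction ha using Submodule.span_induction with
    | mem b hb =>
      by_contra h
      exact hj (Finset.mem_biUnion.2 ⟨b, hb, DFinsupp.mem_support_iff.2 h⟩)
    | zero => rw [map_zero]; rfl
    | add x y _ _ hx hy => rw [map_add]; exact (congrArg₂ (· + ·) hx hy).trans (add_zero _)
    | smul c x _ hx => rw [map_smul]; exact (congrArg (c • ·) hx).trans (smul_zero _)
  choose F hF using h1
  refine ⟨hK2.toFinset.biUnion F, fun p q h a ha j hj => ?_⟩
  subst h
  have h2 := map_mem_Bc_of_ihom hφ (rfl : p + n = p + n) (S.sub_e_mem ha)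
  have h3 : (show Π₀ j, (V j).X (p + n) from ap φ p (p + n) rfl (S.e p a)) j = 0 := by
    by_cases hp : S.e p = 0
    · rw [hp, LinearMap.zero_apply, map_zero]; rfl
    · exact hF p a j fun h => hj (Finset.mem_biUnion.2 ⟨p, by simpa using hp, h⟩)
  have h4 := (sumC_mem_Bc V).1 h2 j
  rw [map_sub] at h4
  have h5 : (show Π₀ j, (V j).X (p + n) from ap φ p (p + n) rfl a) j =
      (show Π₀ j, (V j).X (p + n) from ap φ p (p + n) rfl a - ap φ p (p + n) rfl (S.e p a)) j :=
    ((congrArg (_ - ·) h3).trans (sub_zero _)).symm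
  rw [h5]
  exact h4

/-- The complex with `k` in degree `n`; in degree `i` it is the space of functions on the proofs of
`i = n`, which is `k` or `0`. -/
abbrev kc (k : Type u) [Field k] (n : ℤ) : Cx k :=
  mkCx (fun i => PLift (i = n) → k) (fun _ => 0) fun _ _ => rfl

lemma kc_d (n i j : ℤ) : (kc k n).d i j = 0 := by
  by_cases h : i + 1 = j
  · subst h
    exact ModuleCat.hom_ext (LinearMap.ext fun a =>
      mkCx_d (fun i => PLift (i = n) → k) (fun _ => 0) (fun _ _ => rfl) i a)
  · exact (kc k n).shape i j h

variable [HasDerivedCategory.{w} (ModuleCat.{u} k)]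

lemma derivedQ_map_eq_zero {K L : Cx k} {f : K ⟶ L} (hf : HZero f) :
    DerivedCategory.Q.map f = 0 := by
  obtain ⟨h⟩ := nonempty_homotopy hf
  rw [DerivedCategory.Q_map_eq_of_homotopy _ h, Functor.map_zero]

/-- The subgroup of morphisms which vanish on homology. -/
def hzero (K L : Cx k) : AddSubgroup (K ⟶ L) where
  carrier := {f | HZero f}
  add_mem' hf hg n a ha := (Bc L n).add_mem (hf n a ha) (hg n a ha)
  zero_mem' n _ _ := (Bc L n).zero_mem
  neg_mem' hf n a ha := (Bc L n).neg_mem (hf n a ha)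

lemma exists_lift_of_quasiIso {P X Y : Cx k} (w : X ⟶ Y) (hw : QuasiIso w) (g : P ⟶ Y) :
    ∃ g' : P ⟶ X, g - g' ≫ w ∈ hzero P Y := by
  obtain ⟨φ, hφ, h⟩ := ((quasiIso_iff _).1 (quasiIso_ihomMap P w hw) 0).2 _ (toGr_mem_Zc g)
  refine ⟨ofGr φ hφ, fun n a ha => ?_⟩
  have e : ap (K := P) (V := Y) (((ihomMap P w).f 0).hom φ - toGr g) n n (add_zero n) a ∈ Bc Y n :=
    map_mem_Bc_of_ihom_mem_Bc h (add_zero n) ha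
  have e2 : ap (K := P) (V := Y) (((ihomMap P w).f 0).hom φ - toGr g) n n (add_zero n) a =
      -(((g - ofGr φ hφ ≫ w).f n).hom a) := by
    refine (congrArg (_ - ·) (ap_toGr g (add_zero n) a)).trans ?_
    exact (neg_sub _ _).symm
  rw [e2] at e
  exact (Submodule.neg_mem_iff _).1 e

lemma derivedQ_map_surjective {K L : Cx k}
    (φ : DerivedCategory.Q.obj K ⟶ DerivedCategory.Q.obj L) :
    ∃ f : K ⟶ L, DerivedCategory.Q.map f = φ :=
  exists_map_eq_of_lift DerivedCategory.Q
    (HomologicalComplex.quasiIso (ModuleCat.{u} k) (ComplexShape.up ℤ)) (hzero K)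
    (fun _ _ hf => derivedQ_map_eq_zero hf) (fun w hw g => exists_lift_of_quasiIso w hw g) φ

lemma derivedQ_map_eq_zero_iff {K L : Cx k} (f : K ⟶ L) :
    DerivedCategory.Q.map f = 0 ↔ HZero f :=
  ⟨fun hf => mem_of_map_eq_zero DerivedCategory.Q
    (HomologicalComplex.quasiIso (ModuleCat.{u} k) (ComplexShape.up ℤ)) (hzero K)
    (fun _ g hf n a ha => map_mem_Bc g (hf n a ha))
    (fun w hw g => exists_lift_of_quasiIso w hw g)
    (fun w hw g h n a ha => ((quasiIso_iff w).1 hw n).1 _ (map_mem_Zc g ha) (h n a ha)) f hf,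
    derivedQ_map_eq_zero⟩

lemma HZero.of_sumι {J : Type u} (V : J → Cx k) {W : Cx k} (f : sumC V ⟶ W)
    (h : ∀ j, HZero (sumι V j ≫ f)) : HZero f := by
  classical
  intro n a ha
  have ha' := (sumC_mem_Zc V).1 ha
  let a' : Π₀ j, (V j).X n := a
  have : a = ∑ j ∈ a'.support, ((sumι V j).f n).hom (a' j) := by
    conv_lhs => rw [show a = a' from rfl, ← DFinsupp.sum_single (f := a')]
    refine Finset.sum_congr rfl fun j _ => ?_
    rw [sumι_apply]
  rw [this, map_sum]
  exact Submodule.sum_mem _ fun j _ => h j n _ (ha' j)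

/-- Direct sums of complexes are coproducts in the derived category. -/
lemma nonempty_isColimit_sumC {J : Type u} (V : J → Cx k) : Nonempty (IsColimit
    (Cofan.mk (DerivedCategory.Q.obj (sumC V)) fun j => DerivedCategory.Q.map (sumι V j))) := by
  have : (DerivedCategory.Q (C := ModuleCat.{u} k)).EssSurj := inferInstance
  refine nonempty_isColimit_cofan DerivedCategory.Q _ (fun Z φ => ?_) fun Z ψ h => ?_
  · choose f hf using fun j => derivedQ_map_surjective (φ j)
    exact ⟨DerivedCategory.Q.map (sumDesc V f), fun j => by
      rw [← Functor.map_comp, sumι_sumDesc, hf]⟩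
  · obtain ⟨f, rfl⟩ := derivedQ_map_surjective ψ
    rw [derivedQ_map_eq_zero_iff]
    refine HZero.of_sumι V f fun j => ?_
    rw [← derivedQ_map_eq_zero_iff, Functor.map_comp, h j]

/-- A complex is compact in the derived category if and only if every morphism to a direct sum is equal
on homology to one with values in a finite subsum. -/
lemma isCompactObject_derivedQ_iff {K : Cx k} :
    IsCompactObject.{u} (DerivedCategory.Q.obj K) ↔ ∀ (J : Type u) (V : J → Cx k)
      (f : K ⟶ sumC V), ∃ F : Finset J, HZero (f - ∑ j ∈ F, f ≫ sumπ V j ≫ sumι V j) := by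
  have key {J : Type u} (V : J → Cx k) (f : K ⟶ sumC V) (F : Finset J) :
      HZero (f - ∑ j ∈ F, f ≫ sumπ V j ≫ sumι V j) ↔ DerivedCategory.Q.map f =
        ∑ j ∈ F, DerivedCategory.Q.map f ≫ DerivedCategory.Q.map (sumπ V j) ≫
          DerivedCategory.Q.map (sumι V j) := by
    rw [← derivedQ_map_eq_zero_iff, Functor.map_sub, sub_eq_zero, Functor.map_sum]
    simp only [Functor.map_comp]
  have h1 {J : Type u} (V : J → Cx k) (j : J) :
      DerivedCategory.Q.map (sumι V j) ≫ DerivedCategory.Q.map (sumπ V j) = 𝟙 _ := by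
    rw [← Functor.map_comp, sumι_sumπ, DerivedCategory.Q.map_id]
  have h2 {J : Type u} (V : J → Cx k) (i j : J) (h : i ≠ j) :
      DerivedCategory.Q.map (sumι V i) ≫ DerivedCategory.Q.map (sumπ V j) = 0 := by
    rw [← Functor.map_comp, sumι_sumπ_ne V h, Functor.map_zero]
  constructor
  · intro hK J V f
    obtain ⟨F, hF⟩ := hK.exists_finset _ _ (h1 V) (h2 V) (nonempty_isColimit_sumC V).some
      (DerivedCategory.Q.map f)
    exact ⟨F, (key V f F).2 hF⟩
  · intro H
    have : (DerivedCategory.Q (C := ModuleCat.{u} k)).EssSurj := inferInstance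
    refine isCompactObject_of DerivedCategory.Q fun J V => ⟨_, _, _, h1 V, h2 V,
      nonempty_isColimit_sumC V, fun φ => ?_⟩
    obtain ⟨f, rfl⟩ := derivedQ_map_surjective φ
    obtain ⟨F, hF⟩ := H J V f
    exact ⟨F, (key V f F).1 hF⟩

/-- The morphism `f - ∑ j ∈ F, f ≫ π j ≫ ι j` to a direct sum is `f` with the components in `F`
removed. -/
lemma sum_f_sub {K : Cx k} {J : Type u} (V : J → Cx k) (f : K ⟶ sumC V) (F : Finset J) {n : ℤ}
    (a : K.X n) [DecidableEq J] (j : J) :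
    (show Π₀ j, (V j).X n from ((f - ∑ j ∈ F, f ≫ sumπ V j ≫ sumι V j).f n).hom a) j =
      if j ∈ F then 0 else (show Π₀ j, (V j).X n from (f.f n).hom a) j := by
  have h1 : (f - ∑ i ∈ F, f ≫ sumπ V i ≫ sumι V i) ≫ sumπ V j =
      if j ∈ F then 0 else f ≫ sumπ V j := by
    rw [Preadditive.sub_comp, Preadditive.sum_comp]
    have h3 (i : J) (hi : i ≠ j) : (f ≫ sumπ V i ≫ sumι V i) ≫ sumπ V j = 0 := by
      rw [Category.assoc, Category.assoc, sumι_sumπ_ne V hi, comp_zero, comp_zero]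
    split_ifs with h
    · rw [Finset.sum_eq_single_of_mem j h fun i _ hi => h3 i hi, Category.assoc, Category.assoc,
        sumι_sumπ, Category.comp_id, sub_self]
    · rw [Finset.sum_eq_zero fun i hi => h3 i fun h' => h (h' ▸ hi), sub_zero]
  have h2 := congrArg (fun g => (g.f n).hom a) h1
  refine Eq.trans h2 ?_
  split_ifs <;> rfl

/-- A complex with finite total homology is compact. -/
lemma isCompactObject_of_perf {K : Cx k} (hK : Perf K) :
    IsCompactObject.{u} (DerivedCategory.Q.obj K) := by
  classical
  refine isCompactObject_derivedQ_iff.2 fun J V f => ?_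
  obtain ⟨F, hF⟩ := hK.exists_finset V (toGr_mem_Zc f)
  refine ⟨F, fun n a ha => (sumC_mem_Bc V).2 fun j => ?_⟩
  rw [sum_f_sub]
  split_ifs with hj
  · exact zero_mem _
  · have := hF n n (add_zero n) a ha j hj
    rwa [ap_toGr] at this

/-- A compact complex has finite total homology: apply compactness to the projection of `K` to its
homology, written as a direct sum of copies of `k[-n]` indexed by a basis. -/
lemma perf_of_isCompactObject {K : Cx k}
    (hK : IsCompactObject.{u} (DerivedCategory.Q.obj K)) : Perf K := by
  classical
  obtain ⟨S⟩ := nonempty_splitting K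
  let b (n : ℤ) := Module.Basis.ofVectorSpace k (LinearMap.range (S.e n))
  let I (n : ℤ) : Type u := Module.Basis.ofVectorSpaceIndex k (LinearMap.range (S.e n))
  let J : Type u := Σ n, I n
  let V (j : J) : Cx k := kc k j.1
  have hV (n m : ℤ) (z : Π₀ j, (V j).X n) : ((sumC V).d n m).hom z = 0 :=
    DFinsupp.ext fun j => (sumC_d V z j).trans (by rw [kc_d]; rfl)
  let f : K ⟶ sumC V := mkHom (L := sumC V) (fun n => (b n).constr k (fun i =>
      ((sumι V ⟨n, i⟩).f n).hom (fun _ => 1)) ∘ₗ LinearMap.rangeRestrict (S.e n)) fun n a => by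
    refine (hV _ _ _).trans ?_
    have : LinearMap.rangeRestrict (S.e (n + 1)) ((K.d n (n + 1)).hom a) = 0 :=
      Subtype.ext (S.e_d n (n + 1) a)
    rw [LinearMap.comp_apply, this, map_zero]
  obtain ⟨F, hF⟩ := isCompactObject_derivedQ_iff.1 hK J V f
  have hJ (j : J) : j ∈ F := by
    by_contra hj
    obtain ⟨n, i⟩ := j
    have hb : (LinearMap.rangeRestrict (S.e n)) (b n i) = b n i := by
      obtain ⟨a, ha⟩ := (b n i).2
      exact Subtype.ext (by rw [LinearMap.codRestrict_apply, ← ha, S.e_e])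
    have h1 : (f.f n).hom (b n i : K.X n) = ((sumι V ⟨n, i⟩).f n).hom (fun _ => 1) := by
      refine (congrArg ((b n).constr k _) hb).trans ?_
      exact (b n).constr_basis k _ i
    have h2 : (b n i : K.X n) ∈ Zc K n := by
      obtain ⟨a, ha⟩ := (b n i).2
      rw [← ha]
      exact S.e_mem_Zc n a
    have h3 := (sumC_mem_Bc V).1 (hF n _ h2) ⟨n, i⟩
    rw [sum_f_sub, if_neg hj, h1, sumι_same] at h3
    obtain ⟨z, hz⟩ := h3
    rw [kc_d] at hz
    exact zero_ne_one (congrFun hz ⟨rfl⟩)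
  have : Finite J := Set.finite_univ_iff.1 (F.finite_toSet.subset fun j _ => hJ j)
  refine S.perf_iff.2 ⟨fun n => ?_, ?_⟩
  · have : Finite (I n) := Finite.of_injective (fun i => (⟨n, i⟩ : J)) fun i i' h => by
      cases h; rfl
    exact Module.Finite.of_basis (b n)
  · refine (Set.finite_range (fun j : J => j.1)).subset fun n hn => ?_
    by_contra h
    refine hn ?_
    have : IsEmpty (I n) := ⟨fun i => h ⟨⟨n, i⟩, rfl⟩⟩
    have : Subsingleton (LinearMap.range (S.e n)) := (b n).repr.toEquiv.subsingleton
    exact LinearMap.ext fun a => congrArg Subtype.val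
      (Subsingleton.elim (LinearMap.rangeRestrict (S.e n) a) 0)

end DerivedCat

end DG

namespace DG

variable {k : Type u} [Field k]

/-- The Yoneda lemma in the homotopy category of complexes of vector spaces. -/
lemma quasiIso_of_yoneda {K L : Cx k} (f : K ⟶ L)
    (hinj : ∀ (V : Cx k) (g : L ⟶ V), HZero (f ≫ g) → HZero g)
    (hsurj : ∀ (V : Cx k) (g : K ⟶ V), ∃ g' : L ⟶ V, HZero (g - f ≫ g')) : QuasiIso f := by
  obtain ⟨g, hg⟩ := hsurj K (𝟙 K)
  have hg' : HZero (g ≫ f - 𝟙 L) := by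
    refine hinj L _ fun n a ha => ?_
    have h1 := (Bc L n).neg_mem (map_mem_Bc f (hg n a ha))
    have h2 : (f ≫ (g ≫ f - 𝟙 L)) = -((𝟙 K - f ≫ g) ≫ f) := by simp
    rw [h2]
    exact h1
  refine (quasiIso_iff f).2 fun n => ⟨fun a ha hb => ?_, fun b hb => ?_⟩
  · have h1 := (Bc K n).add_mem (hg n a ha) (map_mem_Bc g hb)
    have h2 : ((𝟙 K - f ≫ g).f n).hom a + (g.f n).hom ((f.f n).hom a) = a := sub_add_cancel a _
    rwa [h2] at h1
  · exact ⟨(g.f n).hom b, map_mem_Zc g hb, hg' n b hb⟩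

/-- If `K` is perfect, then `Hom_k(K, -)` preserves direct sums up to quasi-isomorphism. -/
lemma Perf.quasiIso_ihom_sum {K : Cx k} (hK : Perf K) {J : Type u} (V : J → Cx k) :
    QuasiIso (sumDesc (fun j => ihom K (V j)) fun j => ihomMap K (sumι V j)) := by
  classical
  let c := sumDesc (fun j => ihom K (V j)) fun j => ihomMap K (sumι V j)
  have hc (j : J) : c ≫ ihomMap K (sumπ V j) = sumπ (fun j => ihom K (V j)) j := by
    refine sum_hom_ext _ fun i => ?_
    rw [← Category.assoc, sumι_sumDesc]
    have h0 : ihomMap K (sumι V i) ≫ ihomMap K (sumπ V j) = ihomMap K (sumι V i ≫ sumπ V j) := rfl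
    rw [h0]
    by_cases h : i = j
    · subst h
      rw [sumι_sumπ, sumι_sumπ]
      rfl
    · rw [sumι_sumπ_ne V h, sumι_sumπ_ne _ h]
      rfl
  refine (quasiIso_iff c).2 fun n => ⟨fun φ _ hb => (sumC_mem_Bc _).2 fun j => ?_,
    fun φ hφ => ?_⟩
  · have := map_mem_Bc (ihomMap K (sumπ V j)) hb
    exact (congrArg (· ∈ Bc (ihom K (V j)) n)
      (congrArg (fun f => (f.f n).hom φ) (hc j))).mp this
  · obtain ⟨F, hF⟩ := hK.exists_finset V hφ
    let φ' (j : J) : Gr K (V j) n := ((ihomMap K (sumπ V j)).f n).hom φ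
    let ψ : (sumC fun j => ihom K (V j)).X n :=
      ∑ j ∈ F, ((sumι (fun j => ihom K (V j)) j).f n).hom (φ' j)
    have hψ : ψ ∈ Zc (sumC fun j => ihom K (V j)) n :=
      Submodule.sum_mem _ fun j _ => map_mem_Zc _ (map_mem_Zc _ hφ)
    refine ⟨ψ, hψ, ?_⟩
    refine ihom_mem_Bc_of (K := K) (V := sumC V) (Submodule.sub_mem _ (map_mem_Zc c hψ) hφ)
      fun p q h a ha => (sumC_mem_Bc V).2 fun j => ?_
    have h3 : (show Π₀ j, (V j).X q from ap (K := K) (V := sumC V) ((c.f n).hom ψ) p q h a) j =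
        if j ∈ F then (show Π₀ j, (V j).X q from ap (K := K) (V := sumC V) φ p q h a) j
          else 0 := by
      have h4 := congrArg (fun f => (f.f n).hom ψ) (hc j)
      have h5 : ((sumπ (fun j => ihom K (V j)) j).f n).hom ψ = if j ∈ F then φ' j else 0 := by
        refine (map_sum ((sumπ (fun j => ihom K (V j)) j).f n).hom _ _).trans ?_
        split_ifs with hj
        · rw [Finset.sum_eq_single_of_mem j hj]
          · exact sumι_same (fun j => ihom K (V j)) j _
          · intro i _ hi
            exact sumι_of_ne (fun j => ihom K (V j)) hi _
        · refine Finset.sum_eq_zero fun i hi => ?_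
          exact sumι_of_ne (fun j => ihom K (V j)) (show i ≠ j from fun h' => hj (h' ▸ hi)) _
      refine (congrArg (fun φ : Gr K (V j) n => ap φ p q h a) (h4.trans h5)).trans ?_
      split_ifs
      · rfl
      · rfl
    have h7 : (show Π₀ j, (V j).X q from ap (K := K) (V := sumC V) ((c.f n).hom ψ - φ) p q h a) j =
        (if j ∈ F then (show Π₀ j, (V j).X q from ap (K := K) (V := sumC V) φ p q h a) j
          else 0) - (show Π₀ j, (V j).X q from ap (K := K) (V := sumC V) φ p q h a) j :=
      congrArg (· - (show Π₀ j, (V j).X q from ap (K := K) (V := sumC V) φ p q h a) j) h3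
    refine (congrArg (· ∈ Bc (V j) q) h7).mpr ?_
    split_ifs with hj
    · rw [sub_self]; exact zero_mem _
    · rw [zero_sub]; exact (Bc _ _).neg_mem (hF p q h a ha j hj)

namespace DGModule

variable {A : DGCat k}

lemma hom_ext_apply {M N : DGModule A} {f g : M ⟶ N}
    (h : ∀ (x : A.Obj) (n : ℤ) (m : (M.obj x).X n), ((f.app x).f n).hom m = ((g.app x).f n).hom m) :
    f = g :=
  hom_ext fun x => HomologicalComplex.hom_ext _ _ fun n =>
    ModuleCat.hom_ext (LinearMap.ext fun m => h x n m)

/-! ### The tensor product of dg modules -/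

section Tensor

variable {M : DGModule A} {P : DGModule A.op}

/-- The element `m ⊗ r` of `M ⊗_A P`. -/
def tm (M : DGModule A) (P : DGModule A.op) (x : A.Obj) {a c n : ℤ} (h : a + c = n) :
    (M.obj x).X a →ₗ[k] (P.obj x).X c →ₗ[k] (tensorOver M P).X n :=
  (tmk M.obj P.obj x h).compr₂ (tensorRel M P n).mkQ

lemma tm_d (x : A.Obj) {a c n a' c' n' : ℤ} (h : a + c = n) (ha : a + 1 = a') (hc : c + 1 = c')
    (hn : n + 1 = n') (m : (M.obj x).X a) (r : (P.obj x).X c) :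
    ((tensorOver M P).d n n').hom (tm M P x h m r) =
      tm M P x (show a' + c = n' by omega) (((M.obj x).d a a').hom m) r +
        (-1 : k) ^ a • tm M P x (show a + c' = n' by omega) m (((P.obj x).d c c').hom r) := by
  subst ha hc
  refine (congrArg (tensorRel M P n').mkQ (tensorD_tmk M.obj P.obj x hn h m r)).trans ?_
  rw [map_add, map_smul]
  rfl

lemma tm_act {x y : A.Obj} {a b c n ab cb : ℤ} (hab : a + b = ab) (hcb : c + b = cb)
    (h : ab + c = n) (m : (M.obj y).X a) (f : (A.Hom x y).X b) (r : (P.obj x).X c) :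
    tm M P x h (M.act hab m f) r =
      (-1 : k) ^ (b * c) • tm M P y (show a + cb = n by omega) m
        (P.act (x := y) (y := x) hcb r f) := by
  have := (Submodule.Quotient.mk_eq_zero _).2 (tmk_sub_mem M P hab hcb h m f r)
  exact sub_eq_zero.1 this

lemma tm_ext {n : ℤ} {W : Type u} [AddCommGroup W] [Module k W]
    {f g : (tensorOver M P).X n →ₗ[k] W}
    (h : ∀ (x : A.Obj) (a c : ℤ) (h : a + c = n) (m : (M.obj x).X a) (r : (P.obj x).X c),
      f (tm M P x h m r) = g (tm M P x h m r)) : f = g :=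
  Submodule.linearMap_qext _ (tensor_ext h)

/-- The linear map out of `M ⊗_A P` given on `m ⊗ r` by a balanced family of bilinear maps. -/
def tmLift {n : ℤ} {W : Type u} [AddCommGroup W] [Module k W]
    (φ : ∀ (x : A.Obj) (a c : ℤ), a + c = n → (M.obj x).X a →ₗ[k] (P.obj x).X c →ₗ[k] W)
    (hφ : ∀ (x y : A.Obj) (a b c ab cb : ℤ) (hab : a + b = ab) (hcb : c + b = cb)
      (h : ab + c = n) (m : (M.obj y).X a) (f : (A.Hom x y).X b) (r : (P.obj x).X c),
      φ x ab c h (M.act hab m f) r =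
        (-1 : k) ^ (b * c) • φ y a cb (by omega) m (P.act (x := y) (y := x) hcb r f)) :
    (tensorOver M P).X n →ₗ[k] W :=
  (tensorRel M P n).liftQ (tlift φ) (by
    refine Submodule.span_le.2 ?_
    rintro _ ⟨x, y, a, b, c, h, m, f, r, rfl⟩
    refine LinearMap.mem_ker.2 ?_
    rw [map_sub, map_smul, tlift_tmk, tlift_tmk, hφ x y a b c _ _ rfl rfl, sub_self])

lemma tmLift_tm {n : ℤ} {W : Type u} [AddCommGroup W] [Module k W]
    (φ : ∀ (x : A.Obj) (a c : ℤ), a + c = n → (M.obj x).X a →ₗ[k] (P.obj x).X c →ₗ[k] W)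
    (hφ) (x : A.Obj) {a c : ℤ} (h : a + c = n) (m : (M.obj x).X a) (r : (P.obj x).X c) :
    tmLift φ hφ (tm M P x h m r) = φ x a c h m r :=
  tlift_tmk φ x h m r

/-- The morphism of complexes out of `M ⊗_A P` given on `m ⊗ r` by a balanced family of bilinear
maps which satisfies the Leibniz rule. -/
def tmHom {V : Cx k}
    (φ : ∀ (n : ℤ) (x : A.Obj) (a c : ℤ), a + c = n →
      (M.obj x).X a →ₗ[k] (P.obj x).X c →ₗ[k] V.X n)
    (hφ : ∀ (n : ℤ) (x y : A.Obj) (a b c ab cb : ℤ) (hab : a + b = ab) (hcb : c + b = cb)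
      (h : ab + c = n) (m : (M.obj y).X a) (f : (A.Hom x y).X b) (r : (P.obj x).X c),
      φ n x ab c h (M.act hab m f) r =
        (-1 : k) ^ (b * c) • φ n y a cb (by omega) m (P.act (x := y) (y := x) hcb r f))
    (hd : ∀ (n : ℤ) (x : A.Obj) (a c : ℤ) (h : a + c = n) (m : (M.obj x).X a) (r : (P.obj x).X c),
      (V.d n (n + 1)).hom (φ n x a c h m r) =
        φ (n + 1) x (a + 1) c (by omega) (((M.obj x).d a (a + 1)).hom m) r +
        (-1 : k) ^ a • φ (n + 1) x a (c + 1) (by omega) m (((P.obj x).d c (c + 1)).hom r)) :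
    tensorOver M P ⟶ V :=
  mkHom (fun n => tmLift (φ n) (hφ n)) fun n t => by
    refine LinearMap.congr_fun (tm_ext (f := (V.d n (n + 1)).hom ∘ₗ tmLift (φ n) (hφ n))
      (g := tmLift (φ (n + 1)) (hφ (n + 1)) ∘ₗ ((tensorOver M P).d n (n + 1)).hom)
      fun x a c h m r => ?_) t
    rw [LinearMap.comp_apply, LinearMap.comp_apply, tmLift_tm, tm_d x h rfl rfl rfl, map_add,
      map_smul, tmLift_tm, tmLift_tm, hd]

lemma tmHom_tm {V : Cx k}
    (φ : ∀ (n : ℤ) (x : A.Obj) (a c : ℤ), a + c = n →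
      (M.obj x).X a →ₗ[k] (P.obj x).X c →ₗ[k] V.X n) (hφ) (hd) (x : A.Obj) {a c n : ℤ}
    (h : a + c = n) (m : (M.obj x).X a) (r : (P.obj x).X c) :
    ((tmHom φ hφ hd).f n).hom (tm M P x h m r) = φ n x a c h m r :=
  tmLift_tm (φ n) (hφ n) x h m r

/-- The morphism `M ⊗_A P ⟶ M ⊗_A P'` induced by a morphism `P ⟶ P'`. -/
def tensorMap (M : DGModule A) {P P' : DGModule A.op} (w : P ⟶ P') :
    tensorOver M P ⟶ tensorOver M P' :=
  tmHom (fun n x a c h => (tm M P' x h).compl₂ ((w.app x).f c).hom)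
    (fun n x y a b c ab cb hab hcb h m f r => by
      rw [LinearMap.compl₂_apply, LinearMap.compl₂_apply, tm_act hab hcb]
      exact congrArg (fun z => _ • tm M P' y _ m z) (w.map_act (x := y) (y := x) hcb r f).symm)
    fun n x a c h m r => by
      rw [LinearMap.compl₂_apply, LinearMap.compl₂_apply, LinearMap.compl₂_apply,
        tm_d x h rfl rfl rfl, d_f]

lemma tensorMap_tm (M : DGModule A) {P P' : DGModule A.op} (w : P ⟶ P') (x : A.Obj) {a c n : ℤ}
    (h : a + c = n) (m : (M.obj x).X a) (r : (P.obj x).X c) :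
    ((tensorMap M w).f n).hom (tm M P x h m r) = tm M P' x h m (((w.app x).f c).hom r) :=
  tmHom_tm _ _ _ x h m r

end Tensor

/-! ### The dg module of maps from `P` to a complex -/

section Coind

variable (P : DGModule A.op) (V : Cx k)

/-- The action `(φ · f)(r) = (-1)^{|f||r|} φ(r · f)`. -/
def coindAct {x y : A.Obj} {p q n : ℤ} (h : p + q = n) :
    Gr (P.obj y) V p →ₗ[k] (A.Hom x y).X q →ₗ[k] Gr (P.obj x) V n :=
  LinearMap.mk₂ k (fun φ f => grMk fun c e he => (-1 : k) ^ (q * c) •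
      ap φ (c + q) e (by omega) ∘ₗ (P.act (x := y) (y := x) (rfl : c + q = c + q)).flip f)
    (fun φ ψ f => gr_ext fun c e he r => by
      simp only [ap, grMk, Pi.add_apply, LinearMap.smul_apply, LinearMap.comp_apply,
        LinearMap.add_apply, smul_add])
    (fun s φ f => gr_ext fun c e he r => by
      simp only [ap, grMk, Pi.smul_apply, LinearMap.smul_apply, LinearMap.comp_apply, smul_comm s])
    (fun φ f g => gr_ext fun c e he r => by
      simp only [ap, grMk, Pi.add_apply, LinearMap.smul_apply, LinearMap.comp_apply,
        LinearMap.add_apply, map_add, smul_add])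
    (fun s φ f => gr_ext fun c e he r => by
      simp only [ap, grMk, Pi.smul_apply, LinearMap.smul_apply, LinearMap.comp_apply, map_smul,
        smul_comm s])

lemma coindAct_apply {x y : A.Obj} {p q n : ℤ} (h : p + q = n) (φ : Gr (P.obj y) V p)
    (f : (A.Hom x y).X q) {c e c' : ℤ} (he : c + n = e) (hc : c + q = c') (r : (P.obj x).X c) :
    ap (coindAct P V h φ f) c e he r =
      (-1 : k) ^ (q * c) • ap φ c' e (by omega) (P.act (x := y) (y := x) hc r f) := by
  subst hc; rfl

/-- The right dg `A`-module `x ↦ Hom_k(P(x), V)`. -/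
abbrev coind : DGModule A where
  obj x := ihom (P.obj x) V
  act h := coindAct P V h
  act_id {x p} φ := gr_ext (K := P.obj x) (V := V) fun c e he r => by
    refine (coindAct_apply P V (add_zero p) φ (A.id x) he (add_zero c) r).trans ?_
    rw [P.act_id]
    simp
  act_comp {x y z p q r s t n} hs ht h h' φ f g :=
    gr_ext (K := P.obj x) (V := V) fun c e he m => by
      refine (coindAct_apply P V h _ g he rfl m).trans ?_
      refine (congrArg _ (coindAct_apply P V hs φ f _ (show c + r + q = c + t by omega) _)).trans ?_
      refine Eq.trans ?_ (coindAct_apply P V h' φ _ he rfl m).symm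
      rw [P.act_comp rfl (show r + q = t by omega) (show c + r + q = c + t by omega) rfl]
      change _ • _ • ap φ _ _ _ (P.act _ m ((-1 : k) ^ (r * q) • A.comp _ f g)) = _
      rw [map_smul, map_smul, smul_smul, smul_smul, ← zpow_add₀ (by simp), ← zpow_add₀ (by simp)]
      refine congrArg₂ _ (sgn_congr ⟨r * q, by rw [← ht]; ring⟩) rfl
  d_act {x y p q n} h φ f := by
    refine (ihom_d (K := P.obj x) (V := V) _).trans
      (gr_ext (K := P.obj x) (V := V) fun c e he r => ?_)
    rw [grD_apply _ he (sub_add_cancel e 1) rfl, coindAct_apply P V h φ f _ rfl,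
      coindAct_apply P V h φ f _ (show c + 1 + q = c + q + 1 by omega)]
    change _ = ap (coindAct P V _ (((ihom (P.obj y) V).d p (p + 1)).hom φ) f) c e he r +
      (-1 : k) ^ p • ap (coindAct P V _ φ (((A.Hom x y).d q (q + 1)).hom f)) c e he r
    rw [coindAct_apply P V _ _ f he rfl, coindAct_apply P V _ φ _ he
      (show c + (q + 1) = c + q + 1 by omega)]
    erw [ihom_d]
    rw [grD_apply φ _ (sub_add_cancel e 1) rfl, P.d_act (x := y) (y := x) rfl]
    simp only [map_add, map_smul, smul_sub, smul_add, smul_smul,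
      ← zpow_add₀ (show (-1 : k) ≠ 0 by simp)]
    rw [sgn_congr (k := k) (a := n + q * (c + 1)) (b := q * c + p) ⟨q, by rw [← h]; ring⟩,
      sgn_congr (k := k) (a := p + (q + 1) * c) (b := q * c + (p + c)) ⟨0, by ring⟩]
    abel

variable {V}

/-- The morphism of dg modules given by composition with a morphism of complexes. -/
def coindMap {W : Cx k} (f : V ⟶ W) : coind P V ⟶ coind P W where
  app x := ihomMap (P.obj x) f
  map_act {x y p q n} h φ a := gr_ext (K := P.obj x) (V := W) fun c e he r => by
    refine (ihomMap_apply _ f _ c e he r).trans ?_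
    refine (congrArg _ (coindAct_apply P V h φ a he rfl r)).trans ?_
    refine Eq.trans ?_ (coindAct_apply P W h _ a he rfl r).symm
    rw [map_smul]
    rfl

lemma coindMap_comp {W X : Cx k} (f : V ⟶ W) (g : W ⟶ X) :
    coindMap P (f ≫ g) = coindMap P f ≫ coindMap P g := rfl

lemma coindMap_id : coindMap P (𝟙 V) = 𝟙 _ := rfl

lemma coindMap_zero (V W : Cx k) : coindMap P (0 : V ⟶ W) = 0 := rfl

variable {P} (V)

/-- The morphism of dg modules given by composition with a morphism `P ⟶ P'`. -/
def coindPre {P' : DGModule A.op} (w : P ⟶ P') : coind P' V ⟶ coind P V where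
  app x := ihomPre (w.app x) V
  map_act {x y p q n} h φ a := gr_ext (K := P.obj x) (V := V) fun c e he r => by
    refine (ihomPre_apply _ V _ c e he r).trans ?_
    refine (coindAct_apply P' V h φ a he rfl _).trans ?_
    refine Eq.trans ?_ (coindAct_apply P V h _ a he rfl r).symm
    refine congrArg _ (congrArg (ap φ _ _ _) ?_)
    exact (w.map_act (x := y) (y := x) rfl r a).symm

variable {V}
variable {M : DGModule A}

/-- The map `m ↦ (r ↦ Φ(m ⊗ r))`. -/
def sharpGr (Φ : tensorOver M P ⟶ V) (x : A.Obj) (a : ℤ) :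
    (M.obj x).X a →ₗ[k] Gr (P.obj x) V a :=
  LinearMap.pi fun s => (tm M P x ((add_comm a s.1.1).trans s.2)).compr₂ (Φ.f s.1.2).hom

/-- The adjunction between `- ⊗_A P` and `Hom_k(P, -)`: the morphism `m ↦ (r ↦ Φ(m ⊗ r))`. -/
def sharp (Φ : tensorOver M P ⟶ V) : M ⟶ coind P V where
  app x := mkHom (L := ihom (P.obj x) V) (sharpGr Φ x) fun a m => by
    refine (ihom_d (K := P.obj x) (V := V) _).trans
      (gr_ext (K := P.obj x) (V := V) fun c n h r => ?_)
    rw [grD_apply _ h (sub_add_cancel n 1) rfl]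
    change (V.d (n - 1) n).hom ((Φ.f (n - 1)).hom (tm M P x _ m r)) - (-1 : k) ^ a •
      (Φ.f n).hom (tm M P x _ m _) = (Φ.f n).hom (tm M P x _ (((M.obj x).d a (a + 1)).hom m) r)
    rw [d_f, tm_d x _ rfl rfl (sub_add_cancel n 1), map_add, map_smul, add_sub_cancel_right]
  map_act {x y p q n} h m f := gr_ext (K := P.obj x) (V := V) fun c e he r => by
    refine Eq.trans ?_ (coindAct_apply P V h _ f he rfl r).symm
    change (Φ.f e).hom (tm M P x _ (M.act h m f) r) = _ • (Φ.f e).hom (tm M P y _ m _)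
    rw [tm_act h rfl, map_smul]

lemma sharp_apply (Φ : tensorOver M P ⟶ V) (x : A.Obj) {a c n : ℤ} (h : c + a = n)
    (m : (M.obj x).X a) (r : (P.obj x).X c) :
    ap (K := P.obj x) (V := V) ((((sharp Φ).app x).f a).hom m) c n h r =
      (Φ.f n).hom (tm M P x (by omega) m r) := rfl

/-- The adjunction `sharp` is surjective. -/
lemma exists_sharp_eq (ψ : M ⟶ coind P V) : ∃ Φ : tensorOver M P ⟶ V, sharp Φ = ψ := by
  let B (n : ℤ) (x : A.Obj) (a c : ℤ) (h : a + c = n) : (M.obj x).X a →ₗ[k] (P.obj x).X c →ₗ[k]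
      V.X n :=
    LinearMap.proj (φ := fun s : {s : ℤ × ℤ // s.1 + a = s.2} => (P.obj x).X s.1.1 →ₗ[k] V.X s.1.2)
      ⟨(c, n), by omega⟩ ∘ₗ ((ψ.app x).f a).hom
  have hB (n : ℤ) (x : A.Obj) (a c : ℤ) (h : a + c = n) (m : (M.obj x).X a) (r : (P.obj x).X c) :
      B n x a c h m r = ap (K := P.obj x) (V := V) (((ψ.app x).f a).hom m) c n (by omega) r := rfl
  let Φ : tensorOver M P ⟶ V := tmHom B
    (fun n x y a b c ab cb hab hcb h m f r => by
      refine (hB n x ab c h _ r).trans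
        (Eq.trans ?_ (congrArg (_ • ·) (hB n y a cb (by omega) m _)).symm)
      exact (congrArg (fun z : Gr (P.obj x) V ab => ap z c n (by omega) r)
        (ψ.map_act hab m f)).trans (coindAct_apply P V hab _ f _ hcb r))
    fun n x a c h m r => by
      rw [hB n x a c h, hB (n + 1) x (a + 1) c (by omega), hB (n + 1) x a (c + 1) (by omega),
        ← d_f]
      have h3 : ap (K := P.obj x) (V := V) (((ihom (P.obj x) V).d a (a + 1)).hom
          (((ψ.app x).f a).hom m)) c (n + 1) (by omega) r =
          (V.d n (n + 1)).hom (ap (K := P.obj x) (V := V) (((ψ.app x).f a).hom m) c n (by omega) r)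
            - (-1 : k) ^ a • ap (K := P.obj x) (V := V) (((ψ.app x).f a).hom m) (c + 1) (n + 1)
              (by omega) (((P.obj x).d c (c + 1)).hom r) := by
        erw [ihom_d (K := P.obj x) (V := V)]
        exact grD_apply _ _ rfl rfl _
      exact eq_add_of_sub_eq h3.symm
  have hΦ (n : ℤ) (x : A.Obj) (a c : ℤ) (h : a + c = n) (m : (M.obj x).X a) (r : (P.obj x).X c) :
      (Φ.f n).hom (tm M P x h m r) = B n x a c h m r := by
    exact tmHom_tm B _ _ x h m r
  exact ⟨Φ, hom_ext_apply fun x a m => gr_ext (K := P.obj x) (V := V) fun c n h r =>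
    hΦ n x a c (by omega) m r⟩

lemma sharp_sub (Φ Ψ : tensorOver M P ⟶ V) : sharp (Φ - Ψ) = sharp Φ - sharp Ψ := rfl

lemma sharp_tensorMap {P' : DGModule A.op} (w : P ⟶ P') (Φ : tensorOver M P' ⟶ V) :
    sharp (tensorMap M w ≫ Φ) = sharp Φ ≫ coindPre V w := by
  refine hom_ext_apply fun x a m => gr_ext (K := P.obj x) (V := V) fun c n h r => ?_
  refine (congrArg (Φ.f n).hom (tensorMap_tm M w x _ m r)).trans ?_
  rfl

/-- The adjunction between `- ⊗_A P` and `Hom_k(P, -)` respects homotopies. As every morphism of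
complexes of vector spaces which vanishes on homology is null-homotopic, the homotopies of `Φ` may
be replaced by the vanishing of `Φ` on homology. -/
lemma nullHomotopic_sharp_iff (Φ : tensorOver M P ⟶ V) : NullHomotopic (sharp Φ) ↔ HZero Φ := by
  have e1 : (-1 : k) ^ (-1 : ℤ) = -1 := by simp
  constructor
  · rintro ⟨s, hs, hs'⟩
    -- A null-homotopy `s` of `sharp Φ` is balanced, hence descends to the map `T (m ⊗ r) = s(m)(r)` of
    -- degree `-1`.
    let B (n n' : ℤ) (hn : n' + 1 = n) (x : A.Obj) (a c : ℤ) (h : a + c = n) :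
        (M.obj x).X a →ₗ[k] (P.obj x).X c →ₗ[k] V.X n' :=
      LinearMap.proj (φ := fun s : {s : ℤ × ℤ // s.1 + (a - 1) = s.2} =>
        (P.obj x).X s.1.1 →ₗ[k] V.X s.1.2) ⟨(c, n'), by omega⟩ ∘ₗ s x a (a - 1) (sub_add_cancel a 1)
    have hB (n n' : ℤ) (hn : n' + 1 = n) (x : A.Obj) (a c a' : ℤ) (h : a + c = n) (ha : a' + 1 = a)
        (m : (M.obj x).X a) (r : (P.obj x).X c) : B n n' hn x a c h m r =
          ap (K := P.obj x) (V := V) (s x a a' ha m) c n' (by omega) r := by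
      obtain rfl : a' = a - 1 := by omega
      rfl
    let T (n n' : ℤ) (hn : n' + 1 = n) : (tensorOver M P).X n →ₗ[k] V.X n' :=
      tmLift (B n n' hn) fun x y a b c ab cb hab hcb h m f r => by
        rw [hB n n' hn x ab c (ab - 1) h (by omega), hs x y a (a - 1) b ab (ab - 1) (by omega)
          (by omega) hab, hB n n' hn y a cb (a - 1) (by omega) (by omega)]
        exact coindAct_apply P V (show a - 1 + b = ab - 1 by omega) _ f _ hcb r
    have hT (n n' : ℤ) (hn : n' + 1 = n) (x : A.Obj) (a c a' : ℤ) (h : a + c = n) (ha : a' + 1 = a)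
        (m : (M.obj x).X a) (r : (P.obj x).X c) : T n n' hn (tm M P x h m r) =
          ap (K := P.obj x) (V := V) (s x a a' ha m) c n' (by omega) r :=
      (tmLift_tm (B n n' hn) _ x h m r).trans (hB n n' hn x a c a' h ha m r)
    have key (n : ℤ) (t : (tensorOver M P).X n) : (Φ.f n).hom t =
        (V.d (n - 1) n).hom (T n (n - 1) (by omega) t) +
          T (n + 1) n rfl (((tensorOver M P).d n (n + 1)).hom t) := by
      refine LinearMap.congr_fun (tm_ext (M := M) (P := P) (f := (Φ.f n).hom) (g := (V.d (n - 1) n).hom ∘ₗ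
        T n (n - 1) (by omega) + T (n + 1) n rfl ∘ₗ ((tensorOver M P).d n (n + 1)).hom)
        fun x a c h m r => ?_) t
      rw [LinearMap.add_apply, LinearMap.comp_apply, LinearMap.comp_apply, tm_d x h rfl rfl rfl,
        map_add, map_smul, hT n (n - 1) (by omega) x a c (a - 1) h (by omega),
        hT (n + 1) n rfl x (a + 1) c a (by omega) rfl,
        hT (n + 1) n rfl x a (c + 1) (a - 1) (by omega) (by omega)]
      have h1 := congrArg (fun φ : Gr (P.obj x) V a => ap φ c n (by omega) r)
        (hs' x a m)
      refine (sharp_apply Φ x (by omega) m r).symm.trans (h1.trans ?_)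
      have h2 : ((ihom (P.obj x) V).d (a - 1) a).hom (s x a (a - 1) (by omega) m) ∈
        Bc (ihom (P.obj x) V) a := ⟨_, rfl⟩
      have h3 (a' : ℤ) (ha : a' + 1 = a) (φ : Gr (P.obj x) V a') : ap (K := P.obj x) (V := V)
          (((ihom (P.obj x) V).d a' a).hom φ) c n (by omega) r =
          (V.d (n - 1) n).hom (ap φ c (n - 1) (by omega) r) -
          (-1 : k) ^ a' • ap φ (c + 1) n (by omega) (((P.obj x).d c (c + 1)).hom r) := by
        subst ha
        erw [ihom_d (K := P.obj x) (V := V)]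
        exact grD_apply _ _ (by omega) rfl _
      refine (congrArg (· + _) (h3 (a - 1) (by omega) _)).trans ?_
      rw [sgn_pred, neg_smul, sub_neg_eq_add, add_assoc, add_comm (_ • _)]
    intro n t ht
    rw [key, mem_Zc.1 ht, map_zero, add_zero]
    exact d_mem_Bc _
  · intro hΦ
    obtain ⟨ψ, hψ⟩ := (ihom_mem_Bc (show (-1 : ℤ) + 1 = 0 by omega)).1 (toGr_mem_Bc hΦ)
    have hψ' (n n' n'' : ℤ) (h' : n' + 1 = n) (h'' : n + 1 = n'') (t : (tensorOver M P).X n) :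
        (Φ.f n).hom t = (V.d n' n).hom (ap ψ n n' (by omega) t) +
          ap ψ n'' n (by omega) (((tensorOver M P).d n n'').hom t) := by
      have := hψ n n n'' n' (add_zero n) h'' h' t
      rw [ap_toGr, e1, neg_smul, one_smul, sub_neg_eq_add] at this
      exact this
    -- Conversely a homotopy `ψ` of `Φ` gives `m ↦ (r ↦ ψ(m ⊗ r))`.
    let s (x : A.Obj) (p q : ℤ) (h : q + 1 = p) : (M.obj x).X p →ₗ[k] Gr (P.obj x) V q :=
      LinearMap.pi fun t => (tm M P x (add_comm p t.1.1)).compr₂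
        (ap ψ (t.1.1 + p) t.1.2 (by have := t.2; omega))
    have hs (x : A.Obj) (p q : ℤ) (h : q + 1 = p) (m : (M.obj x).X p) (c n i : ℤ) (hc : c + q = n)
        (hi : p + c = i) (r : (P.obj x).X c) :
        ap (s x p q h m) c n hc r = ap ψ i n (by omega) (tm M P x hi m r) := by
      obtain rfl : i = c + p := by omega
      rfl
    refine ⟨s, fun x y p q b p' q' h h' hp m f => gr_ext (K := P.obj x) (V := V)
      fun c n hc r => ?_, fun x p m => gr_ext (K := P.obj x) (V := V) fun c n hc r => ?_⟩
    · refine (hs x p' q' h' _ c n (p' + c) hc rfl r).trans ?_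
      refine Eq.trans ?_ (coindAct_apply P V (show q + b = q' by omega) _ f hc rfl r).symm
      rw [hs y p q h m (c + b) n (p' + c) (by omega) (by omega), tm_act hp rfl, map_smul]
    · refine (sharp_apply Φ x hc m r).trans ?_
      rw [hψ' n (n - 1) (n + 1) (by omega) rfl, tm_d x _ rfl rfl rfl, map_add, map_smul]
      have h3 (a' : ℤ) (ha : a' + 1 = p) (φ : Gr (P.obj x) V a') : ap (K := P.obj x) (V := V)
          (((ihom (P.obj x) V).d a' p).hom φ) c n (by omega) r =
          (V.d (n - 1) n).hom (ap φ c (n - 1) (by omega) r) -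
          (-1 : k) ^ a' • ap φ (c + 1) n (by omega) (((P.obj x).d c (c + 1)).hom r) := by
        subst ha
        erw [ihom_d (K := P.obj x) (V := V)]
        exact grD_apply _ _ (by omega) rfl _
      refine Eq.trans ?_ (congrArg₂ (· + ·) (h3 (p - 1) (by omega) _).symm
        (hs x (p + 1) p rfl _ c n (n + 1) hc (by omega) r).symm)
      rw [hs x p (p - 1) (by omega) m c (n - 1) n (by omega) (by omega),
        hs x p (p - 1) (by omega) m (c + 1) n (n + 1) (by omega) (by omega), sgn_pred, neg_smul, sub_neg_eq_add]
      exact (add_assoc _ _ _).symm.trans (add_right_comm _ _ _)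

end Coind

/-- Homotopically projective dg modules are flat. -/
lemma IsHProjective.quasiIso_tensorMap {M : DGModule A} (hM : M.IsHProjective)
    {P P' : DGModule A.op} (w : P ⟶ P') (hw : qis A.op w) : QuasiIso (tensorMap M w) := by
  have hq (V : Cx k) : qis A (coindPre V w) := fun x => quasiIso_ihomPre (w.app x) (hw x) V
  -- By adjunction this is the lifting property of `M` along `Hom_k(P', V) ⟶ Hom_k(P, V)`.
  refine quasiIso_of_yoneda _ (fun V g hg => ?_) fun V g => ?_
  · rw [← nullHomotopic_sharp_iff, sharp_tensorMap] at hg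
    rw [← nullHomotopic_sharp_iff]
    exact hM.nullHomotopic_of_comp _ (hq V) _ hg
  · obtain ⟨ψ, hψ⟩ := hM.exists_lift _ (hq V) (sharp g)
    obtain ⟨Φ, rfl⟩ := exists_sharp_eq ψ
    refine ⟨Φ, ?_⟩
    rwa [← nullHomotopic_sharp_iff, sharp_sub, sharp_tensorMap]

/-- If `P` is pointwise perfect, then `Hom_k(P, -)` preserves direct sums up to
quasi-isomorphism. -/
lemma qis_coind_sum (P : DGModule A.op) (hP : ∀ x, Perf (P.obj x)) {J : Type u} (V : J → Cx k) :
    qis A (desc (fun j => coind P (V j)) fun j => coindMap P (sumι V j)) :=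
  fun x => (hP x).quasiIso_ihom_sum V

/-- The tensor product of a compact dg module with a pointwise perfect one is perfect. -/
lemma perf_tensorOver [HasDerivedCategory.{w} (ModuleCat.{u} k)] {M : DGModule A}
    (hM : M.IsHProjective) (hc : M.IsCompact) (P : DGModule A.op) (hP : ∀ x, Perf (P.obj x)) :
    Perf (tensorOver M P) := by
  -- A morphism `M ⊗ P ⟶ ⨁ V` corresponds to `M ⟶ Hom_k(P, ⨁ V)`, which lifts to `⨁ Hom_k(P, V)` as
  -- `P` is pointwise perfect, and then to a finite subsum as `M` is compact.
  refine perf_of_isCompactObject (isCompactObject_derivedQ_iff.2 fun J V f => ?_)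
  let c := desc (fun j => coind P (V j)) fun j => coindMap P (sumι V j)
  have hcq : qis A c := qis_coind_sum P hP V
  have hcπ (j : J) : c ≫ coindMap P (sumπ V j) = prj (fun j => coind P (V j)) j := by
    refine sum_hom_ext _ fun i => ?_
    rw [← Category.assoc, inj_desc, ← coindMap_comp]
    by_cases h : i = j
    · subst h
      rw [sumι_sumπ, inj_prj, coindMap_id]
    · rw [sumι_sumπ_ne V h, inj_prj_ne _ h, coindMap_zero]
  obtain ⟨g, hg⟩ := hM.exists_lift c hcq (sharp f)
  obtain ⟨F, hF⟩ := isCompact_iff.1 hc J _ (D.Q.map g)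
  refine ⟨F, ?_⟩
  have h1 : D.Q.map (sharp f) = D.Q.map g ≫ D.Q.map c := by
    rw [← D.Q.map_comp, ← sub_eq_zero, ← D.Q.map_sub]
    exact Q_map_eq_zero hg
  rw [← nullHomotopic_sharp_iff, sharp_sub]
  have h2 : sharp (∑ j ∈ F, f ≫ sumπ V j ≫ sumι V j) =
      ∑ j ∈ F, sharp f ≫ coindMap P (sumπ V j) ≫ coindMap P (sumι V j) := by
    let sh : (tensorOver M P ⟶ sumC V) →+ (M ⟶ coind P (sumC V)) :=
      AddMonoidHom.mk' sharp fun _ _ => rfl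
    exact map_sum sh _ _
  rw [h2, ← hM.Q_map_eq_zero_iff, D.Q.map_sub, sub_eq_zero, D.Q.map_sum]
  simp only [D.Q.map_comp]
  simp only [h1]
  nth_rewrite 1 [hF]
  rw [Preadditive.sum_comp]
  refine Finset.sum_congr rfl fun j _ => ?_
  rw [Category.assoc, Category.assoc, Category.assoc, ← D.Q.map_comp (inj _ j), inj_desc, ← hcπ,
    D.Q.map_comp, Category.assoc]

/-! ### The co-Yoneda isomorphism -/

section CoYoneda

variable (N : DGModule A) (y : A.Obj)

/-- The morphism `m ⊗ a ↦ m · a` from `N ⊗_A A(y, -)` to `N(y)`. -/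
def evalRep : tensorOver N (rep (A := A.op) y) ⟶ N.obj y :=
  tmHom (P := rep (A := A.op) y) (fun n x a c h => N.act (x := y) (y := x) h)
    (fun n x x' a b c ab cb hab hcb h m f r => by
      change _ = _ • N.act _ m ((-1 : k) ^ (c * b) • A.comp _ f r)
      rw [map_smul, smul_smul, mul_comm c b, sgn_mul_self, one_smul]
      exact N.act_comp hab _ h _ m f r)
    fun n x a c h m r => N.d_act h m r

lemma evalRep_tm {x : A.Obj} {a c n : ℤ} (h : a + c = n) (m : (N.obj x).X a)
    (r : (A.Hom y x).X c) :
    ((evalRep N y).f n).hom (tm N (rep (A := A.op) y) x h m r) = N.act h m r :=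
  tmHom_tm (P := rep (A := A.op) y) _ _ _ x h m r

/-- The co-Yoneda isomorphism `N ⊗_A A(y, -) ≅ N(y)`, with inverse `m ↦ m ⊗ 1`. -/
lemma quasiIso_evalRep : QuasiIso (evalRep N y) := by
  let P := rep (A := A.op) y
  let g : N.obj y ⟶ tensorOver N P :=
    mkHom (fun n => (tm N P y (add_zero n)).flip (A.id y)) fun n m => by
      refine (tm_d (P := P) y (add_zero n) rfl (zero_add 1) rfl m (A.id y)).trans ?_
      have : ((P.obj y).d 0 1).hom (A.id y) = 0 := A.d_id y
      rw [this, map_zero, smul_zero]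
      exact add_zero _
  have h1 : evalRep N y ≫ g = 𝟙 _ := by
    ext n : 2
    refine tm_ext fun x a c h m r => ?_
    refine (congrArg (g.f n).hom (evalRep_tm N y h m r)).trans ?_
    refine (tm_act (P := P) h (zero_add c) _ m r (A.id y)).trans ?_
    rw [mul_zero, zpow_zero, one_smul]
    exact congrArg (tm N P x h m) (A.op.id_comp (x := x) (y := y) r)
  have h2 : g ≫ evalRep N y = 𝟙 _ := by
    ext n m
    exact (evalRep_tm N y _ m _).trans (N.act_id m)
  have : IsIso (evalRep N y) := ⟨g, h1, h2⟩
  infer_instance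

end CoYoneda

/-- The values of a compact dg module over a proper dg category are perfect. -/
lemma IsCompact.perf [HasDerivedCategory.{w} (ModuleCat.{u} k)] {M : DGModule A}
    (hM : M.IsCompact) (hp : A.IsProper) (y : A.Obj) : Perf (M.obj y) := by
  -- `M(y)` is `M ⊗ A(y, -)` for a resolution of `M`, and `A(y, -)` has perfect values.
  obtain ⟨R⟩ := nonempty_resolution M
  have h1 : R.Q.IsCompact := (isCompact_iff_of_qis R.π R.qis).2 hM
  have h2 := perf_tensorOver R.isHProjective h1 (rep (A := A.op) y) fun x => hp y x
  rw [← Perf.of_quasiIso (R.π.app y) (R.qis y), ← Perf.of_quasiIso _ (quasiIso_evalRep R.Q y)]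
  exact h2

end DGModule

end DG

namespace DG

variable {k : Type u} [Field k]

/-! ### Bimodules -/

namespace DGCat

section

variable {A B : DGCat k}

/-- The map `f ↦ f ⊗ 1`. -/
def incL (z : B.Obj) {x x' : A.Obj} {q : ℤ} :
    (A.Hom x x').X q →ₗ[k] TensX (A := A) (B := B) (x, z) (x', z) q :=
  (tens (A := A) (B := B) (a := (x, z)) (b := (x', z)) (add_zero q)).flip (B.id z)

/-- The map `g ↦ 1 ⊗ g`. -/
def incR (x : A.Obj) {z z' : B.Obj} {q : ℤ} :
    (B.Hom z z').X q →ₗ[k] TensX (A := A) (B := B) (x, z) (x, z') q :=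
  tens (A := A) (B := B) (a := (x, z)) (b := (x, z')) (zero_add q) (A.id x)

lemma incL_comp (z : B.Obj) {x y w : A.Obj} {p q n : ℤ} (h : p + q = n) (f : (A.Hom y w).X p)
    (g : (A.Hom x y).X q) :
    (tensor A B).comp h (incL z f) (incL z g) = incL (B := B) z (A.comp h f g) := by
  refine (tensorComp_tens (A := A) (B := B) (a := (x, z)) (b := (y, z)) (c := (w, z))
    h (add_zero p) f (B.id z) (add_zero q) g (B.id z) h
    (add_zero 0)).trans ?_
  rw [zero_mul, zpow_zero, one_smul, B.comp_id]
  rfl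

lemma incR_comp (x : A.Obj) {y z w : B.Obj} {p q n : ℤ} (h : p + q = n) (f : (B.Hom z w).X p)
    (g : (B.Hom y z).X q) :
    (tensor A B).comp h (incR x f) (incR x g) = incR (A := A) x (B.comp h f g) := by
  refine (tensorComp_tens (A := A) (B := B) (a := (x, y)) (b := (x, z)) (c := (x, w))
    h (zero_add p) (A.id x) f (zero_add q) (A.id x) g
    (add_zero 0) h).trans ?_
  rw [mul_zero, zpow_zero, one_smul, A.comp_id]
  rfl

lemma incL_incR {x x' : A.Obj} {z z' : B.Obj} {p q n : ℤ} (h : p + q = n) (f : (A.Hom x x').X p)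
    (g : (B.Hom z z').X q) :
    (tensor A B).comp h (incL z' f) (incR x g) =
      tens (A := A) (B := B) (a := (x, z)) (b := (x', z')) h f g := by
  refine (tensorComp_tens (A := A) (B := B) (a := (x, z)) (b := (x, z')) (c := (x', z'))
    h (add_zero p) f (B.id z') (zero_add q) (A.id x) g
    (add_zero p) (zero_add q)).trans ?_
  rw [zero_mul, zpow_zero, one_smul, B.id_comp, A.comp_id]

lemma incR_incL {x x' : A.Obj} {z z' : B.Obj} {p q n : ℤ} (h : q + p = n) (h' : p + q = n)
    (f : (A.Hom x x').X p) (g : (B.Hom z z').X q) :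
    (tensor A B).comp h (incR x' g) (incL z f) = (-1 : k) ^ (p * q) •
      (tensor A B).comp h' (incL z' f) (incR x g) := by
  rw [incL_incR]
  refine (tensorComp_tens (A := A) (B := B) (a := (x, z)) (b := (x', z)) (c := (x', z'))
    h (zero_add q) (A.id x') g (add_zero p) f (B.id z)
    (zero_add p) (add_zero q)).trans ?_
  rw [B.comp_id, A.id_comp, mul_comm]
  rfl

lemma d_incL (z : B.Obj) {x x' : A.Obj} {q : ℤ} (f : (A.Hom x x').X q) :
    (((tensor A B).Hom (x, z) (x', z)).d q (q + 1)).hom (incL z f) =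
      incL (B := B) z (((A.Hom x x').d q (q + 1)).hom f) := by
  refine (tensorD_tmk (fun _ : PUnit.{u + 1} => A.Hom x x') (fun _ => B.Hom z z)
    PUnit.unit rfl (add_zero q) f (B.id z)).trans ?_
  have := B.d_id z
  erw [this]
  rw [map_zero, smul_zero, add_zero]
  rfl

lemma d_incR (x : A.Obj) {z z' : B.Obj} {q : ℤ} (g : (B.Hom z z').X q) :
    (((tensor A B).Hom (x, z) (x, z')).d q (q + 1)).hom (incR x g) =
      incR (A := A) x (((B.Hom z z').d q (q + 1)).hom g) := by
  refine (tensorD_tmk (fun _ : PUnit.{u + 1} => A.Hom x x) (fun _ => B.Hom z z')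
    PUnit.unit rfl (zero_add q) (A.id x) g).trans ?_
  have := A.d_id x
  erw [this]
  rw [map_zero, LinearMap.zero_apply, zero_add, zpow_zero, one_smul]
  rfl

lemma op_op_comp (A : DGCat k) {x y z : A.Obj} {p q n : ℤ} (h : p + q = n)
    (f : (A.Hom y z).X p) (g : (A.Hom x y).X q) : A.op.op.comp h f g = A.comp h f g := by
  change (-1 : k) ^ (p * q) • (-1 : k) ^ (q * p) • A.comp h f g = _
  rw [smul_smul, mul_comm q p, sgn_mul_self, one_smul]

end

end DGCat

namespace DGModule

open DGCat

section Bimodules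

variable {A B : DGCat k}

/-- The data of a family of dg `A`-modules `X(z)` with an action of `B` in the variable `z` which
commutes with the action of `A` in the graded sense. -/
structure BimoduleData (A B : DGCat k) where
  X : B.Obj → DGModule A
  R {x : A.Obj} {z z' : B.Obj} {p q n : ℤ} (h : p + q = n) :
    ((X z').obj x).X p →ₗ[k] (B.Hom z z').X q →ₗ[k] ((X z).obj x).X n
  R_id {x : A.Obj} {z : B.Obj} {p : ℤ} (m : ((X z).obj x).X p) : R (add_zero p) m (B.id z) = m
  R_comp {a : A.Obj} {x y z : B.Obj} {p q r s t n : ℤ} (hs : p + q = s) (ht : q + r = t)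
    (h : s + r = n) (h' : p + t = n)
    (m : ((X z).obj a).X p) (f : (B.Hom y z).X q) (g : (B.Hom x y).X r) :
    R h (R hs m f) g = R h' m (B.comp ht f g)
  d_R {a : A.Obj} {x y : B.Obj} {p q n : ℤ} (h : p + q = n)
    (m : ((X y).obj a).X p) (f : (B.Hom x y).X q) :
    (((X x).obj a).d n (n + 1)).hom (R h m f) =
      R (show p + 1 + q = n + 1 by omega) ((((X y).obj a).d p (p + 1)).hom m) f +
        (-1 : k) ^ p •
          R (show p + (q + 1) = n + 1 by omega) m (((B.Hom x y).d q (q + 1)).hom f)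
  act_R {x x' : A.Obj} {z z' : B.Obj} {p q r s t n : ℤ} (hs : p + q = s) (ht : p + r = t)
    (h : s + r = n) (h' : t + q = n) (m : ((X z').obj x').X p) (f : (A.Hom x x').X q)
    (g : (B.Hom z z').X r) :
    (X z).act h' (R ht m g) f = (-1 : k) ^ (q * r) • R h ((X z').act hs m f) g

namespace BimoduleData

variable (D : BimoduleData A B)

/-- The map `f ⊗ g ↦ m · (f ⊗ g) = (m · f) · g`. -/
def act₁ {a b : A.Obj × B.Obj} {p q n : ℤ} (h : p + q = n) (m : ((D.X b.2).obj b.1).X p) :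
    TensX (A := A) (B := B) a b q →ₗ[k] ((D.X a.2).obj a.1).X n :=
  tlift fun _ q₁ q₂ h' => (D.R (show (p + q₁) + q₂ = n by omega)).comp ((D.X b.2).act rfl m)

lemma act₁_tens {a b : A.Obj × B.Obj} {p q n q₁ q₂ r : ℤ} (h : p + q = n) (h' : q₁ + q₂ = q)
    (hr : p + q₁ = r) (m : ((D.X b.2).obj b.1).X p) (f : (A.Hom a.1 b.1).X q₁)
    (g : (B.Hom a.2 b.2).X q₂) :
    D.act₁ h m (tens h' f g) = D.R (show r + q₂ = n by omega) ((D.X b.2).act hr m f) g := by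
  subst hr
  rw [act₁, tlift_tmk]
  rfl

/-- The action of `A ⊗ B`. -/
def act {a b : A.Obj × B.Obj} {p q n : ℤ} (h : p + q = n) : ((D.X b.2).obj b.1).X p →ₗ[k]
    TensX (A := A) (B := B) a b q →ₗ[k] ((D.X a.2).obj a.1).X n where
  toFun m := D.act₁ h m
  map_add' m m' := tens_ext fun q₁ q₂ h' f g => by
    rw [LinearMap.add_apply, act₁_tens _ h h' rfl, act₁_tens _ h h' rfl, act₁_tens _ h h' rfl]
    simp only [map_add, LinearMap.add_apply]
  map_smul' c m := tens_ext fun q₁ q₂ h' f g => by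
    rw [LinearMap.smul_apply, act₁_tens _ h h' rfl, act₁_tens _ h h' rfl]
    simp only [map_smul, LinearMap.smul_apply, RingHom.id_apply]

lemma act_tens {a b : A.Obj × B.Obj} {p q n q₁ q₂ r : ℤ} (h : p + q = n) (h' : q₁ + q₂ = q)
    (hr : p + q₁ = r) (m : ((D.X b.2).obj b.1).X p) (f : (A.Hom a.1 b.1).X q₁)
    (g : (B.Hom a.2 b.2).X q₂) :
    D.act h m (tens h' f g) = D.R (show r + q₂ = n by omega) ((D.X b.2).act hr m f) g :=
  D.act₁_tens h h' hr m f g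

lemma act_comp {x y z : A.Obj × B.Obj} {p q r s t n : ℤ} (hs : p + q = s)
    (ht : q + r = t) (h : s + r = n) (h' : p + t = n) (m : ((D.X z.2).obj z.1).X p)
    (f : TensX (A := A) (B := B) y z q) (g : TensX (A := A) (B := B) x y r) :
    D.act h (D.act hs m f) g = D.act h' m (tensorComp ht f g) := by
  induction f using tens_ind with
  | h0 => simp
  | hadd f f' hf hf' => simp only [map_add, LinearMap.add_apply, hf, hf']
  | h q₁ q₂ hq f₁ f₂ =>
  induction g using tens_ind with
  | h0 => simp
  | hadd f f' hf hf' => simp only [map_add, hf, hf']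
  | h r₁ r₂ hr g₁ g₂ =>
  rw [D.act_tens hs hq rfl, tensorComp_tens ht hq f₁ f₂ hr g₁ g₂ rfl rfl, map_smul,
    D.act_tens h hr rfl,
    D.act_tens h' _ (show p + (q₁ + r₁) = p + q₁ + r₁ by omega),
    D.act_R (show p + q₁ + r₁ = p + q₁ + r₁ from rfl) _ (show p + q₁ + r₁ + q₂ = s + r₁ by omega),
    map_smul, LinearMap.smul_apply, (D.X z.2).act_comp rfl rfl _ (add_assoc p q₁ r₁).symm,
    mul_comm q₂ r₁]
  exact congrArg (fun v => (-1 : k) ^ (r₁ * q₂) • v) (D.R_comp (a := x.1) (x := x.2) (y := y.2)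
    (z := z.2) (show p + q₁ + r₁ + q₂ = s + r₁ by omega) rfl (show s + r₁ + r₂ = n by omega)
    (show p + q₁ + r₁ + (q₂ + r₂) = n by omega) _ f₂ g₂)

lemma d_act {x y : A.Obj × B.Obj} {p q n : ℤ} (h : p + q = n)
    (m : ((D.X y.2).obj y.1).X p) (f : TensX (A := A) (B := B) x y q) :
    (((D.X x.2).obj x.1).d n (n + 1)).hom (D.act h m f) =
      D.act (show p + 1 + q = n + 1 by omega) ((((D.X y.2).obj y.1).d p (p + 1)).hom m) f +
        (-1 : k) ^ p • D.act (show p + (q + 1) = n + 1 by omega) m (tensorD _ _ q (q + 1) f) := by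
  induction f using tens_ind with
  | h0 => simp
  | hadd f f' hf hf' => simp only [map_add, hf, hf', smul_add]; abel
  | h q₁ q₂ hq f₁ f₂ =>
  rw [D.act_tens h hq rfl, tensorD_tmk _ _ _ rfl hq, map_add, map_smul,
    D.act_tens _ hq (show p + 1 + q₁ = p + q₁ + 1 by omega),
    D.act_tens _ _ (show p + (q₁ + 1) = p + q₁ + 1 by omega), D.act_tens _ _ rfl,
    D.d_R, (D.X y.2).d_act, map_add, map_smul, LinearMap.add_apply, LinearMap.smul_apply]
  simp only [smul_add, smul_smul, ← zpow_add₀ (show (-1 : k) ≠ 0 by simp), add_assoc]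

end BimoduleData

/-- The dg module over `A ⊗ B` given by two commuting actions. -/
abbrev bimodule (D : BimoduleData A B) : DGModule (tensor A B) where
  obj a := (D.X a.2).obj a.1
  act h := D.act h
  act_id {x p} m := by
    refine (D.act_tens (add_zero p) (add_zero 0) (add_zero p) m _ _).trans ?_
    rw [DGModule.act_id]
    exact D.R_id m
  act_comp hs ht h h' m f g := D.act_comp hs ht h h' m f g
  d_act h m f := D.d_act h m f

/-- The restriction of a bimodule to the first variable. -/
abbrev resL (X : DGModule (tensor A B)) (z : B.Obj) : DGModule A where
  obj x := X.obj (x, z)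
  act {x y p q n} h := (X.act (x := (x, z)) (y := (y, z)) h).compl₂ (incL z)
  act_id m := X.act_id m
  act_comp {x y w p q r s t n} hs ht h h' m f g := by
    refine (X.act_comp hs ht h h' m (incL z f) (incL z g)).trans ?_
    rw [incL_comp]
    rfl
  d_act {x y p q n} h m f := by
    refine (X.d_act h m (incL z f)).trans ?_
    rw [d_incL]
    rfl

end Bimodules

section Smooth

variable {A : DGCat k}

/-- A right dg `A`-module as a right dg module over `(Aᵒᵖ)ᵒᵖ`. -/
abbrev opop (N : DGModule A) : DGModule A.op.op where
  obj := N.obj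
  act h := N.act h
  act_id := N.act_id
  act_comp hs ht h h' m f g := by
    rw [op_op_comp]
    exact N.act_comp hs ht h h' m f g
  d_act := N.d_act

section

variable (N L : DGModule A)

/-- The action `(φ · g)(m) = (-1)^{|g||m|} φ(m) · g`. -/
def postAct {x z z' : A.Obj} {p q n : ℤ} (h : p + q = n) :
    Gr (N.obj x) (L.obj z') p →ₗ[k] (A.Hom z z').X q →ₗ[k] Gr (N.obj x) (L.obj z) n :=
  LinearMap.mk₂ k (fun φ g => grMk fun c e he => (-1 : k) ^ (q * c) •
      (L.act (show c + p + q = e by omega)).flip g ∘ₗ ap φ c (c + p) rfl)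
    (fun φ ψ f => gr_ext fun c e he r => by
      simp only [ap, grMk, Pi.add_apply, LinearMap.smul_apply, LinearMap.comp_apply,
        LinearMap.add_apply, smul_add, map_add])
    (fun s φ f => gr_ext fun c e he r => by
      simp only [ap, grMk, Pi.smul_apply, LinearMap.smul_apply, LinearMap.comp_apply, smul_comm s,
        map_smul])
    (fun φ f g => gr_ext fun c e he r => by
      simp only [ap, grMk, Pi.add_apply, LinearMap.smul_apply, LinearMap.comp_apply,
        LinearMap.add_apply, map_add, smul_add])
    (fun s φ f => gr_ext fun c e he r => by
      simp only [ap, grMk, Pi.smul_apply, LinearMap.smul_apply, LinearMap.comp_apply, map_smul,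
        smul_comm s])

lemma postAct_apply {x z z' : A.Obj} {p q n : ℤ} (h : p + q = n) (φ : Gr (N.obj x) (L.obj z') p)
    (g : (A.Hom z z').X q) {c e e' : ℤ} (he : c + n = e) (he' : c + p = e') (r : (N.obj x).X c) :
    ap (postAct N L h φ g) c e he r =
      (-1 : k) ^ (q * c) • L.act (show e' + q = e by omega) (ap φ c e' he' r) g := by
  subst he'; rfl

/-- The bimodule `Hom_k(N, L)`, `(x, z) ↦ Hom_k(N(x), L(z))`. -/
def homData : BimoduleData A.op A where
  X z := coind (A := A.op) (opop N) (L.obj z)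
  R {x z z' p q n} h := postAct N L (x := x) h
  R_id {x z p} φ := gr_ext (K := N.obj x) (V := L.obj z) fun c e he r => by
    refine (postAct_apply N L (add_zero p) φ (A.id z) he he r).trans ?_
    rw [L.act_id]
    simp
  R_comp {a x y z p q r s t n} hs ht h h' φ f g :=
    gr_ext (K := N.obj a) (V := L.obj x) fun c e he m => by
      refine (postAct_apply N L h _ g he rfl m).trans ?_
      refine (congrArg (fun z => _ • L.act _ z g)
        (postAct_apply N L hs φ f (show c + s = c + s from rfl) rfl m)).trans ?_
      refine Eq.trans ?_ (postAct_apply N L h' φ _ he rfl m).symm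
      rw [map_smul, LinearMap.smul_apply, L.act_comp _ ht _ (show c + p + t = e by omega),
        smul_smul, ← zpow_add₀ (by simp)]
      refine congrArg₂ _ (sgn_congr ⟨0, by rw [← ht]; ring⟩) rfl
  d_R {a x y p q n} h φ f := by
    refine (ihom_d (K := N.obj a) (V := L.obj x) _).trans
      (gr_ext (K := N.obj a) (V := L.obj x) fun c e he r => ?_)
    rw [grD_apply _ he (sub_add_cancel e 1) rfl]
    change _ = ap (postAct N L (x := a) _ (((ihom (N.obj a) (L.obj y)).d p (p + 1)).hom φ) f)
        c e he r +
      (-1 : k) ^ p • ap (postAct N L (x := a) _ φ (((A.Hom x y).d q (q + 1)).hom f)) c e he r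
    rw [postAct_apply N L (x := a) h φ f (show c + n = e - 1 by omega) (show c + p = c + p from rfl),
      postAct_apply N L (x := a) h φ f (show c + 1 + n = e by omega)
        (show c + 1 + p = c + p + 1 by omega),
      postAct_apply N L (x := a) _ _ f he (show c + (p + 1) = c + p + 1 by omega),
      postAct_apply N L (x := a) _ φ _ he (show c + p = c + p from rfl)]
    erw [ihom_d]
    rw [grD_apply φ _ (show c + p + 1 = c + p + 1 from rfl) rfl, map_smul,
      L.d_act' (p' := c + p + 1) _ rfl (sub_add_cancel e 1)]
    simp only [map_sub, map_smul, smul_sub, smul_add, smul_smul, LinearMap.sub_apply,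
      LinearMap.smul_apply, ← zpow_add₀ (show (-1 : k) ≠ 0 by simp)]
    rw [sgn_congr (k := k) (a := n + q * (c + 1)) (b := q * c + p) ⟨q, by rw [← h]; ring⟩,
      sgn_congr (k := k) (a := p + (q + 1) * c) (b := q * c + (c + p)) ⟨0, by ring⟩]
    abel
  act_R {x x' z z' p q r s t n} hs ht h h' φ f g :=
    gr_ext (K := N.obj x) (V := L.obj z) fun c e he m => by
      refine (coindAct_apply (A := A.op) (opop N) (L.obj z) h' _ f he rfl m).trans ?_
      refine (congrArg _ (postAct_apply N L ht φ g (show c + q + t = e by omega)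
        (show c + q + p = c + s by omega) _)).trans ?_
      refine Eq.trans ?_ (congrArg (fun v => (-1 : k) ^ (q * r) • v)
        (postAct_apply N L (x := x) h _ g he (show c + s = c + s from rfl) m).symm)
      rw [coindAct_apply (A := A.op) (opop N) (L.obj z') hs φ f (show c + s = c + s from rfl) rfl m,
        map_smul, LinearMap.smul_apply, smul_smul, smul_smul, smul_smul, ← zpow_add₀ (by simp),
        ← zpow_add₀ (by simp), ← zpow_add₀ (by simp)]
      refine congrArg₂ _ (sgn_congr ⟨0, by ring⟩) rfl

end

end Smooth

end DGModule

end DG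

namespace DG

variable {k : Type u} [Field k]

namespace DGModule

open DGCat

section

variable {A B : DGCat k}

/-- A family of morphisms of complexes which is compatible with both actions is a morphism of
bimodules. -/
def tensHom {X Y : DGModule (tensor A B)} (app : ∀ a, X.obj a ⟶ Y.obj a)
    (hL : ∀ (x x' : A.Obj) (z : B.Obj) (p q n : ℤ) (h : p + q = n) (m : (X.obj (x', z)).X p)
      (f : (A.Hom x x').X q), ((app (x, z)).f n).hom (X.act h m (incL z f)) =
        Y.act (x := (x, z)) (y := (x', z)) h (((app (x', z)).f p).hom m) (incL z f))
    (hR : ∀ (x : A.Obj) (z z' : B.Obj) (p q n : ℤ) (h : p + q = n) (m : (X.obj (x, z')).X p)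
      (g : (B.Hom z z').X q), ((app (x, z)).f n).hom (X.act h m (incR x g)) =
        Y.act (x := (x, z)) (y := (x, z')) h (((app (x, z')).f p).hom m) (incR x g)) :
    X ⟶ Y where
  app := app
  map_act {a b p q n} h m f := by
    refine LinearMap.congr_fun (f := ((app a).f n).hom ∘ₗ X.act h m)
      (g := Y.act h (((app b).f p).hom m)) (tens_ext (A := A) (B := B) (a := a) (b := b)
        fun q₁ q₂ hq f g => ?_) f
    have e := incL_incR (A := A) (B := B) (z := a.2) (z' := b.2) (x := a.1) (x' := b.1) hq f g
    refine Eq.trans (congrArg (fun v => ((app a).f n).hom (X.act h m v)) e.symm)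
      (Eq.trans ?_ (congrArg (Y.act h (((app b).f p).hom m)) e))
    refine (congrArg ((app a).f n).hom (X.act_comp (x := a) (y := (a.1, b.2)) (z := b) rfl hq
      (show p + q₁ + q₂ = n by omega) h m (incL b.2 f) (incR a.1 g)).symm).trans ?_
    refine (hR a.1 a.2 b.2 _ _ _ _ _ g).trans ?_
    refine (congrArg (fun v => Y.act (x := a) (y := (a.1, b.2)) _ v (incR a.1 g))
      (hL a.1 b.1 b.2 _ _ _ rfl m f)).trans ?_
    exact Y.act_comp (x := a) (y := (a.1, b.2)) (z := b) rfl hq _ h _ (incL b.2 f) (incR a.1 g)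

variable (D : BimoduleData A B)

lemma bimodule_act_incL {x x' : A.Obj} {z : B.Obj} {p q n : ℤ} (h : p + q = n)
    (m : ((D.X z).obj x').X p) (f : (A.Hom x x').X q) :
    (bimodule D).act (x := (x, z)) (y := (x', z)) h m (incL z f) = (D.X z).act h m f :=
  (D.act_tens (a := (x, z)) (b := (x', z)) h (add_zero q) h m f (B.id z)).trans (D.R_id _)

lemma bimodule_act_incR {x : A.Obj} {z z' : B.Obj} {p q n : ℤ} (h : p + q = n)
    (m : ((D.X z').obj x).X p) (g : (B.Hom z z').X q) :
    (bimodule D).act (x := (x, z)) (y := (x, z')) h m (incR x g) = D.R h m g := by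
  refine (D.act_tens (a := (x, z)) (b := (x, z')) h (zero_add q) (add_zero p) m (A.id x) g).trans ?_
  rw [DGModule.act_id]

end

section Smooth

variable {A : DGCat k}

section

lemma diag_act_incL (A : DGCat k) {x x' z : A.Obj} {p q n : ℤ} (h : p + q = n)
    (hn : q + p = n) (b : (A.Hom z x').X p) (f : (A.Hom x' x).X q) :
    A.diag.act (x := (x, z)) (y := (x', z)) h b (incL (A := A.op) (B := A) z f) =
      (-1 : k) ^ (p * q) • A.comp hn f b := by
  refine (diagAct_tens A (x := (x, z)) (y := (x', z)) h (add_zero q) (add_zero p) b f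
    (A.id z)).trans ?_
  rw [A.comp_id]

lemma diag_act_incR (A : DGCat k) {x z z' : A.Obj} {p q n : ℤ} (h : p + q = n)
    (b : (A.Hom z' x).X p) (g : (A.Hom z z').X q) :
    A.diag.act (x := (x, z)) (y := (x, z')) h b (incR (A := A.op) (B := A) x g) =
      A.comp h b g := by
  refine (diagAct_tens A (x := (x, z)) (y := (x, z')) h (zero_add q) h b (A.id x) g).trans ?_
  rw [mul_zero, zpow_zero, one_smul]
  exact A.id_comp _

/-- A morphism to the diagonal bimodule, restricted to the first variable. -/
def resDiag {X : DGModule (tensor A.op A)} (β : X ⟶ A.diag) (y : A.Obj) :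
    resL X y ⟶ rep (A := A.op) y where
  app x := β.app (x, y)
  map_act {x x' p q n} h m f := (β.map_act h m (incL y f)).trans
    (diag_act_incL A h (show q + p = n by omega) _ f)

/-- The morphism of bimodules `Hom_k(N, L) ⟶ Hom_k(N, L')` induced by `L ⟶ L'`. -/
def homMap (N : DGModule A) {L L' : DGModule A} (w : L ⟶ L') :
    bimodule (homData N L) ⟶ bimodule (homData N L') :=
  tensHom (fun a => ihomMap (N.obj a.1) (w.app a.2))
    (fun x x' z p q n h m f => by
      rw [bimodule_act_incL]
      refine Eq.trans ?_ (bimodule_act_incL (homData N L') h _ f).symm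
      exact (coindMap (A := A.op) (opop N) (w.app z)).map_act h m f)
    fun x z z' p q n h φ g => by
      rw [bimodule_act_incR]
      refine Eq.trans ?_ (bimodule_act_incR (homData N L') h _ g).symm
      refine gr_ext (K := N.obj x) (V := L'.obj z) fun c e he r => ?_
      refine (ihomMap_apply (N.obj x) (w.app z) _ c e he r).trans ?_
      refine (congrArg _ (postAct_apply N L h φ g he rfl r)).trans ?_
      refine Eq.trans ?_ (postAct_apply N L' h _ g he rfl r).symm
      rw [map_smul, w.map_act]
      rfl

lemma homMap_comp (N : DGModule A) {L L' L'' : DGModule A} (w : L ⟶ L') (w' : L' ⟶ L'') :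
    homMap N (w ≫ w') = homMap N w ≫ homMap N w' := rfl

/-- The map `b ↦ (m ↦ (-1)^{|b||m|} w(m · b))`. -/
def homSharpGr {N L : DGModule A} (w : N ⟶ L) (x z : A.Obj) (n : ℤ) :
    (A.Hom z x).X n →ₗ[k] Gr (N.obj x) (L.obj z) n :=
  LinearMap.pi fun s => (-1 : k) ^ (n * s.1.1) •
    ((N.act s.2).flip.compr₂ ((w.app z).f s.1.2).hom)

lemma homSharpGr_apply {N L : DGModule A} (w : N ⟶ L) (x z : A.Obj) {n c e : ℤ} (h : c + n = e)
    (b : (A.Hom z x).X n) (m : (N.obj x).X c) :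
    ap (homSharpGr w x z n b) c e h m =
      (-1 : k) ^ (n * c) • ((w.app z).f e).hom (N.act h m b) := rfl

lemma grD_homSharpGr {N L : DGModule A} (w : N ⟶ L) (x z : A.Obj) (n : ℤ) (b : (A.Hom z x).X n) :
    grD (N.obj x) (L.obj z) n (homSharpGr w x z n b) =
      homSharpGr w x z (n + 1) (((A.Hom z x).d n (n + 1)).hom b) := by
  refine gr_ext fun c e he m => ?_
  rw [grD_apply _ he (sub_add_cancel e 1) rfl, homSharpGr_apply, homSharpGr_apply,
    homSharpGr_apply, map_smul, d_f, N.d_act' (p' := c + 1) _ rfl (sub_add_cancel e 1), map_add,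
    map_smul]
  simp only [smul_add, smul_smul, ← zpow_add₀ (show (-1 : k) ≠ 0 by simp)]
  rw [sgn_congr (k := k) (a := n + n * (c + 1)) (b := n * c) ⟨n, by ring⟩,
    add_sub_cancel_left]
  refine congrArg₂ _ (sgn_congr ⟨0, by ring⟩) rfl

/-- The morphism of bimodules `A ⟶ Hom_k(N, L)` which corresponds to a morphism `w : N ⟶ L`, seen
as a morphism `N ⊗_A A ⟶ L`. -/
def homSharp {N L : DGModule A} (w : N ⟶ L) : A.diag ⟶ bimodule (homData N L) :=
  tensHom (fun a => mkHom (L := ihom (N.obj a.1) (L.obj a.2)) (homSharpGr w a.1 a.2) fun n b => by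
      exact (ihom_d (K := N.obj a.1) (V := L.obj a.2) _).trans (grD_homSharpGr w a.1 a.2 n b))
    (fun x x' z p q n h b f => by
      refine (congrArg (homSharpGr w x z n)
        (diag_act_incL A h (show q + p = n by omega) b f)).trans ?_
      refine Eq.trans ?_ (bimodule_act_incL (homData N L) h _ f).symm
      refine gr_ext (K := N.obj x) (V := L.obj z) fun c e he m => ?_
      refine (homSharpGr_apply w x z he _ m).trans ?_
      refine Eq.trans ?_ (coindAct_apply (A := A.op) (opop N) (L.obj z) h _ f he rfl m).symm
      refine Eq.trans ?_ (congrArg _ (homSharpGr_apply w x' z (show c + q + p = e by omega) b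
        _).symm)
      rw [N.act_comp rfl (show q + p = n by omega) _ he m f b, map_smul, map_smul, smul_smul,
        smul_smul, ← zpow_add₀ (by simp), ← zpow_add₀ (by simp)]
      refine congrArg₂ _ (sgn_congr ⟨0, by rw [← h]; ring⟩) rfl)
    fun x z z' p q n h b g => by
      refine (congrArg (homSharpGr w x z n) (diag_act_incR A h b g)).trans ?_
      refine Eq.trans ?_ (bimodule_act_incR (homData N L) h _ g).symm
      refine gr_ext (K := N.obj x) (V := L.obj z) fun c e he m => ?_
      refine (homSharpGr_apply w x z he _ m).trans ?_
      refine Eq.trans ?_ (postAct_apply N L h _ g he rfl m).symm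
      refine Eq.trans ?_ (congrArg (fun v => (-1 : k) ^ (q * c) • L.act _ v g)
        (homSharpGr_apply w x z' (show c + p = c + p from rfl) b m).symm)
      rw [← N.act_comp rfl h (show c + p + q = e by omega) he m b g, w.map_act, map_smul,
        LinearMap.smul_apply, smul_smul, ← zpow_add₀ (by simp)]
      refine congrArg₂ _ (sgn_congr ⟨0, by rw [← h]; ring⟩) rfl

lemma homSharp_apply {N L : DGModule A} (w : N ⟶ L) (x z : A.Obj) {n c e : ℤ} (h : c + n = e)
    (b : (A.Hom z x).X n) (m : (N.obj x).X c) :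
    ap (K := N.obj x) (V := L.obj z) ((((homSharp w).app (x, z)).f n).hom b) c e h m =
      (-1 : k) ^ (n * c) • ((w.app z).f e).hom (N.act h m b) := rfl

lemma homSharp_comp {N L L' : DGModule A} (w : N ⟶ L) (v : L ⟶ L') :
    homSharp (w ≫ v) = homSharp w ≫ homMap N v :=
  hom_ext_apply fun a _ _ => gr_ext (K := N.obj a.1) (V := L'.obj a.2) fun _ e _ _ =>
    (map_smul ((v.app a.2).f e).hom _ _).symm

lemma homSharp_sub {N L : DGModule A} (w v : N ⟶ L) :
    homSharp (w - v) = homSharp w - homSharp v :=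
  hom_ext_apply fun a _ _ => gr_ext (K := N.obj a.1) (V := L.obj a.2) fun _ _ _ _ =>
    smul_sub _ _ _

lemma homSharp_add {N L : DGModule A} (w v : N ⟶ L) :
    homSharp (w + v) = homSharp w + homSharp v :=
  hom_ext_apply fun a _ _ => gr_ext (K := N.obj a.1) (V := L.obj a.2) fun _ _ _ _ =>
    smul_add _ _ _

lemma qis_homMap_sum {N : DGModule A} (hN : ∀ x, Perf (N.obj x)) {J : Type u}
    (V : J → DGModule A) : qis (tensor A.op A)
      (desc (fun j => bimodule (homData N (V j))) fun j => homMap N (inj V j)) :=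
  fun a => (hN a.1).quasiIso_ihom_sum fun j => (V j).obj a.2

end

section

variable (N : DGModule A) (X : DGModule (tensor A.op A))

/-- The action `(m ⊗ r) · g = m ⊗ (r · (1 ⊗ g))` on `N ⊗_A X`. -/
def tensorBiAct₁ {y z : A.Obj} {p q n : ℤ} (h : p + q = n) (x : A.Obj) (a c : ℤ) (h' : a + c = p) :
    (N.obj x).X a →ₗ[k] (X.obj (x, z)).X c →ₗ[k] (A.Hom y z).X q →ₗ[k]
      (tensorOver N (resL X y)).X n :=
  LinearMap.mk₂ k (fun m r => tm N (resL X y) x (show a + (c + q) = n by omega) m ∘ₗ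
      X.act (x := (x, y)) (y := (x, z)) rfl r ∘ₗ incR (A := A.op) x)
    (fun m m' r => by ext; simp)
    (fun s m r => by ext; simp)
    (fun m r r' => by
      ext
      simp only [map_add]
      exact map_add (tm N (resL X y) x _ m) _ _)
    (fun s m r => by
      ext
      simp only [map_smul]
      exact map_smul (tm N (resL X y) x _ m) _ _)

lemma tensorBiAct₁_apply {y z : A.Obj} {p q n : ℤ} (h : p + q = n) (x : A.Obj) {a c c' : ℤ}
    (h' : a + c = p) (hc : c + q = c') (m : (N.obj x).X a) (r : (X.obj (x, z)).X c)
    (g : (A.Hom y z).X q) :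
    tensorBiAct₁ N X h x a c h' m r g = tm N (resL X y) x (show a + c' = n by omega) m
      (X.act (x := (x, y)) (y := (x, z)) hc r (incR (A := A.op) x g)) := by
  subst hc; rfl

/-- The action `(m ⊗ r) · g = m ⊗ (r · (1 ⊗ g))` on `N ⊗_A X`. -/
def tensorBiAct {y z : A.Obj} {p q n : ℤ} (h : p + q = n) :
    (tensorOver N (resL X z)).X p →ₗ[k] (A.Hom y z).X q →ₗ[k] (tensorOver N (resL X y)).X n :=
  tmLift (P := resL X z) (fun x a c h' => tensorBiAct₁ N X h x a c h')
    fun x x' a b c ab cb hab hcb h' m f r => LinearMap.ext fun g => by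
      rw [LinearMap.smul_apply, tensorBiAct₁_apply N X h x h' rfl]
      refine (tm_act (P := resL X y) hab (show c + q + b = cb + q by omega) _ m f _).trans ?_
      refine Eq.trans ?_ (congrArg (_ • ·) (tensorBiAct₁_apply N X h x' (show a + cb = p by omega)
        rfl m _ g).symm)
      have h1 := X.act_comp (x := (x', y)) (y := (x, y)) (z := (x, z)) rfl
        (show q + b = q + b from rfl) (show c + q + b = cb + q by omega)
        (show c + (q + b) = cb + q by omega) r (incR (A := A.op) x g) (incL (A := A.op) y f)
      have h2 := X.act_comp (x := (x', y)) (y := (x', z)) (z := (x, z)) hcb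
        (show b + q = q + b by omega) rfl
        (show c + (q + b) = cb + q by omega) r (incL (A := A.op) z f) (incR (A := A.op) x' g)
      rw [incR_incL (A := A.op) (B := A) rfl (show b + q = q + b by omega) f g, map_smul,
        ← h2] at h1
      refine (congrArg (fun v => _ • tm N (resL X y) x' _ m v) h1).trans ?_
      rw [map_smul, smul_smul, ← zpow_add₀ (by simp)]
      refine congrArg₂ _ (sgn_congr ⟨b * q, by ring⟩) rfl

lemma tensorBiAct_tm {y z : A.Obj} {p q n : ℤ} (h : p + q = n) (x : A.Obj) {a c c' : ℤ}
    (h' : a + c = p) (hc : c + q = c') (m : (N.obj x).X a) (r : (X.obj (x, z)).X c)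
    (g : (A.Hom y z).X q) :
    tensorBiAct N X h (tm N (resL X z) x h' m r) g = tm N (resL X y) x (show a + c' = n by omega) m
      (X.act (x := (x, y)) (y := (x, z)) hc r (incR (A := A.op) x g)) :=
  (LinearMap.congr_fun (tmLift_tm (P := resL X z) _ _ x h' m r) g).trans
    (tensorBiAct₁_apply N X h x h' hc m r g)

/-- The right dg `A`-module `N ⊗_A X`. -/
abbrev tensorBi : DGModule A where
  obj z := tensorOver N (resL X z)
  act h := tensorBiAct N X h
  act_id {z p} t := by
    refine LinearMap.congr_fun (f := (tensorBiAct N X (add_zero p)).flip (A.id z))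
      (g := LinearMap.id) (tm_ext (P := resL X z) fun x a c h m r => ?_) t
    rw [LinearMap.flip_apply, tensorBiAct_tm N X _ x h (add_zero c)]
    exact congrArg (tm N (resL X z) x h m) (X.act_id (x := (x, z)) r)
  act_comp {x y z p q r s t n} hs ht h h' v f g := by
    refine LinearMap.congr_fun (f := (tensorBiAct N X h).flip g ∘ₗ (tensorBiAct N X hs).flip f)
      (g := (tensorBiAct N X h').flip (A.comp ht f g))
      (tm_ext (P := resL X z) fun w a c h'' m b => ?_) v
    rw [LinearMap.comp_apply, LinearMap.flip_apply, LinearMap.flip_apply, LinearMap.flip_apply,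
      tensorBiAct_tm N X hs w h'' rfl, tensorBiAct_tm N X h w _ (show c + q + r = c + t by omega),
      tensorBiAct_tm N X h' w h'' rfl, ← incR_comp (A := A.op) (B := A) w ht]
    exact congrArg (tm N (resL X x) w _ m) (X.act_comp (x := (w, x)) (y := (w, y)) (z := (w, z))
      rfl ht _ rfl b (incR (A := A.op) w f) (incR (A := A.op) w g))
  d_act {y z p q n} h t g := by
    refine LinearMap.congr_fun
      (f := ((tensorOver N (resL X y)).d n (n + 1)).hom ∘ₗ (tensorBiAct N X h).flip g)
      (g := (tensorBiAct N X (show p + 1 + q = n + 1 by omega)).flip g ∘ₗ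
        ((tensorOver N (resL X z)).d p (p + 1)).hom + (-1 : k) ^ p •
          (tensorBiAct N X (show p + (q + 1) = n + 1 by omega)).flip
            (((A.Hom y z).d q (q + 1)).hom g))
      (tm_ext (P := resL X z) fun x a c h' m r => ?_) t
    rw [LinearMap.add_apply, LinearMap.smul_apply, LinearMap.comp_apply, LinearMap.comp_apply,
      LinearMap.flip_apply, LinearMap.flip_apply, LinearMap.flip_apply,
      tensorBiAct_tm N X h x h' rfl, tm_d (P := resL X z) x h' rfl rfl rfl,
      tm_d (P := resL X y) x _ rfl rfl rfl, map_add, map_smul, LinearMap.add_apply,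
      LinearMap.smul_apply, tensorBiAct_tm N X _ x _ rfl,
      tensorBiAct_tm N X _ x (show a + (c + 1) = p + 1 by omega)
        (show c + 1 + q = c + q + 1 by omega),
      tensorBiAct_tm N X _ x h' (show c + (q + 1) = c + q + 1 by omega)]
    have h1 := X.d_act (x := (x, y)) (y := (x, z)) rfl r (incR (A := A.op) x g)
    rw [d_incR (A := A.op) (B := A)] at h1
    refine (congrArg (fun v => _ + (-1 : k) ^ a • tm N (resL X y) x _ m v) h1).trans ?_
    rw [map_add, map_smul, smul_add, smul_smul, ← zpow_add₀ (by simp), h']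
    exact (add_assoc _ _ _).symm

end

section

variable (N : DGModule A) {X : DGModule (tensor A.op A)} (β : X ⟶ A.diag)

lemma tensorBiEval_tm {x z : A.Obj} {a c n : ℤ} (h : a + c = n) (m : (N.obj x).X a)
    (r : (X.obj (x, z)).X c) :
    ((tensorMap N (resDiag β z) ≫ evalRep N z).f n).hom (tm N (resL X z) x h m r) =
      N.act h m (((β.app (x, z)).f c).hom r) := by
  refine (congrArg ((evalRep N z).f n).hom (tensorMap_tm N (resDiag β z) x h m r)).trans ?_
  exact evalRep_tm N z h m _

/-- The morphism `N ⊗_A X ⟶ N`, `m ⊗ r ↦ m · β(r)`, for a morphism `β` from `X` to the diagonal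
bimodule. -/
def tensorBiEval : tensorBi N X ⟶ N where
  app z := tensorMap N (resDiag β z) ≫ evalRep N z
  map_act {y z p q n} h t g := by
    refine LinearMap.congr_fun
      (f := ((tensorMap N (resDiag β y) ≫ evalRep N y).f n).hom ∘ₗ (tensorBiAct N X h).flip g)
      (g := (N.act h).flip g ∘ₗ ((tensorMap N (resDiag β z) ≫ evalRep N z).f p).hom)
      (tm_ext (P := resL X z) fun x a c h' m r => ?_) t
    rw [LinearMap.comp_apply, LinearMap.comp_apply, LinearMap.flip_apply, LinearMap.flip_apply,
      tensorBiAct_tm N X h x h' rfl, tensorBiEval_tm, tensorBiEval_tm]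
    have h1 := (β.map_act (x := (x, y)) (y := (x, z)) rfl r (incR (A := A.op) x g)).trans
      (diag_act_incR A rfl _ g)
    refine (congrArg (N.act _ m) h1).trans ?_
    exact (N.act_comp h' rfl h _ m _ g).symm

variable {N β}

/-- For `X` a resolution of the diagonal bimodule, `N ⊗_A X` resolves `N`. -/
lemma qis_tensorBiEval (hN : N.IsHProjective) (hβ : qis (tensor A.op A) β) :
    qis A (tensorBiEval N β) := fun z => by
  have h1 : QuasiIso (tensorMap N (resDiag β z)) :=
    hN.quasiIso_tensorMap _ fun x => hβ (x, z)
  have h2 := quasiIso_evalRep N z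
  change QuasiIso (tensorMap N (resDiag β z) ≫ evalRep N z)
  infer_instance

/-- If the composition of `X ⟶ A` with the morphism `A ⟶ Hom_k(N, L)` corresponding to `w` is
null-homotopic, then so is `N ⊗_A X ⟶ N ⟶ L`: a homotopy `s` of the former induces the homotopy
`m ⊗ r ↦ (-1)^{|m||r|} s(r)(m)` of the latter. -/
lemma nullHomotopic_tensorBiEval_comp {L : DGModule A} {w : N ⟶ L}
    (h : NullHomotopic (β ≫ homSharp w)) : NullHomotopic (tensorBiEval N β ≫ w) := by
  obtain ⟨s, hs, hs'⟩ := h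
  let T (z : A.Obj) (p q : ℤ) (h : q + 1 = p) (x : A.Obj) (a c : ℤ) (h' : a + c = p) :
      (N.obj x).X a →ₗ[k] (X.obj (x, z)).X c →ₗ[k] (L.obj z).X q :=
    (-1 : k) ^ (a * c) • (LinearMap.proj (φ := fun s : {s : ℤ × ℤ // s.1 + (c - 1) = s.2} =>
        (N.obj x).X s.1.1 →ₗ[k] (L.obj z).X s.1.2) ⟨(a, q), by omega⟩ ∘ₗ
          s (x, z) c (c - 1) (sub_add_cancel c 1)).flip
  have hT (z : A.Obj) (p q : ℤ) (h : q + 1 = p) (x : A.Obj) (a c c' : ℤ) (h' : a + c = p)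
      (hc : c' + 1 = c) (m : (N.obj x).X a) (r : (X.obj (x, z)).X c) : T z p q h x a c h' m r =
        (-1 : k) ^ (a * c) • ap (K := N.obj x) (V := L.obj z) (s (x, z) c c' hc r) a q
          (by omega) m := by
    obtain rfl : c' = c - 1 := by omega
    rfl
  have hb (z : A.Obj) (p q : ℤ) (h : q + 1 = p) (x y : A.Obj) (a b c ab cb : ℤ) (hab : a + b = ab)
      (hcb : c + b = cb) (h' : ab + c = p) (m : (N.obj y).X a) (f : (A.Hom x y).X b)
      (r : (X.obj (x, z)).X c) : T z p q h x ab c h' (N.act hab m f) r = (-1 : k) ^ (b * c) •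
        T z p q h y a cb (by omega) m ((resL X z).act (x := y) (y := x) hcb r f) := by
    rw [hT z p q h x ab c (c - 1) h' (by omega),
      hT z p q h y a cb (cb - 1) (by omega) (by omega)]
    have h1 := (hs (y, z) (x, z) c (c - 1) b cb (cb - 1) (by omega) (by omega) hcb r
      (incL (A := A.op) z f)).trans (bimodule_act_incL (homData N L) _ _ f)
    refine Eq.trans ?_ (congrArg (fun v : Gr (N.obj y) (L.obj z) (cb - 1) =>
      (-1 : k) ^ (b * c) • (-1 : k) ^ (a * cb) • ap v a q (by omega) m) h1).symm
    refine Eq.trans ?_ (congrArg (fun v => (-1 : k) ^ (b * c) • (-1 : k) ^ (a * cb) • v)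
      (coindAct_apply (A := A.op) (opop N) (L.obj z) (show c - 1 + b = cb - 1 by omega) _ f
        (show a + (cb - 1) = q by omega) hab m).symm)
    rw [smul_smul, smul_smul, ← zpow_add₀ (by simp), ← zpow_add₀ (by simp)]
    refine congrArg₂ _ (sgn_congr ⟨-(b * a), by rw [← hab, ← hcb]; ring⟩) rfl
  let S (z : A.Obj) (p q : ℤ) (h : q + 1 = p) : (tensorOver N (resL X z)).X p →ₗ[k] (L.obj z).X q :=
    tmLift (P := resL X z) (T z p q h) (hb z p q h)
  have hS (z : A.Obj) (p q : ℤ) (h : q + 1 = p) (x : A.Obj) (a c c' : ℤ) (h' : a + c = p)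
      (hc : c' + 1 = c) (m : (N.obj x).X a) (r : (X.obj (x, z)).X c) :
      S z p q h (tm N (resL X z) x h' m r) =
        (-1 : k) ^ (a * c) • ap (K := N.obj x) (V := L.obj z) (s (x, z) c c' hc r) a q
          (by omega) m :=
    (tmLift_tm (P := resL X z) (T z p q h) (hb z p q h) x h' m r).trans
      (hT z p q h x a c c' h' hc m r)
  refine ⟨S, fun y z p q b p' q' h h' hp t g => ?_, fun z n t => ?_⟩
  · refine LinearMap.congr_fun (f := S y p' q' h' ∘ₗ (tensorBiAct N X hp).flip g)
      (g := (L.act (show q + b = q' by omega)).flip g ∘ₗ S z p q h)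
      (tm_ext (P := resL X z) fun x a c h'' m r => ?_) t
    rw [LinearMap.comp_apply, LinearMap.comp_apply, LinearMap.flip_apply, LinearMap.flip_apply,
      tensorBiAct_tm N X hp x h'' rfl, hS y p' q' h' x a (c + b) (c + b - 1) (by omega) (by omega),
      hS z p q h x a c (c - 1) h'' (by omega)]
    have h1 := (hs (x, y) (x, z) c (c - 1) b (c + b) (c + b - 1) (by omega) (by omega) rfl r
      (incR (A := A.op) x g)).trans (bimodule_act_incR (homData N L) _ _ g)
    refine (congrArg (fun v : Gr (N.obj x) (L.obj y) (c + b - 1) =>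
      (-1 : k) ^ (a * (c + b)) • ap v a q' (by omega) m) h1).trans ?_
    refine (congrArg (fun v => (-1 : k) ^ (a * (c + b)) • v)
      (postAct_apply N L (show c - 1 + b = c + b - 1 by omega) _ g
        (show a + (c + b - 1) = q' by omega) (show a + (c - 1) = q by omega) m)).trans ?_
    rw [smul_smul, ← zpow_add₀ (by simp), map_smul, LinearMap.smul_apply]
    refine congrArg₂ _ (sgn_congr ⟨a * b, by ring⟩) rfl
  · refine LinearMap.congr_fun (f := ((w.app z).f n).hom ∘ₗ
      ((tensorMap N (resDiag β z) ≫ evalRep N z).f n).hom)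
      (g := ((L.obj z).d (n - 1) n).hom ∘ₗ S z n (n - 1) (by omega) +
        S z (n + 1) n rfl ∘ₗ ((tensorOver N (resL X z)).d n (n + 1)).hom)
      (tm_ext (P := resL X z) fun x a c h' m r => ?_) t
    rw [LinearMap.add_apply, LinearMap.comp_apply, LinearMap.comp_apply, LinearMap.comp_apply,
      tensorBiEval_tm, tm_d (P := resL X z) x h' rfl rfl rfl, map_add, map_smul,
      hS z n (n - 1) (by omega) x a c (c - 1) h' (by omega),
      hS z (n + 1) n rfl x (a + 1) c (c - 1) (by omega) (by omega),
      hS z (n + 1) n rfl x a (c + 1) c (by omega) rfl]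
    have h1 := congrArg (fun φ : Gr (N.obj x) (L.obj z) c => (-1 : k) ^ (a * c) • ap φ a n h' m)
      (hs' (x, z) c r)
    have h2 : (-1 : k) ^ (a * c) • ap (K := N.obj x) (V := L.obj z)
        ((((homSharp w).app (x, z)).f c).hom (((β.app (x, z)).f c).hom r)) a n h' m =
        ((w.app z).f n).hom (N.act h' m (((β.app (x, z)).f c).hom r)) := by
      refine (congrArg (fun v => (-1 : k) ^ (a * c) • v) (homSharp_apply w x z h' _ m)).trans ?_
      rw [smul_smul, mul_comm c a, sgn_mul_self, one_smul]
    refine h2.symm.trans (h1.trans ?_)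
    have h3 (c' : ℤ) (hc : c' + 1 = c) (φ : Gr (N.obj x) (L.obj z) c') :
        ap (K := N.obj x) (V := L.obj z)
          (((ihom (N.obj x) (L.obj z)).d c' c).hom φ) a n h' m =
          ((L.obj z).d (n - 1) n).hom (ap φ a (n - 1) (by omega) m) -
          (-1 : k) ^ c' • ap φ (a + 1) n (by omega) (((N.obj x).d a (a + 1)).hom m) := by
      subst hc
      erw [ihom_d (K := N.obj x) (V := L.obj z)]
      exact grD_apply _ _ (by omega) rfl _
    refine (congrArg (fun v => (-1 : k) ^ (a * c) • (v + _)) (h3 (c - 1) (by omega) _)).trans ?_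
    rw [sgn_pred, neg_smul, sub_neg_eq_add, map_smul]
    simp only [smul_add, smul_smul, ← zpow_add₀ (show (-1 : k) ≠ 0 by simp)]
    rw [sgn_congr (k := k) (a := a * c + c) (b := (a + 1) * c) ⟨0, by ring⟩,
      sgn_congr (k := k) (a := a + a * (c + 1)) (b := a * c) ⟨a, by ring⟩, add_assoc]

end

end Smooth

end DGModule

end DG

namespace DG

variable {k : Type u} [Field k]

namespace DGModule

open DGCat

/-! ### Compactness over a smooth dg category -/

/-- Compactness of a homotopically projective dg module, in terms of morphisms up to homotopy. -/
lemma IsHProjective.isCompact_iff {A : DGCat k} {N : DGModule A} (hN : N.IsHProjective) :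
    N.IsCompact ↔ ∀ (J : Type u) (V : J → DGModule A) (f : N ⟶ sum V), ∃ F : Finset J,
      NullHomotopic (f - ∑ j ∈ F, f ≫ prj V j ≫ inj V j) := by
  have key (J : Type u) (V : J → DGModule A) (f : N ⟶ sum V) (F : Finset J) :
      NullHomotopic (f - ∑ j ∈ F, f ≫ prj V j ≫ inj V j) ↔
        D.Q.map f = ∑ j ∈ F, D.Q.map f ≫ D.Q.map (prj V j) ≫ D.Q.map (inj V j) := by
    rw [← hN.Q_map_eq_zero_iff, D.Q.map_sub, sub_eq_zero, D.Q.map_sum]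
    simp only [D.Q.map_comp]
  rw [DGModule.isCompact_iff]
  refine ⟨fun h J V f => ?_, fun h J V φ => ?_⟩
  · obtain ⟨F, hF⟩ := h J V (D.Q.map f)
    exact ⟨F, (key J V f F).2 hF⟩
  · obtain ⟨f, rfl⟩ := hN.Q_map_surjective φ
    obtain ⟨F, hF⟩ := h J V f
    exact ⟨F, (key J V f F).1 hF⟩

/-- Null-homotopic morphisms form a two-sided ideal; this is the form in which a statement up to
homotopy on `g` is transported to `g ≫ c`. -/
lemma NullHomotopic.sum_comp_sub {A : DGCat k} {X Y Z : DGModule A} {u : X ⟶ Z} {g : X ⟶ Y}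
    {c : Y ⟶ Z} (h : NullHomotopic (u - g ≫ c)) {J : Type u} (F : Finset J) (p : J → (Y ⟶ Y))
    (q : J → (Z ⟶ Z)) (hpq : ∀ j, p j ≫ c = c ≫ q j)
    (hF : NullHomotopic (g - ∑ j ∈ F, g ≫ p j)) : NullHomotopic (u - ∑ j ∈ F, u ≫ q j) := by
  have h1 := hF.comp c
  have h2 : NullHomotopic ((u - g ≫ c) ≫ (∑ j ∈ F, q j)) := h.comp _
  have h3 := (h.add h1).add h2.neg
  have h4 : u - ∑ j ∈ F, u ≫ q j = u - g ≫ c + (g - ∑ j ∈ F, g ≫ p j) ≫ c +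
      -((u - g ≫ c) ≫ ∑ j ∈ F, q j) := by
    have h5 : (∑ j ∈ F, g ≫ p j) ≫ c = (g ≫ c) ≫ ∑ j ∈ F, q j := by
      rw [Preadditive.sum_comp, Preadditive.comp_sum]
      exact Finset.sum_congr rfl fun j _ => by
        rw [Category.assoc, Category.assoc, hpq]
    rw [Preadditive.sub_comp, Preadditive.sub_comp, h5, ← Preadditive.comp_sum]
    abel
  rwa [h4]

variable {A : DGCat k}

/-- A quasi-isomorphism to a homotopically projective dg module has a section up to homotopy. -/
lemma IsHProjective.nullHomotopic_of_precomp {N X L : DGModule A} (hN : N.IsHProjective)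
    {ρ : X ⟶ N} (hρ : qis A ρ) {θ : N ⟶ L} (h : NullHomotopic (ρ ≫ θ)) : NullHomotopic θ := by
  obtain ⟨g, hg⟩ := hN.exists_lift ρ hρ (𝟙 N)
  have h1 := (hg.comp θ).add (h.precomp g)
  rw [Preadditive.sub_comp, Category.id_comp, Category.assoc, sub_add_cancel] at h1
  exact h1

lemma desc_homMap_prj (N : DGModule A) {J : Type u} (V : J → DGModule A) (j : J) :
    desc (fun j => bimodule (homData N (V j))) (fun j => homMap N (inj V j)) ≫
      homMap N (prj V j) = prj (fun j => bimodule (homData N (V j))) j := by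
  classical
  refine sum_hom_ext _ fun i => ?_
  rw [← Category.assoc, inj_desc, ← homMap_comp]
  by_cases h : i = j
  · subst h
    rw [inj_prj, inj_prj]
    rfl
  · rw [inj_prj_ne V h, inj_prj_ne _ h]
    rfl

lemma desc_homMap_prj_inj (N : DGModule A) {J : Type u} (V : J → DGModule A) (j : J) :
    (prj (fun j => bimodule (homData N (V j))) j ≫ inj (fun j => bimodule (homData N (V j))) j) ≫
      desc (fun j => bimodule (homData N (V j))) (fun j => homMap N (inj V j)) =
    desc (fun j => bimodule (homData N (V j))) (fun j => homMap N (inj V j)) ≫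
      homMap N (prj V j ≫ inj V j) := by
  rw [Category.assoc, inj_desc, homMap_comp, ← desc_homMap_prj, Category.assoc]

lemma homSharp_sub_sum {N L : DGModule A} (f : N ⟶ L) {J : Type u} (F : Finset J)
    (p : J → (L ⟶ L)) : homSharp (f - ∑ j ∈ F, f ≫ p j) =
      homSharp f - ∑ j ∈ F, homSharp f ≫ homMap N (p j) := by
  let sh : (N ⟶ L) →+ (A.diag ⟶ bimodule (homData N L)) := AddMonoidHom.mk' homSharp homSharp_add
  rw [homSharp_sub]
  exact congrArg (homSharp f - ·)
    ((map_sum sh _ _).trans (Finset.sum_congr rfl fun j _ => homSharp_comp _ _))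

/-- Over a smooth dg category, a homotopically projective dg module `N` with perfect values is
compact: as `A` is compact as a bimodule, the morphism `A ⟶ Hom_k(N, ⨁ V)` corresponding to a
morphism `N ⟶ ⨁ V` takes values in a finite subsum. -/
lemma IsHProjective.exists_finset_of_isSmooth (hs : A.IsSmooth) {N : DGModule A}
    (hN : N.IsHProjective) (hN' : ∀ x, Perf (N.obj x)) {J : Type u} (V : J → DGModule A)
    (f : N ⟶ sum V) : ∃ F : Finset J, NullHomotopic (f - ∑ j ∈ F, f ≫ prj V j ≫ inj V j) := by
  obtain ⟨S⟩ := nonempty_resolution A.diag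
  have hS : S.Q.IsCompact := (isCompact_iff_of_qis S.π S.qis).2 hs
  obtain ⟨g, hg⟩ := S.isHProjective.exists_lift _ (qis_homMap_sum hN' V) (S.π ≫ homSharp f)
  obtain ⟨F, hF⟩ := S.isHProjective.isCompact_iff.1 hS J _ g
  refine ⟨F, ?_⟩
  have h1 := hg.sum_comp_sub F _ _ (desc_homMap_prj_inj N V) hF
  simp only [Category.assoc] at h1
  rw [← Preadditive.comp_sum, ← Preadditive.comp_sub, ← homSharp_sub_sum] at h1
  exact hN.nullHomotopic_of_precomp (qis_tensorBiEval hN S.qis) (nullHomotopic_tensorBiEval_comp h1)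

/-- Over a smooth dg category, a dg module with perfect values is compact. -/
lemma isCompact_of_isSmooth (hs : A.IsSmooth) (N : DGModule A) (hN : ∀ x, Perf (N.obj x)) :
    N.IsCompact := by
  obtain ⟨R⟩ := nonempty_resolution N
  rw [← isCompact_iff_of_qis R.π R.qis, R.isHProjective.isCompact_iff]
  have hQ (x : A.Obj) : Perf (R.Q.obj x) := (Perf.of_quasiIso (R.π.app x) (R.qis x)).2 (hN x)
  exact fun J V f => R.isHProjective.exists_finset_of_isSmooth hs hQ V f

end DGModule

end DG

namespace DG

variable {k : Type u} [Field k]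

/-! ### The opposite of a smooth dg category is smooth -/

section Swap

variable {ι : Type u} (K L : ι → Cx k)

/-- The map `a ⊗ b ↦ (-1)^{|a||b|} b ⊗ a`. -/
def swapT (n : ℤ) : SumTensorX K L n →ₗ[k] SumTensorX L K n :=
  tlift fun i p q h => (-1 : k) ^ (p * q) • (tmk L K i (show q + p = n by omega)).flip

lemma swapT_tmk (i : ι) {p q n : ℤ} (h : p + q = n) (h' : q + p = n) (a : (K i).X p)
    (b : (L i).X q) : swapT K L n (tmk K L i h a b) = (-1 : k) ^ (p * q) • tmk L K i h' b a := by
  rw [swapT, tlift_tmk]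
  rfl

lemma swapT_swapT {n : ℤ} (t : SumTensorX K L n) : swapT L K n (swapT K L n t) = t := by
  refine LinearMap.congr_fun (f := swapT L K n ∘ₗ swapT K L n) (g := LinearMap.id)
    (tensor_ext fun i p q h a b => ?_) t
  rw [LinearMap.comp_apply, swapT_tmk K L i h (show q + p = n by omega), map_smul,
    swapT_tmk L K i _ h, mul_comm q p, smul_smul, sgn_mul_self, one_smul, LinearMap.id_apply]

lemma tensorD_swapT {n n' : ℤ} (hn : n + 1 = n') (t : SumTensorX K L n) :
    tensorD L K n n' (swapT K L n t) = swapT K L n' (tensorD K L n n' t) := by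
  refine LinearMap.congr_fun (f := tensorD L K n n' ∘ₗ swapT K L n)
    (g := swapT K L n' ∘ₗ tensorD K L n n') (tensor_ext fun i p q h a b => ?_) t
  rw [LinearMap.comp_apply, LinearMap.comp_apply, swapT_tmk K L i h (show q + p = n by omega),
    map_smul, tensorD_tmk L K i hn, tensorD_tmk K L i hn, map_add, map_smul,
    swapT_tmk K L i _ (show q + (p + 1) = n' by omega),
    swapT_tmk K L i _ (show q + 1 + p = n' by omega), smul_add, smul_smul, smul_smul,
    ← zpow_add₀ (by simp), ← zpow_add₀ (by simp), add_comm]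
  refine congrArg₂ _ (congrArg₂ _ (sgn_congr ⟨0, by ring⟩) rfl)
    (congrArg₂ _ (sgn_congr ⟨-p, by ring⟩) rfl)

end Swap

namespace DGCat

variable {A : DGCat k}

/-- The isomorphism `f ⊗ g ↦ (-1)^{|f||g|} g ⊗ f` from `(Aᵒᵖ)ᵒᵖ ⊗ Aᵒᵖ` to `Aᵒᵖ ⊗ A`, on morphisms. -/
def opHom (a b : A.Obj × A.Obj) (n : ℤ) : TensX (A := A.op.op) (B := A.op) a b n →ₗ[k]
    TensX (A := A.op) (B := A) (a.2, a.1) (b.2, b.1) n :=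
  swapT (fun _ : PUnit.{u + 1} => A.Hom a.1 b.1) (fun _ => A.Hom b.2 a.2) n

/-- The isomorphism `f ⊗ g ↦ (-1)^{|f||g|} g ⊗ f` from `Aᵒᵖ ⊗ A` to `(Aᵒᵖ)ᵒᵖ ⊗ Aᵒᵖ`, on morphisms. -/
def ofOpHom (a b : A.Obj × A.Obj) (n : ℤ) : TensX (A := A.op) (B := A) a b n →ₗ[k]
    TensX (A := A.op.op) (B := A.op) (a.2, a.1) (b.2, b.1) n :=
  swapT (fun _ : PUnit.{u + 1} => A.Hom b.1 a.1) (fun _ => A.Hom a.2 b.2) n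

lemma opHom_tens {a b : A.Obj × A.Obj} {p q n : ℤ} (h : p + q = n) (h' : q + p = n)
    (f : (A.Hom a.1 b.1).X p) (g : (A.Hom b.2 a.2).X q) :
    opHom a b n (tens (A := A.op.op) (B := A.op) h f g) = (-1 : k) ^ (p * q) •
      tens (A := A.op) (B := A) (a := (a.2, a.1)) (b := (b.2, b.1)) h' g f :=
  swapT_tmk (fun _ : PUnit.{u + 1} => A.Hom a.1 b.1) (fun _ => A.Hom b.2 a.2) PUnit.unit h h' f g

lemma ofOpHom_tens {a b : A.Obj × A.Obj} {p q n : ℤ} (h : p + q = n) (h' : q + p = n)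
    (f : (A.Hom b.1 a.1).X p) (g : (A.Hom a.2 b.2).X q) :
    ofOpHom a b n (tens (A := A.op) (B := A) h f g) = (-1 : k) ^ (p * q) •
      tens (A := A.op.op) (B := A.op) (a := (a.2, a.1)) (b := (b.2, b.1)) h' g f :=
  swapT_tmk (fun _ : PUnit.{u + 1} => A.Hom b.1 a.1) (fun _ => A.Hom a.2 b.2) PUnit.unit h h' f g

lemma ofOpHom_opHom {a b : A.Obj × A.Obj} {n : ℤ}
    (f : TensX (A := A.op.op) (B := A.op) a b n) :
    ofOpHom (a.2, a.1) (b.2, b.1) n (opHom a b n f) = f :=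
  swapT_swapT (fun _ : PUnit.{u + 1} => A.Hom a.1 b.1) (fun _ => A.Hom b.2 a.2) f

lemma opHom_ofOpHom {a b : A.Obj × A.Obj} {n : ℤ} (f : TensX (A := A.op) (B := A) a b n) :
    opHom (a.2, a.1) (b.2, b.1) n (ofOpHom a b n f) = f :=
  swapT_swapT (fun _ : PUnit.{u + 1} => A.Hom b.1 a.1) (fun _ => A.Hom a.2 b.2) f

lemma d_opHom {a b : A.Obj × A.Obj} {n : ℤ} (f : TensX (A := A.op.op) (B := A.op) a b n) :
    (((tensor A.op A).Hom (a.2, a.1) (b.2, b.1)).d n (n + 1)).hom (opHom a b n f) =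
      opHom a b (n + 1) ((((tensor A.op.op A.op).Hom a b).d n (n + 1)).hom f) :=
  tensorD_swapT (fun _ : PUnit.{u + 1} => A.Hom a.1 b.1) (fun _ => A.Hom b.2 a.2) rfl f

lemma d_ofOpHom {a b : A.Obj × A.Obj} {n : ℤ} (f : TensX (A := A.op) (B := A) a b n) :
    (((tensor A.op.op A.op).Hom (a.2, a.1) (b.2, b.1)).d n (n + 1)).hom (ofOpHom a b n f) =
      ofOpHom a b (n + 1) ((((tensor A.op A).Hom a b).d n (n + 1)).hom f) :=
  tensorD_swapT (fun _ : PUnit.{u + 1} => A.Hom b.1 a.1) (fun _ => A.Hom a.2 b.2) rfl f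

lemma opHom_comp {a b c : A.Obj × A.Obj} {p q n : ℤ} (h : p + q = n)
    (f : TensX (A := A.op.op) (B := A.op) b c p) (g : TensX (A := A.op.op) (B := A.op) a b q) :
    opHom a c n (tensorComp h f g) = tensorComp (A := A.op) (B := A) (a := (a.2, a.1))
      (b := (b.2, b.1)) (c := (c.2, c.1)) h (opHom b c p f) (opHom a b q g) := by
  induction f using tens_ind with
  | h0 => simp
  | hadd f f' hf hf' => simp only [map_add, LinearMap.add_apply, hf, hf']
  | h p₁ p₂ hp f₁ f₂ =>
  induction g using tens_ind with
  | h0 => simp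
  | hadd f f' hf hf' => simp only [map_add, hf, hf']
  | h q₁ q₂ hq g₁ g₂ =>
  refine (congrArg (opHom a c n) (tensorComp_tens (A := A.op.op) (B := A.op) (a := a) (b := b)
    (c := c) h hp f₁ f₂ hq g₁ g₂ rfl rfl)).trans ?_
  refine (map_smul _ _ _).trans ?_
  refine (congrArg (fun v => (-1 : k) ^ (p₂ * q₁) • v) (opHom_tens (a := a) (b := c) _
    (show p₂ + q₂ + (p₁ + q₁) = n by omega) _ _)).trans ?_
  refine Eq.trans ?_ (congrArg₂ (fun u v => tensorComp (A := A.op) (B := A) (a := (a.2, a.1))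
    (b := (b.2, b.1)) (c := (c.2, c.1)) h u v)
    (opHom_tens (a := b) (b := c) hp (show p₂ + p₁ = p by omega) f₁ f₂)
    (opHom_tens (a := a) (b := b) hq (show q₂ + q₁ = q by omega) g₁ g₂)).symm
  refine Eq.trans ?_ ((LinearMap.map_smul₂ _ _ _ _).trans (congrArg (fun v => (-1 : k) ^ (p₁ * p₂) • v)
    ((LinearMap.map_smul (tensorComp h _) _ _).trans (congrArg (fun v => (-1 : k) ^ (q₁ * q₂) • v)
      (tensorComp_tens (A := A.op) (B := A) (a := (a.2, a.1)) (b := (b.2, b.1)) (c := (c.2, c.1))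
      h (show p₂ + p₁ = p by omega) f₂ f₁ (show q₂ + q₁ = q by omega) g₂ g₁ rfl rfl))))).symm
  have e : A.op.op.comp rfl f₁ g₁ = A.comp rfl f₁ g₁ := op_op_comp _ _ _ _
  rw [smul_smul, smul_smul, smul_smul, ← zpow_add₀ (by simp), ← zpow_add₀ (by simp),
    ← zpow_add₀ (by simp)]
  exact congrArg₂ (fun (r : k) v => r • v) (sgn_congr ⟨p₂ * q₁, by ring⟩)
    (congrArg (tens (A := A.op) (B := A) (a := (a.2, a.1)) (b := (c.2, c.1)) _ _) e)

lemma ofOpHom_comp {a b c : A.Obj × A.Obj} {p q n : ℤ} (h : p + q = n)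
    (f : TensX (A := A.op) (B := A) b c p) (g : TensX (A := A.op) (B := A) a b q) :
    ofOpHom a c n (tensorComp h f g) = tensorComp (A := A.op.op) (B := A.op) (a := (a.2, a.1))
      (b := (b.2, b.1)) (c := (c.2, c.1)) h (ofOpHom b c p f) (ofOpHom a b q g) := by
  induction f using tens_ind with
  | h0 => simp
  | hadd f f' hf hf' => simp only [map_add, LinearMap.add_apply, hf, hf']
  | h p₁ p₂ hp f₁ f₂ =>
  induction g using tens_ind with
  | h0 => simp
  | hadd f f' hf hf' => simp only [map_add, hf, hf']
  | h q₁ q₂ hq g₁ g₂ =>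
  refine (congrArg (ofOpHom a c n) (tensorComp_tens (A := A.op) (B := A) (a := a) (b := b)
    (c := c) h hp f₁ f₂ hq g₁ g₂ rfl rfl)).trans ?_
  refine (map_smul _ _ _).trans ?_
  refine (congrArg (fun v => (-1 : k) ^ (p₂ * q₁) • v) (ofOpHom_tens (a := a) (b := c) _
    (show p₂ + q₂ + (p₁ + q₁) = n by omega) _ _)).trans ?_
  refine Eq.trans ?_ (congrArg₂ (fun u v => tensorComp (A := A.op.op) (B := A.op) (a := (a.2, a.1))
    (b := (b.2, b.1)) (c := (c.2, c.1)) h u v)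
    (ofOpHom_tens (a := b) (b := c) hp (show p₂ + p₁ = p by omega) f₁ f₂)
    (ofOpHom_tens (a := a) (b := b) hq (show q₂ + q₁ = q by omega) g₁ g₂)).symm
  refine Eq.trans ?_ ((LinearMap.map_smul₂ _ _ _ _).trans (congrArg (fun v => (-1 : k) ^ (p₁ * p₂) • v)
    ((LinearMap.map_smul (tensorComp h _) _ _).trans (congrArg (fun v => (-1 : k) ^ (q₁ * q₂) • v)
      (tensorComp_tens (A := A.op.op) (B := A.op) (a := (a.2, a.1)) (b := (b.2, b.1)) (c := (c.2, c.1))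
      h (show p₂ + p₁ = p by omega) f₂ f₁ (show q₂ + q₁ = q by omega) g₂ g₁ rfl rfl))))).symm
  have e : A.comp rfl f₂ g₂ = A.op.op.comp rfl f₂ g₂ := (op_op_comp _ _ _ _).symm
  rw [smul_smul, smul_smul, smul_smul, ← zpow_add₀ (by simp), ← zpow_add₀ (by simp),
    ← zpow_add₀ (by simp)]
  exact congrArg₂ (fun (r : k) v => r • v) (sgn_congr ⟨p₂ * q₁, by ring⟩)
    (congrArg (fun v => tens (A := A.op.op) (B := A.op) (a := (a.2, a.1)) (b := (c.2, c.1)) _ v _) e)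

end DGCat

namespace DGModule

open DGCat

section

variable {A : DGCat k}

/-- A dg module over `Aᵒᵖ ⊗ A` as a dg module over `(Aᵒᵖ)ᵒᵖ ⊗ Aᵒᵖ`. -/
abbrev opMod (X : DGModule (tensor A.op A)) : DGModule (tensor A.op.op A.op) where
  obj a := X.obj (a.2, a.1)
  act {a b p q n} h := (X.act (x := (a.2, a.1)) (y := (b.2, b.1)) h).compl₂ (opHom a b q)
  act_id {a p} m := by
    refine Eq.trans (congrArg (X.act (add_zero p) m) ?_) (X.act_id (x := (a.2, a.1)) m)
    refine (opHom_tens (add_zero 0) (add_zero 0) (A.id a.1) (A.id a.2)).trans ?_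
    rw [mul_zero, zpow_zero, one_smul]
  act_comp {x y z p q r s t n} hs ht h h' m f g :=
    (X.act_comp (x := (x.2, x.1)) (y := (y.2, y.1)) (z := (z.2, z.1)) hs ht h h' m
      (opHom y z q f) (opHom x y r g)).trans
      (congrArg (X.act (x := (x.2, x.1)) (y := (z.2, z.1)) h' m) (opHom_comp ht f g).symm)
  d_act {x y p q n} h m f := by
    refine (X.d_act (x := (x.2, x.1)) (y := (y.2, y.1)) h m (opHom x y q f)).trans ?_
    exact congrArg (fun v => X.act (x := (x.2, x.1)) (y := (y.2, y.1))
        (show p + 1 + q = n + 1 by omega) (((X.obj (y.2, y.1)).d p (p + 1)).hom m)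
          (opHom x y q f) +
      (-1 : k) ^ p • X.act (x := (x.2, x.1)) (y := (y.2, y.1))
        (show p + (q + 1) = n + 1 by omega) m v) (d_opHom f)

/-- A dg module over `(Aᵒᵖ)ᵒᵖ ⊗ Aᵒᵖ` as a dg module over `Aᵒᵖ ⊗ A`. -/
abbrev ofOpMod (X : DGModule (tensor A.op.op A.op)) : DGModule (tensor A.op A) where
  obj a := X.obj (a.2, a.1)
  act {a b p q n} h := (X.act (x := (a.2, a.1)) (y := (b.2, b.1)) h).compl₂ (ofOpHom (A := A) a b q)
  act_id {a p} m := by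
    refine Eq.trans (congrArg (X.act (add_zero p) m) ?_) (X.act_id (x := (a.2, a.1)) m)
    refine (ofOpHom_tens (A := A) (add_zero 0) (add_zero 0) (A.id a.1) (A.id a.2)).trans ?_
    rw [mul_zero, zpow_zero, one_smul]
  act_comp {x y z p q r s t n} hs ht h h' m f g :=
    (X.act_comp (x := (x.2, x.1)) (y := (y.2, y.1)) (z := (z.2, z.1)) hs ht h h' m
      (ofOpHom (A := A) y z q f) (ofOpHom (A := A) x y r g)).trans
      (congrArg (X.act (x := (x.2, x.1)) (y := (z.2, z.1)) h' m) (ofOpHom_comp (A := A) ht f g).symm)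
  d_act {x y p q n} h m f := by
    refine (X.d_act (x := (x.2, x.1)) (y := (y.2, y.1)) h m (ofOpHom (A := A) x y q f)).trans ?_
    exact congrArg (fun v => X.act (x := (x.2, x.1)) (y := (y.2, y.1))
        (show p + 1 + q = n + 1 by omega) (((X.obj (y.2, y.1)).d p (p + 1)).hom m)
          (ofOpHom (A := A) x y q f) +
      (-1 : k) ^ p • X.act (x := (x.2, x.1)) (y := (y.2, y.1))
        (show p + (q + 1) = n + 1 by omega) m v) (d_ofOpHom (A := A) f)

variable {X : DGModule (tensor A.op A)} {Y : DGModule (tensor A.op.op A.op)}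

/-- The morphism `X ⟶ ofOpMod Y` which corresponds to a morphism `opMod X ⟶ Y`. -/
def unop (g : opMod X ⟶ Y) : X ⟶ ofOpMod Y where
  app a := g.app (a.2, a.1)
  map_act {a b p q n} h m f := by
    refine Eq.trans (congrArg (fun v => ((g.app (a.2, a.1)).f n).hom (X.act h m v))
      (opHom_ofOpHom f).symm) ?_
    exact g.map_act (x := (a.2, a.1)) (y := (b.2, b.1)) h m (ofOpHom (A := A) a b q f)

lemma nullHomotopic_of_unop {g : opMod X ⟶ Y} (h : NullHomotopic (unop g)) :
    NullHomotopic g := by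
  obtain ⟨s, hs, hs'⟩ := h
  refine ⟨fun a => s (a.2, a.1), fun a b p q r p' q' h h' hp m f => ?_,
    fun a => hs' (a.2, a.1)⟩
  refine (hs (a.2, a.1) (b.2, b.1) p q r p' q' h h' hp m (opHom a b r f)).trans ?_
  exact congrArg (Y.act (x := a) (y := b) _ _) (ofOpHom_opHom f)

lemma isHProjective_opMod (hX : X.IsHProjective) : (opMod X).IsHProjective := fun N hN g =>
  nullHomotopic_of_unop (hX (ofOpMod N) (fun a => hN (a.2, a.1)) (unop g))

/-- Compactness of a homotopically projective bimodule is preserved by swapping the two variables, as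
the swap is an isomorphism on the level of morphisms and homotopies. -/
lemma isCompact_opMod (hX : X.IsHProjective) (hc : X.IsCompact) : (opMod X).IsCompact := by
  rw [(isHProjective_opMod hX).isCompact_iff]
  intro J V f
  obtain ⟨F, hF⟩ := hX.isCompact_iff.1 hc J (fun j => ofOpMod (V j)) (unop f)
  refine ⟨F, nullHomotopic_of_unop ?_⟩
  let sh : (opMod X ⟶ sum V) →+ (X ⟶ ofOpMod (sum V)) := AddMonoidHom.mk' unop fun _ _ => rfl
  have h1 : unop (f - ∑ j ∈ F, f ≫ prj V j ≫ inj V j) =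
      unop f - ∑ j ∈ F, unop (f ≫ prj V j ≫ inj V j) :=
    (map_sub sh _ _).trans (congrArg (unop f - ·) (map_sum sh _ _))
  rw [h1]
  exact hF

end

variable {A : DGCat k}

/-- The morphism from the swap of `X` to the diagonal bimodule of `Aᵒᵖ` which corresponds to a
morphism from `X` to the diagonal bimodule of `A`. -/
def opDiag {X : DGModule (tensor A.op A)} (β : X ⟶ A.diag) :
    opMod X ⟶ A.op.diag where
  app a := β.app (a.2, a.1)
  map_act {a b p q n} h m f := by
    refine (β.map_act h m (opHom a b q f)).trans ?_
    refine LinearMap.congr_fun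
      (f := A.diag.act (x := (a.2, a.1)) (y := (b.2, b.1)) h (((β.app (b.2, b.1)).f p).hom m) ∘ₗ
        opHom a b q) (g := A.op.diag.act (x := a) (y := b) h (((β.app (b.2, b.1)).f p).hom m))
      (tens_ext (A := A.op.op) (B := A.op) (a := a) (b := b) fun q₁ q₂ hq f g => ?_) f
    refine (congrArg (diagAct A (x := (a.2, a.1)) (y := (b.2, b.1)) h _) (opHom_tens hq (show q₂ + q₁ = q by omega) f g)).trans ?_
    rw [map_smul]
    refine (congrArg (fun v => (-1 : k) ^ (q₁ * q₂) • v) (diagAct_tens A (x := (a.2, a.1))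
      (y := (b.2, b.1)) h (show q₂ + q₁ = q by omega) rfl _ g f)).trans ?_
    refine Eq.trans ?_ (diagAct_tens A.op (x := a) (y := b) h hq rfl _ f g).symm
    have h1 (r : ℤ) (hr : p + q₂ = r) (v : (A.Hom b.1 b.2).X p) :
        A.op.comp (x := a.2) (y := b.2) (z := b.1) hr v g =
        (-1 : k) ^ (p * q₂) • A.comp (show q₂ + p = r by omega) g v := rfl
    have h2 (r : ℤ) (hr : q₁ + r = n) (v : (A.Hom b.1 a.2).X r) :
        A.op.comp (x := a.2) (y := b.1) (z := a.1) hr f v =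
        (-1 : k) ^ (q₁ * r) • A.comp (show r + q₁ = n by omega) v f := rfl
    refine Eq.trans ?_ (congrArg (fun v => (-1 : k) ^ (p * q₁) • v) ((h2 _ _ _).trans
      (congrArg (fun v => (-1 : k) ^ (q₁ * (p + q₂)) • A.comp _ v f) (h1 _ rfl _)))).symm
    rw [map_smul, LinearMap.smul_apply, smul_smul, smul_smul, smul_smul, ← zpow_add₀ (by simp),
      ← zpow_add₀ (by simp), ← zpow_add₀ (by simp)]
    exact congrArg₂ _ (sgn_congr ⟨-(p * q₁), by ring⟩)
      (A.assoc (show q₂ + p = p + q₂ by omega) rfl (show p + q₂ + q₁ = n by omega)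
        (show q₂ + (p + q₁) = n by omega) g _ f).symm

end DGModule

namespace DGCat

variable {A : DGCat k}

/-- Swapping the variables takes a resolution of the diagonal bimodule of `A` to one of the diagonal
bimodule of `Aᵒᵖ`. -/
lemma IsSmooth.op (hs : A.IsSmooth) : A.op.IsSmooth := by
  obtain ⟨S⟩ := DGModule.nonempty_resolution A.diag
  have h1 : S.Q.IsCompact := (DGModule.isCompact_iff_of_qis S.π S.qis).2 hs
  have h2 := DGModule.isCompact_opMod S.isHProjective h1
  exact (DGModule.isCompact_iff_of_qis (DGModule.opDiag S.π)
    fun a => S.qis (a.2, a.1)).1 h2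

lemma IsProper.op (hp : A.IsProper) : A.op.IsProper := fun x y => hp y x

end DGCat

end DG

namespace DG

variable {k : Type u} [Field k]

/-! ### The Euler pairing and the tensor product -/

section Kc

variable {K : Cx k}

lemma kc_ext {n m : ℤ} {a b : (kc k n).X m} (h : ∀ h : m = n,
    (show PLift (m = n) → k from a) ⟨h⟩ = (show PLift (m = n) → k from b) ⟨h⟩) : a = b :=
  funext fun i => h i.down

lemma mem_Bc_kc {n m : ℤ} {a : (kc k n).X m} : a ∈ Bc (kc k n) m ↔ a = 0 := by
  constructor
  · rintro ⟨c, rfl⟩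
    rw [kc_d]
    rfl
  · rintro rfl
    exact zero_mem _

/-- The morphism to `k` placed in degree `n` given by a linear form which vanishes on the
boundaries. -/
def kcHom {n : ℤ} (g : K.X n →ₗ[k] k) (hg : ∀ (m : ℤ) (a : K.X m), g ((K.d m n).hom a) = 0) :
    K ⟶ kc k n :=
  mkHom (L := kc k n) (fun m => LinearMap.pi fun h : PLift (m = n) => g ∘ₗ cst K h.down)
    fun m a => by
      rw [kc_d]
      refine kc_ext fun h => ?_
      change 0 = g (cst K h ((K.d m (m + 1)).hom a))
      subst h
      rw [cst_rfl, hg]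

lemma hZero_kc_iff {n : ℤ} (f : K ⟶ kc k n) :
    HZero f ↔ ∀ a ∈ Zc K n, (show PLift (n = n) → k from (f.f n).hom a) ⟨rfl⟩ = 0 := by
  constructor
  · intro h a ha
    exact congrFun (mem_Bc_kc.1 (h n a ha)) ⟨rfl⟩
  · intro h m a ha
    refine mem_Bc_kc.2 (kc_ext fun hm => ?_)
    subst hm
    exact h a ha

/-- The morphism `e ≫ l` to `k` placed in degree `n`, for a linear form `l` on the homology. -/
def homDual (S : Splitting K) (n : ℤ) :
    Module.Dual k (LinearMap.range (S.e n)) →ₗ[k] (K ⟶ kc k n) where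
  toFun l := kcHom (l ∘ₗ (S.e n).rangeRestrict) fun m a => by
    have : (S.e n).rangeRestrict ((K.d m n).hom a) = 0 := Subtype.ext (S.e_d m n a)
    rw [LinearMap.comp_apply, this, map_zero]
  map_add' l l' := by ext; rfl
  map_smul' c l := by ext; rfl

lemma homDual_apply (S : Splitting K) (n : ℤ) (l : Module.Dual k (LinearMap.range (S.e n)))
    (a : K.X n) : (show PLift (n = n) → k from ((homDual S n l).f n).hom a) ⟨rfl⟩ =
      l ((S.e n).rangeRestrict a) := 
  congrArg (l ∘ₗ (S.e n).rangeRestrict) (cst_rfl K rfl a)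

lemma hZero_homDual_iff (S : Splitting K) (n : ℤ)
    (l : Module.Dual k (LinearMap.range (S.e n))) : HZero (homDual S n l) ↔ l = 0 := by
  rw [hZero_kc_iff]
  constructor
  · intro h
    ext ⟨_, a, rfl⟩
    have := h _ (S.e_mem_Zc n a)
    rw [homDual_apply] at this
    refine Eq.trans (congrArg l (Subtype.ext ?_)) this
    exact (S.e_e n a).symm
  · rintro rfl a -
    rw [homDual_apply]
    rfl

lemma exists_homDual (S : Splitting K) (n : ℤ) (f : K ⟶ kc k n) :
    ∃ l, HZero (f - homDual S n l) := by
  let g : K.X n →ₗ[k] k :=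
    LinearMap.proj (φ := fun _ : PLift (n = n) => k) ⟨rfl⟩ ∘ₗ (f.f n).hom
  refine ⟨g ∘ₗ (LinearMap.range (S.e n)).subtype, (hZero_kc_iff _).2 fun a ha => ?_⟩
  have h1 := mem_Bc_kc.1 (map_mem_Bc f (S.sub_e_mem ha))
  have h2 : g (a - S.e n a) = 0 := congrFun h1 ⟨rfl⟩
  rw [map_sub] at h2
  refine Eq.trans ?_ h2
  exact congrArg (g a - ·) (homDual_apply S n _ a)

end Kc

lemma quasiIso_of_bijective {K L : Cx k} (f : K ⟶ L)
    (h : ∀ n, Function.Bijective (f.f n).hom) : QuasiIso f := by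
  have h1 (n : ℤ) : IsIso (f.f n) := (ConcreteCategory.isIso_iff_bijective _).2 (h n)
  have : IsIso f := HomologicalComplex.Hom.isIso_of_components f
  infer_instance

/-- The identification `φ ↦ φ` of the graded maps of degree `m` to `k` placed in degree `n` with
those of degree `m - n` to `k` placed in degree `0`. -/
def grShift (K : Cx k) (n m : ℤ) : Gr K (kc k n) m →ₗ[k] Gr K (kc k 0) (m + -n) where
  toFun φ := grMk fun p q h => LinearMap.pi fun e : PLift (q = 0) =>
    LinearMap.proj (φ := fun _ : PLift (n = n) => k) ⟨rfl⟩ ∘ₗ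
      ap φ p n (by have := e.down; omega)
  map_add' _ _ := rfl
  map_smul' _ _ := rfl

lemma grShift_apply {K : Cx k} {n m p : ℤ} (φ : Gr K (kc k n) m) (h : p + (m + -n) = 0)
    (h' : p + m = n) (a : K.X p) :
    (show PLift ((0 : ℤ) = 0) → k from ap (grShift K n m φ) p 0 h a) ⟨rfl⟩ =
      (show PLift (n = n) → k from ap φ p n h' a) ⟨rfl⟩ := rfl

lemma grShift_bijective (K : Cx k) (n m : ℤ) : Function.Bijective (grShift K n m) := by
  refine ⟨fun φ ψ h => gr_ext fun p q hq a => kc_ext fun e => ?_, fun ψ => ⟨grMk fun p q h =>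
    LinearMap.pi fun e : PLift (q = n) =>
      LinearMap.proj (φ := fun _ : PLift ((0 : ℤ) = 0) => k) ⟨rfl⟩ ∘ₗ
        ap ψ p 0 (by have := e.down; omega), gr_ext fun p q hq a => kc_ext fun e => ?_⟩⟩
  · subst e
    have h0 : p + (m + -q) = 0 := by omega
    exact congrFun (LinearMap.congr_fun (congrFun h ⟨(p, 0), h0⟩) a) ⟨rfl⟩
  · subst e
    rfl

lemma ihom_d_apply {K V : Cx k} {i j : ℤ} (hj : i + 1 = j) (φ : Gr K V i) {p q q' p' : ℤ}
    (h : p + j = q) (hq : q' + 1 = q) (hp : p + 1 = p') (a : K.X p) :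
    ap (K := K) (V := V) (((ihom K V).d i j).hom φ) p q h a =
      (V.d q' q).hom (ap φ p q' (by omega) a) -
        (-1 : k) ^ i • ap φ p' q (by omega) ((K.d p p').hom a) := by
  subst hj
  exact (congrArg (fun ψ : Gr K V (i + 1) => ap ψ p q h a) (ihom_d φ)).trans
    (grD_apply φ h hq hp a)

namespace DGModule

variable {A : DGCat k}

/-- The shift of a morphism. -/
def shiftHom {N L : DGModule A} (w : N ⟶ L) (n : ℤ) : N.shift n ⟶ L.shift n where
  app x := (CochainComplex.shiftFunctor _ n).map (w.app x)
  map_act _ m f := w.map_act _ m f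

lemma qis_shiftHom {N L : DGModule A} (w : N ⟶ L) (hw : qis A w) (n : ℤ) :
    qis A (shiftHom w n) := fun x => by
  have := hw x
  exact (CochainComplex.quasiIso_shift_iff (w.app x) n).2 this

lemma sharp_add {M : DGModule A} {P : DGModule A.op} {V : Cx k} (Φ Ψ : tensorOver M P ⟶ V) :
    sharp (Φ + Ψ) = sharp Φ + sharp Ψ := rfl

lemma sharp_smul {M : DGModule A} {P : DGModule A.op} {V : Cx k} (c : k) (Φ : tensorOver M P ⟶ V) :
    sharp (c • Φ) = c • sharp Φ := rfl

/-- Morphisms to `Hom_k(P, k[-n])` in the derived category are linear forms on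
`Hⁿ(M ⊗_A P)`. -/
lemma IsHProjective.nonempty_equiv_dual {M : DGModule A} (hM : M.IsHProjective)
    (P : DGModule A.op) (S : Splitting (tensorOver M P)) (n : ℤ) :
    Nonempty (Module.Dual k (LinearMap.range (S.e n)) ≃ₗ[k]
      (D.Q.obj M ⟶ D.Q.obj (coind P (kc k n)))) := by
  let T : Module.Dual k (LinearMap.range (S.e n)) →ₗ[k]
      (D.Q.obj M ⟶ D.Q.obj (coind P (kc k n))) :=
    { toFun := fun l => D.Q.map (sharp (homDual S n l))
      map_add' := fun l l' => by rw [map_add, sharp_add, D.Q.map_add]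
      map_smul' := fun c l => by
        rw [map_smul, sharp_smul, D.Q.map_smul]
        rfl }
  refine ⟨LinearEquiv.ofBijective T ⟨(injective_iff_map_eq_zero T).2 fun l hl => ?_,
    fun φ => ?_⟩⟩
  · exact (hZero_homDual_iff S n l).1
      ((nullHomotopic_sharp_iff _).1 ((hM.Q_map_eq_zero_iff _).1 hl))
  · obtain ⟨g, rfl⟩ := hM.Q_map_surjective φ
    obtain ⟨Φ, rfl⟩ := exists_sharp_eq g
    obtain ⟨l, hl⟩ := exists_homDual S n Φ
    refine ⟨l, ?_⟩
    have := (hM.Q_map_eq_zero_iff _).2 ((nullHomotopic_sharp_iff _).2 hl)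
    rw [sharp_sub, D.Q.map_sub, sub_eq_zero] at this
    exact this.symm

/-- The isomorphism `Hom_k(P, k[-n]) ≅ Hom_k(P, k)[-n]`. -/
def coindShift (P : DGModule A.op) (n : ℤ) :
    coind P (kc k n) ⟶ (coind P (kc k 0)).shift (-n) where
  app x := mkHom (K := ihom (P.obj x) (kc k n))
    (L := (CochainComplex.shiftFunctor _ (-n)).obj (ihom (P.obj x) (kc k 0)))
    (grShift (P.obj x) n) fun m φ => by
      refine (shift_d _ (-n) m (m + 1) _).trans
        (gr_ext (K := P.obj x) (V := kc k 0) fun p q h a => ?_)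
      refine kc_ext fun e => ?_
      subst e
      refine (congrArg (fun v : PLift ((0 : ℤ) = 0) → k => ((-1 : k) ^ (-n) • v) ⟨rfl⟩)
        (ihom_d_apply (i := m + -n) (by omega) _ h (sub_add_cancel 0 1) rfl a)).trans ?_
      refine Eq.trans ?_ ((grShift_apply (K := P.obj x) _ h (show p + (m + 1) = n by omega) a).trans
        (congrArg (fun v : PLift (n = n) → k => v ⟨rfl⟩)
          (ihom_d_apply rfl φ _ (sub_add_cancel n 1) rfl a))).symm
      rw [kc_d, kc_d]
      change (-1 : k) ^ (-n) * (0 - (-1 : k) ^ (m + -n) * _) = 0 - (-1 : k) ^ m * _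
      rw [zero_sub, mul_neg, ← mul_assoc, ← zpow_add₀ (by simp)]
      have e1 : (-1 : k) ^ (-n + (m + -n)) = (-1 : k) ^ m := sgn_congr ⟨-n, by ring⟩
      rw [e1]
      exact (zero_sub ((-1 : k) ^ m * _)).symm
  map_act {x y p q r} h φ f := gr_ext (K := P.obj x) (V := kc k 0) fun c e he m =>
    kc_ext fun e0 => by
      subst e0
      refine (grShift_apply (K := P.obj x) _ he (show c + r = n by omega) m).trans ?_
      refine (congrArg (fun v : PLift (n = n) → k => v ⟨rfl⟩)
        (coindAct_apply P (kc k n) h φ f _ rfl m)).trans ?_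
      have h1 := coindAct_apply P (kc k 0) (show p + -n + q = r + -n by omega)
        (grShift (P.obj y) n p φ) f he rfl m
      exact (congrArg (fun v : PLift ((0 : ℤ) = 0) → k => v ⟨rfl⟩) h1).symm

lemma qis_coindShift (P : DGModule A.op) (n : ℤ) : qis A (coindShift P n) := fun x =>
  quasiIso_of_bijective _ fun m => grShift_bijective (P.obj x) n m

/-- If `N` is quasi-isomorphic to `Hom_k(P, k)`, then `Hom(M, N[-n])` is dual to the homology of
`M ⊗ᴸ P` in degree `n`. -/
lemma nonempty_equiv_dual {M N : DGModule A} (R : M.Resolution) (P : DGModule A.op)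
    (w : N ⟶ coind P (kc k 0)) (hw : qis A w) (S : Splitting (tensorOver R.Q P)) (n : ℤ) :
    Nonempty (Module.Dual k (LinearMap.range (S.e n)) ≃ₗ[k]
      (D.Q.obj M ⟶ D.Q.obj (N.shift (-n)))) := by
  obtain ⟨e⟩ := R.isHProjective.nonempty_equiv_dual P S n
  have h1 : IsIso (D.Q.map R.π) := Localization.inverts _ (qis A) _ R.qis
  have h2 : IsIso (D.Q.map (coindShift P n)) :=
    Localization.inverts _ (qis A) _ (qis_coindShift P n)
  have h3 : IsIso (D.Q.map (shiftHom w (-n))) :=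
    Localization.inverts _ (qis A) _ (qis_shiftHom w hw (-n))
  exact ⟨e.trans (Linear.homCongr k (asIso (D.Q.map R.π))
    (asIso (D.Q.map (coindShift P n)) ≪≫ (asIso (D.Q.map (shiftHom w (-n)))).symm))⟩

/-- If `N` is quasi-isomorphic to `Hom_k(P, k)` and `M ⊗ᴸ P` is perfect, then the total space of the
`Hom(M, N[-n])` is finite dimensional. -/
lemma homFinite_of_qis {M N : DGModule A} (R : M.Resolution) (P : DGModule A.op)
    (w : N ⟶ coind P (kc k 0)) (hw : qis A w) (hP : Perf (tensorOver R.Q P)) : M.HomFinite N := by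
  obtain ⟨S⟩ := nonempty_splitting (tensorOver R.Q P)
  obtain ⟨h1, h2⟩ := S.perf_iff.1 hP
  have e (n : ℤ) := (nonempty_equiv_dual R P w hw S n).some
  refine ⟨fun n => Module.Finite.equiv (e n), h2.subset fun n hn h => ?_⟩
  have h3 : Nontrivial (Module.Dual k (LinearMap.range (S.e n))) :=
    (e n).toEquiv.nontrivial_congr.2 hn
  have h4 := LinearMap.range_eq_bot.2 h
  have : Subsingleton (LinearMap.range (S.e n)) := by rw [h4]; infer_instance
  exact not_subsingleton (Module.Dual k (LinearMap.range (S.e n))) inferInstance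

end DGModule

/-- The Euler characteristic of a complex. -/
def eulerChar (K : Cx k) : ℤ :=
  ∑ᶠ n : ℤ, (n.negOnePow : ℤ) * (Module.finrank k (K.homology n) : ℤ)

/-- If `N` is quasi-isomorphic to `Hom_k(P, k)`, then `χ(M, N)` is the Euler characteristic of
`M ⊗ᴸ P`. -/
lemma DGModule.euler_eq {A : DGCat k} {M N : DGModule A} (R : M.Resolution) (P : DGModule A.op)
    (w : N ⟶ coind P (kc k 0)) (hw : qis A w) : M.euler N = eulerChar (tensorOver R.Q P) := by
  obtain ⟨S⟩ := nonempty_splitting (tensorOver R.Q P)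
  refine finsum_congr fun n => ?_
  have e := (nonempty_equiv_dual R P w hw S n).some
  rw [← e.finrank_eq, Subspace.dual_finrank_eq, (S.rangeEquiv n).finrank_eq]

end DG

namespace DG

variable {k : Type u} [Field k]

/-! ### Duality -/

section Dual

variable {K : Cx k}

/-- The graded map `l ∘ e` of degree `-r`, for a linear form `l` on the homology in degree `r`. -/
def dualGr (S : Splitting K) {r m : ℤ} (h : r + m = 0) :
    Module.Dual k (LinearMap.range (S.e r)) →ₗ[k] Gr K (kc k 0) m where
  toFun l := grMk fun p q hq => LinearMap.pi fun e : PLift (q = 0) =>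
    l ∘ₗ (S.e r).rangeRestrict ∘ₗ cst K (by have := e.down; omega)
  map_add' _ _ := rfl
  map_smul' _ _ := rfl

lemma dualGr_apply (S : Splitting K) {r m : ℤ} (h : r + m = 0)
    (l : Module.Dual k (LinearMap.range (S.e r))) (a : K.X r) :
    (show PLift ((0 : ℤ) = 0) → k from ap (dualGr S h l) r 0 h a) ⟨rfl⟩ =
      l ((S.e r).rangeRestrict a) :=
  congrArg (l ∘ₗ (S.e r).rangeRestrict) (cst_rfl K rfl a)

lemma dualGr_mem_Zc (S : Splitting K) {r m : ℤ} (h : r + m = 0)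
    (l : Module.Dual k (LinearMap.range (S.e r))) : dualGr S h l ∈ Zc (ihom K (kc k 0)) m := by
  refine ihom_mem_Zc.2 fun p q p' q' hq hp hq' a => ?_
  have h1 : ap (dualGr S h l) p' q' (by omega) ((K.d p p').hom a) = 0 := kc_ext fun e => by
    subst e
    obtain rfl : p' = r := by omega
    refine (dualGr_apply S h l _).trans ?_
    have : (S.e p').rangeRestrict ((K.d p p').hom a) = 0 := Subtype.ext (S.e_d p p' a)
    rw [this, map_zero]
    rfl
  rw [h1, kc_d, smul_zero]
  rfl

/-- Every homology class of the dual complex comes from a linear form on the homology. -/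
lemma exists_sub_dualGr_mem_Bc (S : Splitting K) {r m : ℤ} (h : r + m = 0)
    {φ : Gr K (kc k 0) m} (hφ : φ ∈ Zc (ihom K (kc k 0)) m) :
    ∃ l, φ - dualGr S h l ∈ Bc (ihom K (kc k 0)) m := by
  let g : K.X r →ₗ[k] k :=
    LinearMap.proj (φ := fun _ : PLift ((0 : ℤ) = 0) => k) ⟨rfl⟩ ∘ₗ ap φ r 0 h
  refine ⟨g ∘ₗ (LinearMap.range (S.e r)).subtype, ihom_mem_Bc_of
    (Submodule.sub_mem _ hφ (dualGr_mem_Zc S h _)) fun p q hq a ha =>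
      mem_Bc_kc.2 (kc_ext fun e => ?_)⟩
  subst e
  obtain rfl : p = r := by omega
  have h1 := mem_Bc_kc.1 (map_mem_Bc_of_ihom hφ h (S.sub_e_mem ha))
  have h2 : g (a - S.e p a) = 0 := congrFun h1 ⟨rfl⟩
  rw [map_sub] at h2
  refine Eq.trans ?_ h2
  exact congrArg (g a - ·) (dualGr_apply S h _ a)

/-- The dual of a perfect complex is perfect. -/
lemma Perf.ihom_kc (hK : Perf K) : Perf (ihom K (kc k 0)) := by
  obtain ⟨S⟩ := nonempty_splitting K
  obtain ⟨h1, h2⟩ := S.perf_iff.1 hK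
  have key (m : ℤ) : ∃ T : Module.Dual k (LinearMap.range (S.e (-m))) →ₗ[k]
      (ihom K (kc k 0)).homology m, Function.Surjective T := by
    refine ⟨hcls _ m ∘ₗ LinearMap.codRestrict (Zc (ihom K (kc k 0)) m)
      (dualGr S (neg_add_cancel m)) (dualGr_mem_Zc S _), fun x => ?_⟩
    obtain ⟨φ, rfl⟩ := hcls_surjective _ m x
    obtain ⟨l, hl⟩ := exists_sub_dualGr_mem_Bc S (neg_add_cancel m) φ.2
    refine ⟨l, (sub_eq_zero.1 ?_).symm⟩
    rw [LinearMap.comp_apply, ← map_sub, hcls_eq_zero_iff]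
    exact hl
  refine ⟨fun m => ?_, (h2.preimage (neg_injective.injOn)).subset fun m hm h => ?_⟩
  · obtain ⟨T, hT⟩ := key m
    exact Module.Finite.of_surjective T hT
  · obtain ⟨T, hT⟩ := key m
    have h3 : Nontrivial ((ihom K (kc k 0)).homology m) := hm
    have h4 := LinearMap.range_eq_bot.2 h
    have : Subsingleton (LinearMap.range (S.e (-m))) := by rw [h4]; infer_instance
    have := hT.subsingleton
    exact not_subsingleton _ this

variable (K) in
/-- The map `a ↦ (φ ↦ (-1)^{|a||φ|} φ(a))`. -/
def bidualGr (V : Cx k) (n : ℤ) : K.X n →ₗ[k] Gr (ihom K V) V n :=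
  LinearMap.pi fun s => (-1 : k) ^ (n * s.1.1) • LinearMap.flip
    (LinearMap.proj (φ := fun t : {t : ℤ × ℤ // t.1 + s.1.1 = t.2} => K.X t.1.1 →ₗ[k] V.X t.1.2)
      ⟨(n, s.1.2), (add_comm _ _).trans s.2⟩)

lemma bidualGr_apply {V : Cx k} {n p q : ℤ} (h : p + n = q) (h' : n + p = q) (a : K.X n)
    (φ : Gr K V p) : ap (K := ihom K V) (bidualGr K V n a) p q h φ =
      (-1 : k) ^ (n * p) • ap φ n q h' a := rfl

/-- The canonical morphism from a complex to its bidual. -/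
def bidual (K V : Cx k) : K ⟶ ihom (ihom K V) V :=
  mkHom (L := ihom (ihom K V) V) (bidualGr K V) fun n a => by
    refine (ihom_d (K := ihom K V) (V := V) _).trans
      (gr_ext (K := ihom K V) (V := V) fun p q h φ => ?_)
    rw [grD_apply (K := ihom K V) (V := V) _ h (sub_add_cancel q 1) rfl]
    refine (congrArg₂ (fun x y => (V.d (q - 1) q).hom x - (-1 : k) ^ n • y)
      (bidualGr_apply _ (show n + p = q - 1 by omega) a φ)
      ((bidualGr_apply _ (show n + (p + 1) = q by omega) a _).trans
      (congrArg (fun v => (-1 : k) ^ (n * (p + 1)) • v) (ihom_d_apply rfl φ _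
        (sub_add_cancel q 1) rfl a)))).trans ?_
    refine Eq.trans ?_ (bidualGr_apply h (show n + 1 + p = q by omega) _ φ).symm
    have e1 : (-1 : k) ^ (n + n * (p + 1)) = (-1 : k) ^ (n * p) := sgn_congr ⟨n, by ring⟩
    have e2 : (-1 : k) ^ (n * p + p) = (-1 : k) ^ ((n + 1) * p) := sgn_congr ⟨0, by ring⟩
    rw [map_smul, smul_smul, ← zpow_add₀ (by simp), e1, smul_sub, sub_sub_cancel, smul_smul,
      ← zpow_add₀ (by simp), e2]

/-- A perfect complex is reflexive. -/
lemma Perf.quasiIso_bidual (hK : Perf K) : QuasiIso (bidual K (kc k 0)) := by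
  obtain ⟨S⟩ := nonempty_splitting K
  obtain ⟨h1, -⟩ := S.perf_iff.1 hK
  have hw {n m : ℤ} (h : n + m = 0) (a : K.X n) (l : Module.Dual k (LinearMap.range (S.e n))) :
      (show PLift ((0 : ℤ) = 0) → k from ap (K := ihom K (kc k 0)) (bidualGr K (kc k 0) n a) m 0
        ((add_comm _ _).trans h) (dualGr S h l)) ⟨rfl⟩ =
        (-1 : k) ^ (n * m) * l ((S.e n).rangeRestrict a) :=
    congrArg (fun v => (-1 : k) ^ (n * m) * v) (dualGr_apply S h l a)
  refine (quasiIso_iff _).2 fun n => ⟨fun a ha hb => ?_, fun b hb => ?_⟩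
  · have h2 : (S.e n).rangeRestrict a = 0 := by
      refine (Module.forall_dual_apply_eq_zero_iff k _).1 fun l => ?_
      have h3 := mem_Bc_kc.1 (map_mem_Bc_of_ihom_mem_Bc hb (neg_add_cancel n)
        (dualGr_mem_Zc S (add_neg_cancel n) l))
      have h4 := (hw (add_neg_cancel n) a l).symm.trans (congrFun h3 ⟨rfl⟩)
      exact (mul_eq_zero.1 h4).resolve_left (sgn_ne_zero _)
    have h3 := S.sub_e_mem ha
    rwa [show S.e n a = 0 from congrArg Subtype.val h2, sub_zero] at h3
  · have := h1 n
    let b' : Gr (ihom K (kc k 0)) (kc k 0) n := b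
    let L : Module.Dual k (Module.Dual k (LinearMap.range (S.e n))) :=
      (-1 : k) ^ (n * -n) • LinearMap.proj (φ := fun _ : PLift ((0 : ℤ) = 0) => k) ⟨rfl⟩ ∘ₗ
        ap b' (-n) 0 (neg_add_cancel n) ∘ₗ dualGr S (add_neg_cancel n)
    obtain ⟨⟨_, a, rfl⟩, hv⟩ := (Module.evalEquiv k (LinearMap.range (S.e n))).surjective L
    refine ⟨S.e n a, S.e_mem_Zc n a, ihom_mem_Bc_of
      (Submodule.sub_mem _ (map_mem_Zc (bidual K (kc k 0)) (S.e_mem_Zc n a)) hb)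
      fun p q hq φ hφ => mem_Bc_kc.2 (kc_ext fun e => ?_)⟩
    subst e
    obtain rfl : p = -n := by omega
    obtain ⟨l, hl⟩ := exists_sub_dualGr_mem_Bc S (add_neg_cancel n) hφ
    let c : Gr (ihom K (kc k 0)) (kc k 0) n := bidualGr K (kc k 0) n (S.e n a) - b'
    have hc : c ∈ Zc (ihom (ihom K (kc k 0)) (kc k 0)) n :=
      Submodule.sub_mem _ (map_mem_Zc (bidual K (kc k 0)) (S.e_mem_Zc n a)) hb
    have h2 := mem_Bc_kc.1 (map_mem_Bc_of_ihom hc hq hl)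
    have h3 : ap c (-n) 0 hq φ = ap c (-n) 0 hq (dualGr S (add_neg_cancel n) l) :=
      sub_eq_zero.1 ((map_sub (ap c (-n) 0 hq) _ _).symm.trans h2)
    have h4 := LinearMap.congr_fun hv l
    refine (congrFun h3 ⟨rfl⟩).trans ?_
    refine (congrArg (· - _) (hw (add_neg_cancel n) (S.e n a) l)).trans ?_
    have h5 : l ⟨S.e n a, a, rfl⟩ = (-1 : k) ^ (n * -n) *
      (show PLift ((0 : ℤ) = 0) → k from ap b' (-n) 0 hq (dualGr S (add_neg_cancel n) l)) ⟨rfl⟩ := h4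
    have h6 : (S.e n).rangeRestrict (S.e n a) = ⟨S.e n a, a, rfl⟩ := Subtype.ext (S.e_e n a)
    rw [h6, h5, ← mul_assoc, sgn_mul_self, one_mul]
    exact sub_self _

end Dual

namespace DGModule

variable {A : DGCat k}

/-- The dual `Hom_k(N, k)` of a dg `A`-module, as a dg module over `Aᵒᵖ`. -/
abbrev dual (N : DGModule A) : DGModule A.op := coind (A := A.op) (opop N) (kc k 0)

/-- The canonical morphism from a dg module to its bidual. -/
def toBidual (N : DGModule A) : N ⟶ coind (dual N) (kc k 0) where
  app x := bidual (N.obj x) (kc k 0)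
  map_act {x y p q n} h m f := gr_ext (K := ihom (N.obj x) (kc k 0)) (V := kc k 0)
    fun c e he φ => by
      refine (bidualGr_apply he (show n + c = e by omega) (N.act h m f) φ).trans ?_
      refine Eq.trans ?_ (coindAct_apply (dual N) (kc k 0) h (bidualGr (N.obj y) (kc k 0) p m) f he
        rfl φ).symm
      refine Eq.trans ?_ (congrArg (fun v => (-1 : k) ^ (q * c) • v)
        ((bidualGr_apply _ (show p + (c + q) = e by omega) m _).trans
        (congrArg (fun v => (-1 : k) ^ (p * (c + q)) • v) (coindAct_apply (A := A.op) (opop N)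
          (kc k 0) (rfl : c + q = c + q) φ f _ h m)))).symm
      rw [smul_smul, smul_smul, ← zpow_add₀ (by simp), ← zpow_add₀ (by simp)]
      exact congrArg₂ (fun (r : k) v => r • v) (sgn_congr ⟨- (p * q), by rw [← h]; ring⟩) rfl

lemma qis_toBidual (N : DGModule A) (hN : ∀ x, Perf (N.obj x)) : qis A (toBidual N) :=
  fun x => (hN x).quasiIso_bidual

end DGModule

end DG

namespace DG

variable {k : Type u} [Field k]

/-! ### The Grothendieck group of the derived category of vector spaces -/

section

open Pretriangulated ZeroObject

variable {T : Type u'} [Category.{v'} T] [HasZeroObject T] [HasShift T ℤ] [Preadditive T]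
  [∀ n : ℤ, (shiftFunctor T n).Additive] [Pretriangulated T]

namespace K0

lemma mk_eq_add {t : Triangle T} (ht : t ∈ distTriang T) (h₁ : IsCompactObject.{w} t.obj₁)
    (h₂ : IsCompactObject.{w} t.obj₂) (h₃ : IsCompactObject.{w} t.obj₃) :
    K0.mk t.obj₂ h₂ = K0.mk t.obj₁ h₁ + K0.mk t.obj₃ h₃ := by
  rw [← sub_eq_zero, ← sub_sub]
  exact (QuotientAddGroup.eq_zero_iff _).2 (AddSubgroup.subset_closure ⟨t, ht, h₁, h₂, h₃, rfl⟩)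

lemma mk_eq_zero_of_isZero {Z : T} (hZ : IsZero Z) (h : IsCompactObject.{w} Z) :
    K0.mk Z h = 0 := by
  have ht : Triangle.mk (0 : Z ⟶ Z) (0 : Z ⟶ Z) 0 ∈ distTriang T :=
    isomorphic_distinguished _ (contractible_distinguished Z) _
      (Triangle.isoMk _ _ (Iso.refl _) (Iso.refl _) (hZ.iso (isZero_zero T))
        (hZ.eq_of_src _ _) (hZ.eq_of_src _ _) (hZ.eq_of_src _ _))
  exact left_eq_add.1 (mk_eq_add ht h h h)

lemma mk_eq_of_iso {X Y : T} (e : X ≅ Y) (hX : IsCompactObject.{w} X)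
    (hY : IsCompactObject.{w} Y) (h0 : IsCompactObject.{w} (0 : T)) : K0.mk X hX = K0.mk Y hY := by
  have ht : Triangle.mk e.hom (0 : Y ⟶ 0) 0 ∈ distTriang T :=
    isomorphic_distinguished _ (contractible_distinguished X) _
      (Triangle.isoMk _ _ (Iso.refl _) e.symm (Iso.refl _)
        (by change e.hom ≫ e.inv = 𝟙 X ≫ 𝟙 X; simp)
        ((isZero_zero T).eq_of_tgt _ _) ((isZero_zero T).eq_of_src _ _))
  have h1 : K0.mk Y hY = K0.mk X hX + K0.mk 0 h0 := mk_eq_add ht hX hY h0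
  rw [h1, mk_eq_zero_of_isZero (isZero_zero T), add_zero]

lemma mk_shift {X : T} (hX : IsCompactObject.{w} X) (h0 : IsCompactObject.{w} (0 : T))
    (h : IsCompactObject.{w} (X⟦(1 : ℤ)⟧)) : K0.mk (X⟦(1 : ℤ)⟧) h = - K0.mk X hX := by
  have h1 : K0.mk 0 h0 = K0.mk X hX + K0.mk (X⟦(1 : ℤ)⟧) h :=
    mk_eq_add (contractible_distinguished₂ X) hX h0 h
  rw [mk_eq_zero_of_isZero (isZero_zero T)] at h1
  exact (neg_eq_of_add_eq_zero_right h1.symm).symm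

/-- An invariant of objects which is additive on the distinguished triangles of compact objects
defines a homomorphism on the Grothendieck group. -/
lemma exists_hom (χ : T → ℤ) (hχ : ∀ t ∈ distTriang T, IsCompactObject.{w} t.obj₁ →
    IsCompactObject.{w} t.obj₂ → χ t.obj₂ = χ t.obj₁ + χ t.obj₃) :
    ∃ φ : K0.{w} T →+ ℤ, ∀ (X : T) (hX : IsCompactObject.{w} X), φ (K0.mk X hX) = χ X := by
  obtain ⟨φ, hφ⟩ : ∃ φ : FreeAbelianGroup {X : T // IsCompactObject.{w} X} →+ ℤ,
      ∀ X, φ (FreeAbelianGroup.of X) = χ X.1 :=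
    ⟨FreeAbelianGroup.lift fun X => χ X.1, fun X => FreeAbelianGroup.lift_apply_of _ X⟩
  have h1 : K0Rel.{w} T ≤ φ.ker := by
    refine (AddSubgroup.closure_le φ.ker).2 ?_
    rintro r ⟨t, ht, h₁, h₂, h₃, hr⟩
    have e : φ r = χ t.obj₂ - χ t.obj₁ - χ t.obj₃ := by
      rw [hr, map_sub φ, map_sub φ, hφ, hφ, hφ]
    refine AddMonoidHom.mem_ker.2 ?_
    rw [e, hχ t ht h₁ h₂]
    ring
  exact ⟨QuotientAddGroup.lift _ φ h1, fun X hX => hφ ⟨X, hX⟩⟩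

end K0

end

variable [HasDerivedCategory.{w} (ModuleCat.{u} k)]

/-- The homology of an object of the derived category. -/
abbrev hD (X : DerivedCategory (ModuleCat.{u} k)) (n : ℤ) : ModuleCat.{u} k :=
  (DerivedCategory.homologyFunctor (ModuleCat.{u} k) n).obj X

/-- An object of the derived category is perfect if its total homology is finite dimensional. -/
def PerfD (X : DerivedCategory (ModuleCat.{u} k)) : Prop :=
  (∀ n, Module.Finite k (hD X n)) ∧ {n | Nontrivial (hD X n)}.Finite

/-- The homology of a complex is the homology of its image in the derived category. -/
def hDEquiv (K : Cx k) (n : ℤ) : hD (DerivedCategory.Q.obj K) n ≃ₗ[k] K.homology n :=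
  ((DerivedCategory.homologyFunctorFactors (ModuleCat.{u} k) n).app K).toLinearEquiv

lemma perfD_Q_iff {K : Cx k} : PerfD (DerivedCategory.Q.obj K) ↔ Perf K := by
  refine and_congr (forall_congr' fun n => Module.Finite.equiv_iff (hDEquiv K n)) ?_
  simp only [(hDEquiv K _).toEquiv.nontrivial_congr]

lemma PerfD.of_iso {X Y : DerivedCategory (ModuleCat.{u} k)} (e : X ≅ Y) (h : PerfD X) :
    PerfD Y := by
  have e' (n : ℤ) : hD X n ≃ₗ[k] hD Y n :=
    ((DerivedCategory.homologyFunctor (ModuleCat.{u} k) n).mapIso e).toLinearEquiv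
  refine ⟨fun n => (Module.Finite.equiv_iff (e' n)).1 (h.1 n), ?_⟩
  have := h.2
  simpa only [(e' _).toEquiv.nontrivial_congr] using this

lemma isCompactObject_iff_perfD {X : DerivedCategory (ModuleCat.{u} k)} :
    IsCompactObject.{u} X ↔ PerfD X := by
  let e := DerivedCategory.Q.objObjPreimageIso X
  exact ⟨fun h => (perfD_Q_iff.2 (perf_of_isCompactObject (h.of_iso e.symm))).of_iso e,
    fun h => (isCompactObject_of_perf (perfD_Q_iff.1 (h.of_iso e.symm))).of_iso e⟩

/-- The Euler characteristic of an object of the derived category. -/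
def eulerD (X : DerivedCategory (ModuleCat.{u} k)) : ℤ :=
  ∑ᶠ n : ℤ, (n.negOnePow : ℤ) * (Module.finrank k (hD X n) : ℤ)

lemma eulerD_Q (K : Cx k) : eulerD (DerivedCategory.Q.obj K) = eulerChar K :=
  finsum_congr fun n => by rw [(hDEquiv K n).finrank_eq]

/-- The total dimension of the homology. -/
def dimD (X : DerivedCategory (ModuleCat.{u} k)) : ℕ := ∑ᶠ n : ℤ, Module.finrank k (hD X n)

lemma finrank_of_range_eq_ker {U V W : Type u} [AddCommGroup U] [Module k U] [AddCommGroup V]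
    [Module k V] [AddCommGroup W] [Module k W] [Module.Finite k V] {f : U →ₗ[k] V} {g : V →ₗ[k] W}
    (h : LinearMap.range f = LinearMap.ker g) : Module.finrank k V =
      Module.finrank k (LinearMap.range f) + Module.finrank k (LinearMap.range g) := by
  rw [h, add_comm, LinearMap.finrank_range_add_finrank_ker]

lemma PerfD.finite_support {X : DerivedCategory (ModuleCat.{u} k)} (hX : PerfD X) {r : ℤ → ℕ}
    (hr : ∀ n, r n ≤ Module.finrank k (hD X n)) : r.support.Finite :=
  hX.2.subset fun n hn => by
    have := hX.1 n
    exact Module.finrank_pos_iff.1 ((Nat.pos_of_ne_zero hn).trans_le (hr n))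

lemma support_negOnePow_mul_finite {r : ℤ → ℕ} (hr : r.support.Finite) :
    (fun n : ℤ => (n.negOnePow : ℤ) * (r n : ℤ)).support.Finite :=
  hr.subset fun n hn h => hn (by
    change _ * ((r n : ℕ) : ℤ) = 0
    rw [show r n = 0 from h]; simp)

section Triangle

open Pretriangulated DerivedCategory

variable (t : Triangle (DerivedCategory (ModuleCat.{u} k)))

/-- The rank of the first map in the long exact sequence. -/
def rk₁ (n : ℤ) : ℕ :=
  Module.finrank k (LinearMap.range ((homologyFunctor (ModuleCat.{u} k) n).map t.mor₁).hom)

/-- The rank of the second map in the long exact sequence. -/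
def rk₂ (n : ℤ) : ℕ :=
  Module.finrank k (LinearMap.range ((homologyFunctor (ModuleCat.{u} k) n).map t.mor₂).hom)

/-- The rank of the connecting map in the long exact sequence. -/
def rk₃ (n : ℤ) : ℕ :=
  Module.finrank k (LinearMap.range (HomologySequence.δ t n (n + 1) rfl).hom)

variable {t} (ht : t ∈ distTriang (DerivedCategory (ModuleCat.{u} k)))

include ht

lemma finrank_obj₂ {n : ℤ} [Module.Finite k (hD t.obj₂ n)] :
    Module.finrank k (hD t.obj₂ n) = rk₁ t n + rk₂ t n :=
  finrank_of_range_eq_ker (HomologySequence.exact₂ t ht n).moduleCat_range_eq_ker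

lemma finrank_obj₃ {n : ℤ} [Module.Finite k (hD t.obj₃ n)] :
    Module.finrank k (hD t.obj₃ n) = rk₂ t n + rk₃ t n :=
  finrank_of_range_eq_ker (HomologySequence.exact₃ t ht n (n + 1) rfl).moduleCat_range_eq_ker

lemma finrank_obj₁ {n : ℤ} [Module.Finite k (hD t.obj₁ (n + 1))] :
    Module.finrank k (hD t.obj₁ (n + 1)) = rk₃ t n + rk₁ t (n + 1) :=
  finrank_of_range_eq_ker (HomologySequence.exact₁ t ht n (n + 1) rfl).moduleCat_range_eq_ker

/-- Two of three: the long exact sequence bounds the homology of the third object. -/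
lemma PerfD.obj₃ (h₁ : PerfD t.obj₁) (h₂ : PerfD t.obj₂) : PerfD t.obj₃ := by
  have hfin (n : ℤ) : Module.Finite k (hD t.obj₃ n) := by
    have e1 := h₁.1 (n + 1)
    have e2 := h₂.1 n
    have e := (HomologySequence.exact₃ t ht n (n + 1) rfl).moduleCat_range_eq_ker
    have e3 : Module.Finite k (LinearMap.ker (HomologySequence.δ t n (n + 1) rfl).hom) := by
      erw [← e]
      infer_instance
    let d : hD t.obj₃ n →ₗ[k] hD t.obj₁ (n + 1) := (HomologySequence.δ t n (n + 1) rfl).hom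
    have e4 : Module.Finite k (hD t.obj₃ n ⧸ LinearMap.ker d) :=
      Module.Finite.equiv d.quotKerEquivRange.symm
    exact Module.Finite.of_submodule_quotient (LinearMap.ker d)
  refine ⟨hfin, ((h₁.2.preimage (add_left_injective 1).injOn).union h₂.2).subset fun n hn => ?_⟩
  have e1 := h₁.1 (n + 1)
  have e2 := h₂.1 n
  have e3 := hfin n
  by_contra h
  rw [Set.mem_union, not_or] at h
  have f1 : Subsingleton (hD t.obj₁ (n + 1)) := not_nontrivial_iff_subsingleton.1 h.1
  have f2 : Subsingleton (hD t.obj₂ n) := not_nontrivial_iff_subsingleton.1 h.2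
  have g1 := finrank_obj₁ ht (n := n)
  have g2 := finrank_obj₂ ht (n := n)
  have g3 := finrank_obj₃ ht (n := n)
  rw [Module.finrank_zero_of_subsingleton] at g1 g2
  have := (Module.finrank_pos_iff (R := k)).2 hn
  omega

/-- The Euler characteristic is additive on distinguished triangles: in the long exact sequence every
dimension is the sum of the ranks of two consecutive maps, and the ranks cancel in the alternating
sum. -/
lemma eulerD_eq_add (h₁ : PerfD t.obj₁) (h₂ : PerfD t.obj₂) :
    eulerD t.obj₂ = eulerD t.obj₁ + eulerD t.obj₃ := by
  have h₃ := PerfD.obj₃ ht h₁ h₂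
  have d1 (n : ℤ) : Module.finrank k (hD t.obj₁ n) = rk₃ t (n - 1) + rk₁ t n := by
    have := h₁.1 (n - 1 + 1)
    have h := finrank_obj₁ ht (n := n - 1)
    rwa [sub_add_cancel] at h
  have d2 (n : ℤ) : Module.finrank k (hD t.obj₂ n) = rk₁ t n + rk₂ t n :=
    have := h₂.1 n
    finrank_obj₂ ht
  have d3 (n : ℤ) : Module.finrank k (hD t.obj₃ n) = rk₂ t n + rk₃ t n :=
    have := h₃.1 n
    finrank_obj₃ ht
  have s1 := support_negOnePow_mul_finite (h₂.finite_support (r := rk₁ t) fun n => by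
    rw [d2]; omega)
  have s2 := support_negOnePow_mul_finite (h₂.finite_support (r := rk₂ t) fun n => by
    rw [d2]; omega)
  have s3 := support_negOnePow_mul_finite (h₃.finite_support (r := rk₃ t) fun n => by
    rw [d3]; omega)
  have s4 := support_negOnePow_mul_finite (h₁.finite_support (r := fun n => rk₃ t (n - 1))
    fun n => by rw [d1]; omega)
  have e2 : eulerD t.obj₂ = ∑ᶠ n : ℤ, (n.negOnePow : ℤ) * (rk₁ t n : ℤ) +
      ∑ᶠ n : ℤ, (n.negOnePow : ℤ) * (rk₂ t n : ℤ) := by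
    rw [← finsum_add_distrib s1 s2]
    exact finsum_congr fun n => by rw [d2, Nat.cast_add, mul_add]
  have e1 : eulerD t.obj₁ = ∑ᶠ n : ℤ, (n.negOnePow : ℤ) * (rk₃ t (n - 1) : ℤ) +
      ∑ᶠ n : ℤ, (n.negOnePow : ℤ) * (rk₁ t n : ℤ) := by
    rw [← finsum_add_distrib s4 s1]
    exact finsum_congr fun n => by rw [d1, Nat.cast_add, mul_add]
  have e3 : eulerD t.obj₃ = ∑ᶠ n : ℤ, (n.negOnePow : ℤ) * (rk₂ t n : ℤ) +
      ∑ᶠ n : ℤ, (n.negOnePow : ℤ) * (rk₃ t n : ℤ) := by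
    rw [← finsum_add_distrib s2 s3]
    exact finsum_congr fun n => by rw [d3, Nat.cast_add, mul_add]
  have e4 : ∑ᶠ n : ℤ, (n.negOnePow : ℤ) * (rk₃ t (n - 1) : ℤ) =
      -∑ᶠ n : ℤ, (n.negOnePow : ℤ) * (rk₃ t n : ℤ) := by
    rw [← finsum_neg_distrib, ← finsum_comp_equiv (Equiv.addRight (1 : ℤ))]
    refine finsum_congr fun n => ?_
    rw [Equiv.coe_addRight, add_sub_cancel_right, Int.negOnePow_succ, Units.val_neg, neg_mul]
  rw [e1, e2, e3, e4]
  ring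

end Triangle

lemma eulerD_eq_zero_of_mk_eq_zero {X : DerivedCategory (ModuleCat.{u} k)}
    (hX : IsCompactObject.{u} X) (h : K0.mk X hX = 0) : eulerD X = 0 := by
  obtain ⟨φ, hφ⟩ := K0.exists_hom.{u} (T := DerivedCategory (ModuleCat.{u} k)) eulerD
    fun t ht h₁ h₂ => eulerD_eq_add ht (isCompactObject_iff_perfD.1 h₁)
      (isCompactObject_iff_perfD.1 h₂)
  rw [← hφ X hX, h, map_zero]

end DG

namespace DG

variable {k : Type u} [Field k]

section Kc

lemma finrank_homology_kc (n m : ℤ) :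
    Module.finrank k ((kc k n).homology m) = if m = n then 1 else 0 := by
  have h1 : Function.Bijective (hcls (kc k n) m) := by
    refine ⟨(injective_iff_map_eq_zero _).2 fun a ha => ?_, hcls_surjective _ m⟩
    rw [hcls_eq_zero_iff, mem_Bc_kc] at ha
    exact Subtype.ext ha
  have h2 : Zc (kc k n) m = ⊤ := by
    refine eq_top_iff.2 fun a _ => ?_
    rw [mem_Zc, kc_d]
    rfl
  rw [← (LinearEquiv.ofBijective _ h1).finrank_eq, h2, finrank_top]
  change Module.finrank k (PLift (m = n) → k) = _
  split_ifs with h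
  · have : Unique (PLift (m = n)) := ⟨⟨⟨h⟩⟩, fun _ => rfl⟩
    rw [Module.finrank_fintype_fun_eq_card, Fintype.card_unique]
  · have : IsEmpty (PLift (m = n)) := ⟨fun e => h e.down⟩
    exact Module.finrank_zero_of_subsingleton

lemma perf_kc (n : ℤ) : Perf (kc k n) := by
  refine ⟨fun m => ?_, (Set.finite_singleton n).subset fun m hm => ?_⟩
  · have : Module.Finite k (Zc (kc k n) m) := by
      have : Module.Finite k ((kc k n).X m) :=
        inferInstanceAs (Module.Finite k (PLift (m = n) → k))
      infer_instance
    exact Module.Finite.of_surjective _ (hcls_surjective (kc k n) m)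
  · by_contra h
    have h1 : Subsingleton (Zc (kc k n) m) :=
      ⟨fun a b => Subtype.ext (kc_ext fun e => absurd e h)⟩
    have h2 := (hcls_surjective (kc k n) m).subsingleton
    exact not_nontrivial_iff_subsingleton.2 h2 hm

/-- The identification of `k` placed in degree `n` with a shift of `k` placed in degree `n + 1`. -/
def kcShift (k : Type u) [Field k] (n : ℤ) :
    kc k n ⟶ (CochainComplex.shiftFunctor (ModuleCat.{u} k) 1).obj (kc k (n + 1)) :=
  mkHom (L := (CochainComplex.shiftFunctor (ModuleCat.{u} k) 1).obj (kc k (n + 1)))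
    (fun m => show (PLift (m = n) → k) →ₗ[k] (PLift (m + 1 = n + 1) → k) from
      LinearMap.pi fun e => LinearMap.proj ⟨by have := e.down; omega⟩) fun m a => by
    refine (DGModule.shift_d (kc k (n + 1)) 1 m (m + 1) _).trans ?_
    rw [kc_d, kc_d]
    exact smul_zero _

lemma quasiIso_kcShift (n : ℤ) : QuasiIso (kcShift k n) :=
  quasiIso_of_bijective _ fun m => ⟨fun a b h => kc_ext fun e => by
    subst e
    exact congrFun h ⟨rfl⟩, fun b => ⟨fun e : PLift (m = n) =>
      (show PLift (m + 1 = n + 1) → k from b) ⟨by rw [e.down]⟩, rfl⟩⟩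

end Kc

open Pretriangulated ZeroObject

variable [HasDerivedCategory.{w} (ModuleCat.{u} k)]

lemma isCompactObject_zero : IsCompactObject.{u} (0 : DerivedCategory (ModuleCat.{u} k)) := by
  have h (n : ℤ) : Subsingleton (hD (0 : DerivedCategory (ModuleCat.{u} k)) n) :=
    ModuleCat.isZero_iff_subsingleton.1 (Functor.map_isZero _ (isZero_zero _))
  refine isCompactObject_iff_perfD.2 ⟨fun n => inferInstance, ?_⟩
  convert Set.finite_empty
  exact Set.eq_empty_of_forall_notMem fun n hn => not_nontrivial_iff_subsingleton.2 (h n) hn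

lemma isCompactObject_kc (n : ℤ) :
    IsCompactObject.{u} (DerivedCategory.Q.obj (kc k n)) := isCompactObject_of_perf (perf_kc n)

lemma mk_kc_succ (n : ℤ) : K0.mk _ (isCompactObject_kc (k := k) n) =
    - K0.mk _ (isCompactObject_kc (k := k) (n + 1)) := by
  have := quasiIso_kcShift (k := k) n
  have h1 : IsIso (DerivedCategory.Q.map (kcShift k n)) :=
    (DerivedCategory.isIso_Q_map_iff_quasiIso _ _).2 this
  let e : DerivedCategory.Q.obj (kc k n) ≅ (DerivedCategory.Q.obj (kc k (n + 1)))⟦(1 : ℤ)⟧ :=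
    asIso (DerivedCategory.Q.map (kcShift k n)) ≪≫
      (DerivedCategory.Q.commShiftIso (1 : ℤ)).app (kc k (n + 1))
  have h2 := (isCompactObject_kc (k := k) n).of_iso e
  rw [K0.mk_eq_of_iso e _ h2 isCompactObject_zero,
    K0.mk_shift (isCompactObject_kc (k := k) (n + 1)) isCompactObject_zero h2]

/-- The class of `k[-n]` is `(-1)ⁿ` times the class of `k`. -/
lemma mk_kc (n : ℤ) : K0.mk _ (isCompactObject_kc (k := k) n) =
    (n.negOnePow : ℤ) • K0.mk _ (isCompactObject_kc (k := k) 0) := by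
  induction n with
  | zero => simp
  | succ n ih =>
    have := mk_kc_succ (k := k) (n : ℤ)
    rw [ih] at this
    rw [Int.negOnePow_succ, Units.val_neg, neg_smul, this, neg_neg]
  | pred n ih =>
    have h1 : -(n : ℤ) = -(n : ℤ) - 1 + 1 := by ring
    have h2 : (-(n : ℤ)).negOnePow = -(-(n : ℤ) - 1).negOnePow := by
      conv_lhs => rw [h1, Int.negOnePow_succ]
    have h3 := mk_kc_succ (k := k) (-(n : ℤ) - 1)
    have h4 : K0.mk _ (isCompactObject_kc (k := k) (-(n : ℤ) - 1 + 1)) =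
        K0.mk _ (isCompactObject_kc (k := k) (-(n : ℤ))) := by
      congr 3; omega
    rw [h3, h4, ih, h2, Units.val_neg, neg_smul, neg_neg]

lemma eulerD_kc (n : ℤ) : eulerD (DerivedCategory.Q.obj (kc k n)) = n.negOnePow := by
  rw [eulerD_Q, eulerChar, finsum_eq_single _ n fun m hm => by
    rw [finrank_homology_kc, if_neg hm, Nat.cast_zero, mul_zero], finrank_homology_kc, if_pos rfl,
    Nat.cast_one, mul_one]

/-- A non-zero homology group is detected by a morphism to a shift of `k`. -/
lemma exists_map_kc (X : DerivedCategory (ModuleCat.{u} k)) {n : ℤ} (h : Nontrivial (hD X n)) :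
    ∃ f : X ⟶ DerivedCategory.Q.obj (kc k n),
      (DerivedCategory.homologyFunctor (ModuleCat.{u} k) n).map f ≠ 0 := by
  let K := DerivedCategory.Q.objPreimage X
  let e : DerivedCategory.Q.obj K ≅ X := DerivedCategory.Q.objObjPreimageIso X
  obtain ⟨S⟩ := nonempty_splitting K
  have e1 : hD (DerivedCategory.Q.obj K) n ≃ₗ[k] hD X n :=
    ((DerivedCategory.homologyFunctor (ModuleCat.{u} k) n).mapIso e).toLinearEquiv
  have h1 : Nontrivial (LinearMap.range (S.e n)) :=
    (((S.rangeEquiv n).trans ((hDEquiv K n).symm.trans e1)).toEquiv.nontrivial_congr).2 h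
  obtain ⟨l, hl⟩ := exists_ne (0 : Module.Dual k (LinearMap.range (S.e n)))
  let g := homDual S n l
  have hg : HomologicalComplex.homologyMap g n ≠ 0 := fun h0 => by
    refine hl ((hZero_homDual_iff S n l).1 ((hZero_kc_iff g).2 fun a ha => ?_))
    have h2 := homologyMap_hcls g n ⟨a, ha⟩
    rw [h0] at h2
    exact congrFun (mem_Bc_kc.1 ((hcls_eq_zero_iff _ n _).1 h2.symm)) ⟨rfl⟩
  refine ⟨e.inv ≫ DerivedCategory.Q.map g, fun h0 => hg ?_⟩
  have h3 : (DerivedCategory.homologyFunctor (ModuleCat.{u} k) n).map (DerivedCategory.Q.map g)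
      = 0 := by
    rw [← cancel_epi ((DerivedCategory.homologyFunctor (ModuleCat.{u} k) n).map e.inv),
      ← Functor.map_comp, h0, comp_zero]
  have h4 := DerivedCategory.homologyFunctorFactors_hom_naturality g n
  rw [h3, zero_comp] at h4
  exact (cancel_epi ((DerivedCategory.homologyFunctorFactors (ModuleCat.{u} k) n).hom.app K)).1
    (h4.symm.trans comp_zero.symm)

lemma isZero_of_subsingleton (X : DerivedCategory (ModuleCat.{u} k))
    (h : ∀ n, Subsingleton (hD X n)) : IsZero X := by
  let K := DerivedCategory.Q.objPreimage X
  let e : DerivedCategory.Q.obj K ≅ X := DerivedCategory.Q.objObjPreimageIso X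
  refine IsZero.of_iso ?_ e.symm
  rw [IsZero.iff_id_eq_zero, ← DerivedCategory.Q.map_id, derivedQ_map_eq_zero_iff]
  intro n a ha
  have e1 : hD (DerivedCategory.Q.obj K) n ≃ₗ[k] hD X n :=
    ((DerivedCategory.homologyFunctor (ModuleCat.{u} k) n).mapIso e).toLinearEquiv
  have : Subsingleton (K.homology n) :=
    ((hDEquiv K n).symm.trans e1).toEquiv.subsingleton
  exact (hcls_eq_zero_iff K n ⟨a, ha⟩).1 (Subsingleton.elim _ _)

/-- The third object of a triangle on a morphism `X ⟶ k[-n]` which is non-zero on homology has total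
dimension one less than `X`. -/
lemma PerfD.kc_triangle {X : DerivedCategory (ModuleCat.{u} k)} (hX : PerfD X) {n : ℤ}
    (h : Nontrivial (hD X n)) : ∃ t ∈ distTriang (DerivedCategory (ModuleCat.{u} k)),
      t.obj₁ = X ∧ t.obj₂ = DerivedCategory.Q.obj (kc k n) ∧ dimD X = dimD t.obj₃ + 1 := by
  obtain ⟨f, hf⟩ := exists_map_kc X h
  obtain ⟨Z, g, δ, ht⟩ := distinguished_cocone_triangle f
  refine ⟨Triangle.mk f g δ, ht, rfl, rfl, ?_⟩
  set t := Triangle.mk f g δ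
  have h₁ : PerfD t.obj₁ := hX
  have h₂ : PerfD t.obj₂ := perfD_Q_iff.2 (perf_kc n)
  have h₃ := PerfD.obj₃ ht h₁ h₂
  have d1 (m : ℤ) : Module.finrank k (hD X m) = rk₃ t (m - 1) + rk₁ t m := by
    have := h₁.1 (m - 1 + 1)
    have h := finrank_obj₁ ht (n := m - 1)
    rwa [sub_add_cancel] at h
  have d2 (m : ℤ) : (if m = n then 1 else 0) = rk₁ t m + rk₂ t m := by
    have := h₂.1 m
    rw [← finrank_obj₂ ht, ← finrank_homology_kc (k := k), ← (hDEquiv (kc k n) m).finrank_eq]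
    rfl
  have d3 (m : ℤ) : Module.finrank k (hD t.obj₃ m) = rk₂ t m + rk₃ t m :=
    have := h₃.1 m
    finrank_obj₃ ht
  have r1 : 0 < rk₁ t n := by
    have := h₂.1 n
    refine Module.finrank_pos_iff.2 (Submodule.nontrivial_iff_ne_bot.2 fun h0 => hf ?_)
    exact ModuleCat.hom_ext (LinearMap.range_eq_bot.1 h0)
  have r1' : rk₁ t n = 1 := by
    have := d2 n
    rw [if_pos rfl] at this
    omega
  have r1'' (m : ℤ) (hm : m ≠ n) : rk₁ t m = 0 := by
    have := d2 m
    rw [if_neg hm] at this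
    omega
  have r2 (m : ℤ) : rk₂ t m = 0 := by
    have := d2 m
    split_ifs at this with hm
    · subst hm
      omega
    · omega
  have s1 := h₁.finite_support (r := rk₁ t) fun m => by
    change _ ≤ Module.finrank k (hD X m)
    rw [d1]; omega
  have s4 := h₁.finite_support (r := fun m => rk₃ t (m - 1)) fun m => by
    change _ ≤ Module.finrank k (hD X m)
    rw [d1]; omega
  have e1 : dimD X = ∑ᶠ m, rk₃ t (m - 1) + ∑ᶠ m, rk₁ t m :=
    (finsum_congr d1).trans (finsum_add_distrib s4 s1)
  have e3 : dimD t.obj₃ = ∑ᶠ m, rk₃ t m :=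
    finsum_congr fun m => by rw [d3, r2, zero_add]
  rw [e1, e3, finsum_eq_single _ n r1'', r1']
  exact congrArg (· + 1) (finsum_comp_equiv (Equiv.subRight (1 : ℤ)) (f := rk₃ t))

/-- The Grothendieck group is generated by the class of `k`, by induction on the total dimension: a
non-zero object maps to some `k[-n]` so that the third object of the triangle is smaller. -/
lemma mk_eq_eulerD_smul (N : ℕ) : ∀ (X : DerivedCategory (ModuleCat.{u} k))
    (hX : IsCompactObject.{u} X), dimD X = N →
      K0.mk X hX = eulerD X • K0.mk _ (isCompactObject_kc (k := k) 0) := by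
  induction N using Nat.strong_induction_on with
  | h N ih =>
  intro X hX hN
  by_cases h : ∃ n, Nontrivial (hD X n)
  · obtain ⟨n, hn⟩ := h
    have hX' := isCompactObject_iff_perfD.1 hX
    obtain ⟨⟨X, Y, Z, f, g, δ⟩, ht, rfl, rfl, hd⟩ := hX'.kc_triangle hn
    have h₂ := isCompactObject_kc (k := k) n
    have h₂' := perfD_Q_iff.2 (perf_kc (k := k) n)
    have h₃' := PerfD.obj₃ ht hX' h₂'
    have h₃ := isCompactObject_iff_perfD.2 h₃'
    have e1 := K0.mk_eq_add.{u} ht hX h₂ h₃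
    have e2 := eulerD_eq_add ht hX' h₂'
    have e3 := ih _ (by omega) _ h₃ rfl
    have e4 := mk_kc (k := k) n
    rw [← eulerD_kc (k := k) n] at e4
    rw [eq_sub_of_add_eq e1.symm, eq_sub_of_add_eq e2.symm, sub_smul, ← e3]
    exact congrArg (· - _) e4
  · have h' (n : ℤ) : Subsingleton (hD X n) :=
      not_nontrivial_iff_subsingleton.1 fun hn => h ⟨n, hn⟩
    rw [K0.mk_eq_zero_of_isZero.{u} (isZero_of_subsingleton X h')]
    have : eulerD X = 0 := (finsum_congr fun n => by
      rw [Module.finrank_zero_of_subsingleton, Nat.cast_zero, mul_zero]).trans finsum_zero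
    rw [this, zero_smul]

/-- The Euler characteristic detects the vanishing of classes in `K₀(k)`. -/
lemma mk_Q_eq_zero_iff {K : Cx k} (hK : IsCompactObject.{u} (DerivedCategory.Q.obj K)) :
    K0.mk _ hK = 0 ↔ eulerChar K = 0 := by
  rw [← eulerD_Q]
  refine ⟨eulerD_eq_zero_of_mk_eq_zero hK, fun h => ?_⟩
  rw [mk_eq_eulerD_smul _ _ hK rfl, h, zero_smul]

end DG

end

theorem mainTheorem7 {k : Type u} [Field k] [HasDerivedCategory.{w} (ModuleCat.{u} k)]
    (A : DG.DGCat k) (hs : A.IsSmooth) (hp : A.IsProper)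
    (M : DG.DGModule A) (hM : M.IsCompact) :
    (∀ N : DG.DGModule A, N.IsCompact → M.HomFinite N) ∧
    Nonempty M.Resolution ∧
    ∀ R : M.Resolution,
      ∃ hc : ∀ P : DG.DGModule A.op, P.IsCompact →
          DG.IsCompactObject.{u} (DG.DGModule.derivedTensor R P),
        (∀ N : DG.DGModule A, N.IsCompact → M.euler N = 0) ↔
          ∀ (P : DG.DGModule A.op) (hP : P.IsCompact),
            DG.K0.mk (DG.DGModule.derivedTensor R P) (hc P hP) = 0 := by
  have hR (R : M.Resolution) : R.Q.IsCompact := (DG.DGModule.isCompact_iff_of_qis R.π R.qis).2 hM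
  have hperf (R : M.Resolution) (P : DG.DGModule A.op) (hP : ∀ x, DG.Perf (P.obj x)) :=
    DG.DGModule.perf_tensorOver R.isHProjective (hR R) P hP
  have hN (N : DG.DGModule A) (h : N.IsCompact) (x : A.Obj) : DG.Perf (N.obj x) := h.perf hp x
  have hP (P : DG.DGModule A.op) (h : P.IsCompact) (x : A.Obj) : DG.Perf (P.obj x) :=
    h.perf hp.op x
  have hN' (N : DG.DGModule A) (h : N.IsCompact) (x : A.Obj) : DG.Perf (N.dual.obj x) :=
    (hN N h x).ihom_kc
  refine ⟨fun N h => ?_, DG.DGModule.nonempty_resolution M, fun R =>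
    ⟨fun P h => DG.isCompactObject_of_perf (hperf R P (hP P h)), fun H P h => ?_, fun H N h => ?_⟩⟩
  · obtain ⟨R⟩ := DG.DGModule.nonempty_resolution M
    exact DG.DGModule.homFinite_of_qis R N.dual N.toBidual (N.qis_toBidual (hN N h))
      (hperf R _ (hN' N h))
  · refine (DG.mk_Q_eq_zero_iff _).2 ?_
    -- `Hom_k(P, k)` is compact because it is pointwise perfect and `A` is smooth.
    have h1 : (DG.DGModule.coind P (DG.kc k 0)).IsCompact :=
      DG.DGModule.isCompact_of_isSmooth hs _ fun x => (hP P h x).ihom_kc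
    rw [← DG.DGModule.euler_eq R P (𝟙 _) fun x => inferInstanceAs (QuasiIso (𝟙 _))]
    exact H _ h1
  -- By biduality `N` is quasi-isomorphic to `Hom_k(P, k)` for `P = Hom_k(N, k)`, which is compact over
  -- the smooth dg category `Aᵒᵖ`.
  · have h1 : N.dual.IsCompact := DG.DGModule.isCompact_of_isSmooth hs.op _ (hN' N h)
    rw [DG.DGModule.euler_eq R N.dual N.toBidual (N.qis_toBidual (hN N h))]
    exact (DG.mk_Q_eq_zero_iff _).1 (H N.dual h1)
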